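/- **Terms.** Clique-width terms are built from nullary symbols $\mathbf a$ (one new vertex with label $a$), the binary disjoint union $\oplus$, the unary $add_{a,b}$ with $a<b$ (join every $a$-labelled vertex to every $b$-labelled vertex) and the unary $relab_{a\to b}$ (every label $a$ becomes $b$). Labels are natural numbers. For a term $t$ let $G=\mathbf{val}(t)$ be the graph it denotes, $m$ the number of its operation symbols (including nullary ones) and $k$ its width, i.e. the number of labels that occur in it. **Schemes.** A *scheme* is a finite multiset of finite sets of labels. A *single-step overapproximation* of $s$ replaces one copy of some set $L\in s$ by $L\cup\{a\}$, for some label $a$, in such a way that the new scheme still has an element not containing $a$; an *overapproximation* is the result of any number ($\ge 0$) of such steps. For an occurrence $u$ of a subterm $t/u$ of $t$, the set $B(u)$ of *boundary labels* consists of the labels in $\mathbf{val}(t/u)$ of vertices that are adjacent in $G$ to a vertex outside $t/u$; a pair $(a,b)$ is *pending* at $u$ if some vertices $x,y$ of $t/u$ with labels $a,b$ in $\mathbf{val}(t/u)$ are non-adjacent in $\mathbf{val}(t/u)$ but adjacent in $G$. **The dynamic programming.** For $c\ge1$ define sets $S_c(u)$ of schemes recursively: - nullary symbol $\mathbf a$: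 the single scheme consisting of $\{a\}\cap B(u)$ and $c-1$ copies of $\varnothing$; - $add_{a,b}$: the set of the argument; - $relab_{a\to b}$: replace $a$ by $b$ in all elements of all schemes of the argument, and discard the schemes in which every element contains $b$; - $\oplus$ with arguments at $u_1,u_2$: take all schemes that overapproximate both a member of $S_c(u_1)$ and a member of $S_c(u_2)$ and whose set of used labels is exactly $B(u_1)\cup B(u_2)$; discard those with an element containing both labels of a pair pending at $u$; finally intersect every element of each remaining scheme with $B(u)$, adding up multiplicities. **Theorem.** 1. (Correctness.) For every term $t$ and every $c\ge1$, the set $S_c(\text{root})$ of the whole term is nonempty if and only if $G$ is $c$-colourable. 2. (Running time.) There are a single random access machine program (unit cost; registers and arrays of natural numbers; the only arithmetic is successor and predecessor, the only tests are $=$ and $<$) and a constant $C$ such that, for every term $t$ and every $c\ge2$, the program started on $(t,c)$ halts, having output the list of the schemes in $S_c(u)$ for every subterm occurrence $u$ in postorder, followed by the answer whether $G$ is $c$-colourable, and its number of steps is at most $$C\cdot m\cdot\min\bigl((c+1)^{2^k},(2^c-2)^k\bigr)\cdot(\min(c,2^k)+k)\cdot k\cdot\min(c,2^k)\cdot(k+\log_2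 c)$$ and also at most $$C\cdot m\cdot\min\bigl((c+1)^{2^k}\cdot2^{2k}\cdot\log_2 c,\ (2^c-2)^k\cdot c^3\bigr)\cdot k^3 .$$ -/

import Mathlib

/-! ## Clique-width terms and the labelled graphs they denote -/

/-- Clique-width terms, with natural numbers as labels. The vertices of the denoted graph are the
occurrences of nullary symbols, so a vertex needs no name and no two occurrences of nullary symbols
denote the same vertex. -/
inductive CWTerm : Type
  /-- nullary symbol: one vertex with label `a` -/
  | vertex (a : ℕ) : CWTerm
  /-- disjoint union -/
  | union (t₁ t₂ : CWTerm) : CWTerm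
  /-- `add_{a,b}`, `a < b`: join every `a`-labelled vertex to every `b`-labelled vertex -/
  | add (a b : ℕ) (hab : a < b) (t : CWTerm) : CWTerm
  /-- relabelling: every label `a` becomes `b` -/
  | rename (a b : ℕ) (t : CWTerm) : CWTerm

namespace CWTerm

/-- The number of operation symbols, nullary ones included. -/
def size : CWTerm → ℕ
  | vertex _ => 1
  | union t₁ t₂ => t₁.size + t₂.size + 1
  | add _ _ _ t => t.size + 1
  | rename _ _ t => t.size + 1

/-- The labels that occur in a term. -/
def labels : CWTerm → Finset ℕ
  | vertex a => {a}
  | union t₁ t₂ => t₁.labels ∪ t₂.labels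
  | add a b _ t => {a, b} ∪ t.labels
  | rename a b t => {a, b} ∪ t.labels

/-- The width: the number of labels that occur in the term. -/
def width (t : CWTerm) : ℕ := t.labels.card

/-- The vertices: one for each occurrence of a nullary symbol. -/
def Vert : CWTerm → Type
  | vertex _ => Unit
  | union t₁ t₂ => t₁.Vert ⊕ t₂.Vert
  | add _ _ _ t => t.Vert
  | rename _ _ t => t.Vert

/-- The relabelling of a single label by `a → b`. -/
def relabel (a b x : ℕ) : ℕ := if x = a then b else x

/-- The vertex labels of the denoted graph. -/
def lab : (t : CWTerm) → t.Vert → ℕ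
  | vertex a => fun _ => a
  | union t₁ t₂ => Sum.elim t₁.lab t₂.lab
  | add _ _ _ t => t.lab
  | rename a b t => fun x => relabel a b (t.lab x)

/-- The denoted graph. -/
def graph : (t : CWTerm) → SimpleGraph t.Vert
  | vertex _ => ⊥
  | union t₁ t₂ => SimpleGraph.sum t₁.graph t₂.graph
  | add a b _ t => t.graph ⊔ SimpleGraph.fromRel (fun x y => t.lab x = a ∧ t.lab y = b)
  | rename _ _ t => t.graph

end CWTerm

/-! ## Schemes -/

/-- A label-colouring scheme: a multiset of sets of labels. -/
abbrev Scheme : Type := Multiset (Finset ℕ)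

namespace Scheme

/-- A single-step overapproximation: one copy of a set `L` is replaced by `L ∪ {a}`, and afterwards
some set of the scheme still does not contain `a`. -/
def Step (s s' : Scheme) : Prop :=
  ∃ L ∈ s, ∃ a : ℕ, s' = insert a L ::ₘ s.erase L ∧ ∃ L' ∈ s', a ∉ L'

/-- `s'` is an overapproximation of `s`. -/
def Overapprox (s s' : Scheme) : Prop := Relation.ReflTransGen Step s s'

/-- The labels that a scheme uses. -/
def labels (s : Scheme) : Set ℕ := {a | ∃ L ∈ s, a ∈ L}

open Classical in
/-- Remove from every element the labels outside `B`, adding up multiplicities. -/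
noncomputable def restrict (B : Set ℕ) (s : Scheme) : Scheme :=
  s.map (fun L => L.filter (fun a => a ∈ B))

end Scheme

/-! ## The dynamic programming over subterms

An occurrence of a subterm in a term with graph `G` on the vertex set `V` is given by the subterm
`s` and the inclusion `e : s.Vert → V` of its vertices. -/

namespace CWTerm

variable {V : Type}

/-- The boundary labels of an occurrence: the labels carried by a vertex that is adjacent, in the
full graph, to a vertex outside the subterm. -/
def boundary (G : SimpleGraph V) (s : CWTerm) (e : s.Vert → V) : Set ℕ :=
  {a | ∃ x : s.Vert, s.lab x = a ∧ ∃ y : V, y ∉ Set.range e ∧ G.Adj (e x) y}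

/-- The pair of labels `(a, b)` is pending at an occurrence: some edge of the full graph between an
`a`-labelled and a `b`-labelled vertex of the subterm is not yet an edge of the subterm's graph. -/
def Pending (G : SimpleGraph V) (s : CWTerm) (e : s.Vert → V) (a b : ℕ) : Prop :=
  ∃ x y : s.Vert, s.lab x = a ∧ s.lab y = b ∧ ¬ s.graph.Adj x y ∧ G.Adj (e x) (e y)

/-- The set of schemes that the algorithm computes for an occurrence of a subterm. -/
def schemesAt (c : ℕ) (G : SimpleGraph V) : (s : CWTerm) → (s.Vert → V) → Set Scheme
  | vertex a, e =>
      {Scheme.restrict (boundary G (vertex a) e)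
        (({a} : Finset ℕ) ::ₘ Multiset.replicate (c - 1) ∅)}
  | add _ _ _ t, e => schemesAt c G t e
  | rename a b t, e =>
      {s' | ∃ s ∈ schemesAt c G t e,
        s' = s.map (fun L => L.image (relabel a b)) ∧ ¬ ∀ L ∈ s', b ∈ L}
  | union t₁ t₂, e =>
      {s' | ∃ s : Scheme,
        (∃ s₁ ∈ schemesAt c G t₁ (fun x => e (Sum.inl x)), Scheme.Overapprox s₁ s) ∧
        (∃ s₂ ∈ schemesAt c G t₂ (fun x => e (Sum.inr x)), Scheme.Overapprox s₂ s) ∧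
        s.labels = boundary G t₁ (fun x => e (Sum.inl x)) ∪
          boundary G t₂ (fun x => e (Sum.inr x)) ∧
        (∀ L ∈ s, ∀ a ∈ L, ∀ b ∈ L, ¬ Pending G (union t₁ t₂) e a b) ∧
        s' = s.restrict (boundary G (union t₁ t₂) e)}

/-- All occurrences of subterms, in postorder. -/
def occurrences : (s : CWTerm) → (s.Vert → V) → List (Σ s : CWTerm, s.Vert → V)
  | vertex a, e => [⟨vertex a, e⟩]
  | union t₁ t₂, e =>
      occurrences t₁ (fun x => e (Sum.inl x)) ++ occurrences t₂ (fun x => e (Sum.inr x)) ++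
        [⟨union t₁ t₂, e⟩]
  | add a b h t, e => occurrences t e ++ [⟨add a b h t, e⟩]
  | rename a b t, e => occurrences t e ++ [⟨rename a b t, e⟩]

/-- The set of schemes for the whole term. -/
def schemes (c : ℕ) (t : CWTerm) : Set Scheme := schemesAt c t.graph t id

/-- The sets of schemes for all subterms of `t`, in postorder. -/
def allSchemes (c : ℕ) (t : CWTerm) : List (Set Scheme) :=
  (occurrences t (id : t.Vert → t.Vert)).map (fun o => schemesAt c t.graph o.1 o.2)

end CWTerm

/-! ## A random access machine with a step count

Programs work with registers and with one-dimensional arrays, both holding natural numbers. The only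
arithmetic is successor and predecessor and the only tests are `=` and `<`, so in `T` steps no number
can exceed the largest number in the input and in the program by more than `T`. Every evaluation of a
node of an expression, every elementary command and every test takes one step. -/

namespace RAM

/-- Expressions: constants, registers, successor, predecessor, array access. -/
inductive Expr : Type
  | lit (n : ℕ) : Expr
  | reg (r : ℕ) : Expr
  | succ (x : Expr) : Expr
  | pred (x : Expr) : Expr
  | get (A : ℕ) (x : Expr) : Expr

/-- Tests. -/
inductive Test : Type
  | eq (x y : Expr) : Test
  | lt (x y : Expr) : Test

/-- Programs. -/
inductive Prog : Type
  | skip : Prog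
  | assign (r : ℕ) (x : Expr) : Prog
  | store (A : ℕ) (i x : Expr) : Prog
  | write (x : Expr) : Prog
  | seq (p q : Prog) : Prog
  | cond (b : Test) (p q : Prog) : Prog
  | loop (b : Test) (p : Prog) : Prog

/-- A state: registers, arrays and the output written so far. -/
structure State : Type where
  reg : ℕ → ℕ
  arr : ℕ → ℕ → ℕ
  out : List ℕ

namespace Expr

/-- The value of an expression. -/
def eval (σ : State) : Expr → ℕ
  | lit n => n
  | reg r => σ.reg r
  | succ x => x.eval σ + 1
  | pred x => x.eval σ - 1
  | get A x => σ.arr A (x.eval σ)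

/-- The cost of evaluating an expression: its number of nodes. -/
def cost : Expr → ℕ
  | lit _ => 1
  | reg _ => 1
  | succ x => x.cost + 1
  | pred x => x.cost + 1
  | get _ x => x.cost + 1

end Expr

namespace Test

/-- The truth value of a test. -/
def Holds (σ : State) : Test → Prop
  | eq x y => x.eval σ = y.eval σ
  | lt x y => x.eval σ < y.eval σ

/-- The cost of a test. -/
def cost : Test → ℕ
  | eq x y => x.cost + y.cost + 1
  | lt x y => x.cost + y.cost + 1

end Test

/-- `Exec p σ T τ`: the program `p`, started in the state `σ`, halts after exactly `T` steps in the
state `τ`. -/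
inductive Exec : Prog → State → ℕ → State → Prop
  | skip (σ : State) : Exec Prog.skip σ 1 σ
  | assign (r : ℕ) (x : Expr) (σ : State) :
      Exec (Prog.assign r x) σ (x.cost + 1) { σ with reg := Function.update σ.reg r (x.eval σ) }
  | store (A : ℕ) (i x : Expr) (σ : State) :
      Exec (Prog.store A i x) σ (i.cost + x.cost + 1)
        { σ with arr := Function.update σ.arr A
                   (Function.update (σ.arr A) (i.eval σ) (x.eval σ)) }
  | write (x : Expr) (σ : State) :
      Exec (Prog.write x) σ (x.cost + 1) { σ with out := σ.out ++ [x.eval σ] }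
  | seq {p q : Prog} {σ₁ σ₂ σ₃ : State} {T U : ℕ} :
      Exec p σ₁ T σ₂ → Exec q σ₂ U σ₃ → Exec (Prog.seq p q) σ₁ (T + U) σ₃
  | cond_true {b : Test} {p : Prog} (q : Prog) {σ τ : State} {T : ℕ} :
      b.Holds σ → Exec p σ T τ → Exec (Prog.cond b p q) σ (b.cost + T) τ
  | cond_false {b : Test} (p : Prog) {q : Prog} {σ τ : State} {T : ℕ} :
      ¬ b.Holds σ → Exec q σ T τ → Exec (Prog.cond b p q) σ (b.cost + T) τ
  | loop_true {b : Test} {p : Prog} {σ₁ σ₂ σ₃ : State} {T U : ℕ} :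
      b.Holds σ₁ → Exec p σ₁ T σ₂ → Exec (Prog.loop b p) σ₂ U σ₃ →
        Exec (Prog.loop b p) σ₁ (b.cost + T + U) σ₃
  | loop_false {b : Test} (p : Prog) {σ : State} :
      ¬ b.Holds σ → Exec (Prog.loop b p) σ b.cost σ

/-- The initial state: the input fills the beginning of array `0`; everything else is `0` and
nothing has been written. -/
def init (input : List ℕ) : State where
  reg := fun _ => 0
  arr := fun A i => if A = 0 then input.getD i 0 else 0
  out := []

end RAM

/-! ## Input and output formats -/

/-- A term as a list of numbers, in reverse Polish notation; every symbol takes at most three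
entries and starts with a nonzero entry. -/
def CWTerm.code : CWTerm → List ℕ
  | vertex a => [1, a]
  | add a b _ t => t.code ++ [2, a, b]
  | rename a b t => t.code ++ [3, a, b]
  | union t₁ t₂ => t₁.code ++ t₂.code ++ [4]

/-- A list of encoded items: each item is preceded by `1`, and the list is closed by `0`. -/
def codeList {α : Type} (f : α → List ℕ) (l : List α) : List ℕ :=
  l.flatMap (fun x => 1 :: f x) ++ [0]

/-- A scheme written down as a list of pairs: a multiplicity and a list of labels. -/
abbrev SchemeList : Type := List (ℕ × List ℕ)

/-- The scheme that has been written down. -/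
def SchemeList.toScheme (l : SchemeList) : Scheme :=
  (l.map (fun p => Multiset.replicate p.1 p.2.toFinset)).sum

/-- A written scheme as a list of numbers. -/
def SchemeList.code (l : SchemeList) : List ℕ :=
  codeList (fun p => p.1 :: codeList (fun a => [a]) p.2) l

/-- `IsAnswer c t out`: the output `out` lists, for every subterm of `t` in postorder, the schemes
computed for it, and ends with `1` if the graph of `t` is `c`-colourable and with `0` otherwise. -/
def IsAnswer (c : ℕ) (t : CWTerm) (out : List ℕ) : Prop :=
  ∃ (blocks : List (List SchemeList)) (b : ℕ),
    out = blocks.flatMap (codeList SchemeList.code) ++ [b] ∧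
    blocks.map (fun l => {s : Scheme | s ∈ l.map SchemeList.toScheme}) = t.allSchemes c ∧
    ((b = 1 ∧ t.graph.Colorable c) ∨ (b = 0 ∧ ¬ t.graph.Colorable c))

/-! ## The time bounds -/

/-- `m · min((c+1)^(2^k) · 2^(2k) · log c, (2^c-2)^k · c³) · k³`. -/
noncomputable def mainBound (m k c : ℕ) : ℝ :=
  m * min (((c : ℝ) + 1) ^ (2 ^ k) * 2 ^ (2 * k) * Real.logb 2 c)
    (((2 : ℝ) ^ c - 2) ^ k * (c : ℝ) ^ 3) * (k : ℝ) ^ 3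

/-- `m · min((c+1)^(2^k), (2^c-2)^k) · (min(c,2^k) + k) · k · min(c,2^k) · (k + log c)`. -/
noncomputable def preciseBound (m k c : ℕ) : ℝ :=
  m * min (((c : ℝ) + 1) ^ (2 ^ k)) (((2 : ℝ) ^ c - 2) ^ k) * (min (c : ℝ) (2 ^ k) + k) * k *
    min (c : ℝ) (2 ^ k) * (k + Real.logb 2 c)

/-! Correctness. What the operations above an occurrence `u` do to the vertices below `u` depends
only on their labels: vertices with the same label have the same neighbours outside `u`, and the
edges still to come join two different labels completely. The structure `Ctx` records this. Hence a
colouring of the part below `u` matters to the rest of the graph only through the sets of boundary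
labels of its colour classes, and these sets form a scheme. From a scheme computed at `u` one builds
a colouring whose colour classes have their boundary labels inside the elements of the scheme
(`coloring_of_mem`). Conversely, the scheme of a colouring of the whole graph is computed at every
`u` (`ofFn_colorLabels_mem`). At a union, a common overapproximation matches the colours of the two
sides, and an edge between the sides is a pending pair. The rule that an added label must stay
absent somewhere is harmless: if `y` is an outside neighbour of the vertices labelled `a`, then no
vertex labelled `a` has the colour of `y`.

Number of schemes. At a union, the overapproximations are found by breadth-first search. Adding
labels in arbitrary order would meet schemes with too many different label sets. Therefore a label
of `B = B(u₁) ∪ B(u₂)` may be added only if all earlier labels of `B` are already in use (`IsMove`).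
Every overapproximation with label set `B` remains reachable, by inserting the missing labels in
increasing order (`reach_of_overapprox`), while the label sets met on the way form a chain
(`Stage`). A scheme with `j` used labels is given by `j` proper nonempty sets of colours, so at most
`∑ (2^c - 2)^j ≤ 2 (2^c - 2)^k` schemes are met (`length_le_of_stage`). There are also at most
`(c+1)^(2^k - 1)` of them, since a scheme is determined by the multiplicities of its nonempty
elements (`length_le_of_sorted`).

Time per scheme. A scheme has at most `min(c, 2^k)` distinct elements, hence at most `min(c, 2^k) ·
k` moves, and the result of a move is written, sorted and looked up in `O(c k)` steps. The factor
`c` exceeds the allowed `min(c, 2^k)` if `c > 2^k`. But then `(c+1)^(2^k) ≤ 8 (2^c - 2)^k`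
(`succ_pow_le`), so the first count is decisive up to a constant, and its saved exponent pays for
`c` (`bound_mul_le`).

Machine. Only successor, predecessor and comparisons are available. A set of labels is a number with
`k` bits, and its bits are reached by rotations looked up in tables of size `2^k`. Lists of sets are
brought into a canonical order by radix sort. Sets of lists are kept in binary tries that share one
array; nothing is ever cleared, because fresh cells are 0. Boundary labels and pending pairs follow
from two relations on labels for each occurrence: `NonAdj`, computed upwards, and the relation `Q`
of `Ctx`, computed downwards. Both are given by formulas with at most two quantifiers, evaluated in
`O(k^6)` steps per occurrence, which the bound absorbs since `k^3 ≤ 4 · 2^k`. -/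

theorem getElem?_lt {α : Type*} {l : List α} {i : ℕ} {a : α} (h : l[i]? = some a) : i < l.length :=
  (List.getElem?_eq_some_iff.1 h).1

/-- A tuple of sets of labels. -/
abbrev Tuple : Type := List (Finset ℕ)

/-- A list of terms with maps from their vertices to `V`. -/
abbrev OccList (V : Type*) := List (Σ s : CWTerm, s.Vert → V)

/-! ## Occurrences of subterms in their context -/

namespace CWTerm

variable {V : Type} {G : SimpleGraph V}

/-- Some vertices labelled `a` and `b` are not adjacent. -/
def NonAdj (s : CWTerm) (a b : ℕ) : Prop := ∃ x y : s.Vert, s.lab x = a ∧ s.lab y = b ∧ ¬ s.graph.Adj x y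

/-- The context of an occurrence, seen through labels: for `a ≠ b`, `Q a b` says that the operations
above the occurrence join `a` to `b`, and `Q a a` that the vertices labelled `a` have a neighbour
outside the occurrence. -/
structure Ctx (G : SimpleGraph V) (s : CWTerm) (e : s.Vert → V) (Q : ℕ → ℕ → Prop) : Prop where
  inj : Function.Injective e
  adj : ∀ x y, G.Adj (e x) (e y) ↔ s.graph.Adj x y ∨ (s.lab x ≠ s.lab y ∧ Q (s.lab x) (s.lab y))
  out : ∀ x, (∃ y, y ∉ Set.range e ∧ G.Adj (e x) y) ↔ Q (s.lab x) (s.lab x)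
  twin : ∀ x x', s.lab x = s.lab x' → ∀ y, y ∉ Set.range e → G.Adj (e x) y → G.Adj (e x') y

theorem Ctx.root (t : CWTerm) : Ctx t.graph t id (fun _ _ => False) where
  inj := Function.injective_id
  adj x y := by simp
  out x := by simp
  twin x x' _ y hy := by simp at hy

/-- Edges created by the addition itself belong to the context of its argument. Since `a < b`, only
entries off the diagonal change, so no vertex gains an outside neighbour. -/
theorem Ctx.add {a b : ℕ} {h : a < b} {s : CWTerm} {e : s.Vert → V} {Q : ℕ → ℕ → Prop}
    (hc : Ctx G (CWTerm.add a b h s) e Q) :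
    Ctx G s e (fun x y => Q x y ∨ (x = a ∧ y = b) ∨ (x = b ∧ y = a)) where
  inj := hc.inj
  adj x y := by
    refine (hc.adj x y).trans ?_
    simp only [lab]
    constructor
    · rintro ((h1 | ⟨h1, h2 | h2⟩) | ⟨h1, h2⟩)
      · exact Or.inl h1
      · right; exact ⟨by omega, by tauto⟩
      · right; exact ⟨by omega, by tauto⟩
      · right; exact ⟨h1, by tauto⟩
    · rintro (h1 | ⟨h1, h2 | h2 | h2⟩)
      · exact Or.inl (Or.inl h1)
      · exact Or.inr ⟨h1, h2⟩
      · refine Or.inl (Or.inr ⟨?_, by tauto⟩); rintro rfl; exact h1 rfl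
      · refine Or.inl (Or.inr ⟨?_, by tauto⟩); rintro rfl; exact h1 rfl
  out x := by
    refine (hc.out x).trans ?_
    simp only [lab]
    constructor
    · exact Or.inl
    · rintro (h1 | h1 | h1)
      · exact h1
      · omega
      · omega
  twin := hc.twin

/-- Two labels merged by the relabelling can no longer be joined to each other. The entry of `Q` at
the merged label may hold nevertheless, with its other meaning of an outside neighbour; the first
conjunct excludes this confusion. -/
theorem Ctx.rename {a b : ℕ} {s : CWTerm} {e : s.Vert → V} {Q : ℕ → ℕ → Prop} (hc : Ctx G (CWTerm.rename a b s) e Q) :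
    Ctx G s e (fun x y => (x = y ∨ relabel a b x ≠ relabel a b y) ∧ Q (relabel a b x) (relabel a b y)) where
  inj := hc.inj
  adj x y := by
    have := hc.adj x y
    rw [this]
    simp only [graph, lab]
    constructor
    · rintro (h1 | ⟨h1, h2⟩)
      · exact Or.inl h1
      · exact Or.inr ⟨fun h => h1 (by rw [h]), Or.inr h1, h2⟩
    · rintro (h1 | ⟨h1, h2, h3⟩)
      · exact Or.inl h1
      · exact Or.inr ⟨by tauto, h3⟩
  out x := by
    refine (hc.out x).trans ?_
    simp [lab]
  twin x x' h := hc.twin x x' (by simp [lab, h])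

/-- A vertex is not adjacent to itself, so the diagonal of `NonAdj` tells which labels occur. One
relation thus serves both purposes. -/
theorem nonAdj_self {s : CWTerm} {a : ℕ} : s.NonAdj a a ↔ ∃ x, s.lab x = a := by
  constructor
  · rintro ⟨x, _, h, _⟩; exact ⟨x, h⟩
  · rintro ⟨x, h⟩; exact ⟨x, x, h, h, by simp⟩

/-- The vertices of `s₂` become outside vertices. One of them is a neighbour of the vertices
labelled `x` exactly if some label `z ≠ x` present in `s₂` is joined to `x` above. The new disjunct
lives on the diagonal and does not affect `adj`. -/
theorem Ctx.union_left {s₁ s₂ : CWTerm} {e : (union s₁ s₂).Vert → V} {Q : ℕ → ℕ → Prop} (hc : Ctx G (union s₁ s₂) e Q) :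
    Ctx G s₁ (fun x => e (Sum.inl x)) (fun x y => Q x y ∨ (x = y ∧ ∃ z, z ≠ x ∧ s₂.NonAdj z z ∧ Q x z)) where
  inj x y h := Sum.inl_injective (hc.inj h)
  adj x y := by
    rw [hc.adj (Sum.inl x) (Sum.inl y)]
    simp only [graph, lab, Sum.elim_inl, SimpleGraph.sum_adj]
    tauto
  out x := by
    have h1 := hc.out (Sum.inl x)
    simp only [lab, Sum.elim_inl] at h1
    rw [← h1]
    constructor
    · rintro ⟨y, h2, h3⟩
      by_cases h4 : y ∈ Set.range e
      · obtain ⟨z | z, rfl⟩ := h4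
        · exact absurd ⟨z, rfl⟩ h2
        · right
          refine ⟨rfl, s₂.lab z, ?_⟩
          have := (hc.adj (Sum.inl x) (Sum.inr z)).1 h3
          simp only [graph, lab, Sum.elim_inl, Sum.elim_inr, SimpleGraph.sum_adj] at this
          rcases this with h | ⟨h5, h6⟩
          · exact absurd h (by simp)
          · exact ⟨fun h => h5 h.symm, nonAdj_self.2 ⟨z, rfl⟩, h6⟩
      · exact Or.inl ⟨y, h4, h3⟩
    · rintro (⟨y, h2, h3⟩ | ⟨-, z, h2, h3, h4⟩)
      · exact ⟨y, fun ⟨z, hz⟩ => h2 ⟨_, hz⟩, h3⟩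
      · obtain ⟨z, rfl⟩ := nonAdj_self.1 h3
        refine ⟨e (Sum.inr z), ?_, (hc.adj _ _).2 (Or.inr ⟨fun h => h2 h.symm, h4⟩)⟩
        rintro ⟨w, hw⟩
        exact absurd (hc.inj hw) (by simp)
  twin x x' h y hy hxy := by
    by_cases h4 : y ∈ Set.range e
    · obtain ⟨z | z, rfl⟩ := h4
      · exact absurd ⟨z, rfl⟩ hy
      · have := (hc.adj (Sum.inl x) (Sum.inr z)).1 hxy
        refine (hc.adj (Sum.inl x') (Sum.inr z)).2 ?_
        simp only [graph, lab, Sum.elim_inl, Sum.elim_inr, SimpleGraph.sum_adj] at this ⊢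
        rwa [h] at this
    · exact hc.twin (Sum.inl x) (Sum.inl x') h y h4 hxy

theorem Ctx.union_right {s₁ s₂ : CWTerm} {e : (union s₁ s₂).Vert → V} {Q : ℕ → ℕ → Prop}
    (hc : Ctx G (union s₁ s₂) e Q) :
    Ctx G s₂ (fun x => e (Sum.inr x)) (fun x y => Q x y ∨ (x = y ∧ ∃ z, z ≠ x ∧ s₁.NonAdj z z ∧ Q x z)) where
  inj x y h := Sum.inr_injective (hc.inj h)
  adj x y := by
    rw [hc.adj (Sum.inr x) (Sum.inr y)]
    simp only [graph, lab, Sum.elim_inr, SimpleGraph.sum_adj]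
    tauto
  out x := by
    have h1 := hc.out (Sum.inr x)
    simp only [lab, Sum.elim_inr] at h1
    rw [← h1]
    constructor
    · rintro ⟨y, h2, h3⟩
      by_cases h4 : y ∈ Set.range e
      · obtain ⟨z | z, rfl⟩ := h4
        · right
          refine ⟨rfl, s₁.lab z, ?_⟩
          have := (hc.adj (Sum.inr x) (Sum.inl z)).1 h3
          simp only [graph, lab, Sum.elim_inl, Sum.elim_inr, SimpleGraph.sum_adj] at this
          rcases this with h | ⟨h5, h6⟩
          · exact absurd h (by simp)
          · exact ⟨fun h => h5 h.symm, nonAdj_self.2 ⟨z, rfl⟩, h6⟩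
        · exact absurd ⟨z, rfl⟩ h2
      · exact Or.inl ⟨y, h4, h3⟩
    · rintro (⟨y, h2, h3⟩ | ⟨-, z, h2, h3, h4⟩)
      · exact ⟨y, fun ⟨z, hz⟩ => h2 ⟨_, hz⟩, h3⟩
      · obtain ⟨z, rfl⟩ := nonAdj_self.1 h3
        refine ⟨e (Sum.inl z), ?_, (hc.adj _ _).2 (Or.inr ⟨fun h => h2 h.symm, h4⟩)⟩
        rintro ⟨w, hw⟩
        exact absurd (hc.inj hw) (by simp)
  twin x x' h y hy hxy := by
    by_cases h4 : y ∈ Set.range e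
    · obtain ⟨z | z, rfl⟩ := h4
      · have := (hc.adj (Sum.inr x) (Sum.inl z)).1 hxy
        refine (hc.adj (Sum.inr x') (Sum.inl z)).2 ?_
        simp only [graph, lab, Sum.elim_inl, Sum.elim_inr, SimpleGraph.sum_adj] at this ⊢
        rwa [h] at this
      · exact absurd ⟨z, rfl⟩ hy
    · exact hc.twin (Sum.inr x) (Sum.inr x') h y h4 hxy

/-! ### Boundary labels and pending pairs in terms of the context -/

section
variable {s : CWTerm} {e : s.Vert → V} {Q : ℕ → ℕ → Prop}

theorem Ctx.mem_boundary (hc : Ctx G s e Q) {a : ℕ} : a ∈ boundary G s e ↔ s.NonAdj a a ∧ Q a a := by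
  rw [nonAdj_self]
  constructor
  · rintro ⟨x, rfl, h⟩
    exact ⟨⟨x, rfl⟩, (hc.out x).1 h⟩
  · rintro ⟨⟨x, rfl⟩, h⟩
    exact ⟨x, rfl, (hc.out x).2 h⟩

theorem Ctx.lab_mem_boundary (hc : Ctx G s e Q) {x : s.Vert} : s.lab x ∈ boundary G s e ↔ ∃ y, y ∉ Set.range e ∧ G.Adj
    (e x) y := by
  rw [hc.mem_boundary, hc.out, nonAdj_self]
  exact ⟨fun h => h.2, fun h => ⟨⟨x, rfl⟩, h⟩⟩

theorem Ctx.pending (hc : Ctx G s e Q) {a b : ℕ} : Pending G s e a b ↔ s.NonAdj a b ∧ a ≠ b ∧ Q a b := by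
  constructor
  · rintro ⟨x, y, rfl, rfl, h1, h2⟩
    exact ⟨⟨x, y, rfl, rfl, h1⟩, by have := (hc.adj x y).1 h2; tauto⟩
  · rintro ⟨⟨x, y, rfl, rfl, h1⟩, h2, h3⟩
    exact ⟨x, y, rfl, rfl, h1, (hc.adj x y).2 (Or.inr ⟨h2, h3⟩)⟩

end

theorem lab_mem_labels : (s : CWTerm) → (x : s.Vert) → s.lab x ∈ s.labels
  | vertex a, _ => by simp [lab, labels]
  | union s₁ s₂, Sum.inl x => by simp [lab, labels, lab_mem_labels s₁ x]
  | union s₁ s₂, Sum.inr x => by simp [lab, labels, lab_mem_labels s₂ x]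
  | add a b h s, x => by
    have := lab_mem_labels s x
    simp only [lab, labels, Finset.mem_union]; exact Or.inr this
  | rename a b s, x => by
    have := lab_mem_labels s x
    simp only [lab, labels, Finset.mem_union, relabel]
    split_ifs
    · simp
    · exact Or.inr this

theorem boundary_subset_labels (s : CWTerm) (e : s.Vert → V) {a : ℕ} (h : a ∈ boundary G s e) : a ∈ s.labels := by
  obtain ⟨x, rfl, -⟩ := h
  exact s.lab_mem_labels x

theorem boundary_union_subset {s₁ s₂ : CWTerm} {e : (union s₁ s₂).Vert → V} : boundary G (union s₁ s₂) e ⊆ boundary G s₁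
    (fun x => e (Sum.inl x)) ∪ boundary G s₂ (fun x => e (Sum.inr x)) := by
  rintro a ⟨x | x, rfl, y, h1, h2⟩
  · exact Or.inl ⟨x, rfl, y, fun ⟨z, hz⟩ => h1 ⟨_, hz⟩, h2⟩
  · exact Or.inr ⟨x, rfl, y, fun ⟨z, hz⟩ => h1 ⟨_, hz⟩, h2⟩

theorem boundary_rename {a b : ℕ} {s : CWTerm} {e : s.Vert → V} : boundary G (rename a b s) e = relabel a b '' boundary
    G s e := by
  ext z
  constructor
  · rintro ⟨x, rfl, h⟩
    exact ⟨s.lab x, ⟨x, rfl, h⟩, rfl⟩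
  · rintro ⟨_, ⟨x, rfl, h⟩, rfl⟩
    exact ⟨x, rfl, h⟩

end CWTerm

/-! ## Schemes as families of sets -/

namespace Scheme

variable {c : ℕ}

/-- The scheme formed by a family of sets. -/
def ofFn (f : Fin c → Finset ℕ) : Scheme := Multiset.map f Finset.univ.val

theorem ofFn_eq_cons (f : Fin c → Finset ℕ) (i : Fin c) : ofFn f = f i ::ₘ Multiset.map f (Finset.univ.erase i).val :=
    by
  rw [ofFn, ← Multiset.map_cons, Finset.erase_val, Multiset.cons_erase (Finset.mem_univ_val i)]

theorem ofFn_update (f : Fin c → Finset ℕ) (i : Fin c) (L : Finset ℕ) : ofFn (Function.update f i L) = L ::ₘ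
    Multiset.map f (Finset.univ.erase i).val := by
  rw [ofFn_eq_cons _ i, Function.update_self]
  congr 1
  refine Multiset.map_congr rfl fun j hj => ?_
  have : j ≠ i := by
    have : j ∈ Finset.univ.erase i := hj
    simpa using this
  rw [Function.update_of_ne this]

theorem ofFn_update_eq (f : Fin c → Finset ℕ) (i : Fin c) (L : Finset ℕ) : ofFn (Function.update f i L) = L ::ₘ (ofFn
    f).erase (f i) := by
  rw [ofFn_update, ofFn_eq_cons f i, Multiset.erase_cons_head]

theorem mem_ofFn {f : Fin c → Finset ℕ} {L : Finset ℕ} : L ∈ ofFn f ↔ ∃ i, f i = L := by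
  simp [ofFn]

theorem card_ofFn (f : Fin c → Finset ℕ) : Multiset.card (ofFn f) = c := by simp [ofFn]

theorem exists_ofFn {s : Scheme} (h : Multiset.card s = c) : ∃ f : Fin c → Finset ℕ, s = ofFn f := by
  obtain ⟨l, rfl⟩ := Quot.exists_rep s
  have hl : l.length = c := h
  subst hl
  refine ⟨l.get, ?_⟩
  show (l : Scheme) = _
  simp [ofFn]

/-- The fibres of `f` and `g` over every set have the same size, and bijections between the fibres
assemble to a permutation of the indices. It is used to match the colours of the two sides of a
union. -/
theorem ofFn_eq_ofFn {f g : Fin c → Finset ℕ} (h : ofFn f = ofFn g) : ∃ π : Equiv.Perm (Fin c), g = f ∘ π := by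
  have key : ∀ L, Nonempty ({i // g i = L} ≃ {i // f i = L}) := by
    intro L
    refine ⟨Fintype.equivOfCardEq ?_⟩
    have := congrArg (Multiset.count L) h
    simp only [ofFn, Multiset.count_map] at this
    rw [Fintype.card_subtype, Fintype.card_subtype]
    simpa [Finset.card, Finset.filter_val, eq_comm] using this.symm
  let E := fun L => Classical.choice (key L)
  exact ⟨Equiv.ofFiberEquiv E, funext fun i => (Equiv.ofFiberEquiv_map E i).symm⟩

theorem map_ofFn (f : Fin c → Finset ℕ) (g : Finset ℕ → Finset ℕ) : Multiset.map g (ofFn f) = ofFn (g ∘ f) := by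
  rw [ofFn, Multiset.map_map, ofFn]

/-- Carried out on an indexed family, steps only enlarge the members, and the condition on every
single step can be checked at the end. A step that adds `a` leaves a member without `a`, and later
additions of other labels do not change this. Conversely, if all intermediate families stay below
`f'`, a member of `f'` without `a` lacks `a` all the time. -/
theorem overapprox_ofFn_iff {f : Fin c → Finset ℕ} {s' : Scheme} : Overapprox (ofFn f) s' ↔ ∃ f' : Fin c → Finset ℕ, s'
    = ofFn f' ∧ (∀ i, f i ⊆ f' i) ∧ ∀ i, ∀ a ∈ f' i, a ∉ f i → ∃ j, a ∉ f' j := by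
  constructor
  · intro h
    induction h with
    | refl => exact ⟨f, rfl, fun _ => subset_rfl, fun i a h h' => absurd h h'⟩
    | tail _ hs ih =>
      obtain ⟨f', rfl, h1, h2⟩ := ih
      obtain ⟨L, hL, a, rfl, L', hL', ha⟩ := hs
      obtain ⟨i, rfl⟩ := mem_ofFn.1 hL
      rw [← ofFn_update_eq] at hL' ⊢
      refine ⟨_, rfl, fun j => ?_, fun j b hb hb' => ?_⟩
      · by_cases hj : j = i
        · subst hj; simpa using (h1 j).trans (Finset.subset_insert _ _)
        · simpa [hj] using h1 j
      · by_cases hba : b = a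
        · subst hba
          obtain ⟨j', hj'⟩ := mem_ofFn.1 hL'
          exact ⟨j', by rwa [hj']⟩
        · have hb1 : b ∈ f' j := by
            by_cases hj : j = i
            · subst hj; simpa [hba] using hb
            · simpa [hj] using hb
          obtain ⟨j', hj'⟩ := h2 j b hb1 hb'
          refine ⟨j', ?_⟩
          by_cases hj : j' = i
          · subst hj; simpa [hba] using hj'
          · simpa [hj] using hj'
  · rintro ⟨f', rfl, h1, h2⟩
    -- Induction on the number of single insertions that remain to be made.
    generalize hn : ∑ i, (f' i \ f i).card = n
    induction n generalizing f with
    | zero =>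
      have : f = f' := by
        funext i
        have := (Finset.sum_eq_zero_iff.1 hn) i (Finset.mem_univ i)
        rw [Finset.card_eq_zero, Finset.sdiff_eq_empty_iff_subset] at this
        exact (h1 i).antisymm this
      rw [this]
      exact Relation.ReflTransGen.refl
    | succ n ih =>
      obtain ⟨i, hi⟩ : ∃ i, (f' i \ f i).Nonempty := by
        by_contra hcon
        push Not at hcon
        have : ∑ i, (f' i \ f i).card = 0 := Finset.sum_eq_zero fun i _ => by simp [hcon i]
        omega
      obtain ⟨a, ha⟩ := hi
      rw [Finset.mem_sdiff] at ha
      obtain ⟨j, hj⟩ := h2 i a ha.1 ha.2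
      have hle : ∀ l, Function.update f i (insert a (f i)) l ⊆ f' l := by
        intro l
        by_cases hl : l = i
        · subst hl; simpa [Finset.insert_subset_iff] using ⟨ha.1, h1 l⟩
        · simpa [hl] using h1 l
      refine Relation.ReflTransGen.head (b := ofFn (Function.update f i (insert a (f i)))) ?_ (ih hle ?_ ?_)
      -- By `hle` the intersection is just the member at `j`; in this form `a ∉ f' j` settles the
      -- claim at once.
      · refine ⟨f i, mem_ofFn.2 ⟨i, rfl⟩, a, ofFn_update_eq _ _ _, f' j ∩ Function.update f i (insert a (f i)) j, mem_ofFn.2 ⟨j, ?_⟩, ?_⟩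
        · exact (Finset.inter_eq_right.2 (hle j)).symm
        · simp [hj]
      · intro l b hb hb'
        refine h2 l b hb fun h => hb' ?_
        by_cases hl : l = i
        · subst hl; simp [h]
        · simpa [hl] using h
      · have key : ∀ l, (f' l \ f l).card = (f' l \ Function.update f i (insert a (f i)) l).card +
            if l = i then 1 else 0 := by
          intro l
          by_cases hl : l = i
          · subst hl
            have : f' l \ Function.update f l (insert a (f l)) l = (f' l \ f l).erase a := by
              ext z; simp; tauto
            rw [this, Finset.card_erase_of_mem (by simp [ha])]
            have : 0 < (f' l \ f l).card := Finset.card_pos.2 ⟨a, by simp [ha]⟩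
            simp; omega
          · simp [hl]
        simp only [key, Finset.sum_add_distrib, Finset.sum_ite_eq', Finset.mem_univ, if_true] at hn
        omega

theorem mem_labels_ofFn {f : Fin c → Finset ℕ} {a : ℕ} : a ∈ (ofFn f).labels ↔ ∃ i, a ∈ f i := by
  simp [labels, mem_ofFn]

theorem restrict_ofFn (B : Set ℕ) [DecidablePred (· ∈ B)] (f : Fin c → Finset ℕ) : restrict B (ofFn f) = ofFn (fun i =>
    (f i).filter (· ∈ B)) := by
  rw [restrict, map_ofFn]
  congr 1
  funext i
  simp only [Function.comp]
  congr

/-- The scheme with one set `L` and otherwise empty sets. -/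
theorem cons_replicate_empty (n : ℕ) (L : Finset ℕ) (i : Fin (n + 1)) : L ::ₘ Multiset.replicate n (∅ : Finset ℕ) = ofFn
    (Function.update (fun _ => ∅) i L) := by
  rw [ofFn_update]
  simp

end Scheme

/-! ## Correctness of the dynamic programming -/

namespace CWTerm

variable {V : Type} {G : SimpleGraph V}

/-- A scheme computed for an occurrence has `c` elements, uses exactly the boundary labels, and no
label belongs to all of its elements. -/
structure Fits (c : ℕ) (B : Set ℕ) (s : Scheme) : Prop where
  card : Multiset.card s = c
  labels : s.labels = B
  notFull : ∀ a, ∃ L ∈ s, a ∉ L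

/-- The invariant on which the counting of schemes rests; correctness does not depend on it. With
two colours, a vertex leaves an empty element, which gives `notFull` at the leaves. -/
theorem fits_of_mem {c : ℕ} (hc2 : 2 ≤ c) : (s : CWTerm) → (e : s.Vert → V) → (S : Scheme) →
    S ∈ schemesAt c G s e → Fits c (boundary G s e) S
  | vertex a, e, S, hS => by
    classical
    obtain ⟨n, rfl⟩ : ∃ n, c = n + 1 := ⟨c - 1, by omega⟩
    simp only [schemesAt, Set.mem_singleton_iff, Nat.add_sub_cancel] at hS
    rw [Scheme.cons_replicate_empty n _ 0, Scheme.restrict_ofFn] at hS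
    subst hS
    refine ⟨Scheme.card_ofFn _, ?_, fun b => ⟨_, Scheme.mem_ofFn.2 ⟨⟨1, by omega⟩, rfl⟩, ?_⟩⟩
    · ext b
      rw [Scheme.mem_labels_ofFn]
      constructor
      · rintro ⟨i, hi⟩
        exact (Finset.mem_filter.1 hi).2
      · intro hb
        refine ⟨0, Finset.mem_filter.2 ⟨?_, hb⟩⟩
        have := boundary_subset_labels _ _ hb
        simpa [CWTerm.labels] using this
    · rw [Function.update_of_ne (by simp [Fin.ext_iff])]
      simp
  | add _ _ _ t, e, S, hS => fits_of_mem hc2 t e S hS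
  | rename a b t, e, S, hS => by
    obtain ⟨s, hs, rfl, hb⟩ := hS
    have ih := fits_of_mem hc2 t e s hs
    obtain ⟨f, rfl⟩ := Scheme.exists_ofFn ih.card
    rw [Scheme.map_ofFn] at hb ⊢
    refine ⟨Scheme.card_ofFn _, ?_, fun x => ?_⟩
    · have hbr : boundary G (rename a b t) e = relabel a b '' boundary G t e := boundary_rename
      rw [hbr, ← ih.labels]
      ext x
      simp only [Scheme.mem_labels_ofFn, Set.mem_image, Function.comp, Finset.mem_image]
      constructor
      · rintro ⟨i, y, hy, rfl⟩; exact ⟨y, ⟨i, hy⟩, rfl⟩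
      · rintro ⟨y, ⟨i, hy⟩, rfl⟩; exact ⟨i, y, hy, rfl⟩
    -- The label `b` is covered by the discarding rule, `a` has disappeared, and any other label is
    -- where it was before.
    · by_cases hxb : x = b
      · subst hxb; push Not at hb; exact hb
      · by_cases hxa : x = a
        · subst hxa
          refine ⟨_, Scheme.mem_ofFn.2 ⟨⟨0, by omega⟩, rfl⟩, ?_⟩
          simp only [Function.comp, Finset.mem_image, not_exists, not_and, relabel]
          intro y _
          split_ifs <;> omega
        · obtain ⟨L, hL, hx⟩ := ih.notFull x
          obtain ⟨i, rfl⟩ := Scheme.mem_ofFn.1 hL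
          refine ⟨_, Scheme.mem_ofFn.2 ⟨i, rfl⟩, ?_⟩
          simp only [Function.comp, Finset.mem_image, not_exists, not_and, relabel]
          rintro y hy
          split_ifs
          · omega
          · rintro rfl; exact hx hy
  | union t₁ t₂, e, S, hS => by
    classical
    obtain ⟨s, ⟨s₁, hs₁, h1⟩, -, h3, -, rfl⟩ := hS
    have ih := fits_of_mem hc2 t₁ _ s₁ hs₁
    obtain ⟨f, rfl⟩ := Scheme.exists_ofFn ih.card
    obtain ⟨f', rfl, h4, h5⟩ := Scheme.overapprox_ofFn_iff.1 h1
    rw [Scheme.restrict_ofFn]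
    refine ⟨Scheme.card_ofFn _, ?_, fun x => ?_⟩
    · ext x
      have hx := Set.ext_iff.1 h3 x
      rw [Scheme.mem_labels_ofFn] at hx ⊢
      simp only [Finset.mem_filter, exists_and_right]
      rw [hx]
      exact ⟨fun h => h.2, fun h => ⟨boundary_union_subset h, h⟩⟩
    · obtain ⟨j, hj⟩ : ∃ j, x ∉ f' j := by
        obtain ⟨L, hL, hx⟩ := ih.notFull x
        obtain ⟨i, rfl⟩ := Scheme.mem_ofFn.1 hL
        by_cases hi : x ∈ f' i
        · exact h5 i x hi hx
        · exact ⟨i, hi⟩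
      exact ⟨_, Scheme.mem_ofFn.2 ⟨j, rfl⟩, fun h => hj (Finset.mem_filter.1 h).1⟩

/-- Soundness. Only an inclusion is maintained, since overapproximation enlarges the elements of a
scheme. Properness refers to all edges of `G` inside the occurrence, including those that are added
later; this is why an addition of edges requires no work and why the pairs to be avoided at a union
are the pending ones. -/
theorem coloring_of_mem {c : ℕ} (hc1 : 1 ≤ c) : (s : CWTerm) → (e : s.Vert → V) → (Q : ℕ → ℕ → Prop) →
    Ctx G s e Q → (S : Scheme) → S ∈ schemesAt c G s e →
    ∃ (κ : s.Vert → Fin c) (f : Fin c → Finset ℕ), S = Scheme.ofFn f ∧ (∀ x y, G.Adj (e x) (e y) → κ x ≠ κ y) ∧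
      ∀ x, s.lab x ∈ boundary G s e → s.lab x ∈ f (κ x)
  | vertex a, e, Q, hC, S, hS => by
    classical
    obtain ⟨n, rfl⟩ : ∃ n, c = n + 1 := ⟨c - 1, by omega⟩
    simp only [schemesAt, Set.mem_singleton_iff, Nat.add_sub_cancel] at hS
    rw [Scheme.cons_replicate_empty n _ 0, Scheme.restrict_ofFn] at hS
    refine ⟨fun _ => 0, _, hS, fun x y h => ?_, fun x hx => ?_⟩
    · exact absurd h (by rw [show x = y from rfl]; exact G.loopless.irrefl _)
    · refine Finset.mem_filter.2 ⟨?_, hx⟩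
      simp [lab]
  | add _ _ _ t, e, Q, hC, S, hS => coloring_of_mem hc1 t e _ hC.add S hS
  | rename a b t, e, Q, hC, S, hS => by
    obtain ⟨s, hs, rfl, -⟩ := hS
    obtain ⟨κ, f, rfl, h1, h2⟩ := coloring_of_mem hc1 t e _ hC.rename s hs
    refine ⟨κ, _, Scheme.map_ofFn _ _, h1, fun x hx => ?_⟩
    have hx' : t.lab x ∈ boundary G t e := hC.rename.lab_mem_boundary.2 (hC.lab_mem_boundary.1 hx)
    exact Finset.mem_image_of_mem _ (h2 x hx')
  | union t₁ t₂, e, Q, hC, S, hS => by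
    classical
    obtain ⟨s, ⟨s₁, hs₁, h1⟩, ⟨s₂, hs₂, h2⟩, h3, h4, rfl⟩ := hS
    obtain ⟨κ₁, f₁, rfl, p1, b1⟩ := coloring_of_mem hc1 t₁ _ _ hC.union_left s₁ hs₁
    obtain ⟨κ₂, f₂, rfl, p2, b2⟩ := coloring_of_mem hc1 t₂ _ _ hC.union_right s₂ hs₂
    obtain ⟨g₁, rfl, l1, -⟩ := Scheme.overapprox_ofFn_iff.1 h1
    obtain ⟨g₂, h5, l2, -⟩ := Scheme.overapprox_ofFn_iff.1 h2
    obtain ⟨π, rfl⟩ := Scheme.ofFn_eq_ofFn h5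
    -- An edge of `G` between the two sides makes both its labels boundary labels, and it is pending
    -- because the union has no such edge. Equal colours would put both labels into one element.
    have key : ∀ (x : t₁.Vert) (y : t₂.Vert), G.Adj (e (Sum.inl x)) (e (Sum.inr y)) → κ₁ x ≠ π (κ₂ y) := by
      intro x y hxy hκ
      have hx : t₁.lab x ∈ boundary G t₁ (fun x => e (Sum.inl x)) := by
        refine ⟨x, rfl, _, ?_, hxy⟩
        rintro ⟨z, hz⟩; exact absurd (hC.inj hz) (by simp)
      have hy : t₂.lab y ∈ boundary G t₂ (fun x => e (Sum.inr x)) := by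
        refine ⟨y, rfl, _, ?_, hxy.symm⟩
        rintro ⟨z, hz⟩; exact absurd (hC.inj hz) (by simp)
      have hx1 := l1 _ (b1 x hx)
      have hy1 := l2 _ (b2 y hy)
      simp only [Function.comp, ← hκ] at hy1
      refine h4 _ (Scheme.mem_ofFn.2 ⟨κ₁ x, rfl⟩) _ hx1 _ hy1 ⟨Sum.inl x, Sum.inr y, rfl, rfl, ?_, hxy⟩
      simp [graph]
    refine ⟨Sum.elim κ₁ (fun y => π (κ₂ y)), _, Scheme.restrict_ofFn _ _, ?_, ?_⟩
    · rintro (x | x) (y | y) hxy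
      · exact p1 x y hxy
      · exact key x y hxy
      · exact (key y x hxy.symm).symm
      · exact fun h => p2 x y hxy (π.injective h)
    · rintro (x | x) hx
      · obtain ⟨y, hy, hxy⟩ := hC.lab_mem_boundary.1 hx
        have hx' : t₁.lab x ∈ boundary G t₁ (fun x => e (Sum.inl x)) := ⟨x, rfl, y, fun ⟨z, hz⟩ => hy ⟨_, hz⟩, hxy⟩
        exact Finset.mem_filter.2 ⟨l1 _ (b1 x hx'), hx⟩
      · obtain ⟨y, hy, hxy⟩ := hC.lab_mem_boundary.1 hx
        have hx' : t₂.lab x ∈ boundary G t₂ (fun x => e (Sum.inr x)) := ⟨x, rfl, y, fun ⟨z, hz⟩ => hy ⟨_, hz⟩, hxy⟩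
        exact Finset.mem_filter.2 ⟨l2 _ (b2 x hx'), hx⟩

/-! ### The schemes of a colouring of the whole graph -/

open Classical in
/-- The labels of the vertices of an occurrence that have a given colour and a boundary label. -/
noncomputable def colorLabels {c : ℕ} (G : SimpleGraph V) (s : CWTerm) (e : s.Vert → V)
    (κ : V → Fin c) (i : Fin c) : Finset ℕ :=
  s.labels.filter (fun a => a ∈ boundary G s e ∧ ∃ x, s.lab x = a ∧ κ (e x) = i)

theorem mem_colorLabels {c : ℕ} {s : CWTerm} {e : s.Vert → V} {κ : V → Fin c} {i : Fin c} {a : ℕ} : a ∈ colorLabels G s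
    e κ i ↔ a ∈ boundary G s e ∧ ∃ x, s.lab x = a ∧ κ (e x) = i := by
  simp only [colorLabels, Finset.mem_filter, and_iff_right_iff_imp]
  rintro ⟨h, -⟩
  exact boundary_subset_labels _ _ h

/-- All vertices labelled `a` share an outside neighbour, by `twin`, and the colour of this
neighbour avoids them all. -/
theorem exists_notMem_colorLabels {c : ℕ} {s : CWTerm} {e : s.Vert → V} {Q : ℕ → ℕ → Prop} (hC : Ctx G s e Q) (κ :
    G.Coloring (Fin c)) {a : ℕ} (ha : a ∈ boundary G s e) : ∃ j, a ∉ colorLabels G s e κ j := by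
  obtain ⟨x, rfl, y, hy, hxy⟩ := ha
  refine ⟨κ y, fun h => ?_⟩
  obtain ⟨-, z, hz, hzy⟩ := mem_colorLabels.1 h
  exact κ.valid (hC.twin x z hz.symm y hy hxy) hzy

/-- Completeness. The boundary labels of the colour classes obey the recursion exactly; at a union,
the elementwise union of the families of both sides is the common overapproximation. -/
theorem ofFn_colorLabels_mem {c : ℕ} (κ : G.Coloring (Fin c)) : (s : CWTerm) → (e : s.Vert → V) →
    (Q : ℕ → ℕ → Prop) → Ctx G s e Q → Scheme.ofFn (colorLabels G s e κ) ∈ schemesAt c G s e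
  | vertex a, e, Q, hC => by
    classical
    have hc1 : 0 < c := (κ (e ())).pos
    obtain ⟨n, rfl⟩ : ∃ n, c = n + 1 := ⟨c - 1, by omega⟩
    simp only [schemesAt, Set.mem_singleton_iff, Nat.add_sub_cancel]
    rw [Scheme.cons_replicate_empty n _ (κ (e ())), Scheme.restrict_ofFn]
    congr 1
    funext i
    ext b
    rw [mem_colorLabels, Finset.mem_filter, and_comm]
    refine and_congr_left fun hb => ?_
    by_cases hi : i = κ (e ())
    · subst hi
      simp only [Function.update_self, Finset.mem_singleton]
      constructor
      · rintro ⟨_, rfl, _⟩; rfl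
      · rintro rfl; exact ⟨(), rfl, rfl⟩
    · simp only [Function.update_of_ne hi, Finset.notMem_empty, iff_false]
      rintro ⟨x, -, h⟩
      exact hi h.symm
  | add a b hab t, e, Q, hC => by
    have : colorLabels G (add a b hab t) e κ = colorLabels G t e κ := by
      funext i
      ext b
      exact mem_colorLabels.trans (mem_colorLabels (G := G) (s := t) (e := e) (κ := κ)).symm
    rw [this]
    exact ofFn_colorLabels_mem κ t e _ hC.add
  | rename a b t, e, Q, hC => by
    refine ⟨_, ofFn_colorLabels_mem κ t e _ hC.rename, ?_, ?_⟩
    · rw [Scheme.map_ofFn]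
      congr 1
      funext i
      ext z
      rw [mem_colorLabels, Function.comp, Finset.mem_image]
      constructor
      · rintro ⟨h, x, rfl, hx⟩
        exact ⟨t.lab x, mem_colorLabels.2 ⟨hC.rename.lab_mem_boundary.2 (hC.lab_mem_boundary.1 h), x, rfl, hx⟩, rfl⟩
      · rintro ⟨y, hy, rfl⟩
        obtain ⟨h, x, rfl, hx⟩ := mem_colorLabels.1 hy
        exact ⟨hC.lab_mem_boundary.2 (hC.rename.lab_mem_boundary.1 h), x, rfl, hx⟩
    · intro hall
      have hmem : ∀ i, b ∈ colorLabels G (rename a b t) e κ i := fun i => hall _ (Scheme.mem_ofFn.2 ⟨i, rfl⟩)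
      by_cases hne : Nonempty (Fin c)
      · obtain ⟨i⟩ := hne
        obtain ⟨j, hj⟩ := exists_notMem_colorLabels hC κ (mem_colorLabels.1 (hmem i)).1
        exact hj (hmem j)
      -- Without colours the assumption on all elements would be vacuous. This case does not arise,
      -- since every term has a vertex and this vertex has a colour.
      · obtain ⟨x⟩ : Nonempty t.Vert := by
          clear hall hmem hC
          induction t with
          | vertex a => exact ⟨()⟩
          | union t₁ t₂ ih1 ih2 => exact ⟨Sum.inl (ih1 (fun x => e (Sum.inl x))).some⟩
          | add _ _ _ t ih => exact ih e
          | rename _ _ t ih => exact ih e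
        exact hne ⟨κ (e x)⟩
  | union t₁ t₂, e, Q, hC => by
    classical
    set f₁ := colorLabels G t₁ (fun x => e (Sum.inl x)) κ with hf₁
    set f₂ := colorLabels G t₂ (fun x => e (Sum.inr x)) κ with hf₂
    -- The neighbour `y` of the vertices labelled `a` in `t₁` is adjacent to those in `t₂` as well,
    -- whether it lies in `t₂` or outside the union. So the colour of `y` lacks `a` on both sides.
    have key1 : ∀ a ∈ boundary G t₁ (fun x => e (Sum.inl x)), ∃ j, a ∉ f₁ j ∧ a ∉ f₂ j := by
      rintro a ⟨x, rfl, y, hy, hxy⟩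
      refine ⟨κ y, fun h => ?_, fun h => ?_⟩
      · obtain ⟨-, z, hz, hzy⟩ := mem_colorLabels.1 h
        exact κ.valid (hC.union_left.twin x z hz.symm y hy hxy) hzy
      · obtain ⟨-, z, hz, hzy⟩ := mem_colorLabels.1 h
        refine κ.valid (?_ : G.Adj (e (Sum.inr z)) y) hzy
        by_cases h4 : y ∈ Set.range e
        · obtain ⟨w | w, rfl⟩ := h4
          · exact absurd ⟨w, rfl⟩ hy
          · have := (hC.adj (Sum.inl x) (Sum.inr w)).1 hxy
            refine (hC.adj (Sum.inr z) (Sum.inr w)).2 ?_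
            simp only [graph, lab, Sum.elim_inl, Sum.elim_inr, SimpleGraph.sum_adj] at this ⊢
            rw [hz]
            right; simpa using this
        · exact hC.twin (Sum.inl x) (Sum.inr z) hz.symm y h4 hxy
    have key2 : ∀ a ∈ boundary G t₂ (fun x => e (Sum.inr x)), ∃ j, a ∉ f₁ j ∧ a ∉ f₂ j := by
      rintro a ⟨x, rfl, y, hy, hxy⟩
      refine ⟨κ y, fun h => ?_, fun h => ?_⟩
      · obtain ⟨-, z, hz, hzy⟩ := mem_colorLabels.1 h
        refine κ.valid (?_ : G.Adj (e (Sum.inl z)) y) hzy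
        by_cases h4 : y ∈ Set.range e
        · obtain ⟨w | w, rfl⟩ := h4
          · have := (hC.adj (Sum.inr x) (Sum.inl w)).1 hxy
            refine (hC.adj (Sum.inl z) (Sum.inl w)).2 ?_
            simp only [graph, lab, Sum.elim_inl, Sum.elim_inr, SimpleGraph.sum_adj] at this ⊢
            rw [hz]
            right; simpa using this
          · exact absurd ⟨w, rfl⟩ hy
        · exact hC.twin (Sum.inr x) (Sum.inl z) hz.symm y h4 hxy
      · obtain ⟨-, z, hz, hzy⟩ := mem_colorLabels.1 h
        exact κ.valid (hC.union_right.twin x z hz.symm y hy hxy) hzy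
    have notFull : ∀ i a, a ∈ f₁ i ∪ f₂ i → ∃ j, a ∉ f₁ j ∪ f₂ j := by
      intro i a ha
      rcases Finset.mem_union.1 ha with h | h
      · obtain ⟨j, h1, h2⟩ := key1 a (mem_colorLabels.1 h).1
        exact ⟨j, by simp [h1, h2]⟩
      · obtain ⟨j, h1, h2⟩ := key2 a (mem_colorLabels.1 h).1
        exact ⟨j, by simp [h1, h2]⟩
    have hlab : ∀ i a, a ∈ f₁ i ∪ f₂ i → ∃ x, (union t₁ t₂).lab x = a ∧ κ (e x) = i := by
      intro i a ha
      rcases Finset.mem_union.1 ha with h | h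
      · obtain ⟨x, hx, hi⟩ := (mem_colorLabels.1 h).2; exact ⟨Sum.inl x, hx, hi⟩
      · obtain ⟨x, hx, hi⟩ := (mem_colorLabels.1 h).2; exact ⟨Sum.inr x, hx, hi⟩
    refine ⟨Scheme.ofFn (fun i => f₁ i ∪ f₂ i), ⟨_, ofFn_colorLabels_mem κ t₁ _ _ hC.union_left, ?_⟩,
      ⟨_, ofFn_colorLabels_mem κ t₂ _ _ hC.union_right, ?_⟩, ?_, ?_, ?_⟩
    · exact Scheme.overapprox_ofFn_iff.2 ⟨_, rfl, fun i => Finset.subset_union_left, fun i a h _ => notFull i a h⟩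
    · exact Scheme.overapprox_ofFn_iff.2 ⟨_, rfl, fun i => Finset.subset_union_right, fun i a h _ => notFull i a h⟩
    · ext a
      rw [Scheme.mem_labels_ofFn]
      constructor
      · rintro ⟨i, h⟩
        rcases Finset.mem_union.1 h with h | h
        · exact Or.inl (mem_colorLabels.1 h).1
        · exact Or.inr (mem_colorLabels.1 h).1
      · rintro (h | h)
        · obtain ⟨x, rfl, -⟩ := id h
          exact ⟨κ (e (Sum.inl x)), Finset.mem_union_left _ (mem_colorLabels.2 ⟨h, x, rfl, rfl⟩)⟩
        · obtain ⟨x, rfl, -⟩ := id h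
          exact ⟨κ (e (Sum.inr x)), Finset.mem_union_right _ (mem_colorLabels.2 ⟨h, x, rfl, rfl⟩)⟩
    · intro L hL a ha b hb hp
      obtain ⟨i, rfl⟩ := Scheme.mem_ofFn.1 hL
      obtain ⟨x, rfl, hx⟩ := hlab i a ha
      obtain ⟨y, rfl, hy⟩ := hlab i b hb
      obtain ⟨-, h1, h2⟩ := hC.pending.1 hp
      exact κ.valid ((hC.adj x y).2 (Or.inr ⟨h1, h2⟩)) (hx.trans hy.symm)
    · rw [Scheme.restrict_ofFn]
      congr 1
      funext i
      ext a
      rw [Finset.mem_filter, mem_colorLabels]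
      constructor
      · rintro ⟨h, x | x, rfl, hx⟩
        · refine ⟨Finset.mem_union_left _ (mem_colorLabels.2 ⟨?_, x, rfl, hx⟩), h⟩
          obtain ⟨y, hy, hxy⟩ := hC.lab_mem_boundary.1 h
          exact ⟨x, rfl, y, fun ⟨z, hz⟩ => hy ⟨_, hz⟩, hxy⟩
        · refine ⟨Finset.mem_union_right _ (mem_colorLabels.2 ⟨?_, x, rfl, hx⟩), h⟩
          obtain ⟨y, hy, hxy⟩ := hC.lab_mem_boundary.1 h
          exact ⟨x, rfl, y, fun ⟨z, hz⟩ => hy ⟨_, hz⟩, hxy⟩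
      · rintro ⟨h1, h2⟩
        exact ⟨h2, hlab i a h1⟩

theorem schemes_nonempty_iff {t : CWTerm} {c : ℕ} (hc : 1 ≤ c) : (t.schemes c).Nonempty ↔ t.graph.Colorable c := by
  constructor
  · rintro ⟨S, hS⟩
    obtain ⟨κ, -, -, h, -⟩ := coloring_of_mem hc t id _ (Ctx.root t) S hS
    exact ⟨SimpleGraph.Coloring.mk κ fun h' => h _ _ h'⟩
  · rintro ⟨κ⟩
    exact ⟨_, ofFn_colorLabels_mem κ t id _ (Ctx.root t)⟩

end CWTerm

/-! ## The list of the occurrences of subterms -/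

namespace CWTerm

variable {V : Type}

theorem size_pos (s : CWTerm) : 0 < s.size := by cases s <;> simp [size]

theorem length_occurrences : (s : CWTerm) → (e : s.Vert → V) → (occurrences s e).length = s.size
  | vertex a, e => rfl
  | union s₁ s₂, e => by
    rw [occurrences, List.length_append, List.length_append, length_occurrences s₁, length_occurrences s₂]; rfl
  | add a b h s, e => by rw [occurrences, List.length_append, length_occurrences s e]; rfl
  | rename a b s, e => by rw [occurrences, List.length_append, length_occurrences s e]; rfl

theorem exists_occurrences_eq : (s : CWTerm) → (e : s.Vert → V) → ∃ l, occurrences s e = l ++ [⟨s, e⟩]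
  | vertex _, _ => ⟨[], rfl⟩
  | union _ _, _ => ⟨_, rfl⟩
  | add _ _ _ _, _ => ⟨_, rfl⟩
  | rename _ _ _, _ => ⟨_, rfl⟩

theorem occurrences_getElem? (s : CWTerm) (e : s.Vert → V) {j : ℕ} (h : j + 1 = s.size) : (occurrences s e)[j]? = some
    ⟨s, e⟩ := by
  obtain ⟨l, hl⟩ := exists_occurrences_eq s e
  have := length_occurrences s e
  rw [hl] at this ⊢
  simp only [List.length_append, List.length_cons, List.length_nil] at this
  rw [List.getElem?_append_right (by omega), show j - l.length = 0 by omega]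
  rfl

/-- The occurrences below position `i` of a list of occurrences precede it. -/
def Postorder (l : OccList V) : Prop := ∀ i o, l[i]? = some o → ∃ l', l.take (i + 1) = l' ++ occurrences o.1 o.2

theorem Postorder.append {l l' : OccList V} (h : Postorder l) (h' : Postorder l') : Postorder (l ++ l') := by
  intro i o ho
  rcases lt_or_ge i l.length with hi | hi
  · rw [List.getElem?_append_left hi] at ho
    rw [List.take_append_of_le_length hi]
    exact h i o ho
  · rw [List.getElem?_append_right hi] at ho
    obtain ⟨m, hm⟩ := h' _ o ho
    refine ⟨l ++ m, ?_⟩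
    rw [List.take_append, List.take_of_length_le (by omega), List.append_assoc, ← hm]
    congr 2
    omega

theorem Postorder.snoc {l : OccList V} (h : Postorder l) {s : CWTerm} {e : s.Vert → V} (hl : occurrences s e = l ++ [⟨s,
    e⟩]) : Postorder (l ++ [⟨s, e⟩]) := by
  intro i o ho
  rcases lt_or_ge i l.length with hi | hi
  · rw [List.getElem?_append_left hi] at ho
    rw [List.take_append_of_le_length hi]
    exact h i o ho
  · rw [List.getElem?_append_right hi] at ho
    have h0 := getElem?_lt ho
    simp only [List.length_cons, List.length_nil] at h0
    rw [show i - l.length = 0 by omega] at ho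
    simp only [List.getElem?_cons_zero, Option.some.injEq] at ho
    subst ho
    refine ⟨[], ?_⟩
    rw [List.take_of_length_le (by simp; omega), List.nil_append, hl]

theorem postorder_occurrences : (s : CWTerm) → (e : s.Vert → V) → Postorder (occurrences s e)
  | vertex a, e => Postorder.snoc (l := []) (fun i o h => by simp at h) rfl
  | union s₁ s₂, e => ((postorder_occurrences s₁ _).append (postorder_occurrences s₂ _)).snoc rfl
  | add a b h s, e => (postorder_occurrences s _).snoc rfl
  | rename a b s, e => (postorder_occurrences s _).snoc rfl

section
variable {l : OccList V} {i : ℕ}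

theorem Postorder.size_le (h : Postorder l) {s : CWTerm} {e : s.Vert → V} (hi : l[i]? = some ⟨s, e⟩) : s.size ≤ i + 1 :=
    by
  obtain ⟨m, hm⟩ := h i _ hi
  have h1 := congrArg List.length hm
  have h2 := getElem?_lt hi
  simp only [List.length_take, List.length_append, length_occurrences] at h1
  omega

/-- The occurrences below position `i` fill a segment that ends at `i`. A subterm is therefore
located by counting backwards over `m'`, the part of the segment that follows its root. -/
theorem Postorder.getElem?_of_append (h : Postorder l) {s s' : CWTerm} {e : s.Vert → V} {e' : s'.Vert → V} (hi : l[i]? =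
    some ⟨s, e⟩) {m m' : OccList V} (he : occurrences s e = m ++ occurrences s' e' ++ m') {j : ℕ} (hj : j + m'.length =
    i) : l[j]? = some ⟨s', e'⟩ := by
  obtain ⟨n, hn⟩ := h i _ hi
  obtain ⟨r, hr⟩ := exists_occurrences_eq s' e'
  have h2 := getElem?_lt hi
  have h1 := congrArg List.length hn
  have h3 : l[j]? = (l.take (i + 1))[j]? := by rw [List.getElem?_take, if_pos (by omega)]
  simp only at hn
  rw [h3, hn, he, hr]
  rw [hn, he, hr] at h3
  simp only [he, hr, List.length_take, List.length_append, List.length_cons, List.length_nil] at h1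
  rw [show n ++ (m ++ (r ++ [⟨s', e'⟩]) ++ m') = (n ++ m ++ r) ++ (⟨s', e'⟩ :: m') by simp,
    List.getElem?_append_right (by simp; omega)]
  rw [show j - (n ++ m ++ r).length = 0 by simp; omega]
  rfl

theorem Postorder.add_child (h : Postorder l) {a b : ℕ} {hab : a < b} {s : CWTerm} {e : s.Vert → V} (hi : l[i]? = some
    ⟨CWTerm.add a b hab s, e⟩) : 0 < i ∧ l[i - 1]? = some ⟨s, e⟩ := by
  have h1 := h.size_le hi
  have h2 := s.size_pos
  simp only [size] at h1
  exact ⟨by omega, h.getElem?_of_append hi (m := []) (m' := [_]) rfl (by simp; omega)⟩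

theorem Postorder.rename_child (h : Postorder l) {a b : ℕ} {s : CWTerm} {e : s.Vert → V} (hi : l[i]? = some
    ⟨CWTerm.rename a b s, e⟩) : 0 < i ∧ l[i - 1]? = some ⟨s, e⟩ := by
  have h1 := h.size_le hi
  have h2 := s.size_pos
  simp only [size] at h1
  exact ⟨by omega, h.getElem?_of_append hi (m := []) (m' := [_]) rfl (by simp; omega)⟩

theorem Postorder.right_child (h : Postorder l) {s₁ s₂ : CWTerm} {e : (union s₁ s₂).Vert → V} (hi : l[i]? = some ⟨union
    s₁ s₂, e⟩) : 0 < i ∧ l[i - 1]? = some ⟨s₂, fun x => e (Sum.inr x)⟩ := by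
  have h1 := h.size_le hi
  have h2 := s₂.size_pos
  simp only [size] at h1
  exact ⟨by omega, h.getElem?_of_append hi (m := occurrences s₁ _) (m' := [_]) rfl (by simp; omega)⟩

/-- The `s₂.size` occurrences of the right argument lie between the root of the left argument and
the union itself. -/
theorem Postorder.left_child (h : Postorder l) {s₁ s₂ : CWTerm} {e : (union s₁ s₂).Vert → V} (hi : l[i]? = some ⟨union
    s₁ s₂, e⟩) : s₂.size + 1 ≤ i ∧ l[i - 1 - s₂.size]? = some ⟨s₁, fun x => e (Sum.inl x)⟩ := by
  have h1 := h.size_le hi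
  have h2 := s₁.size_pos
  simp only [size] at h1
  refine ⟨by omega, h.getElem?_of_append hi (m := [])
    (m' := occurrences s₂ (fun x => e (Sum.inr x)) ++ [⟨union s₁ s₂, e⟩]) ?_ ?_⟩
  · simp [occurrences]
  · simp [length_occurrences]; omega

end

/-- The argument of an occurrence of `s` at position `p` is at position `j`. -/
def ChildAt : CWTerm → ℕ → ℕ → Prop
  | vertex _, _, _ => False
  | union _ s₂, p, j => p = j + 1 ∨ p = j + 1 + s₂.size
  | add _ _ _ _, p, j => p = j + 1
  | rename _ _ _, p, j => p = j + 1

theorem ChildAt.shift {s : CWTerm} {p j n : ℕ} (h : s.ChildAt p j) : s.ChildAt (n + p) (n + j) := by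
  cases s <;> simp only [ChildAt] at h ⊢ <;> omega

theorem ChildAt.lt {s : CWTerm} {p j : ℕ} (h : s.ChildAt p j) : j < p := by
  cases s <;> simp only [ChildAt] at h <;> omega

/-- For the pass from the root downwards: every position but the last receives its context from a
later position. -/
theorem exists_parent : (s : CWTerm) → (e : s.Vert → V) → (j : ℕ) → j + 1 < s.size →
    ∃ (p : ℕ) (o : Σ s : CWTerm, s.Vert → V), (occurrences s e)[p]? = some o ∧ o.1.ChildAt p j
  | vertex a, e, j, h => by simp [size] at h
  | add a b hab s, e, j, h => by
    have hlen := length_occurrences s e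
    simp only [size] at h
    rcases Nat.lt_or_ge (j + 1) s.size with h1 | h1
    · obtain ⟨p, o, hp, hc⟩ := exists_parent s e j h1
      refine ⟨p, o, ?_, hc⟩
      rw [occurrences, List.getElem?_append_left (getElem?_lt hp), hp]
    · exact ⟨j + 1, ⟨add a b hab s, e⟩, occurrences_getElem? _ _ (by simp only [size]; omega), rfl⟩
  | rename a b s, e, j, h => by
    have hlen := length_occurrences s e
    simp only [size] at h
    rcases Nat.lt_or_ge (j + 1) s.size with h1 | h1
    · obtain ⟨p, o, hp, hc⟩ := exists_parent s e j h1
      refine ⟨p, o, ?_, hc⟩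
      rw [occurrences, List.getElem?_append_left (getElem?_lt hp), hp]
    · exact ⟨j + 1, ⟨rename a b s, e⟩, occurrences_getElem? _ _ (by simp only [size]; omega), rfl⟩
  | union s₁ s₂, e, j, h => by
    have hlen := length_occurrences s₁ (fun x => e (Sum.inl x))
    have hlen' := length_occurrences s₂ (fun x => e (Sum.inr x))
    simp only [size] at h
    rcases Nat.lt_or_ge (j + 1) s₁.size with h1 | h1
    · obtain ⟨p, o, hp, hc⟩ := exists_parent s₁ (fun x => e (Sum.inl x)) j h1
      have hp' := getElem?_lt hp
      refine ⟨p, o, ?_, hc⟩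
      rw [occurrences, List.append_assoc, List.getElem?_append_left hp', hp]
    rcases Nat.lt_or_ge j s₁.size with h2 | h2
    · exact ⟨s₁.size + s₂.size, ⟨union s₁ s₂, e⟩, occurrences_getElem? _ _ (by simp only [size]), Or.inr (by omega)⟩
    rcases Nat.lt_or_ge (j - s₁.size + 1) s₂.size with h3 | h3
    · obtain ⟨p, o, hp, hc⟩ := exists_parent s₂ (fun x => e (Sum.inr x)) (j - s₁.size) h3
      have hp' := getElem?_lt hp
      refine ⟨s₁.size + p, o, ?_, ?_⟩
      · rw [occurrences, List.append_assoc, List.getElem?_append_right (by omega), hlen, Nat.add_sub_cancel_left,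
          List.getElem?_append_left hp', hp]
      · have := hc.shift (n := s₁.size)
        rwa [Nat.add_sub_cancel' h2] at this
    · exact ⟨j + 1, ⟨union s₁ s₂, e⟩, occurrences_getElem? _ _ (by simp only [size]; omega), Or.inl rfl⟩

theorem labels_subset_of_mem : (s : CWTerm) → (e : s.Vert → V) → (o : Σ s : CWTerm, s.Vert → V) →
    o ∈ occurrences s e → o.1.labels ⊆ s.labels
  | vertex a, e, o, h => by
    rw [List.mem_singleton.1 h]
  | union s₁ s₂, e, o, h => by
    simp only [occurrences, List.mem_append, List.mem_singleton] at h
    rcases h with (h | h) | rfl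
    · exact (labels_subset_of_mem s₁ _ o h).trans Finset.subset_union_left
    · exact (labels_subset_of_mem s₂ _ o h).trans Finset.subset_union_right
    · exact subset_rfl
  | add a b hab s, e, o, h => by
    simp only [occurrences, List.mem_append, List.mem_singleton] at h
    rcases h with h | rfl
    · exact (labels_subset_of_mem s _ o h).trans Finset.subset_union_right
    · exact subset_rfl
  | rename a b s, e, o, h => by
    simp only [occurrences, List.mem_append, List.mem_singleton] at h
    rcases h with h | rfl
    · exact (labels_subset_of_mem s _ o h).trans Finset.subset_union_right
    · exact subset_rfl

/-- The labels that are part of the first symbol of a term. -/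
def symbolLabels : CWTerm → List ℕ
  | vertex a => [a]
  | union _ _ => []
  | add a b _ _ => [a, b]
  | rename a b _ => [a, b]

/-- The number of the first symbol of a term. -/
def symbol : CWTerm → ℕ
  | vertex _ => 1
  | union _ _ => 4
  | add _ _ _ _ => 2
  | rename _ _ _ => 3

/-- Reverse Polish notation is postorder, so the number of a symbol in the input is the position of
its occurrence. -/
theorem code_eq_flatMap : (s : CWTerm) → (e : s.Vert → V) →
    s.code = (occurrences s e).flatMap (fun o => o.1.symbol :: o.1.symbolLabels)
  | vertex a, e => rfl
  | union s₁ s₂, e => by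
    rw [code, occurrences, List.flatMap_append, List.flatMap_append, ← code_eq_flatMap s₁, ← code_eq_flatMap s₂]
    rfl
  | add a b h s, e => by rw [code, occurrences, List.flatMap_append, ← code_eq_flatMap s e]; rfl
  | rename a b s, e => by rw [code, occurrences, List.flatMap_append, ← code_eq_flatMap s e]; rfl

theorem labels_eq_flatMap : (s : CWTerm) → (e : s.Vert → V) →
    s.labels = ((occurrences s e).flatMap (fun o => o.1.symbolLabels)).toFinset
  | vertex a, e => by simp [labels, occurrences, symbolLabels]
  | union s₁ s₂, e => by
    simp [labels, occurrences, symbolLabels, labels_eq_flatMap s₁ (fun x => e (Sum.inl x)),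
      labels_eq_flatMap s₂ (fun x => e (Sum.inr x)), List.toFinset_append]
  | add a b h s, e => by
    rw [labels, labels_eq_flatMap s e, occurrences, List.flatMap_append, List.toFinset_append, Finset.union_comm]
    simp [symbolLabels]
  | rename a b s, e => by
    rw [labels, labels_eq_flatMap s e, occurrences, List.flatMap_append, List.toFinset_append, Finset.union_comm]
    simp [symbolLabels]

/-! ### Non-adjacent labels -/

theorem nonAdj_vertex {a x y : ℕ} : (vertex a).NonAdj x y ↔ x = a ∧ y = a := by
  constructor
  · rintro ⟨-, -, rfl, rfl, -⟩
    exact ⟨rfl, rfl⟩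
  · rintro ⟨rfl, rfl⟩
    exact ⟨(), (), rfl, rfl, fun h => h⟩

theorem nonAdj_add {a b : ℕ} {h : a < b} {s : CWTerm} {x y : ℕ} : (add a b h s).NonAdj x y ↔ s.NonAdj x y ∧ ¬ (x = a ∧ y
    = b) ∧ ¬ (x = b ∧ y = a) := by
  constructor
  · rintro ⟨u, v, rfl, rfl, huv⟩
    have h1 : ¬ (s.graph.Adj u v ∨ (u ≠ v ∧ ((s.lab u = a ∧ s.lab v = b) ∨ (s.lab v = a ∧ s.lab u = b)))) := huv
    push Not at h1
    refine ⟨⟨u, v, rfl, rfl, h1.1⟩, ?_, ?_⟩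
    · rintro ⟨h2, h3⟩
      change s.lab u = a at h2
      change s.lab v = b at h3
      exact (h1.2 (by rintro rfl; omega)).1 h2 h3
    · rintro ⟨h2, h3⟩
      change s.lab u = b at h2
      change s.lab v = a at h3
      exact (h1.2 (by rintro rfl; omega)).2 h3 h2
  · rintro ⟨⟨u, v, rfl, rfl, huv⟩, h2, h3⟩
    refine ⟨u, v, rfl, rfl, ?_⟩
    show ¬ (s.graph.Adj u v ∨ (u ≠ v ∧ ((s.lab u = a ∧ s.lab v = b) ∨ (s.lab v = a ∧ s.lab u = b))))
    tauto

theorem nonAdj_rename {a b : ℕ} {s : CWTerm} {x y : ℕ} : (rename a b s).NonAdj x y ↔ ∃ x' y', s.NonAdj x' y' ∧ relabel a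
    b x' = x ∧ relabel a b y' = y := by
  constructor
  · rintro ⟨u, v, rfl, rfl, huv⟩
    exact ⟨s.lab u, s.lab v, ⟨u, v, rfl, rfl, huv⟩, rfl, rfl⟩
  · rintro ⟨-, -, ⟨u, v, rfl, rfl, huv⟩, rfl, rfl⟩
    exact ⟨u, v, rfl, rfl, huv⟩

/-- No edge runs between the two sides, so labels present on opposite sides are non-adjacent.
Presence is expressed by the diagonal. -/
theorem nonAdj_union {s₁ s₂ : CWTerm} {x y : ℕ} : (union s₁ s₂).NonAdj x y ↔ (s₁.NonAdj x y ∨ s₂.NonAdj x y) ∨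
    (s₁.NonAdj x x ∧ s₂.NonAdj y y) ∨ (s₂.NonAdj x x ∧ s₁.NonAdj y y) := by
  simp only [nonAdj_self]
  constructor
  · rintro ⟨u | u, v | v, h1, h2, h⟩
    · exact Or.inl (Or.inl ⟨u, v, h1, h2, h⟩)
    · exact Or.inr (Or.inl ⟨⟨u, h1⟩, ⟨v, h2⟩⟩)
    · exact Or.inr (Or.inr ⟨⟨u, h1⟩, ⟨v, h2⟩⟩)
    · exact Or.inl (Or.inr ⟨u, v, h1, h2, h⟩)
  · rintro ((⟨u, v, h1, h2, h⟩ | ⟨u, v, h1, h2, h⟩) | ⟨⟨u, h1⟩, v, h2⟩ | ⟨⟨u, h1⟩, v, h2⟩)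
    · exact ⟨Sum.inl u, Sum.inl v, h1, h2, h⟩
    · exact ⟨Sum.inr u, Sum.inr v, h1, h2, h⟩
    · exact ⟨Sum.inl u, Sum.inr v, h1, h2, SimpleGraph.not_adj_sum_inl_inr u v⟩
    · exact ⟨Sum.inr u, Sum.inl v, h1, h2, fun h => SimpleGraph.not_adj_sum_inl_inr v u (SimpleGraph.Adj.symm h)⟩

theorem NonAdj.mem_labels {s : CWTerm} {x y : ℕ} (h : s.NonAdj x y) : x ∈ s.labels ∧ y ∈ s.labels := by
  obtain ⟨u, v, rfl, rfl, -⟩ := h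
  exact ⟨lab_mem_labels s u, lab_mem_labels s v⟩

end CWTerm

theorem CWTerm.width_pos (t : CWTerm) : 0 < t.width := by
  rw [width, Finset.card_pos]
  induction t with
  | vertex a => exact Finset.singleton_nonempty a
  | union s₁ s₂ h1 h2 => exact h1.mono Finset.subset_union_left
  | add a b h s ih => exact ih.mono Finset.subset_union_right
  | rename a b s ih => exact ih.mono Finset.subset_union_right

/-! ## Reasoning about programs -/

namespace RAM

/-- Set a register. -/
def State.setR (σ : State) (r v : ℕ) : State := { σ with reg := Function.update σ.reg r v }

/-- Set an array entry. -/
def State.setA (σ : State) (A i v : ℕ) : State :=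
  { σ with arr := Function.update σ.arr A (Function.update (σ.arr A) i v) }

/-- Write a number. -/
def State.emit (σ : State) (v : ℕ) : State := { σ with out := σ.out ++ [v] }

section setters
variable (σ : State) (r v r' A i A' j : ℕ)

@[simp] theorem State.setR_reg : (σ.setR r v).reg r' = if r' = r then v else σ.reg r' := by
  simp [State.setR, Function.update_apply]
@[simp] theorem State.setR_arr : (σ.setR r v).arr = σ.arr := rfl
@[simp] theorem State.setR_out : (σ.setR r v).out = σ.out := rfl
@[simp] theorem State.setA_reg : (σ.setA A i v).reg = σ.reg := rfl
@[simp] theorem State.setA_arr : (σ.setA A i v).arr A' =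
    if A' = A then Function.update (σ.arr A) i v else σ.arr A' := by
  by_cases h : A' = A
  · subst h; simp [State.setA]
  · simp [State.setA, h]
@[simp] theorem State.setA_out : (σ.setA A i v).out = σ.out := rfl
@[simp] theorem State.emit_reg : (σ.emit v).reg = σ.reg := rfl
@[simp] theorem State.emit_arr : (σ.emit v).arr = σ.arr := rfl
@[simp] theorem State.emit_out : (σ.emit v).out = σ.out ++ [v] := rfl

end setters

attribute [simp] Expr.eval Expr.cost Test.Holds Test.cost

namespace Prog

/-- Does the program write to register `r`? -/
def wr : Prog → ℕ → Bool
  | skip, _ => false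
  | assign r _, s => Nat.beq r s
  | store _ _ _, _ => false
  | write _, _ => false
  | seq p q, s => p.wr s || q.wr s
  | cond _ p q, s => p.wr s || q.wr s
  | loop _ p, s => p.wr s

/-- Does the program write to array `A`? -/
def wa : Prog → ℕ → Bool
  | skip, _ => false
  | assign _ _, _ => false
  | store A _ _, s => Nat.beq A s
  | write _, _ => false
  | seq p q, s => p.wa s || q.wa s
  | cond _ p q, s => p.wa s || q.wa s
  | loop _ p, s => p.wa s

/-- Does the program write to the output? -/
def wo : Prog → Bool
  | skip => false
  | assign _ _ => false
  | store _ _ _ => false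
  | write _ => true
  | seq p q => p.wo || q.wo
  | cond _ p q => p.wo || q.wo
  | loop _ p => p.wo

/-- Is the program free of loops? -/
def flat : Prog → Bool
  | skip => true
  | assign _ _ => true
  | store _ _ _ => true
  | write _ => true
  | seq p q => p.flat && q.flat
  | cond _ p q => p.flat && q.flat
  | loop _ _ => false

/-- A bound for the cost of a program without loops. -/
def bcost : Prog → ℕ
  | skip => 1
  | assign _ x => x.cost + 1
  | store _ i x => i.cost + x.cost + 1
  | write x => x.cost + 1
  | seq p q => p.bcost + q.bcost
  | cond b p q => b.cost + max p.bcost q.bcost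
  | loop _ _ => 0

open Classical in
/-- The final state of a program without loops. -/
noncomputable def run : Prog → State → State
  | skip, σ => σ
  | assign r x, σ => σ.setR r (x.eval σ)
  | store A i x, σ => σ.setA A (i.eval σ) (x.eval σ)
  | write x, σ => σ.emit (x.eval σ)
  | seq p q, σ => q.run (p.run σ)
  | cond b p q, σ => if b.Holds σ then p.run σ else q.run σ
  | loop _ _, σ => σ

/-- Programs without loops are evaluated by the function `run`, so their final states can be
computed by `simp`; invariants are needed for loops only. -/
theorem exec_run (p : Prog) (h : p.flat = true) (σ : State) : ∃ T, Exec p σ T (p.run σ) ∧ T ≤ p.bcost := by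
  induction p generalizing σ with
  | skip => exact ⟨_, Exec.skip σ, le_rfl⟩
  | assign r x => exact ⟨_, Exec.assign r x σ, le_rfl⟩
  | store A i x => exact ⟨_, Exec.store A i x σ, le_rfl⟩
  | write x => exact ⟨_, Exec.write x σ, le_rfl⟩
  | seq p q ihp ihq =>
    simp only [flat, Bool.and_eq_true] at h
    obtain ⟨T, h1, h2⟩ := ihp h.1 σ
    obtain ⟨U, h3, h4⟩ := ihq h.2 (p.run σ)
    exact ⟨_, Exec.seq h1 h3, Nat.add_le_add h2 h4⟩
  | cond b p q ihp ihq =>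
    simp only [flat, Bool.and_eq_true] at h
    obtain ⟨T, h1, h2⟩ := ihp h.1 σ
    obtain ⟨U, h3, h4⟩ := ihq h.2 σ
    by_cases hb : b.Holds σ
    · refine ⟨b.cost + T, ?_, by simp only [bcost]; omega⟩
      simp only [run, hb, if_true]
      exact Exec.cond_true q hb h1
    · refine ⟨b.cost + U, ?_, by simp only [bcost]; omega⟩
      simp only [run, hb, if_false]
      exact Exec.cond_false p hb h3
  | loop b p => simp [flat] at h

end Prog

/-- `τ` agrees with `σ` on everything that `p` does not write to. -/
structure Frame (p : Prog) (σ τ : State) : Prop where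
  reg : ∀ r, p.wr r = false → τ.reg r = σ.reg r
  arr : ∀ A, p.wa A = false → τ.arr A = σ.arr A
  out : p.wo = false → τ.out = σ.out

theorem Frame.refl (p : Prog) (σ : State) : Frame p σ σ := ⟨fun _ _ => rfl, fun _ _ => rfl, fun _ => rfl⟩

theorem Frame.trans {p : Prog} {σ τ ρ : State} (h : Frame p σ τ) (h' : Frame p τ ρ) : Frame p σ ρ :=
  ⟨fun r hr => (h'.reg r hr).trans (h.reg r hr), fun r hr => (h'.arr r hr).trans (h.arr r hr),
    fun hr => (h'.out hr).trans (h.out hr)⟩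

theorem Frame.mono {p q : Prog} {σ τ : State} (h : Frame p σ τ) (hr : ∀ r, q.wr r = false → p.wr r = false) (ha : ∀ r,
    q.wa r = false → p.wa r = false) (ho : q.wo = false → p.wo = false) : Frame q σ τ :=
  ⟨fun r h1 => h.reg r (hr r h1), fun r h1 => h.arr r (ha r h1), fun h1 => h.out (ho h1)⟩

theorem Frame.of_loop {b : Test} {p : Prog} {σ τ : State} (h : Frame p σ τ) :
    Frame (Prog.loop b p) σ τ := ⟨h.reg, h.arr, h.out⟩

/-- What a program leaves untouched is read off from its text by computation. Later such side
conditions on concrete programs are closed by `rfl`. -/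
theorem Exec.frame {p : Prog} {σ τ : State} {T : ℕ} (h : Exec p σ T τ) : Frame p σ τ := by
  induction h with
  | skip σ => exact Frame.refl _ _
  | assign r x σ =>
    refine ⟨fun s hs => ?_, fun _ _ => rfl, fun _ => rfl⟩
    have : s ≠ r := by rintro rfl; simp [Prog.wr] at hs
    simp [this]
  | store A i x σ =>
    refine ⟨fun _ _ => rfl, fun s hs => ?_, fun _ => rfl⟩
    have : s ≠ A := by rintro rfl; simp [Prog.wa] at hs
    simp [this]
  | write x σ => exact ⟨fun _ _ => rfl, fun _ _ => rfl, fun h => by simp [Prog.wo] at h⟩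
  | seq _ _ ih1 ih2 =>
    refine Frame.trans (ih1.mono ?_ ?_ ?_) (ih2.mono ?_ ?_ ?_) <;> simp +contextual [Prog.wr, Prog.wa, Prog.wo]
  | cond_true _ _ _ ih => refine ih.mono ?_ ?_ ?_ <;> simp +contextual [Prog.wr, Prog.wa, Prog.wo]
  | cond_false _ _ _ ih => refine ih.mono ?_ ?_ ?_ <;> simp +contextual [Prog.wr, Prog.wa, Prog.wo]
  | loop_true _ _ _ ih1 ih2 => exact ih1.of_loop.trans ih2
  | loop_false _ _ => exact Frame.refl _ _

/-- Started in `σ`, the program `p` halts within `T` steps in a state that satisfies `Q`. -/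
def Spec (p : Prog) (σ : State) (T : ℕ) (Q : State → Prop) : Prop := ∃ U τ, Exec p σ U τ ∧ U ≤ T ∧ Q τ

namespace Spec

variable {p q : Prog} {σ : State} {T U : ℕ} {Q Q' : State → Prop}

theorem mono (h : Spec p σ T Q) (hQ : ∀ τ, Frame p σ τ → Q τ → Q' τ) : Spec p σ T Q' := by
  obtain ⟨V, τ, h1, h2, h3⟩ := h
  exact ⟨V, τ, h1, h2, hQ τ h1.frame h3⟩

theorem le (h : Spec p σ T Q) (hT : T ≤ U) : Spec p σ U Q := by
  obtain ⟨V, τ, h1, h2, h3⟩ := h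
  exact ⟨V, τ, h1, h2.trans hT, h3⟩

theorem seq (h : Spec p σ T (fun τ => Spec q τ U Q)) : Spec (Prog.seq p q) σ (T + U) Q := by
  obtain ⟨V, τ, h1, h2, W, ρ, h3, h4, h5⟩ := h
  exact ⟨V + W, ρ, Exec.seq h1 h3, Nat.add_le_add h2 h4, h5⟩

/-- Sequential composition, with the frame of the first program at hand. -/
theorem seqf {R : State → Prop} (h : Spec p σ T R) (h' : ∀ τ, Frame p σ τ → R τ → Spec q τ U Q) : Spec (Prog.seq p q) σ
    (T + U) Q :=
  seq (h.mono h')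

theorem block (T : ℕ) (hQ : Q (p.run σ)) (h : p.flat = true := by rfl)
    (hT : p.bcost ≤ T := by first | exact le_rfl | decide | simp [Prog.bcost]) : Spec p σ T Q := by
  obtain ⟨V, h1, h2⟩ := p.exec_run h σ
  exact ⟨V, _, h1, h2.trans hT, hQ⟩

theorem blockseq (T : ℕ) (hQ : Spec q (p.run σ) U Q) (h : p.flat = true := by rfl)
    (hT : p.bcost ≤ T := by first | exact le_rfl | decide | simp [Prog.bcost]) : Spec (Prog.seq p q) σ (T + U) Q :=
  seq (block T hQ h hT)

theorem cond {b : Test} (hp : b.Holds σ → Spec p σ T Q) (hq : ¬ b.Holds σ → Spec q σ U Q) : Spec (Prog.cond b p q) σ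
    (b.cost + max T U) Q := by
  by_cases hb : b.Holds σ
  · obtain ⟨V, τ, h1, h2, h3⟩ := hp hb
    exact ⟨_, τ, Exec.cond_true q hb h1, by omega, h3⟩
  · obtain ⟨V, τ, h1, h2, h3⟩ := hq hb
    exact ⟨_, τ, Exec.cond_false p hb h1, by omega, h3⟩

theorem skip (h : Q σ) : Spec Prog.skip σ 1 Q := ⟨1, σ, Exec.skip σ, le_rfl, h⟩

theorem _root_.RAM.Test.cost_pos (b : Test) : 0 < b.cost := by cases b <;> simp

/-- Loops, with a ghost value `x` that determines the remaining time. -/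
theorem loop {α : Type*} {b : Test} (I : α → State → Prop) (Φ : α → ℕ) (x : α) (h0 : I x σ) (hstep : ∀ x τ, Frame
    (Prog.loop b p) σ τ → I x τ → b.Holds τ → ∃ T, Spec p τ T (fun ρ => ∃ y, I y ρ ∧ T + b.cost + Φ y ≤ Φ x)) : Spec
    (Prog.loop b p) σ (Φ x + b.cost) (fun τ => ∃ y, I y τ ∧ ¬ b.Holds τ) := by
  -- Induction on a bound for the potential, which drops by at least the positive cost of the test
  -- in every round.
  have key : ∀ n x τ, Φ x ≤ n → Frame (Prog.loop b p) σ τ → I x τ →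
      Spec (Prog.loop b p) τ (Φ x + b.cost) (fun τ => ∃ y, I y τ ∧ ¬ b.Holds τ) := by
    intro n
    induction n with
    | zero =>
      intro x τ hn hf hI
      by_cases hb : b.Holds τ
      · obtain ⟨T, V, ρ, h1, h2, y, h3, h4⟩ := hstep x τ hf hI hb
        have := b.cost_pos
        omega
      · exact ⟨_, τ, Exec.loop_false p hb, by omega, x, hI, hb⟩
    | succ n ih =>
      intro x τ hn hf hI
      by_cases hb : b.Holds τ
      · obtain ⟨T, V, ρ, h1, h2, y, h3, h4⟩ := hstep x τ hf hI hb
        have := b.cost_pos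
        obtain ⟨W, ρ', h5, h6, h7⟩ := ih y ρ (by omega) (hf.trans h1.frame.of_loop) h3
        exact ⟨_, ρ', Exec.loop_true hb h1 h5, by omega, h7⟩
      · exact ⟨_, τ, Exec.loop_false p hb, by omega, x, hI, hb⟩
  exact key _ x σ le_rfl (Frame.refl _ _) h0

end Spec

/-- `for i = 0, …, n - 1`, where `i` and `n` are registers. -/
def forLoop (i n : ℕ) (p : Prog) : Prog := Prog.seq (Prog.assign i (Expr.lit 0))
    (Prog.loop (Test.lt (Expr.reg i) (Expr.reg n)) (Prog.seq p (Prog.assign i (Expr.succ (Expr.reg i)))))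

/-- Beyond the body, a round costs 3 for the test and 3 for the increment; the initial assignment
(2) and the last, failing test (3) make up the 5. The invariant is required after the increment,
hence `setR`. -/
theorem Spec.forSum {i n : ℕ} {p : Prog} {σ : State} (T : ℕ → ℕ) (N : ℕ) (I : ℕ → State → Prop)
    (hN : σ.reg n = N) (h0 : I 0 (σ.setR i 0)) (hstep : ∀ j < N, ∀ τ,
    Frame (forLoop i n p) σ τ → τ.reg i = j → I j τ → Spec p τ (T j) (fun ρ => I (j + 1) (ρ.setR i (j + 1))))
    (hin : Nat.beq i n = false := by rfl) (hn : p.wr n = false := by rfl) (hi : p.wr i = false := by rfl) : Spec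
    (forLoop i n p) σ (∑ j ∈ Finset.range N, (T j + 6) + 5) (fun τ => τ.reg i = N ∧ I N τ) := by
  have hin' : ¬ n = i := fun h => by rw [h] at hin; simp at hin
  unfold forLoop
  refine ((Spec.blockseq 2 (U := ∑ j ∈ Finset.range N, (T j + 6) + 3) ?_)).le (by omega)
  have := Spec.loop (p := Prog.seq p (Prog.assign i (Expr.succ (Expr.reg i)))) (σ := (Prog.assign i (Expr.lit 0)).run σ)
    (b := Test.lt (Expr.reg i) (Expr.reg n))
    (I := fun j τ => j ≤ N ∧ τ.reg i = j ∧ τ.reg n = N ∧ I j τ)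
    (Φ := fun j => ∑ l ∈ Finset.Ico j N, (T l + 6)) 0
    (by
      refine ⟨Nat.zero_le _, by simp [Prog.run], by simp [Prog.run, hin', hN], h0⟩) (by
    rintro j τ hf ⟨h1, h2, h3, h4⟩ hb
    simp only [Test.Holds, Expr.eval, h2, h3] at hb
    have hf' : Frame (forLoop i n p) σ τ := by
      refine ⟨fun r hr => ?_, fun A hA => ?_, fun h => ?_⟩
      · simp only [forLoop, Prog.wr, Bool.or_eq_false_iff] at hr
        rw [hf.reg r (by simp [Prog.wr, hr])]
        have : r ≠ i := by rintro rfl; simp at hr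
        simp [Prog.run, this]
      · simp only [forLoop, Prog.wa, Bool.or_eq_false_iff] at hA
        rw [hf.arr A (by simp [Prog.wa, hA])]
        rfl
      · simp only [forLoop, Prog.wo, Bool.or_eq_false_iff] at h
        rw [hf.out (by simp [Prog.wo, h])]
        rfl
    refine ⟨T j + 3, Spec.seqf (hstep j hb τ hf' h2 h4) ?_⟩
    intro ρ hfρ hρ
    have e1 : ρ.reg i = j := by rw [hfρ.reg i hi, h2]
    have e2 : ρ.reg n = N := by rw [hfρ.reg n hn, h3]
    refine Spec.block 3 ⟨j + 1, ⟨hb, ?_, ?_, ?_⟩, ?_⟩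
    · simp [Prog.run, e1]
    · simp [Prog.run, hin', e2]
    · simpa [Prog.run, e1] using hρ
    · rw [← Finset.add_sum_Ioo_eq_sum_Ico hb]
      simp only [Test.cost, Expr.cost]
      have : Finset.Ico (j + 1) N = Finset.Ioo j N := by ext; simp
      rw [this])
  refine (this.le ?_).mono ?_
  · simp
  · rintro τ - ⟨j, ⟨h1, h2, h3, h4⟩, h5⟩
    simp only [Test.Holds, Expr.eval, h2, h3] at h5
    obtain rfl : j = N := by omega
    exact ⟨h2, h4⟩

theorem Spec.for {i n : ℕ} {p : Prog} {σ : State} (T : ℕ) (N : ℕ) (I : ℕ → State → Prop)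
    (hN : σ.reg n = N) (h0 : I 0 (σ.setR i 0)) (hstep : ∀ j < N, ∀ τ, Frame
    (forLoop i n p) σ τ → τ.reg i = j → I j τ → Spec p τ T (fun ρ => I (j + 1) (ρ.setR i (j + 1))))
    (hin : Nat.beq i n = false := by rfl) (hn : p.wr n = false := by rfl) (hi : p.wr i = false := by rfl) : Spec (forLoop i n
    p) σ (N * (T + 6) + 5) (fun τ => τ.reg i = N ∧ I N τ) := by
  refine (Spec.forSum (fun _ => T) N I hN h0 hstep hin hn hi).le ?_
  simp

theorem le_mul_and {c k : ℕ} (hc : 0 < c) (hk : 0 < k) : k ≤ c * k ∧ c ≤ c * k ∧ 0 < c * k :=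
  ⟨Nat.le_mul_of_pos_left _ hc, Nat.le_mul_of_pos_right _ hk, Nat.mul_pos hc hk⟩

theorem exists_getElem? {α : Type*} {l : List α} {n : ℕ} (h : n < l.length) : ∃ a, l[n]? = some a :=
  ⟨_, List.getElem?_eq_getElem h⟩

/-- `f` holds the list `l` from position `b` on. -/
def At (f : ℕ → ℕ) (b : ℕ) (l : List ℕ) : Prop := ∀ i v, l[i]? = some v → f (b + i) = v

namespace At

variable {f g : ℕ → ℕ} {b : ℕ} {l l' : List ℕ}

theorem nil : At f b [] := by intro i v h; simp at h

theorem append_iff : At f b (l ++ l') ↔ At f b l ∧ At f (b + l.length) l' := by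
  constructor
  · intro h
    refine ⟨fun i v hi => h i v ?_, fun i v hi => ?_⟩
    · rw [List.getElem?_append_left]
      · exact hi
      · exact getElem?_lt hi
    · rw [add_assoc]
      refine h _ v ?_
      rw [List.getElem?_append_right (by omega)]
      simpa using hi
  · rintro ⟨h1, h2⟩ i v hi
    rcases lt_or_ge i l.length with h | h
    · exact h1 i v (by rwa [List.getElem?_append_left h] at hi)
    · rw [List.getElem?_append_right h] at hi
      have := h2 _ v hi
      rwa [add_assoc, Nat.add_sub_cancel' h] at this

theorem cons_iff {a : ℕ} : At f b (a :: l) ↔ f b = a ∧ At f (b + 1) l := by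
  rw [show a :: l = [a] ++ l from rfl, append_iff]
  refine and_congr ⟨fun h => by simpa using h 0 a, fun h i v hi => ?_⟩ Iff.rfl
  rcases i with _ | i
  · simpa [h] using hi
  · simp at hi

theorem congr (h : At f b l) (hfg : ∀ i, b ≤ i → i < b + l.length → g i = f i) : At g b l := by
  intro i v hi
  have := getElem?_lt hi
  rw [hfg _ (by omega) (by omega)]
  exact h i v hi

theorem snoc {v : ℕ} (h : At f b l) : At (Function.update f (b + l.length) v) b (l ++ [v]) := by
  rw [append_iff, cons_iff]
  refine ⟨h.congr fun i _ hi => ?_, by simp, nil⟩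
  rw [Function.update_of_ne (by omega)]

end At

/-! ## Sets of labels as numbers -/

open RAM.Expr RAM.Test RAM.Prog CWTerm
open Function (update update_of_ne update_self update_apply)
open List (mem_of_getElem? getElem?_of_mem getElem?_eq_getElem getElem?_append_left getElem?_append_right idxOf_lt_length_iff
  take_add_one take_of_length_le flatMap_append length_append length_map mem_map)
open Finset (mem_filter)

variable {L : List ℕ} {c : ℕ} {σ τ : State} {X : List Tuple} {D : Set (ℕ × List Bool)} {x : Tuple}
  {S B : Finset ℕ} {root : ℕ} {𝒮 : Set Scheme}

/-- The number of a set of labels in the numbering `L` of the labels, after `j` rotations: the bit of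
the label `L[a]` is at position `a - j`, modulo the number of labels. -/
def rcode (L : List ℕ) (j : ℕ) (S : Finset ℕ) : ℕ := ∑ a ∈ S, 2 ^ ((L.idxOf a + (L.length - j)) % L.length)

/-- The number of a set of labels in the numbering `L` of the labels. -/
def code (L : List ℕ) (S : Finset ℕ) : ℕ := rcode L 0 S

/-- The part of `code L S` due to the labels before position `j`. -/
def lowcode (L : List ℕ) (j : ℕ) (S : Finset ℕ) : ℕ := ∑ a ∈ S with L.idxOf a < j, 2 ^ L.idxOf a

/-- The label at position `j`. -/
def lb (L : List ℕ) (j : ℕ) : ℕ := L.getD j 0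

section codes

variable {j : ℕ}

theorem lb_mem (hj : j < L.length) : lb L j ∈ L := by
  rw [lb, List.getD_eq_getElem _ _ hj]; exact List.getElem_mem hj

theorem idxOf_lb (hL : L.Nodup) (hj : j < L.length) : L.idxOf (lb L j) = j := by
  rw [lb, List.getD_eq_getElem _ _ hj]; exact hL.idxOf_getElem j hj

theorem lb_idxOf {a : ℕ} (ha : a ∈ L) : lb L (L.idxOf a) = a := by
  rw [lb, List.getD_eq_getElem _ _ (idxOf_lt_length_iff.2 ha)]; exact List.getElem_idxOf _

theorem lb_inj (hL : L.Nodup) {i : ℕ} (hi : i < L.length) (hj : j < L.length) (h : lb L i = lb L j) : i = j := by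
  rw [← idxOf_lb hL hi, h, idxOf_lb hL hj]

theorem sum_two_pow_lt {f : ℕ → ℕ} {n : ℕ} (hf : Set.InjOn f S) (hn : ∀ a ∈ S, f a < n) : ∑ a ∈ S, 2 ^ f a < 2 ^ n := by
  classical
  rw [← Finset.sum_image (g := f) (f := fun i => 2 ^ i) hf]
  calc ∑ i ∈ S.image f, 2 ^ i ≤ ∑ i ∈ Finset.range n, 2 ^ i := Finset.sum_le_sum_of_subset fun i hi => by
          obtain ⟨a, ha, rfl⟩ := Finset.mem_image.1 hi
          exact Finset.mem_range.2 (hn a ha)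
    _ < 2 ^ n := by rw [Nat.geomSum_eq (by norm_num)]; have := Nat.two_pow_pos n; simp

theorem exponent_self (hL : L.Nodup) (hj : j < L.length) : (L.idxOf (lb L j) + (L.length - j)) % L.length = 0 := by
  rw [idxOf_lb hL hj, Nat.add_sub_cancel' hj.le, Nat.mod_self]

theorem exponent_eq {a : ℕ} (ha : a ∈ L) (hj : j ≤ L.length) : (L.idxOf a + (L.length - j)) % L.length = if j ≤ L.idxOf
    a then L.idxOf a - j else L.idxOf a + (L.length - j) := by
  have := idxOf_lt_length_iff.2 ha
  split_ifs with h
  · rw [show L.idxOf a + (L.length - j) = L.idxOf a - j + L.length by omega, Nat.add_mod_right,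
      Nat.mod_eq_of_lt (by omega)]
  · rw [Nat.mod_eq_of_lt (by omega)]

theorem idxOf_inj {a b : ℕ} (ha : a ∈ L) (hb : b ∈ L) (h : L.idxOf a = L.idxOf b) : a = b := by
  rw [← lb_idxOf ha, h, lb_idxOf hb]

theorem rcode_lt (hS : S ⊆ L.toFinset) (hj : j ≤ L.length) : rcode L j S < 2 ^ L.length := by
  refine sum_two_pow_lt ?_ ?_
  · intro a ha b hb h
    have ha' : a ∈ L := by simpa using hS ha
    have hb' : b ∈ L := by simpa using hS hb
    have h1 := idxOf_lt_length_iff.2 ha'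
    have h2 := idxOf_lt_length_iff.2 hb'
    simp only [exponent_eq ha' hj, exponent_eq hb' hj] at h
    refine idxOf_inj ha' hb' ?_
    split_ifs at h <;> omega
  · intro a ha
    have ha' : a ∈ L := by simpa using hS ha
    exact Nat.mod_lt _ (List.length_pos_of_mem ha')

theorem rcode_length : rcode L L.length S = code L S := by
  refine Finset.sum_congr rfl fun a _ => ?_
  simp

/-- After `j` rotations the label at position `j` sits at the lowest bit. So a label whose turn it
is can be inserted by a successor and removed by a predecessor. -/
theorem rcode_insert (hL : L.Nodup) (hj : j < L.length) (h : lb L j ∉ S) : rcode L j (insert (lb L j) S) = rcode L j S +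
    1 := by
  rw [rcode, Finset.sum_insert h, exponent_self hL hj, add_comm]
  rfl

theorem rcode_erase (hL : L.Nodup) (hj : j < L.length) (h : lb L j ∈ S) : rcode L j (S.erase (lb L j)) + 1 = rcode L j S
    := by
  rw [← rcode_insert hL hj (Finset.notMem_erase _ _), Finset.insert_erase h]

/-- The numbers after one more rotation, for a set that does not contain the current label. -/
theorem two_mul_rcode_succ (hS : S ⊆ L.toFinset) (hj : j < L.length) (h : lb L j ∉ S) : rcode L j S = 2 * rcode L (j +
    1) S := by
  rw [rcode, rcode, Finset.mul_sum]
  refine Finset.sum_congr rfl fun a ha => ?_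
  have ha' : a ∈ L := by simpa using hS ha
  have h1 := idxOf_lt_length_iff.2 ha'
  have h2 : L.idxOf a ≠ j := by
    rintro rfl; rw [lb_idxOf ha'] at h; exact h ha
  rw [exponent_eq ha' hj.le, exponent_eq ha' hj, ← pow_succ']
  congr 1
  split_ifs <;> omega

theorem rcode_mod_two (hL : L.Nodup) (hS : S ⊆ L.toFinset) (hj : j < L.length) : rcode L j S % 2 = if lb L j ∈ S then 1
    else 0 := by
  split_ifs with h
  · rw [← rcode_erase hL hj h, two_mul_rcode_succ ((Finset.erase_subset _ _).trans hS) hj (Finset.notMem_erase _ _)]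
    omega
  · rw [two_mul_rcode_succ hS hj h]
    omega

/-- Halving moves every other bit down by one, and the bit of the current label wraps around to the
front. The left-hand side is what the table `aROT` contains. -/
theorem rcode_rot (hL : L.Nodup) (hS : S ⊆ L.toFinset) (hj : j < L.length) : rcode L j S / 2 + rcode L j S % 2 * 2 ^
    (L.length - 1) = rcode L (j + 1) S := by
  by_cases h : lb L j ∈ S
  · have h1 := two_mul_rcode_succ ((Finset.erase_subset (lb L j) _).trans hS) hj (Finset.notMem_erase _ _)
    have h2 := rcode_erase hL hj h
    have h3 : rcode L (j + 1) S = 2 ^ (L.length - 1) + rcode L (j + 1) (S.erase (lb L j)) := by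
      rw [rcode, rcode, ← Finset.add_sum_erase S _ h, exponent_eq (lb_mem hj) hj, idxOf_lb hL hj, if_neg (by omega)]
      congr 2; omega
    have h4 : rcode L j S / 2 = rcode L (j + 1) (S.erase (lb L j)) := by omega
    rw [rcode_mod_two hL hS hj, if_pos h, h3, h4]; omega
  · rw [rcode_mod_two hL hS hj, if_neg h, two_mul_rcode_succ hS hj h]; omega

theorem lowcode_zero : lowcode L 0 S = 0 := by simp [lowcode]

theorem lowcode_succ (hL : L.Nodup) (hS : S ⊆ L.toFinset) (hj : j < L.length) : lowcode L (j + 1) S = lowcode L j S + if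
    lb L j ∈ S then 2 ^ j else 0 := by
  classical
  split_ifs with h
  · rw [lowcode, lowcode, ← Finset.sum_erase_add _ _ (a := lb L j)
      (mem_filter.2 ⟨h, by rw [idxOf_lb hL hj]; omega⟩), idxOf_lb hL hj]
    congr 1
    refine Finset.sum_congr ?_ fun _ _ => rfl
    ext a
    simp only [Finset.mem_erase, mem_filter]
    constructor
    · rintro ⟨h1, h2, h3⟩
      have ha' : a ∈ L := by simpa using hS h2
      have : L.idxOf a ≠ j := by rintro rfl; exact h1 (lb_idxOf ha').symm
      exact ⟨h2, by omega⟩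
    · rintro ⟨h2, h3⟩
      refine ⟨?_, h2, by omega⟩
      rintro rfl; rw [idxOf_lb hL hj] at h3; omega
  · rw [add_zero, lowcode, lowcode]
    refine Finset.sum_congr ?_ fun _ _ => rfl
    ext a
    simp only [mem_filter]
    refine and_congr_right fun h2 => ?_
    have ha' : a ∈ L := by simpa using hS h2
    have : L.idxOf a ≠ j := by rintro rfl; rw [lb_idxOf ha'] at h; exact h h2
    omega

theorem lowcode_lt (hL : L.Nodup) (hS : S ⊆ L.toFinset) (hj : j ≤ L.length) : lowcode L j S < 2 ^ j := by
  induction j with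
  | zero => simp [lowcode_zero]
  | succ j ih =>
    rw [lowcode_succ hL hS hj, pow_succ]
    have := ih (by omega)
    split_ifs <;> omega

theorem lowcode_length (hS : S ⊆ L.toFinset) : lowcode L L.length S = code L S := by
  have : (S.filter fun a => L.idxOf a < L.length) = S := by
    refine Finset.filter_true_of_mem fun a ha => ?_
    have ha' : a ∈ L := by simpa using hS ha
    exact idxOf_lt_length_iff.2 ha'
  rw [lowcode, this, code, rcode]
  refine Finset.sum_congr rfl fun a ha => ?_
  have ha' : a ∈ L := by simpa using hS ha
  rw [Nat.sub_zero, Nat.add_mod_right, Nat.mod_eq_of_lt (idxOf_lt_length_iff.2 ha')]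

/-- The rotations of a number bring each of its bits into the lowest place, where it is seen as a
parity. -/
theorem rcode_inj (hL : L.Nodup) {S' : Finset ℕ} (hS : S ⊆ L.toFinset) (hS' : S' ⊆ L.toFinset) (h : code L S = code L
    S') : S = S' := by
  have key : ∀ j ≤ L.length, rcode L j S = rcode L j S' := by
    intro j hj
    induction j with
    | zero => exact h
    | succ j ih => rw [← rcode_rot hL hS hj, ← rcode_rot hL hS' hj, ih (by omega)]
  ext a
  by_cases ha : a ∈ L
  · have h1 := idxOf_lt_length_iff.2 ha
    have h2 := congrArg (· % 2) (key _ h1.le)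
    simp only [rcode_mod_two hL hS h1, rcode_mod_two hL hS' h1, lb_idxOf ha] at h2
    split_ifs at h2 <;> simp_all
  · exact ⟨fun h => absurd (by simpa using hS h) ha, fun h => absurd (by simpa using hS' h) ha⟩

end codes

/-! ### Radix sort -/

/-- `l` after the stable distribution by the labels before position `j`. -/
def radix (L : List ℕ) : ℕ → Tuple → Tuple
  | 0, l => l
  | j + 1, l => (radix L j l).filter (lb L j ∉ ·) ++ (radix L j l).filter (lb L j ∈ ·)

/-- Sorted by number. -/
def Sorted (L : List ℕ) (l : Tuple) : Prop := l.Pairwise (fun S S' => code L S ≤ code L S')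

section radix

variable {l : Tuple} {j : ℕ}

theorem radix_perm : (radix L j l).Perm l := by
  induction j with
  | zero => exact List.Perm.refl _
  | succ j ih =>
    refine List.Perm.trans ?_ ih
    rw [radix]
    refine List.perm_append_comm.trans ?_
    have := List.filter_append_perm (fun S => decide (lb L j ∈ S)) (radix L j l)
    simpa using this

/-- Sets that agree at position `j` keep the order given by the lower bits, as the distribution is
stable; otherwise the bit at position `j` outweighs all lower ones (`lowcode_lt`). -/
theorem radix_pairwise (hL : L.Nodup) (hl : ∀ S ∈ l, S ⊆ L.toFinset) (hj : j ≤ L.length) : (radix L j l).Pairwise (fun S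
    S' => lowcode L j S ≤ lowcode L j S') := by
  induction j with
  | zero => exact List.pairwise_of_forall (by simp [lowcode_zero])
  | succ j ih =>
    have hl' : ∀ S ∈ radix L j l, S ⊆ L.toFinset := fun S hS => hl S (radix_perm.mem_iff.1 hS)
    have ih' := ih (by omega)
    rw [radix, List.pairwise_append]
    refine ⟨?_, ?_, ?_⟩
    · refine (ih'.filter _).imp_of_mem ?_
      intro S S' hS hS' h
      simp only [List.mem_filter, decide_eq_true_eq] at hS hS'
      rw [lowcode_succ hL (hl' S hS.1) hj, lowcode_succ hL (hl' S' hS'.1) hj, if_neg hS.2, if_neg hS'.2]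
      simpa using h
    · refine (ih'.filter _).imp_of_mem ?_
      intro S S' hS hS' h
      simp only [List.mem_filter, decide_eq_true_eq] at hS hS'
      rw [lowcode_succ hL (hl' S hS.1) hj, lowcode_succ hL (hl' S' hS'.1) hj, if_pos hS.2, if_pos hS'.2]
      simpa using h
    · intro S hS S' hS'
      simp only [List.mem_filter, decide_eq_true_eq] at hS hS'
      rw [lowcode_succ hL (hl' S hS.1) hj, lowcode_succ hL (hl' S' hS'.1) hj, if_neg hS.2, if_pos hS'.2]
      have := lowcode_lt hL (hl' S hS.1) (j := j) (by omega)
      omega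

theorem sorted_radix (hL : L.Nodup) (hl : ∀ S ∈ l, S ⊆ L.toFinset) : Sorted L (radix L L.length l) := by
  refine (radix_pairwise hL hl le_rfl).imp_of_mem ?_
  intro S S' hS hS' h
  rwa [lowcode_length (hl S (radix_perm.mem_iff.1 hS)), lowcode_length (hl S' (radix_perm.mem_iff.1 hS'))] at h

/-- Sorted lists are canonical representatives of schemes, because a number determines its set.
Equality of schemes thus becomes equality of lists and can be tested by a dictionary. -/
theorem Sorted.eq_of_perm (hL : L.Nodup) {l' : Tuple} (hl : ∀ S ∈ l, S ⊆ L.toFinset) (h : l.Perm l') (hs : Sorted L l)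
    (hs' : Sorted L l') : l = l' := by
  refine List.Perm.eq_of_pairwise ?_ hs hs' h
  intro S S' hS hS' h1 h2
  exact rcode_inj hL (hl S hS) (hl S' (h.mem_iff.2 hS')) (le_antisymm h1 h2)

end radix

/-! ## The program: registers and arrays -/

infixr:60 " ;; " => Prog.seq

notation "rC" => (0 : ℕ)
notation "rK" => (1 : ℕ)
notation "rM" => (2 : ℕ)
notation "rN" => (3 : ℕ)
notation "rE" => (4 : ℕ)
notation "rT" => (5 : ℕ)
notation "aROT" => (3 : ℕ)
notation "aODD" => (4 : ℕ)
notation "aCH" => (9 : ℕ)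
notation "aMEM" => (10 : ℕ)
notation "aBUF" => (11 : ℕ)
notation "aTMP" => (12 : ℕ)

/-- Increment a register. -/
def inc (r : ℕ) : Prog := assign r (succ (reg r))

/-- The registers and tables on which the computation with sets of labels relies. -/
structure Env (L : List ℕ) (c : ℕ) (σ : State) : Prop where
  rc : σ.reg rC = c
  rk : σ.reg rK = L.length
  rn : σ.reg rN = 2 ^ L.length
  rot : ∀ x < 2 ^ L.length, σ.arr aROT x = x / 2 + x % 2 * 2 ^ (L.length - 1)
  odd : ∀ x < 2 ^ L.length, σ.arr aODD x = x % 2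

section env

theorem Env.congr (h : Env L c σ) (h0 : τ.reg rC = σ.reg rC := by rfl) (h1 : τ.reg rK = σ.reg rK := by rfl)
    (h2 : τ.reg rN = σ.reg rN := by rfl) (h3 : τ.arr aROT = σ.arr aROT := by rfl) (h4 : τ.arr aODD = σ.arr aODD := by rfl) :
    Env L c τ :=
  ⟨h0.trans h.rc, h1.trans h.rk, h2.trans h.rn, by rw [h3]; exact h.rot, by rw [h4]; exact h.odd⟩

/-- The program does not interfere with the environment. -/
def Prog.safe (p : Prog) : Bool := !(p.wr rC) && !(p.wr rK) && !(p.wr rN) && !(p.wa aROT) && !(p.wa aODD)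

theorem Env.frame (h : Env L c σ) {p : Prog} (hf : Frame p σ τ) (hp : p.safe = true) : Env L c τ := by
  simp only [Prog.safe, Bool.and_eq_true, Bool.not_eq_true'] at hp
  obtain ⟨⟨⟨⟨h1, h2⟩, h3⟩, h4⟩, h5⟩ := hp
  exact h.congr (hf.reg _ h1) (hf.reg _ h2) (hf.reg _ h3) (hf.arr _ h4) (hf.arr _ h5)

theorem Env.odd_rcode (h : Env L c σ) (hL : L.Nodup) (hS : S ⊆ L.toFinset) {j : ℕ} (hj : j < L.length) : σ.arr aODD
    (rcode L j S) = if lb L j ∈ S then 1 else 0 := by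
  rw [h.odd _ (rcode_lt hS hj.le), rcode_mod_two hL hS hj]

theorem Env.rot_rcode (h : Env L c σ) (hL : L.Nodup) (hS : S ⊆ L.toFinset) {j : ℕ} (hj : j < L.length) : σ.arr aROT
    (rcode L j S) = rcode L (j + 1) S := by
  rw [h.rot _ (rcode_lt hS hj.le), rcode_rot hL hS hj]

end env

theorem At.take_succ {f : ℕ → ℕ} {b i v : ℕ} {l : List ℕ} (h : At f b (l.take i)) (hv : l[i]? = some v) : At (update f
    (b + i) v) b (l.take (i + 1)) := by
  have hi := getElem?_lt hv
  have := h.snoc (v := v)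
  rw [List.length_take, min_eq_left hi.le] at this
  rw [take_add_one, hv]
  exact this

/-! ### Sorting -/

notation "rSa" => (10 : ℕ)
notation "rSi" => (11 : ℕ)
notation "rSj" => (12 : ℕ)

/-- Append the rotated numbers with low bit `b` to `TMP`. -/
def sweep (b : ℕ) : Prog := forLoop rSi rC (Prog.cond (eq (get aODD (get aBUF (reg rSi))) (lit b))
    (store aTMP (reg rSj) (get aROT (get aBUF (reg rSi))) ;; inc rSj) skip)

theorem sweep_spec (hL : L.Nodup) {c b j : ℕ} (hE : Env L c σ) (hj : j < L.length) {l : Tuple} (hl : ∀ S ∈ l, S ⊆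
    L.toFinset) (hc : l.length = c) (p : Finset ℕ → Bool) (hp : ∀ S, p S = true ↔ (if lb L j ∈ S then 1 else 0) = b) (hB
    : At (σ.arr aBUF) 0 (l.map (rcode L j))) {w : List ℕ} (hw : At (σ.arr aTMP) 0 w) (hwj : σ.reg rSj = w.length) : Spec
    (sweep b) σ (c * 19 + 5) (fun τ => At (τ.arr aTMP) 0 (w ++ (l.filter p).map (rcode L (j + 1))) ∧ τ.reg rSj = (w ++
    (l.filter p).map (rcode L (j + 1))).length) := by
  refine (Spec.for 13 c (fun i τ => At (τ.arr aTMP) 0 (w ++ ((l.take i).filter p).map (rcode L (j + 1))) ∧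
      τ.reg rSj = (w ++ ((l.take i).filter p).map (rcode L (j + 1))).length)
    hE.rc (by simpa using ⟨hw, hwj⟩) ?_).mono ?_
  · rintro i hi τ hf hri ⟨h1, h2⟩
    have hEτ := hE.frame hf rfl
    have hBτ : At (τ.arr aBUF) 0 (l.map (rcode L j)) := hf.arr aBUF rfl ▸ hB
    obtain ⟨S, hS⟩ := exists_getElem? (l := l) (n := i) (by omega)
    have hSl : S ∈ l := mem_of_getElem? hS
    have hb : τ.arr aBUF i = rcode L j S := by
      have := hBτ i (rcode L j S) (by simp [hS])
      simpa using this
    have htake : l.take (i + 1) = l.take i ++ [S] := by rw [take_add_one, hS]; rfl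
    refine Spec.block 13 ?_
    by_cases hpS : p S = true
    · have hp' := (hp S).1 hpS
      have hx : (w ++ ((l.take (i + 1)).filter p).map (rcode L (j + 1))) =
          (w ++ ((l.take i).filter p).map (rcode L (j + 1))) ++ [rcode L (j + 1) S] := by
        rw [htake]; simp [hpS]
      rw [hx]
      have hh := h1.snoc (v := rcode L (j + 1) S)
      simp only [zero_add, ← h2] at hh
      simp only [run, inc, Holds, eval, hri, hb, hEτ.odd_rcode hL (hl S hSl) hj, hp', if_true,
        hEτ.rot_rcode hL (hl S hSl) hj]
      simp [h2] at hh ⊢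
      exact ⟨hh, by ring⟩
    · have hp' := mt (hp S).2 hpS
      have hx : (w ++ ((l.take (i + 1)).filter p).map (rcode L (j + 1))) =
          (w ++ ((l.take i).filter p).map (rcode L (j + 1))) := by
        rw [htake]; simp [hpS]
      rw [hx]
      simp only [run, Holds, eval, hri, hb, hEτ.odd_rcode hL (hl S hSl) hj, hp', if_false]
      exact ⟨h1, h2⟩
  · rintro τ - ⟨-, h1, h2⟩
    rw [take_of_length_le hc.le] at h1 h2
    exact ⟨h1, h2⟩

/-- Sort `BUF`. -/
def sortP : Prog := forLoop rSa rK (assign rSj (lit 0) ;; sweep 0 ;; sweep 1 ;;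
    forLoop rSi rC (store aBUF (reg rSi) (get aTMP (reg rSi))))

theorem sortP_spec (hL : L.Nodup) (hE : Env L c σ) {l : Tuple} (hl : ∀ S ∈ l, S ⊆ L.toFinset) (hc : l.length = c) (hB :
    At (σ.arr aBUF) 0 (l.map (code L))) : Spec sortP σ (L.length * (c * 48 + 23) + 5) (fun τ => At (τ.arr aBUF) 0
    ((radix L L.length l).map (code L))) := by
  refine (Spec.for (c * 48 + 17) L.length (fun j τ => At (τ.arr aBUF) 0 ((radix L j l).map (rcode L j)))
    hE.rk (by exact hB) ?_).mono ?_
  · rintro j hj τ hf hrj h1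
    have hEτ := hE.frame hf rfl
    have hl' : ∀ S ∈ radix L j l, S ⊆ L.toFinset := fun S hS => hl S (radix_perm.mem_iff.1 hS)
    have hc' : (radix L j l).length = c := radix_perm.length_eq.trans hc
    refine Spec.le (T := 2 + ((c * 19 + 5) + ((c * 19 + 5) + (c * 10 + 5)))) ?_ (by omega)
    refine Spec.blockseq 2 ?_
    have hE0 : Env L c ((assign rSj (lit 0)).run τ) := hEτ.congr
    refine Spec.seqf (sweep_spec hL (j := j) (l := radix L j l)
      (w := []) hE0 hj hl' hc' (lb L j ∉ ·) (by simp) h1 At.nil rfl) ?_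
    rintro τ1 hf1 ⟨h2, h3⟩
    have hE1 : Env L c τ1 := hE0.frame hf1 rfl
    refine Spec.seqf (sweep_spec hL (j := j) (l := radix L j l) hE1 hj hl' hc' (lb L j ∈ ·) (by simp)
      (hf1.arr aBUF rfl ▸ h1) h2 h3) ?_
    rintro τ2 hf2 ⟨h4, h5⟩
    have hE2 := hE1.frame hf2 rfl
    rw [List.nil_append, ← List.map_append] at h4
    have hw : (radix L j l).filter (lb L j ∉ ·) ++ (radix L j l).filter (lb L j ∈ ·) = radix L (j + 1) l := rfl
    rw [hw] at h4
    have hc2 : (radix L (j + 1) l).length = c := radix_perm.length_eq.trans hc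
    refine (Spec.for 4 c (fun i τ => At (τ.arr aBUF) 0
      (((radix L (j + 1) l).map (rcode L (j + 1))).take i)) hE2.rc At.nil ?_).mono ?_
    · intro i hi ρ hfρ hri h6
      refine Spec.block 4 ?_
      have : (List.map (rcode L (j + 1)) (radix L (j + 1) l))[i]? = some (ρ.arr aTMP i) := by
        rw [hfρ.arr aTMP rfl]
        obtain ⟨v, hv⟩ : ∃ v, (List.map (rcode L (j + 1)) (radix L (j + 1) l))[i]? = some v :=
          ⟨_, getElem?_eq_getElem (by simp; omega)⟩
        have := h4 i v hv
        rw [zero_add] at this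
        rw [this, hv]
      have := h6.take_succ this
      simpa [run, hri] using this
    · rintro ρ - ⟨-, h6⟩
      rw [take_of_length_le (by simp [hc2])] at h6
      exact h6
  -- After one rotation for each label the numbers are back in their original form.
  · rintro τ - ⟨-, h1⟩
    have : rcode L L.length = code L := funext fun _ => rcode_length
    rwa [this] at h1

/-! ## A dictionary -/

/-- The bits of a list of sets of labels. -/
def key (L : List ℕ) (l : Tuple) : List Bool :=
  l.flatMap (fun S => (List.range L.length).map (fun a => decide (lb L a ∈ S)))

theorem key_inj {l l' : Tuple} (hl : ∀ S ∈ l, S ⊆ L.toFinset) (hl' : ∀ S ∈ l', S ⊆ L.toFinset) (h : l.length =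
    l'.length) (hk : key L l = key L l') : l = l' := by
  induction l generalizing l' with
  | nil => exact (List.length_eq_zero_iff.1 h.symm).symm
  | cons S l ih =>
    obtain _ | ⟨S', l'⟩ := l'
    · simp at h
    simp only [key, List.flatMap_cons] at hk
    obtain ⟨h1, h2⟩ := List.append_inj hk (by simp)
    rw [ih (fun S hS => hl S (List.mem_cons_of_mem _ hS)) (fun S hS => hl' S (List.mem_cons_of_mem _ hS))
      (by simpa using h) h2]
    congr 1
    ext a
    by_cases ha : a ∈ L
    · have h3 := idxOf_lt_length_iff.2 ha
      have h4 := congrArg (fun l => l[L.idxOf a]?) h1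
      simpa [h3, lb_idxOf ha] using h4
    · exact ⟨fun h => absurd (by simpa using hl S (by simp) h) ha,
        fun h => absurd (by simpa using hl' S' (by simp) h) ha⟩

/-- The numbers of the nodes of the tries. -/
def IsNode (tn v : ℕ) : Prop := 0 < v ∧ v < tn ∧ v % 2 = 0

/-- `CH` represents the set `D` of bit strings, each with the root of the trie that contains it. -/
structure Trie (path : ℕ → ℕ × List Bool) (CH : ℕ → ℕ) (tn : ℕ) (D : Set (ℕ × List Bool)) : Prop where
  next : 0 < tn ∧ tn % 2 = 0
  inj : ∀ v w, IsNode tn v → IsNode tn w → path v = path w → v = w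
  mem : ∀ d, d ∈ D ↔ ∃ v, IsNode tn v ∧ path v = d
  child : ∀ v b, IsNode tn v → (CH (v + Bool.toNat b) = 0 ∧ ((path v).1, (path v).2 ++ [b]) ∉ D) ∨
    (IsNode tn (CH (v + Bool.toNat b)) ∧ path (CH (v + Bool.toNat b)) = ((path v).1, (path v).2 ++ [b]))
  fresh : ∀ q, tn ≤ q → CH q = 0
  parent : ∀ r bs b, (r, bs ++ [b]) ∈ D → (r, bs) ∈ D
  root : ∀ r bs, (r, bs) ∈ D → IsNode tn r ∧ path r = (r, [])

namespace Trie

variable {path : ℕ → ℕ × List Bool} {CH : ℕ → ℕ} {tn : ℕ}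

/-- Nodes have even numbers so that node `v` can keep its two children in the cells `v` and `v + 1`.
Counting starts at 2, because an entry 0 stands for a missing child. -/
theorem init : Trie path (fun _ => 0) 2 ∅ := by
  have h : ∀ v, ¬ IsNode 2 v := by rintro v ⟨h1, h2, h3⟩; omega
  exact ⟨by simp, fun v w hv => absurd hv (h v), fun d => by simp [h], fun v b hv => absurd hv (h v),
    fun _ _ => rfl, by simp, by simp⟩

theorem isNode_succ {v : ℕ} (ht : Trie path CH tn D) : IsNode (tn + 2) v ↔ IsNode tn v ∨ v = tn := by
  have := ht.next
  simp only [IsNode]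
  constructor
  · rintro ⟨h1, h2, h3⟩
    by_cases h : v < tn
    · exact Or.inl ⟨h1, h, h3⟩
    · right; omega
  · rintro (⟨h1, h2, h3⟩ | rfl)
    · exact ⟨h1, by omega, h3⟩
    · exact ⟨by omega, by omega, by omega⟩

/-- The cells from `tn` on have never been written, so a new root needs no initialisation and the
cost of starting a new set is constant. -/
theorem newRoot (ht : Trie path CH tn D) : Trie (update path tn (tn, [])) CH (tn + 2) (insert (tn, []) D) := by
  have hn : ¬ IsNode tn tn := fun h => by have := h.2.1; omega
  have hup : ∀ v, IsNode tn v → update path tn (tn, []) v = path v := fun v hv => by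
    rw [update_of_ne]; rintro rfl; exact hn hv
  have hD : ∀ bs, (tn, bs) ∉ D := fun bs h => hn (ht.root _ _ h).1
  refine ⟨?_, ?_, ?_, ?_, fun q hq => ht.fresh q (by omega), ?_, ?_⟩
  · have := ht.next; omega
  · intro v w hv hw h
    rcases (ht.isNode_succ).1 hv with hv | rfl <;> rcases (ht.isNode_succ).1 hw with hw | rfl
    · rw [hup v hv, hup w hw] at h; exact ht.inj v w hv hw h
    · rw [hup v hv, update_self] at h
      exact absurd ((ht.mem _).2 ⟨v, hv, h⟩) (hD _)
    · rw [hup w hw, update_self] at h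
      exact absurd ((ht.mem _).2 ⟨w, hw, h.symm⟩) (hD _)
    · rfl
  · intro d
    rw [Set.mem_insert_iff, ht.mem]
    constructor
    · rintro (rfl | ⟨v, hv, rfl⟩)
      · exact ⟨tn, ht.isNode_succ.2 (Or.inr rfl), by simp⟩
      · exact ⟨v, ht.isNode_succ.2 (Or.inl hv), hup v hv⟩
    · rintro ⟨v, hv, rfl⟩
      rcases (ht.isNode_succ).1 hv with hv | rfl
      · exact Or.inr ⟨v, hv, (hup v hv).symm⟩
      · left; simp
  · intro v b hv
    rcases (ht.isNode_succ).1 hv with hv | rfl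
    · rw [hup v hv]
      rcases ht.child v b hv with ⟨h1, h2⟩ | ⟨h1, h2⟩
      · refine Or.inl ⟨h1, ?_⟩
        rw [Set.mem_insert_iff]
        rintro (h | h)
        · simp at h
        · exact h2 h
      · exact Or.inr ⟨ht.isNode_succ.2 (Or.inl h1), (hup _ h1).trans h2⟩
    · refine Or.inl ⟨ht.fresh _ (by omega), ?_⟩
      simp only [update_self, Set.mem_insert_iff]
      rintro (h | h)
      · simp at h
      · exact hD _ h
  · rintro r bs b (h | h)
    · simp at h
    · exact Or.inr (ht.parent _ _ _ h)
  · rintro r bs (h | h)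
    · simp only [Prod.mk.injEq] at h
      obtain ⟨rfl, -⟩ := h
      exact ⟨ht.isNode_succ.2 (Or.inr rfl), by simp⟩
    · obtain ⟨h1, h2⟩ := ht.root _ _ h
      exact ⟨ht.isNode_succ.2 (Or.inl h1), (hup _ h1).trans h2⟩

/-- Different nodes own disjoint pairs of cells, since their numbers are even; the single write
therefore concerns one child of one node. -/
theorem addChild (ht : Trie path CH tn D) {v : ℕ} {b : Bool} (hv : IsNode tn v) (h0 : CH (v + Bool.toNat b) = 0) : Trie
    (update path tn ((path v).1, (path v).2 ++ [b])) (update CH (v + Bool.toNat b) tn) (tn + 2) (insert ((path v).1,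
    (path v).2 ++ [b]) D) := by
  set d := ((path v).1, (path v).2 ++ [b]) with hd
  have hb : b.toNat ≤ 1 := by cases b <;> simp
  have hn : ¬ IsNode tn tn := fun h => by have := h.2.1; omega
  have hup : ∀ v, IsNode tn v → update path tn d v = path v := fun v hv => by
    rw [update_of_ne]; rintro rfl; exact hn hv
  have hdD : d ∉ D := by
    rcases ht.child v b hv with ⟨_, h⟩ | ⟨h, _⟩
    · exact h
    · rw [h0] at h; exact absurd h.1 (by simp)
  have hvD : path v ∈ D := (ht.mem _).2 ⟨v, hv, rfl⟩
  have hv2 := hv.2.1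
  have htn := ht.next
  refine ⟨by omega, ?_, ?_, ?_, ?_, ?_, ?_⟩
  · intro v w hv hw h
    rcases (ht.isNode_succ).1 hv with hv | rfl <;> rcases (ht.isNode_succ).1 hw with hw | rfl
    · rw [hup v hv, hup w hw] at h; exact ht.inj v w hv hw h
    · rw [hup v hv, update_self] at h
      exact absurd ((ht.mem _).2 ⟨v, hv, h⟩) hdD
    · rw [hup w hw, update_self] at h
      exact absurd ((ht.mem _).2 ⟨w, hw, h.symm⟩) hdD
    · rfl
  · intro d'
    rw [Set.mem_insert_iff, ht.mem]
    constructor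
    · rintro (rfl | ⟨v, hv, rfl⟩)
      · exact ⟨tn, ht.isNode_succ.2 (Or.inr rfl), by simp⟩
      · exact ⟨v, ht.isNode_succ.2 (Or.inl hv), hup v hv⟩
    · rintro ⟨v, hv, rfl⟩
      rcases (ht.isNode_succ).1 hv with hv | rfl
      · exact Or.inr ⟨v, hv, (hup v hv).symm⟩
      · left; simp
  · intro w b' hw
    have hb' : b'.toNat ≤ 1 := by cases b' <;> simp
    rcases (ht.isNode_succ).1 hw with hw | rfl
    · rw [hup w hw]
      have hw3 := hw.2.2
      have hv3 := hv.2.2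
      by_cases heq : w + b'.toNat = v + b.toNat
      · have hwv : w = v := by omega
        subst hwv
        have hbb : b' = b := by
          cases b <;> cases b' <;> simp_all
        subst hbb
        rw [update_self]
        exact Or.inr ⟨ht.isNode_succ.2 (Or.inr rfl), by simp [hd]⟩
      · rw [update_of_ne heq]
        rcases ht.child w b' hw with ⟨h1, h2⟩ | ⟨h1, h2⟩
        · refine Or.inl ⟨h1, ?_⟩
          rw [Set.mem_insert_iff]
          rintro (h | h)
          · rw [hd, Prod.mk.injEq] at h
            obtain ⟨h3, h4⟩ := List.append_inj' h.2 rfl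
            have hwv := ht.inj w v hw hv (Prod.ext h.1 h3)
            simp only [List.cons.injEq, and_true] at h4
            exact heq (by rw [hwv, h4])
          · exact h2 h
        · exact Or.inr ⟨ht.isNode_succ.2 (Or.inl h1), (hup _ h1).trans h2⟩
    · refine Or.inl ⟨?_, ?_⟩
      · rw [update_of_ne (by have := hv.2.2; omega)]
        exact ht.fresh _ (by omega)
      · simp only [update_self, Set.mem_insert_iff]
        rintro (h | h)
        · have := congrArg (fun x => x.2.length) h; simp at this
        · exact hdD (ht.parent _ _ _ h)
  · intro q hq
    rw [update_of_ne (by omega)]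
    exact ht.fresh q (by omega)
  · rintro r bs b' (h | h)
    · rw [hd, Prod.mk.injEq] at h
      obtain ⟨h3, h4⟩ := List.append_inj' h.2 rfl
      right
      rw [h.1, h3]
      exact hvD
    · exact Or.inr (ht.parent _ _ _ h)
  · intro r bs h
    have : ∃ bs', (r, bs') ∈ D := by
      rcases h with h | h
      · rw [hd, Prod.mk.injEq] at h
        exact ⟨(path v).2, by rw [h.1]; exact hvD⟩
      · exact ⟨bs, h⟩
    obtain ⟨bs', h⟩ := this
    obtain ⟨h1, h2⟩ := ht.root _ _ h
    exact ⟨ht.isNode_succ.2 (Or.inl h1), (hup _ h1).trans h2⟩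

end Trie

/-- The strings that a walk along `bs` from the root `r` adds. -/
def prefixes (r : ℕ) (bs : List Bool) : Set (ℕ × List Bool) := {d | d.1 = r ∧ d.2 <+: bs}

open Classical in
/-- The state of a walk from the root `r` that has read `bs`: `v` is the current node, and `new` tells
whether it is new. -/
def Walk (D : Set (ℕ × List Bool)) (r : ℕ) (bs : List Bool) (CH : ℕ → ℕ) (tn v new : ℕ) : Prop :=
  ∃ path, Trie path CH tn (D ∪ prefixes r bs) ∧ IsNode tn v ∧ path v = (r, bs) ∧ new = if (r, bs) ∈ D then 0 else 1

/-- A child that exists represents a string longer than all prefixes read so far, so it comes from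
`D`. As `D` is closed under prefixes, a walk that has left `D` meets only missing children, and the
flag `new` never has to be reset. -/
theorem Walk.step {r : ℕ} {bs : List Bool} {CH : ℕ → ℕ} {tn v new : ℕ} (hD : ∀ bs b, (r, bs ++ [b]) ∈ D → (r, bs) ∈ D)
    (hw : Walk D r bs CH tn v new) (b : Bool) : if CH (v + b.toNat) = 0 then Walk D r (bs ++ [b]) (update CH (v +
    b.toNat) tn) (tn + 2) tn 1 else Walk D r (bs ++ [b]) CH tn (CH (v + b.toNat)) new := by
  classical
  obtain ⟨path, ht, hv, hp, hn⟩ := hw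
  have hpre : D ∪ prefixes r (bs ++ [b]) = insert (r, bs ++ [b]) (D ∪ prefixes r bs) := by
    ext ⟨r', bs'⟩
    simp only [prefixes, Set.mem_union, Set.mem_ofPred_eq, Set.mem_insert_iff, List.prefix_concat_iff, Prod.mk.injEq]
    tauto
  have hnot : (r, bs ++ [b]) ∉ prefixes r bs := by
    rintro ⟨-, h⟩
    have := h.length_le
    simp at this
  split_ifs with h0
  · refine ⟨update path tn ((path v).1, (path v).2 ++ [b]), ?_,
      ht.isNode_succ.2 (Or.inr rfl), by rw [update_self, hp], ?_⟩
    · rw [hpre]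
      have := ht.addChild hv h0
      rw [hp] at this ⊢
      exact this
    · have : (r, bs ++ [b]) ∉ D ∪ prefixes r bs := by
        rcases ht.child v b hv with ⟨-, h⟩ | ⟨h, -⟩
        · rwa [hp] at h
        · rw [h0] at h; exact absurd h.1 (by simp)
      rw [if_neg (fun h => this (Or.inl h))]
  · rcases ht.child v b hv with ⟨h, -⟩ | ⟨h1, h2⟩
    · exact absurd h h0
    · rw [hp] at h2
      have hmem : (r, bs ++ [b]) ∈ D ∪ prefixes r bs := (ht.mem _).2 ⟨_, h1, h2⟩
      have hmemD : (r, bs ++ [b]) ∈ D := hmem.resolve_right hnot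
      refine ⟨path, ?_, h1, h2, ?_⟩
      · rwa [hpre, Set.insert_eq_of_mem hmem]
      · rw [hn, if_pos (hD _ _ hmemD), if_pos hmemD]

notation "rRoot" => (13 : ℕ)
notation "rV" => (14 : ℕ)
notation "rNew" => (15 : ℕ)
notation "rWi" => (16 : ℕ)
notation "rWa" => (17 : ℕ)
notation "rWx" => (18 : ℕ)
notation "rWq" => (19 : ℕ)

/-- Walk along one bit. -/
def bitP : Prog := Prog.cond (eq (get aODD (reg rWx)) (lit 1)) (assign rWq (succ (reg rV))) (assign rWq (reg rV)) ;;
  Prog.cond (eq (get aCH (reg rWq)) (lit 0))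
    (store aCH (reg rWq) (reg rT) ;; assign rV (reg rT) ;; assign rT (succ (succ (reg rT))) ;;
      assign rNew (lit 1))
    (assign rV (get aCH (reg rWq))) ;;
  assign rWx (get aROT (reg rWx))

/-- Insert the key of `BUF` into the trie with root `rRoot`; `rNew` tells whether it is new. -/
def walkP : Prog := assign rV (reg rRoot) ;; assign rNew (lit 0) ;;
  forLoop rWi rC (assign rWx (get aBUF (reg rWi)) ;; forLoop rWa rK bitP)

open Classical in
theorem walkP_spec (hL : L.Nodup) (hE : Env L c σ) {l : Tuple} (hl : ∀ S ∈ l, S ⊆ L.toFinset) (hc : l.length =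
    c) (hB : At (σ.arr aBUF) 0 (l.map (code L))) {path : ℕ → ℕ × List Bool} (ht : Trie path (σ.arr aCH) (σ.reg rT) D)
    (hr : (σ.reg rRoot, []) ∈ D) : Spec walkP σ (c * (L.length * 33 + 20) + 20) (fun τ => (∃ path', Trie path' (τ.arr
    aCH) (τ.reg rT) (D ∪ prefixes (σ.reg rRoot) (key L l))) ∧ τ.reg rNew = if (σ.reg rRoot, key L l) ∈ D then 0 else 1)
    := by
  set r := σ.reg rRoot with hrdef
  have hD : ∀ bs b, (r, bs ++ [b]) ∈ D → (r, bs) ∈ D := fun bs b h => ht.parent _ _ _ h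
  refine Spec.le (T := 3 + (2 + (c * ((3 + (L.length * (27 + 6) + 5)) + 6) + 5))) ?_ (by
    have : c * (3 + (L.length * (27 + 6) + 5) + 6) ≤ c * (L.length * 33 + 20) := Nat.mul_le_mul_left _ (by omega)
    omega)
  refine Spec.blockseq 3 (Spec.blockseq 2 ?_)
  set σ1 := (assign rNew (lit 0)).run ((assign rV (reg rRoot)).run σ) with hσ1
  have hE1 : Env L c σ1 := hE.congr
  refine (Spec.for (3 + (L.length * (27 + 6) + 5)) c (fun i τ =>
      Walk D r (key L (l.take i)) (τ.arr aCH) (τ.reg rT) (τ.reg rV) (τ.reg rNew))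
    hE1.rc ?_ ?_).mono ?_
  · have hn := (ht.root _ _ hr)
    refine ⟨path, ?_, ?_, hn.2, ?_⟩
    · have : D ∪ prefixes r (key L (List.take 0 l)) = D := by
        refine Set.union_eq_left.2 ?_
        rintro ⟨r', bs⟩ ⟨h1, h2⟩
        simp only [key, List.take_zero, List.flatMap_nil, List.prefix_nil] at h1 h2
        subst h1 h2
        exact hr
      rw [this]
      exact ht
    · exact hn.1
    · show 0 = if (r, []) ∈ D then 0 else 1
      rw [if_pos hr]
  · intro i hi τ hf hri hw
    have hEτ := hE1.frame hf rfl
    have hBτ : At (τ.arr aBUF) 0 (l.map (code L)) := hf.arr aBUF rfl ▸ hB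
    obtain ⟨S, hS⟩ := exists_getElem? (l := l) (n := i) (by omega)
    have hSl : S ⊆ L.toFinset := hl S (mem_of_getElem? hS)
    have hb : τ.arr aBUF i = code L S := by
      have := hBτ i (code L S) (by simp [hS])
      simpa using this
    have htake : l.take (i + 1) = l.take i ++ [S] := by rw [take_add_one, hS]; rfl
    refine Spec.blockseq 3 ?_
    have hE2 : Env L c ((assign rWx (get aBUF (reg rWi))).run τ) := hEτ.congr
    refine (Spec.for 27 L.length (fun a τ =>
      Walk D r (key L (l.take i) ++ (List.range a).map (fun a => decide (lb L a ∈ S)))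
        (τ.arr aCH) (τ.reg rT) (τ.reg rV) (τ.reg rNew) ∧ τ.reg rWx = rcode L a S)
    hE2.rk ?_ ?_).mono ?_
    · refine ⟨by simpa [run] using hw, ?_⟩
      simp [run, hri, hb, code]
    · rintro a ha ρ hfρ hra ⟨h1, h2⟩
      have hEρ := hE2.frame hfρ rfl
      refine Spec.block 27 ?_
      have h3 := h1.step hD (decide (lb L a ∈ S))
      have hodd := hEρ.odd_rcode hL hSl ha
      have hrot := hEρ.rot_rcode hL hSl ha
      have hrange : key L (l.take i) ++ (List.range (a + 1)).map (fun a => decide (lb L a ∈ S)) =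
        key L (l.take i) ++ (List.range a).map (fun a => decide (lb L a ∈ S)) ++ [decide (lb L a ∈ S)] := by
        rw [List.range_succ]; simp
      rw [hrange]
      by_cases hm : lb L a ∈ S
      · simp only [hm, if_true] at hodd
        simp only [hm, decide_true, Bool.toNat_true] at h3 ⊢
        by_cases hz : ρ.arr aCH (ρ.reg rV + 1) = 0
        · simp only [hz, if_true] at h3
          simpa [bitP, run, h2, hodd, hz, hrot] using h3
        · simp only [hz, if_false] at h3
          simpa [bitP, run, h2, hodd, hz, hrot] using h3
      · simp only [hm, if_false] at hodd
        simp only [hm, decide_false, Bool.toNat_false, add_zero] at h3 ⊢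
        by_cases hz : ρ.arr aCH (ρ.reg rV) = 0
        · simp only [hz, if_true] at h3
          simpa [bitP, run, h2, hodd, hz, hrot] using h3
        · simp only [hz, if_false] at h3
          simpa [bitP, run, h2, hodd, hz, hrot] using h3
    · rintro ρ - ⟨-, h1, -⟩
      have : key L (l.take (i + 1)) = key L (l.take i) ++ (List.range L.length).map (fun a => decide (lb L a ∈ S)) := by
        rw [htake]; simp [key]
      rw [this]
      exact h1
  · rintro τ - ⟨-, path', h1, -, -, h4⟩
    rw [take_of_length_le hc.le] at h1 h4
    exact ⟨⟨path', h1⟩, h4⟩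

/-! ## Sets of schemes -/

/-- A list of `c` sets of labels. -/
def Good (L : List ℕ) (c : ℕ) (l : Tuple) : Prop := l.length = c ∧ ∀ S ∈ l, S ⊆ L.toFinset

theorem Good.radix {l : Tuple} (h : Good L c l) (j : ℕ) : Good L c (radix L j l) :=
  ⟨radix_perm.length_eq.trans h.1, fun S hS => h.2 S (radix_perm.mem_iff.1 hS)⟩

/-- The numbers that represent a list of schemes. -/
def enc (L : List ℕ) (X : List Tuple) : List ℕ := X.flatMap (fun l => l.map (code L))

theorem enc_append {X Y : List Tuple} : enc L (X ++ Y) = enc L X ++ enc L Y := by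
  simp [enc]

theorem enc_singleton {l : Tuple} : enc L [l] = l.map (code L) := by
  simp [enc]

theorem length_enc (h : ∀ l ∈ X, Good L c l) : (enc L X).length = X.length * c := by
  induction X with
  | nil => simp [enc]
  | cons l X ih =>
    rw [show l :: X = [l] ++ X from rfl, enc_append, length_append,
      ih fun l hl => h l (List.mem_cons_of_mem _ hl), enc_singleton, length_map,
      (h l (by simp)).1]
    simp; ring

theorem At.enc_get (h : ∀ l ∈ X, Good L c l) {f : ℕ → ℕ} {s i : ℕ} {l : Tuple} (hX : At f s (enc L X)) (hi : X[i]? =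
    some l) : At f (s + i * c) (l.map (code L)) := by
  have hlt := getElem?_lt hi
  have h1 : X = X.take i ++ ([l] ++ X.drop (i + 1)) := by
    conv_lhs => rw [← List.take_append_drop i X]
    congr 1
    rw [List.drop_eq_getElem_cons hlt]
    rw [getElem?_eq_getElem hlt] at hi
    simp only [Option.some.injEq] at hi
    rw [hi]; rfl
  rw [h1, enc_append, enc_append, At.append_iff, At.append_iff, enc_singleton,
    length_enc (fun l hl => h l (List.mem_of_mem_take hl)), List.length_take, min_eq_left hlt.le] at hX
  exact hX.2.1

/-- The memory below the end pointer has been preserved. -/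
def MemLe (σ τ : State) : Prop := σ.reg rE ≤ τ.reg rE ∧ ∀ i < σ.reg rE, τ.arr aMEM i = σ.arr aMEM i

theorem MemLe.refl (σ : State) : MemLe σ σ := ⟨le_rfl, fun _ _ => rfl⟩

theorem MemLe.trans {σ τ ρ : State} (h : MemLe σ τ) (h' : MemLe τ ρ) : MemLe σ ρ :=
  ⟨h.1.trans h'.1, fun i hi => (h'.2 i (hi.trans_le h.1)).trans (h.2 i hi)⟩

theorem MemLe.at (h : MemLe σ τ) {s : ℕ} {l : List ℕ} (hl : At (σ.arr aMEM) s l) (hs : s + l.length ≤ σ.reg rE) : At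
    (τ.arr aMEM) s l :=
  hl.congr fun i _ hi => h.2 i (by omega)

/-- The list `X` of schemes is stored from position `s` to the end of the memory, and the trie with
root `root` represents `X`. -/
structure Building (L : List ℕ) (c : ℕ) (root s : ℕ) (X : List Tuple)
    (D : Set (ℕ × List Bool)) (σ : State) : Prop where
  trie : ∃ path, Trie path (σ.arr aCH) (σ.reg rT) D
  mem : At (σ.arr aMEM) s (enc L X)
  last : σ.reg rE = s + (enc L X).length
  isRoot : (root, []) ∈ D
  dict : ∀ l, Good L c l → ((root, key L l) ∈ D ↔ l ∈ X)
  good : ∀ l ∈ X, Good L c l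
  nodup : X.Nodup

theorem Building.congr {s : ℕ} (h : Building L c root s X D σ)
    (h1 : τ.arr aCH = σ.arr aCH := by rfl) (h2 : τ.reg rT = σ.reg rT := by rfl) (h3 : τ.arr aMEM = σ.arr aMEM := by rfl)
    (h4 : τ.reg rE = σ.reg rE := by rfl) : Building L c root s X D τ :=
  ⟨by rw [h1, h2]; exact h.trie, by rw [h3]; exact h.mem, by rw [h4]; exact h.last, h.isRoot, h.dict, h.good, h.nodup⟩

/-- The program does not interfere with the memory. -/
def Prog.calm (p : Prog) : Bool := !(p.wr rE) && !(p.wr rT) && !(p.wa aMEM) && !(p.wa aCH)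

theorem Building.frame {s : ℕ} (h : Building L c root s X D σ) {p : Prog} (hf : Frame p σ τ) (hp : p.calm = true) :
    Building L c root s X D τ := by
  simp only [Prog.calm, Bool.and_eq_true, Bool.not_eq_true'] at hp
  obtain ⟨⟨⟨h1, h2⟩, h3⟩, h4⟩ := hp
  exact h.congr (hf.arr _ h4) (hf.reg _ h2) (hf.arr _ h3) (hf.reg _ h1)

theorem MemLe.of_frame {p : Prog} (hf : Frame p σ τ) (hp : p.calm = true) : MemLe σ τ := by
  simp only [Prog.calm, Bool.and_eq_true, Bool.not_eq_true'] at hp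
  obtain ⟨⟨⟨h1, h2⟩, h3⟩, h4⟩ := hp
  exact ⟨(hf.reg _ h1).ge, fun i _ => by rw [hf.arr _ h3]⟩

/-- The tries with other roots have been preserved. -/
def SameOff (root : ℕ) (D D' : Set (ℕ × List Bool)) : Prop := ∀ r ≠ root, ∀ bs, (r, bs) ∈ D' ↔ (r, bs) ∈ D

theorem SameOff.refl (root : ℕ) (D : Set (ℕ × List Bool)) : SameOff root D D := fun _ _ _ => Iff.rfl

theorem SameOff.trans {D D' D'' : Set (ℕ × List Bool)} (h : SameOff root D D') (h' : SameOff root D' D'') : SameOff root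
    D D'' :=
  fun r hr bs => (h' r hr bs).trans (h r hr bs)

theorem length_key (l : Tuple) : (key L l).length = l.length * L.length := by
  induction l with
  | nil => simp [key]
  | cons S l ih =>
    simp only [key, List.flatMap_cons, length_append, List.length_cons] at ih ⊢
    rw [ih]; simp; ring

/-- Keys of lists of `c` sets all have the same length, so none of the proper prefixes that a walk
leaves in the trie is such a key. -/
theorem mem_union_prefixes {c r : ℕ} {l l' : Tuple} (hl : Good L c l) (hl' : Good L c l') : (r, key L l') ∈ D ∪ prefixes
    r (key L l) ↔ (r, key L l') ∈ D ∨ l' = l := by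
  refine or_congr Iff.rfl ⟨fun h => ?_, fun h => ?_⟩
  · refine key_inj hl'.2 hl.2 (hl'.1.trans hl.1.symm) (h.2.eq_of_length ?_)
    rw [length_key, length_key, hl'.1, hl.1]
  · rw [h]; exact ⟨rfl, List.prefix_rfl⟩

/-- Append `BUF` to the memory. -/
def appendP : Prog := forLoop 20 rC (store aMEM (reg rE) (get aBUF (reg 20)) ;; inc rE)

theorem appendP_spec (hE : Env L c σ) {w : List ℕ} (hc : w.length = c) (hB : At (σ.arr aBUF) 0 w) {s : ℕ} {u : List ℕ}
    (hu : At (σ.arr aMEM) s u) (hlast : σ.reg rE = s + u.length) : Spec appendP σ (c * 13 + 5) (fun τ => At (τ.arr aMEM)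
    s (u ++ w) ∧ τ.reg rE = s + (u ++ w).length ∧ MemLe σ τ) := by
  refine (Spec.for 7 c (fun i τ => At (τ.arr aMEM) s (u ++ w.take i) ∧
      τ.reg rE = s + (u ++ w.take i).length ∧ MemLe σ τ) hE.rc ?_ ?_).mono ?_
  · refine ⟨by simpa using hu, by simpa using hlast, ?_⟩
    exact ⟨le_rfl, fun _ _ => rfl⟩
  · rintro i hi τ hf hri ⟨h1, h2, h3⟩
    refine Spec.block 7 ?_
    obtain ⟨v, hv⟩ := exists_getElem? (l := w) (n := i) (by omega)
    have hb : τ.arr aBUF i = v := by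
      have := hB i v hv
      rw [hf.arr aBUF rfl]
      simpa using this
    have htake : u ++ w.take (i + 1) = u ++ w.take i ++ [v] := by rw [take_add_one, hv]; simp
    have := h1.snoc (v := v)
    rw [htake]
    rw [← h2] at this
    refine ⟨?_, ?_, h3.trans ⟨?_, ?_⟩⟩
    · simpa [run, inc, hri, hb] using this
    · simp [run, inc, h2]; ring
    · simp [run, inc]
    · intro j hj
      simp only [run, inc, eval, State.setR_arr, State.setA_arr, if_true]
      rw [update_of_ne (by omega)]
  · rintro τ - ⟨-, h1, h2, h3⟩
    rw [take_of_length_le hc.le] at h1 h2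
    exact ⟨h1, h2, h3⟩

/-- Insert the scheme in `BUF`, after sorting. -/
def insP : Prog := sortP ;; walkP ;; Prog.cond (eq (reg rNew) (lit 1)) appendP skip

open Classical in
-- Each of the `c * k` bits is touched a constant number of times while sorting, walking and
-- appending. All dictionaries share one array of nodes, and `SameOff` says that the others keep
-- their contents.
theorem insP_spec (hL : L.Nodup) (hE : Env L c σ) {l : Tuple} (hl : Good L c l) (hB : At (σ.arr aBUF) 0 (l.map (code
    L))) {s : ℕ} (hb : Building L c root s X D σ) (hr : σ.reg rRoot = root) (hpos : 0 < c) (hkpos : 0 < L.length) : Spec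
    insP σ (200 * (c * L.length)) (fun τ => ∃ D', Building L c root s (if radix L L.length l ∈ X then X else X ++ [radix
    L L.length l]) D' τ ∧ SameOff root D D' ∧ MemLe σ τ) := by
  obtain ⟨h1, h2, h3⟩ := le_mul_and hpos hkpos
  refine Spec.le (T := (L.length * (c * 48 + 23) + 5) + ((c * (L.length * 33 + 20) + 20) +
    (3 + max (c * 13 + 5) 1))) ?_ (by
      rw [max_eq_left (by omega)]; nlinarith)
  refine Spec.seqf (sortP_spec hL hE hl.2 hl.1 hB) fun τ hf h3 => ?_
  have hE1 := hE.frame hf rfl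
  have hl' := hl.radix L.length
  have hb1 := hb.frame hf rfl
  obtain ⟨path, ht⟩ := hb1.trie
  have hr1 : τ.reg rRoot = root := (hf.reg _ rfl).trans hr
  refine Spec.seqf (walkP_spec hL hE1 hl'.2 hl'.1 h3 ht (hr1 ▸ hb1.isRoot)) ?_
  rintro ρ hfρ ⟨⟨path', ht'⟩, hnew⟩
  rw [hr1] at ht' hnew
  have hE2 := hE1.frame hfρ rfl
  have hoff : SameOff root D (D ∪ prefixes root (key L (radix L L.length l))) := by
    intro r hr bs
    refine ⟨fun h => h.resolve_right fun h => hr h.1, Or.inl⟩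
  have hroot : (root, []) ∈ D ∪ prefixes root (key L (radix L L.length l)) := Or.inl hb.isRoot
  have hmem : MemLe σ ρ := (MemLe.of_frame hf rfl).trans ⟨(hfρ.reg _ rfl).ge, fun i _ => by rw [hfρ.arr _ rfl]⟩
  rw [show (3 : ℕ) = (eq (reg rNew) (lit 1)).cost from rfl]
  refine Spec.cond (fun hc => ?_) (fun hc => ?_)
  · simp only [Holds, eval, hnew] at hc
    have hnotin : radix L L.length l ∉ X := by
      intro h; rw [if_pos ((hb.dict _ hl').2 h)] at hc; simp at hc
    refine (appendP_spec hE2 (s := s) (u := enc L X) (w := (radix L L.length l).map (code L))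
      (by simpa using hl'.1) (by rw [hfρ.arr _ rfl]; exact h3)
      (by rw [hfρ.arr _ rfl]; exact hb1.mem) (by rw [hfρ.reg _ rfl]; exact hb1.last)).mono ?_
    rintro ρ' hfρ' ⟨h4, h5, h6⟩
    refine ⟨_, ?_, hoff, hmem.trans h6⟩
    rw [if_neg hnotin]
    refine ⟨⟨path', by rw [hfρ'.arr _ rfl, hfρ'.reg _ rfl]; exact ht'⟩, ?_, ?_, hroot, ?_, ?_, ?_⟩
    · rw [enc_append, enc_singleton]; exact h4
    · rw [enc_append, enc_singleton]; exact h5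
    · intro l' hl''
      rw [mem_union_prefixes hl' hl'', hb.dict _ hl'']
      simp
    · intro l' hl''
      rcases List.mem_append.1 hl'' with h | h
      · exact hb.good _ h
      · rw [List.mem_singleton.1 h]; exact hl'
    · rw [List.nodup_append]
      refine ⟨hb.nodup, by simp, ?_⟩
      intro a ha b hb' hab
      rw [List.mem_singleton.1 hb'] at hab
      exact hnotin (hab ▸ ha)
  · simp only [Holds, eval, hnew] at hc
    have hin : radix L L.length l ∈ X := by
      by_contra h
      rw [if_neg (fun h' => h ((hb.dict _ hl').1 h'))] at hc
      exact hc rfl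
    refine Spec.skip ⟨_, ?_, hoff, hmem⟩
    rw [if_pos hin]
    refine ⟨⟨path', ht'⟩, by rw [hfρ.arr _ rfl]; exact hb1.mem, by rw [hfρ.reg _ rfl]; exact hb1.last, hroot, ?_,
      hb.good, hb.nodup⟩
    intro l' hl''
    rw [mem_union_prefixes hl' hl'', hb.dict _ hl'']
    constructor
    · rintro (h | rfl)
      · exact h
      · exact hin
    · exact Or.inl

/-- Start a new set. -/
def newP : Prog := assign rRoot (reg rT) ;; assign rT (succ (succ (reg rT)))

theorem newP_spec (ht : ∃ path, Trie path (σ.arr aCH) (σ.reg rT) D) (hpos : 0 < c) (hkpos : 0 < L.length) : Spec newP σ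
    6 (fun τ => ∃ D', Building L c (σ.reg rT) (σ.reg rE) [] D' τ ∧ τ.reg rRoot = σ.reg rT ∧ τ.reg rE = σ.reg rE ∧ τ.arr
    = σ.arr ∧ SameOff (σ.reg rT) D D') := by
  refine Spec.block 6 ?_
  obtain ⟨path, ht⟩ := ht
  refine ⟨insert (σ.reg rT, []) D, ⟨⟨_, ht.newRoot⟩, At.nil, ?_, Set.mem_insert _ _, ?_, by simp, List.nodup_nil⟩, ?_, ?_, rfl, ?_⟩
  · simp [run, newP, enc]
  · intro l hl
    simp only [Set.mem_insert_iff, Prod.mk.injEq, true_and, List.not_mem_nil, iff_false]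
    -- The root alone represents the empty string, which is no key as `c * k > 0`; older strings
    -- belong to roots with smaller numbers.
    rintro (h | h)
    · have := length_key (L := L) l
      rw [h, hl.1, List.length_nil] at this
      have := Nat.mul_pos hpos hkpos
      omega
    · have := (ht.root _ _ h).1.2.1
      omega
  · simp [run, newP]
  · simp [run, newP]
  · intro r hr bs
    simp [hr]

/-- Load a scheme, from the position in register `31`, into `BUF`. -/
def loadP : Prog := forLoop 30 rC (store aBUF (reg 30) (get aMEM (reg 31)) ;; inc 31)

theorem loadP_spec (hE : Env L c σ) {w : List ℕ} (hc : w.length = c) (hB : At (σ.arr aMEM) (σ.reg 31) w) : Spec loadP σ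
    (c * 13 + 5) (fun τ => At (τ.arr aBUF) 0 w ∧ τ.reg 31 = σ.reg 31 + c) := by
  refine (Spec.for 7 c (fun i τ => At (τ.arr aBUF) 0 (w.take i) ∧ τ.reg 31 = σ.reg 31 + i) hE.rc ?_ ?_).mono ?_
  · exact ⟨At.nil, rfl⟩
  · rintro i hi τ hf hri ⟨h1, h2⟩
    refine Spec.block 7 ?_
    obtain ⟨v, hv⟩ := exists_getElem? (l := w) (n := i) (by omega)
    have hb : τ.arr aMEM (σ.reg 31 + i) = v := by
      rw [hf.arr aMEM rfl]; exact hB i v hv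
    have := h1.take_succ hv
    rw [zero_add] at this
    refine ⟨?_, ?_⟩
    · simpa [run, inc, hri, hb, h2] using this
    · simp [run, inc, h2]; ring
  · rintro τ - ⟨-, h1, h2⟩
    rw [take_of_length_le hc.le] at h1
    exact ⟨h1, h2⟩

/-! ## Single-step overapproximations of a scheme -/

/-- The number of sets that do not contain the label at position `a`. -/
def notIn (L : List ℕ) (x : Tuple) (a : ℕ) : ℕ := x.countP (fun S => decide (lb L a ∉ S))

/-- The labels of `B` before position `a` are used by `x`. -/
def UsedBelow (L : List ℕ) (B : Finset ℕ) (x : Tuple) (a : ℕ) : Prop := ∀ a' < a, lb L a' ∈ B → notIn L x a' ≠ x.length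

theorem usedBelow_succ {a : ℕ} : UsedBelow L B x (a + 1) ↔ UsedBelow L B x a ∧ (lb L a ∈ B → notIn L x a ≠ x.length) :=
    by
  simp only [UsedBelow, Nat.forall_lt_succ_right]

/-- The label at position `a` may be added to an element of `x`. -/
def Allowed (L : List ℕ) (B : Finset ℕ) (x : Tuple) (a : ℕ) : Prop := lb L a ∈ B ∧ 1 < notIn L x a ∧ UsedBelow L B x a

/-- Two functions agree below `n`. -/
def Agree (n : ℕ) (f g : ℕ → ℕ) : Prop := ∀ a < n, f a = g a

theorem Agree.update_iff {n : ℕ} {f g : ℕ → ℕ} (h : Agree n f g) (v : ℕ) : Agree (n + 1) (update f n v) g ↔ v = g n :=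
    by
  simp only [Agree, Nat.forall_lt_succ_right, update_self]
  refine ⟨fun h => h.2, fun h' => ⟨fun a ha => ?_, h'⟩⟩
  rw [update_of_ne ha.ne]
  exact h a ha

/-- `y` arises from `x` by adding an allowed label to an element. -/
def IsMove (L : List ℕ) (B : Finset ℕ) (x y : Tuple) : Prop :=
  ∃ r S a, x[r]? = some S ∧ a < L.length ∧ lb L a ∉ S ∧ Allowed L B x a ∧
    y = radix L L.length (x.set r (insert (lb L a) S))

/-- The array `f` holds the characteristic function of `B`. -/
def HasBits (L : List ℕ) (B : Finset ℕ) (f : ℕ → ℕ) : Prop := ∀ a < L.length, f a = if lb L a ∈ B then 1 else 0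

theorem At.set {f : ℕ → ℕ} {b i v : ℕ} {l : List ℕ} (h : At f b l) : At (update f (b + i) v) b (l.set i v) := by
  intro j w hw
  have hj := getElem?_lt hw
  rw [List.getElem?_set] at hw
  by_cases hij : i = j
  · subst hij
    rw [List.length_set] at hj
    simp only [if_true, hj, Option.some.injEq] at hw
    simp [hw]
  · rw [update_of_ne (by omega)]
    rw [if_neg hij] at hw
    exact h j w hw

theorem coe_set {r : ℕ} (h : x[r]? = some S) (v : Finset ℕ) : ((x.set r v : Tuple) : Scheme) = v ::ₘ (x : Scheme).erase
    S := by
  have hr := getElem?_lt h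
  have h1 : ((x.set r v : Tuple) : Scheme) = v ::ₘ (x.eraseIdx r : Scheme) :=
    Multiset.coe_eq_coe.2 (List.set_perm_cons_eraseIdx hr v)
  have h2 : (x : Scheme) = S ::ₘ (x.eraseIdx r : Scheme) := by
    refine Multiset.coe_eq_coe.2 ?_
    have := (List.getElem_cons_eraseIdx_perm hr).symm
    rwa [(List.getElem?_eq_some_iff.1 h).2] at this
  rw [h1]
  conv_rhs => rw [h2]
  rw [Multiset.erase_cons_head]

theorem Good.set (h : Good L c x) {r : ℕ} (hS : S ⊆ L.toFinset) : Good L c (x.set r S) := by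
  refine ⟨by simpa using h.1, fun T hT => ?_⟩
  rcases List.mem_or_eq_of_mem_set hT with h' | rfl
  · exact h.2 T h'
  · exact hS

theorem Good.getElem? (h : Good L c x) {r : ℕ} (hr : r < c) : ∃ S, x[r]? = some S ∧ S ⊆ L.toFinset := by
  have hr' : r < x.length := h.1 ▸ hr
  exact ⟨_, getElem?_eq_getElem hr', h.2 _ (List.getElem_mem hr')⟩

theorem insert_lb_subset (hS : S ⊆ L.toFinset) {a : ℕ} (ha : a < L.length) : insert (lb L a) S ⊆ L.toFinset :=
  Finset.insert_subset (by simpa using lb_mem ha) hS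

theorem radix_eq_of_coe_eq (hL : L.Nodup) {l l' : Tuple} (hl : ∀ S ∈ l, S ⊆ L.toFinset) (h : (l : Multiset (Finset ℕ)) =
    l') : radix L L.length l = radix L L.length l' := by
  have hp : l.Perm l' := Multiset.coe_eq_coe.1 h
  have hl' : ∀ S ∈ l', S ⊆ L.toFinset := fun S hS => hl S (hp.mem_iff.2 hS)
  exact Sorted.eq_of_perm hL (fun S hS => hl S (radix_perm.mem_iff.1 hS))
    (radix_perm.trans (hp.trans radix_perm.symm)) (sorted_radix hL hl) (sorted_radix hL hl')

/-- A set differs from its predecessor in the list. -/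
def FirstAt (x : Tuple) (r : ℕ) : Prop := r = 0 ∨ x[r - 1]? ≠ x[r]?

open Classical in
-- In a sorted list, the numbers at the beginnings of the runs of equal elements increase strictly,
-- and they are below `2 ^ k`. This bounds the branching of the search.
theorem card_firstAt_le (hL : L.Nodup) (h : Good L c x) (hs : Sorted L x) : ((Finset.range c).filter (FirstAt x)).card ≤
    min c (2 ^ L.length) := by
  refine le_min ((Finset.card_filter_le _ _).trans (by simp)) ?_
  conv_rhs => rw [← Finset.card_range (2 ^ L.length)]
  have hget : ∀ r r' (hrr : r ≤ r') (h' : r' < x.length), code L (x[r]'(by omega)) ≤ code L x[r'] := by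
    intro r r' hrr h'
    rcases hrr.lt_or_eq with h1 | rfl
    · exact (List.pairwise_iff_getElem.1 hs) r r' (by omega) h' h1
    · exact le_rfl
  have key : ∀ r r' (hrr : r < r') (h' : r' < x.length), FirstAt x r' → code L (x[r]'(by omega)) < code L x[r'] := by
    intro r r' hrr h' hf
    refine (hget r (r' - 1) (by omega) (by omega)).trans_lt ((hget (r' - 1) r' (by omega) h').lt_of_ne ?_)
    intro he
    rcases hf with hf | hf
    · omega
    · apply hf
      rw [getElem?_eq_getElem h', getElem?_eq_getElem (by omega)]
      rw [rcode_inj hL (h.2 _ (List.getElem_mem _)) (h.2 _ (List.getElem_mem _)) he]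
  refine Finset.card_le_card_of_injOn (fun r => code L (x.getD r ∅)) ?_ ?_
  · intro r hr
    simp only [Finset.coe_filter, Finset.mem_range] at hr
    have hr' : r < x.length := h.1 ▸ hr.1
    simp only [Finset.coe_range, Set.mem_Iio, List.getD_eq_getElem _ _ hr']
    exact rcode_lt (h.2 _ (List.getElem_mem hr')) (Nat.zero_le _)
  · intro r hr r' hr' he
    simp only [Finset.coe_filter, Finset.mem_range] at hr hr'
    have h1 : r < x.length := h.1 ▸ hr.1
    have h2 : r' < x.length := h.1 ▸ hr'.1
    simp only [List.getD_eq_getElem _ _ h1, List.getD_eq_getElem _ _ h2] at he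
    rcases lt_trichotomy r r' with h3 | h3 | h3
    · have := key r r' h3 h2 hr'.2; omega
    · exact h3
    · have := key r' r h3 h1 hr.2; omega

notation "aCNT" => (13 : ℕ)
notation "aALW" => (14 : ℕ)
notation "aBB" => (15 : ℕ)
notation "rCur" => (21 : ℕ)
notation "rXr" => (22 : ℕ)
notation "rXx" => (23 : ℕ)
notation "rXa" => (24 : ℕ)
notation "rXq" => (25 : ℕ)
notation "rXlow" => (26 : ℕ)
notation "rXprev" => (27 : ℕ)
notation "rXy" => (28 : ℕ)
notation "rXz" => (29 : ℕ)

/-- Count, for every label, the elements of the scheme at position `rCur` of the array `A` that do not contain it. -/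
def countP (A : ℕ) : Prog := forLoop rXa rK (store aCNT (reg rXa) (lit 0)) ;;
  assign rXq (reg rCur) ;;
  forLoop rXr rC (assign rXx (get A (reg rXq)) ;; inc rXq ;;
    forLoop rXa rK (Prog.cond (eq (get aODD (reg rXx)) (lit 0))
        (store aCNT (reg rXa) (succ (get aCNT (reg rXa)))) skip ;;
      assign rXx (get aROT (reg rXx))))

theorem countP_spec {A : ℕ} (hA : Nat.beq aCNT A = false) (hL : L.Nodup) (hE : Env L c σ) (hx : Good L c x) (hm : At
    (σ.arr A) (σ.reg rCur) (x.map (code L))) (hpos : 0 < c) (hkpos : 0 < L.length) : Spec (countP A) σ (60 * (c *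
    L.length)) (fun τ => ∀ a < L.length, τ.arr aCNT a = notIn L x a) := by
  obtain ⟨h1, h2, h3⟩ := le_mul_and hpos hkpos
  refine Spec.le (T := (L.length * (3 + 6) + 5) + (2 + (c * ((3 + (3 + (L.length * (12 + 6) + 5))) + 6) + 5))) ?_ (by
      nlinarith)
  refine Spec.seqf (Spec.for 3 L.length (fun i τ => ∀ a < i, τ.arr aCNT a = 0) hE.rk (by simp) ?_) ?_
  · intro i hi τ hf hri h
    refine Spec.block 3 ?_
    intro a ha
    simp only [run, eval, hri, State.setR_arr, State.setA_arr, if_true]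
    by_cases hai : a = i
    · simp [hai]
    · rw [update_of_ne hai]; exact h a (by omega)
  rintro τ hf ⟨-, h0⟩
  have hE1 := hE.frame hf rfl
  refine Spec.blockseq 2 ?_
  have hE2 : Env L c ((assign rXq (reg rCur)).run τ) := hE1.congr
  refine (Spec.for (3 + (3 + (L.length * (12 + 6) + 5))) c (fun i τ =>
      (∀ a < L.length, τ.arr aCNT a = notIn L (x.take i) a) ∧ τ.reg rXq = σ.reg rCur + i)
    hE2.rc ?_ ?_).mono ?_
  · refine ⟨fun a ha => ?_, ?_⟩
    · simpa [run, notIn] using h0 a ha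
    · simp [run, hf.reg rCur rfl]
  · rintro i hi ρ hfρ hri ⟨h3, h4⟩
    have hE3 := hE2.frame hfρ rfl
    obtain ⟨S, hS, hSl⟩ := hx.getElem? hi
    have hb : ρ.arr A (σ.reg rCur + i) = code L S := by
      rw [hfρ.arr A (by simp [forLoop, inc, Prog.wa, hA])]
      show τ.arr A _ = _
      rw [hf.arr A (by simp [forLoop, Prog.wa, hA])]
      exact hm i _ (by simp [hS])
    refine Spec.blockseq 3 (Spec.blockseq 3 ?_)
    have htake : x.take (i + 1) = x.take i ++ [S] := by rw [take_add_one, hS]; rfl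
    have hE4 : Env L c ((inc rXq).run ((assign rXx (get A (reg rXq))).run ρ)) := hE3.congr
    refine (Spec.for 12 L.length (fun j τ =>
      (∀ a < L.length, τ.arr aCNT a = notIn L (x.take i) a + if a < j ∧ lb L a ∉ S then 1 else 0) ∧
      τ.reg rXx = rcode L j S) hE4.rk ?_ ?_).mono ?_
    · refine ⟨fun a ha => by simpa [run, inc] using h3 a ha, ?_⟩
      simp [run, inc, h4, hb, code]
    · rintro j hj ρ' hfρ' hrj ⟨h5, h6⟩
      have hE5 := hE4.frame hfρ' rfl
      refine Spec.block 12 ?_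
      have hodd := hE5.odd_rcode hL hSl hj
      have hrot := hE5.rot_rcode hL hSl hj
      by_cases hm : lb L j ∈ S
      · rw [if_pos hm] at hodd
        refine ⟨fun a ha => ?_, ?_⟩
        · simp only [run, Holds, eval, h6, hodd]
          have := h5 a ha
          simp only [State.setR_arr]
          simp only [this, one_ne_zero, if_false]
          congr 1
          refine if_congr ?_ rfl rfl
          constructor
          · rintro ⟨h7, h8⟩; exact ⟨by omega, h8⟩
          · rintro ⟨h7, h8⟩
            refine ⟨?_, h8⟩
            rcases (Nat.lt_succ_iff.1 h7).lt_or_eq with h9 | rfl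
            · exact h9
            · exact absurd hm h8
        · simp [run, h6, hodd, hrot]
      · rw [if_neg hm] at hodd
        refine ⟨fun a ha => ?_, ?_⟩
        · simp only [run, Holds, eval, h6, hodd, if_true]
          simp only [State.setR_arr, State.setA_arr, if_true, hrj]
          by_cases haj : a = j
          · subst haj
            have := h5 a ha
            simp [this, hm]
          · rw [update_of_ne haj, h5 a ha]
            congr 1
            refine if_congr ?_ rfl rfl
            refine and_congr_left fun _ => ?_
            omega
        · simp [run, h6, hodd, hrot]
    · rintro ρ' hfρ' ⟨-, h5, -⟩
      refine ⟨fun a ha => ?_, ?_⟩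
      · have := h5 a ha
        simp only [State.setR_arr, this, htake, notIn, List.countP_append]
        simp [ha, List.countP_cons]
      · simp only [State.setR_reg]
        rw [if_neg (by decide), hfρ'.reg rXq rfl]
        simp [run, inc, h4]; ring
  · rintro ρ - ⟨-, h3, -⟩
    rwa [take_of_length_le hx.1.le] at h3

/-- Compute the allowed labels. -/
def allowP : Prog := assign rXlow (lit 1) ;;
  forLoop rXa rK (store aALW (reg rXa) (lit 0) ;;
    Prog.cond (eq (reg rXlow) (lit 1)) (Prog.cond (eq (get aBB (reg rXa)) (lit 1))
      (Prog.cond (lt (lit 1) (get aCNT (reg rXa))) (store aALW (reg rXa) (lit 1)) skip ;;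
        Prog.cond (eq (get aCNT (reg rXa)) (reg rC)) (assign rXlow (lit 0)) skip) skip) skip)

open Classical in
-- A label is unused if all `c` elements lack it. The flag `rXlow` is cleared for good at the first
-- unused label of `B`, after this label itself has been considered.
theorem allowP_spec (hE : Env L c σ) (hx : Good L c x) (hB : HasBits L B (σ.arr aBB)) (hcnt : ∀ a < L.length, σ.arr aCNT
    a = notIn L x a) : Spec allowP σ (L.length * 40 + 10) (fun τ => ∀ a < L.length, τ.arr aALW a = if Allowed L B x a
    then 1 else 0) := by
  refine Spec.le (T := 2 + (L.length * (30 + 6) + 5)) ?_ (by omega)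
  refine Spec.blockseq 2 ?_
  have hE1 : Env L c ((assign rXlow (lit 1)).run σ) := hE.congr
  refine (Spec.for 30 L.length (fun i τ =>
      Agree i (τ.arr aALW) (fun a => if Allowed L B x a then 1 else 0) ∧
      τ.reg rXlow = if UsedBelow L B x i then 1 else 0)
    hE1.rk ?_ ?_).mono ?_
  · exact ⟨by simp [Agree], by simp [run, UsedBelow]⟩
  · rintro i hi τ hf hri ⟨h1, h2⟩
    have hE2 := hE1.frame hf rfl
    refine Spec.block 30 ?_
    have hBi : τ.arr aBB i = if lb L i ∈ B then 1 else 0 := hf.arr aBB rfl ▸ hB i hi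
    have hci : τ.arr aCNT i = notIn L x i := hf.arr aCNT rfl ▸ hcnt i hi
    have hcc : τ.reg rC = x.length := hE2.rc.trans hx.1.symm
    have hup := h1.update_iff
    rw [usedBelow_succ]
    have hA : Allowed L B x i ↔ lb L i ∈ B ∧ 1 < notIn L x i ∧ UsedBelow L B x i := Iff.rfl
    generalize hnl : notIn L x i = n at hci hA
    by_cases hlow : UsedBelow L B x i <;> by_cases hb : lb L i ∈ B <;>
      by_cases hn : 1 < n <;> by_cases hnc : n = x.length <;>
      simp only [hlow, hb, if_true, if_false] at h2 hBi <;>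
      (try subst hnc) <;>
      simp_all [run] <;>
      simp_all [Nat.not_lt.2 hn]
  · rintro τ - ⟨-, h1, -⟩
    exact h1

/-- Insert the scheme that arises from the one at `rCur` by adding the label at position `rXa` to
the element at position `rXr`, of which `rXx` is the number after `rXa` rotations. -/
def moveP : Prog := assign rXy (succ (reg rXx)) ;;
  forLoop rXz rK (Prog.cond (lt (reg rXz) (reg rXa)) skip (assign rXy (get aROT (reg rXy)))) ;;
  assign 31 (reg rCur) ;; loadP ;; store aBUF (reg rXr) (reg rXy) ;; insP

open Classical in
theorem moveP_spec (hL : L.Nodup) (hE : Env L c σ) (hx : Good L c x) (hm : At (σ.arr aMEM) (σ.reg rCur) (x.map (code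
    L))) {r a : ℕ} (hr : x[r]? = some S) (ha : a < L.length) (haS : lb L a ∉ S) (hrr : σ.reg rXr = r) (hra : σ.reg rXa =
    a) (hrx : σ.reg rXx = rcode L a S) {s : ℕ} (hb : Building L c root s X D σ) (hroot : σ.reg rRoot = root) (hpos : 0 <
    c) (hkpos : 0 < L.length) : Spec moveP σ (250 * (c * L.length)) (fun τ => ∃ D', Building L c root s (if radix L
    L.length (x.set r (insert (lb L a) S)) ∈ X then X else X ++ [radix L L.length (x.set r (insert (lb L a) S))]) D' τ ∧
    SameOff root D D' ∧ MemLe σ τ) := by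
  obtain ⟨h1, h2, h3⟩ := le_mul_and hpos hkpos
  refine Spec.le (T := 3 + ((L.length * (6 + 6) + 5) + (2 + ((c * 13 + 5) + (3 + 200 * (c * L.length)))))) ?_ (by
    nlinarith)
  have hSL : S ⊆ L.toFinset := hx.2 S (mem_of_getElem? hr)
  set S' := insert (lb L a) S with hS'
  have hS'L : S' ⊆ L.toFinset := insert_lb_subset hSL ha
  refine Spec.blockseq 3 ?_
  set σ0 := (assign rXy (succ (reg rXx))).run σ with hσ0
  have hE0 : Env L c σ0 := hE.congr
  -- The number was taken after `a` rotations and the label inserted at its lowest bit. A loop of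
  -- `k` rounds that skips the first `a` performs the remaining rotations.
  refine Spec.seqf (Spec.for 6 L.length (fun z τ => τ.reg rXy = rcode L (max a z) S') hE0.rk ?_ ?_) ?_
  · simp [hσ0, run, hrx, hS', rcode_insert hL ha haS]
  · intro z hz τ hf hrz h
    have hE1 := hE0.frame hf rfl
    have hza : τ.reg rXa = a := (hf.reg _ rfl).trans hra
    refine Spec.block 6 ?_
    by_cases hlt : z < a
    · simp only [run, Holds, eval, hrz, hza, hlt, if_true, State.setR_reg]
      rw [if_neg (by decide), h, max_eq_left hlt.le, max_eq_left hlt]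
    · rw [max_eq_right (by omega)] at h
      rw [max_eq_right (by omega)]
      have := hE1.rot_rcode hL hS'L hz
      simp [run, hrz, hza, hlt, h, this]
  rintro τ hf ⟨-, hy⟩
  rw [max_eq_right ha.le, rcode_length] at hy
  have hE1 := hE0.frame hf rfl
  refine Spec.blockseq 2 ?_
  have hE2 : Env L c ((assign 31 (reg rCur)).run τ) := hE1.congr
  have hcur : τ.reg rCur = σ.reg rCur := hf.reg _ rfl
  refine Spec.seqf (loadP_spec hE2 (w := x.map (code L)) (by simpa using hx.1) ?_) ?_
  · simp only [run, eval, State.setR_arr, State.setR_reg, if_true, hcur]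
    rw [hf.arr _ rfl]
    exact hm
  rintro ρ hfρ ⟨hbuf, -⟩
  have hE3 := hE2.frame hfρ rfl
  have hry : ρ.reg rXy = code L S' := (hfρ.reg _ rfl).trans hy
  have hrr' : ρ.reg rXr = r := (hfρ.reg _ rfl).trans ((hf.reg _ rfl).trans hrr)
  refine Spec.blockseq 3 ?_
  have hbuf' : At (((store aBUF (reg rXr) (reg rXy)).run ρ).arr aBUF) 0 ((x.set r S').map (code L)) := by
    have := hbuf.set (i := r) (v := code L S')
    rw [List.map_set]
    simpa [run, hry, hrr'] using this
  have hcalm : Building L c root s X D ((store aBUF (reg rXr) (reg rXy)).run ρ) := by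
    have h1 : Building L c root s X D σ0 := hb.congr
    have h2 := h1.frame hf rfl
    have h3 : Building L c root s X D ((assign 31 (reg rCur)).run τ) := h2.congr
    exact (h3.frame hfρ rfl).congr
  have hE4 : Env L c ((store aBUF (reg rXr) (reg rXy)).run ρ) := hE3.congr
  refine (insP_spec hL hE4 (hx.set hS'L) hbuf' hcalm ?_ hpos hkpos).mono ?_
  · exact (hfρ.reg _ rfl).trans ((hf.reg _ rfl).trans hroot)
  · rintro τ' - ⟨D', h3, h4, h5⟩
    refine ⟨D', h3, h4, ?_⟩
    have hmem : MemLe σ ((store aBUF (reg rXr) (reg rXy)).run ρ) := by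
      have h1 : MemLe σ0 τ := MemLe.of_frame hf rfl
      have h2 : MemLe ((assign 31 (reg rCur)).run τ) ρ := MemLe.of_frame hfρ rfl
      exact ⟨h1.1.trans h2.1, fun i hi => (h2.2 i (hi.trans_le h1.1)).trans (h1.2 i hi)⟩
    exact hmem.trans h5

/-- Insert all moves of the scheme at `rCur`. -/
def expandP : Prog := countP aMEM ;; allowP ;; assign rXprev (reg rN) ;; assign rXq (reg rCur) ;;
  forLoop rXr rC (assign rXx (get aMEM (reg rXq)) ;; inc rXq ;;
    Prog.cond (eq (reg rXx) (reg rXprev)) skip (assign rXprev (reg rXx) ;;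
      forLoop rXa rK (Prog.cond (eq (get aODD (reg rXx)) (lit 0))
          (Prog.cond (eq (get aALW (reg rXa)) (lit 1)) moveP skip) skip ;;
        assign rXx (get aROT (reg rXx)))))

/-- The set `X` has been extended by moves of `x`, among them the moves with positions in `P`. -/
def Moved (L : List ℕ) (c : ℕ) (B : Finset ℕ) (root s : ℕ) (X : List Tuple)
    (D : Set (ℕ × List Bool)) (x : Tuple) (σ : State) (P : ℕ → ℕ → Prop) (τ : State) : Prop :=
  ∃ X' D', Building L c root s X' D' τ ∧ X <+: X' ∧ (∀ y ∈ X', y ∈ X ∨ IsMove L B x y) ∧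
    (∀ r S a, P r a → x[r]? = some S → a < L.length → lb L a ∉ S → Allowed L B x a →
      radix L L.length (x.set r (insert (lb L a) S)) ∈ X') ∧ SameOff root D D' ∧ MemLe σ τ

/-- A position may be exchanged for another one that carries the same set, because the two moves
have the same sorted result. For this reason repeated elements may be skipped. -/
theorem Moved.congr {s : ℕ} {σ τ ρ : State} {P Q : ℕ → ℕ → Prop} (h : Moved L c B root s X D x σ P τ) (hQ : ∀ r S a, Q r a
    → x[r]? = some S → a < L.length → lb L a ∉ S → Allowed L B x a → P r a ∨ ∃ r', P r' a ∧ x[r']? = some S) (hL :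
    L.Nodup) (hx : Good L c x) (h1 : ρ.arr aCH = τ.arr aCH := by rfl) (h2 : ρ.reg rT = τ.reg rT := by rfl)
    (h3 : ρ.arr aMEM = τ.arr aMEM := by rfl) (h4 : ρ.reg rE = τ.reg rE := by rfl) : Moved L c B root s X D x σ Q ρ := by
  obtain ⟨X', D', g1, g2, g3, g4, g5, g6⟩ := h
  refine ⟨X', D', g1.congr h1 h2 h3 h4, g2, g3, ?_, g5, ?_⟩
  · intro r S a hq hr ha haS hall
    rcases hQ r S a hq hr ha haS hall with h | ⟨r', h, hr'⟩
    · exact g4 r S a h hr ha haS hall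
    · have := g4 r' S a h hr' ha haS hall
      rwa [radix_eq_of_coe_eq hL (hx.set (insert_lb_subset (hx.2 S (mem_of_getElem? hr)) ha)).2
        ((coe_set hr' _).trans (coe_set hr _).symm)] at this
  · exact ⟨by rw [h4]; exact g6.1, by rw [h3]; exact g6.2⟩

open Classical in
-- Moves are made only at the first element of each run of equal ones, at most `min c (2 ^ k)`
-- times, and for at most `k` labels each. Every move costs `O(c * k)`, and the scan over all `c`
-- positions is negligible in comparison.
theorem expandP_spec (hL : L.Nodup) (hE : Env L c σ) (hx : Good L c x) (hsort : Sorted L x) (hm : At (σ.arr aMEM) (σ.reg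
    rCur) (x.map (code L))) (hcur : σ.reg rCur + c ≤ σ.reg rE) (hB : HasBits L B (σ.arr aBB)) {s : ℕ} (hb : Building L c
    root s X D σ) (hroot : σ.reg rRoot = root) (hpos : 0 < c) (hkpos : 0 < L.length) : Spec expandP σ (420 * (min c (2 ^
    L.length) * L.length * (c * L.length))) (fun τ => ∃ X' D', Building L c root s X' D' τ ∧ X <+: X' ∧ (∀ y ∈ X', y ∈ X
    ∨ IsMove L B x y) ∧ (∀ y, IsMove L B x y → y ∈ X') ∧ SameOff root D D' ∧ MemLe σ τ) := by
  set M := min c (2 ^ L.length) with hM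
  have hMpos : 0 < M := lt_min hpos (Nat.two_pow_pos _)
  set w := c * L.length with hw
  obtain ⟨h1, h2, h3⟩ := le_mul_and hpos hkpos
  set R := 6 + L.length * (17 + 250 * w) with hR
  -- Rounds at repeated elements are cheap. They have to be summed with their individual costs, as
  -- `c` times the maximum would be too much.
  set T : ℕ → ℕ := fun r => 10 + if FirstAt x r then R else 0 with hT
  have hsum : ∑ r ∈ Finset.range c, (T r + 6) + 5 ≤ 16 * c + M * R + 5 := by
    have h4 : ∑ r ∈ Finset.range c, (T r + 6) = 16 * c + ((Finset.range c).filter (FirstAt x)).card * R := by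
      simp only [hT, Finset.card_filter, Finset.sum_mul, Finset.sum_add_distrib, ite_mul, one_mul, zero_mul]
      simp; ring
    rw [h4]
    have : _ ≤ M * R := Nat.mul_le_mul_right R (card_firstAt_le hL hx hsort)
    omega
  refine Spec.le (T := 60 * w + ((L.length * 40 + 10) + (2 + (2 + (∑ r ∈ Finset.range c, (T r + 6) + 5))))) ?_ (by
    have h5 : M * L.length * w ≥ w := Nat.le_mul_of_pos_left _ (Nat.mul_pos hMpos hkpos)
    have h6 : M * R ≤ 273 * (M * L.length * w) := by
      have : R ≤ 273 * (L.length * w) := by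
        have : L.length ≤ L.length * w := Nat.le_mul_of_pos_right _ h3
        have : 0 < L.length * w := Nat.mul_pos hkpos h3
        rw [hR]; nlinarith
      calc M * R ≤ M * (273 * (L.length * w)) := Nat.mul_le_mul_left _ this
        _ = _ := by ring
    omega)
  refine Spec.seqf (countP_spec rfl hL hE hx hm hpos hkpos) fun τ1 hf1 hcnt => ?_
  have hE1 := hE.frame hf1 rfl
  refine Spec.seqf (allowP_spec (B := B) hE1 hx (hf1.arr aBB rfl ▸ hB) hcnt) fun τ2 hf2 hall => ?_
  have hE2 := hE1.frame hf2 rfl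
  refine Spec.blockseq 2 (Spec.blockseq 2 ?_)
  set τ3 := (assign rXq (reg rCur)).run ((assign rXprev (reg rN)).run τ2) with hτ3
  have hE3 : Env L c τ3 := hE2.congr
  have hb3 : Building L c root s X D τ3 := ((hb.frame hf1 rfl).frame hf2 rfl).congr
  have hcur3 : τ3.reg rCur = σ.reg rCur := (hf2.reg _ rfl).trans (hf1.reg _ rfl)
  have hroot3 : τ3.reg rRoot = root := ((hf2.reg _ rfl).trans (hf1.reg _ rfl)).trans hroot
  have hmem2 : MemLe σ τ2 := (MemLe.of_frame hf1 rfl).trans (MemLe.of_frame hf2 rfl)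
  have hmem3 : MemLe σ τ3 := ⟨hmem2.1, hmem2.2⟩
  have hm3 : ∀ τ, MemLe σ τ → At (τ.arr aMEM) (σ.reg rCur) (x.map (code L)) := fun τ h =>
    h.at hm (by simpa [hx.1] using hcur)
  refine (Spec.forSum T c (fun r τ => Moved L c B root s X D x σ (fun r' _ => r' < r) τ ∧ τ.reg rXq = σ.reg rCur + r ∧
      (r = 0 ∧ τ.reg rXprev = 2 ^ L.length ∨ 0 < r ∧ ∃ S, x[r - 1]? = some S ∧ τ.reg rXprev = code L S))
    hE3.rc ?_ ?_).mono ?_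
  · refine ⟨⟨X, D, hb3.congr, List.prefix_rfl, fun y => Or.inl,
      fun r S a h => absurd h (by omega), SameOff.refl _ _, hmem3⟩, ?_, Or.inl ⟨rfl, ?_⟩⟩
    · simp [hτ3, run, (hf2.reg rCur rfl).trans (hf1.reg rCur rfl)]
    · simp [hτ3, run, hE2.rn]
  · rintro r hr ρ hfρ hrr ⟨hmv, hq, hprev⟩
    have hE4 := hE3.frame hfρ rfl
    obtain ⟨S, hS, hSL⟩ := hx.getElem? hr
    have hmρ := hm3 ρ (by obtain ⟨X', D', h⟩ := hmv; exact h.2.2.2.2.2)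
    have hv : ρ.arr aMEM (σ.reg rCur + r) = code L S := hmρ r _ (by simp [hS])
    refine Spec.le (T := 3 + (3 + (3 + max 1 (if FirstAt x r then 2 + (L.length * (11 + 250 * w + 6) + 5) else 0)))) ?_ (by
      simp only [hT, hR]; split_ifs
      · rw [max_eq_right (by omega)]; have : L.length * (11 + 250 * w + 6) = L.length * (17 + 250 * w) := by ring
        omega
      · simp)
    refine Spec.blockseq 3 (Spec.blockseq 3 ?_)
    set ρ1 := (inc rXq).run ((assign rXx (get aMEM (reg rXq))).run ρ) with hρ1
    have hx1 : ρ1.reg rXx = code L S := by simp [hρ1, run, inc, hq, hv]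
    have hp1 : ρ1.reg rXprev = ρ.reg rXprev := by simp [hρ1, run, inc]
    have hq1 : ρ1.reg rXq = σ.reg rCur + (r + 1) := by simp [hρ1, run, inc, hq]; ring
    have hfirst : ρ1.reg rXx = ρ1.reg rXprev ↔ ¬ FirstAt x r := by
      rw [hx1, hp1]
      -- Initially `rXprev` contains `2 ^ k`, which is the number of no set, so the first element
      -- always counts as new.
      rcases hprev with ⟨rfl, h⟩ | ⟨h, S', hS', h⟩
      · have := rcode_lt hSL (Nat.zero_le L.length)
        rw [h]
        simp only [FirstAt, true_or, not_true, iff_false]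
        exact this.ne
      · rw [h]
        simp only [FirstAt, hS, hS', Option.some.injEq, not_or, not_not, ne_eq]
        constructor
        · intro he
          exact ⟨by omega, (rcode_inj hL hSL (hx.2 S' (mem_of_getElem? hS')) he).symm⟩
        · rintro ⟨-, rfl⟩; rfl
    refine Spec.cond (b := eq (reg rXx) (reg rXprev)) (fun hc => ?_) (fun hc => ?_)
    · have hnf : ¬ FirstAt x r := hfirst.1 hc
      refine Spec.skip ⟨hmv.congr ?_ hL hx, ?_, Or.inr ⟨by omega, S, by simpa using hS, ?_⟩⟩
      · intro r' S' a hr' hS' _ _ _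
        simp only [FirstAt, not_or, not_not, ne_eq] at hnf
        rcases (Nat.lt_succ_iff.1 hr').lt_or_eq with h | rfl
        · exact Or.inl h
        · exact Or.inr ⟨r' - 1, by omega, hnf.2.trans hS'⟩
      · simpa using hq1
      · simp only [Holds, eval] at hc
        simp [← hc, hx1]
    · have hnf : FirstAt x r := by
        by_contra h; exact hc (hfirst.2 h)
      rw [if_pos hnf]
      refine Spec.blockseq 2 ?_
      set ρ2 := (assign rXprev (reg rXx)).run ρ1 with hρ2
      have hE5 : Env L c ρ2 := hE4.congr
      refine (Spec.for (11 + 250 * w) L.length (fun a τ =>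
        Moved L c B root s X D x σ (fun r' a' => r' < r ∨ r' = r ∧ a' < a) τ ∧ τ.reg rXx = rcode L a S)
    hE5.rk ?_ ?_).mono ?_
      · refine ⟨hmv.congr ?_ hL hx, ?_⟩
        · intro r' S' a hr' _ _ _ _
          left; omega
        · simp only [State.setR_reg]
          rw [if_neg (by decide)]
          simp [hρ2, run, hx1, code]
      · rintro a ha π hfπ hra ⟨hmvπ, hxπ⟩
        have hE6 := hE5.frame hfπ rfl
        have hodd := hE6.odd_rcode hL hSL ha
        have hrot := hE6.rot_rcode hL hSL ha
        have hallπ : π.arr aALW a = if Allowed L B x a then 1 else 0 := by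
          rw [hfπ.arr aALW rfl]
          show ρ.arr aALW a = _
          rw [hfρ.arr aALW rfl]
          exact hall a ha
        have hdone : ∀ τ' : State, Moved L c B root s X D x σ (fun r' a' => r' < r ∨ r' = r ∧ a' < a + 1) τ' →
            Env L c τ' → τ'.reg rXx = rcode L a S →
            Spec (assign rXx (get aROT (reg rXx))) τ' 3 (fun τ =>
              Moved L c B root s X D x σ (fun r' a' => r' < r ∨ r' = r ∧ a' < a + 1) (τ.setR rXa (a + 1)) ∧
              (τ.setR rXa (a + 1)).reg rXx = rcode L (a + 1) S) := by
          intro τ' hmv' hE' hx'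
          refine Spec.block 3 ⟨hmv'.congr (fun _ _ _ h _ _ _ _ => Or.inl h) hL hx, ?_⟩
          simp [run, hx', hE'.rot_rcode hL hSL ha]
        refine Spec.le (T := (4 + max (4 + max (250 * w) 1) 1) + 3) ?_ (by
          rw [max_eq_left (by omega : 1 ≤ 250 * w), max_eq_left (by omega)]; omega)
        refine Spec.seqf (R := fun τ' => Moved L c B root s X D x σ (fun r' a' => r' < r ∨ r' = r ∧ a' < a + 1) τ')
          (Spec.cond (b := eq (get aODD (reg rXx)) (lit 0)) (fun hc' => ?_) (fun hc' => ?_)) ?_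
        · simp only [Holds, eval, hxπ, hodd] at hc'
          have haS : lb L a ∉ S := fun h => by rw [if_pos h] at hc'; omega
          refine Spec.cond (b := eq (get aALW (reg rXa)) (lit 1)) (fun hc2 => ?_) (fun hc2 => ?_)
          · simp only [Holds, eval, hra, hallπ] at hc2
            have hal : Allowed L B x a := by
              by_contra h; rw [if_neg h] at hc2; omega
            obtain ⟨X', D', g1, g2, g3, g4, g5, g6⟩ := hmvπ
            have hcurπ : π.reg rCur = σ.reg rCur := by
              rw [hfπ.reg rCur rfl]
              show ρ.reg rCur = _
              rw [hfρ.reg rCur rfl, hcur3]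
            have hrrπ : π.reg rXr = r := hfπ.reg rXr rfl ▸ hrr
            have hrootπ : π.reg rRoot = root := by
              rw [hfπ.reg rRoot rfl]
              show ρ.reg rRoot = _
              rw [hfρ.reg rRoot rfl, hroot3]
            refine (moveP_spec hL hE6 hx (hcurπ ▸ hm3 π g6) hS ha haS hrrπ hra hxπ g1 hrootπ hpos hkpos).mono ?_
            rintro τ' - ⟨D'', k1, k2, k3⟩
            set y := radix L L.length (x.set r (insert (lb L a) S)) with hy
            have hmem : ∀ z, z ∈ (if y ∈ X' then X' else X' ++ [y]) ↔ z ∈ X' ∨ z = y := by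
              intro z
              split_ifs with h
              · constructor
                · exact Or.inl
                · rintro (h' | rfl)
                  · exact h'
                  · exact h
              · simp
            refine ⟨_, D'', k1, ?_, ?_, ?_, g5.trans k2, g6.trans k3⟩
            · split_ifs
              · exact g2
              · exact g2.trans (List.prefix_append _ _)
            · intro z hz
              rcases (hmem z).1 hz with h | rfl
              · exact g3 z h
              · exact Or.inr ⟨r, S, a, hS, ha, haS, hal, rfl⟩
            · intro r' S' a' hP hr' ha' haS' hal'
              rw [hmem]
              by_cases hnew : r' = r ∧ a' = a
              · obtain ⟨rfl, rfl⟩ := hnew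
                rw [hS] at hr'
                obtain rfl : S = S' := Option.some.inj hr'
                exact Or.inr rfl
              · exact Or.inl (g4 r' S' a' (by omega) hr' ha' haS' hal')
          · simp only [Holds, eval, hra, hallπ] at hc2
            have hal : ¬ Allowed L B x a := fun h => by rw [if_pos h] at hc2; exact hc2 rfl
            refine Spec.skip (hmvπ.congr ?_ hL hx)
            intro r' S' a' hP hr' ha' haS' hal'
            have : a' ≠ a := fun h => hal (h ▸ hal')
            left; omega
        · simp only [Holds, eval, hxπ, hodd] at hc'
          have haS : lb L a ∈ S := by by_contra h; rw [if_neg h] at hc'; exact hc' rfl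
          refine Spec.skip (hmvπ.congr ?_ hL hx)
          intro r' S' a' hP hr' ha' haS' hal'
          left
          by_cases hr'r : r' = r
          · subst hr'r
            rw [hS] at hr'
            obtain rfl : S = S' := Option.some.inj hr'
            have : a' ≠ a := fun h => haS' (h ▸ haS)
            omega
          · omega
        · intro τ' hf' hmv'
          exact hdone τ' hmv' (hE6.frame hf' rfl) ((hf'.reg _ rfl).trans hxπ)
      · rintro π hfπ ⟨-, hmvπ, hxπ⟩
        refine ⟨hmvπ.congr ?_ hL hx, ?_, Or.inr ⟨by omega, S, by simpa using hS, ?_⟩⟩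
        · intro r' S' a hr' _ ha _ _
          left; omega
        · simp only [State.setR_reg]
          rw [if_neg (by decide), hfπ.reg _ rfl]
          simpa [hρ2, run] using hq1
        · simp only [State.setR_reg]
          rw [if_neg (by decide), hfπ.reg _ rfl]
          simp [hρ2, run, hx1]
  · rintro τ - ⟨-, ⟨X', D', g1, g2, g3, g4, g5, g6⟩, -⟩
    refine ⟨X', D', g1, g2, g3, ?_, g5, g6⟩
    rintro y ⟨r, S, a, hS, ha, haS, hal, rfl⟩
    refine g4 r S a ?_ hS ha haS hal
    have := getElem?_lt hS
    rw [hx.1] at this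
    exact this

/-! ## All overapproximations of the schemes of a set -/

/-- A loop that advances the pointer `p` by `c` in each round, until it meets `e`. -/
theorem Spec.rows {p e : ℕ} {body : Prog} (I : ℕ → State → Prop) (T n c a : ℕ) (he : body.wr e = false) (hc : 0 < c)
    (hσe : σ.reg e = a + n * c) (hσp : σ.reg p = a) (h0 : I 0 σ) (hstep : ∀ i < n, ∀ τ, Frame (Prog.loop (lt (reg p)
    (reg e)) body) σ τ → τ.reg p = a + i * c → I i τ → Spec body τ T (fun ρ => ρ.reg p = a + (i + 1) * c ∧ I (i + 1) ρ))
    : Spec (Prog.loop (lt (reg p) (reg e)) body) σ (n * (T + 3) + 3) (fun τ => τ.reg p = a + n * c ∧ I n τ) := by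
  have := Spec.loop (b := lt (reg p) (reg e)) (p := body) (σ := σ)
    (fun i τ => i ≤ n ∧ τ.reg e = a + n * c ∧ τ.reg p = a + i * c ∧ I i τ) (fun i => (n - i) * (T + 3)) 0
    ⟨Nat.zero_le _, hσe, by simpa using hσp, h0⟩ (by
      rintro i τ hf ⟨h1, h2, h3, h4⟩ hb
      simp only [Holds, eval, h2, h3] at hb
      have hi : i < n := by
        have := (Nat.mul_lt_mul_right hc).1 (Nat.lt_of_add_lt_add_left hb); exact this
      refine ⟨T, (hstep i hi τ hf h3 h4).mono ?_⟩
      rintro ρ hfρ ⟨h5, h6⟩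
      refine ⟨i + 1, ⟨hi, (hfρ.reg _ he).trans h2, h5, h6⟩, ?_⟩
      obtain ⟨d, rfl⟩ : ∃ d, n = i + 1 + d := ⟨n - (i + 1), by omega⟩
      simp only [Nat.add_sub_cancel_left, show i + 1 + d - i = d + 1 by omega, Test.cost, Expr.cost]
      ring_nf; omega)
  refine (this.le (by simp)).mono ?_
  rintro τ - ⟨i, ⟨h1, h2, h3, h4⟩, hb⟩
  simp only [Holds, eval, h2, h3] at hb
  have : i = n := by
    by_contra h
    exact hb (Nat.add_lt_add_left ((Nat.mul_lt_mul_right hc).2 (by omega)) _)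
  subst this
  exact ⟨h3, h4⟩

/-- Start a new set with the schemes between the positions in the registers `32` and `33`. -/
def copyP : Prog := newP ;; assign 34 (reg 32) ;;
  Prog.loop (lt (reg 34) (reg 33)) (assign 31 (reg 34) ;; loadP ;; assign 34 (reg 31) ;; insP)

/-- Start a new set, and fill it with the overapproximations of the schemes between the positions in
the registers `32` and `33`. -/
def closureP : Prog := assign rCur (reg rE) ;; copyP ;;
  Prog.loop (lt (reg rCur) (reg rE)) (expandP ;; forLoop rXz rC (inc rCur))

theorem radix_self (hL : L.Nodup) {l : Tuple} (hl : ∀ S ∈ l, S ⊆ L.toFinset) (hs : Sorted L l) : radix L L.length l = l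
    :=
  Sorted.eq_of_perm hL (fun S hS => hl S (radix_perm.mem_iff.1 hS)) radix_perm (sorted_radix hL hl) hs

theorem Good.of_isMove {x y : Tuple} (hx : Good L c x) (h : IsMove L B x y) : Good L c y := by
  obtain ⟨r, S, a, hr, ha, -, -, rfl⟩ := h
  exact (hx.set (insert_lb_subset (hx.2 S (mem_of_getElem? hr)) ha)).radix _

theorem Sorted.of_isMove (hL : L.Nodup) {x y : Tuple} (hx : Good L c x) (h : IsMove L B x y) : Sorted L y := by
  obtain ⟨r, S, a, hr, ha, -, -, rfl⟩ := h
  exact sorted_radix hL (hx.set (insert_lb_subset (hx.2 S (mem_of_getElem? hr)) ha)).2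

/-- Reachability by moves. -/
def Reach (L : List ℕ) (B : Finset ℕ) (X : List Tuple) (y : Tuple) : Prop :=
  ∃ x ∈ X, Relation.ReflTransGen (IsMove L B) x y

theorem Reach.good (hL : L.Nodup) (hX : ∀ x ∈ X, Good L c x ∧ Sorted L x) {y : Tuple} (h : Reach L B X y) : Good L c y ∧
    Sorted L y := by
  obtain ⟨x, hx, h⟩ := h
  induction h with
  | refl => exact hX x hx
  | tail _ h ih => exact ⟨ih.1.of_isMove h, Sorted.of_isMove hL ih.1 h⟩

theorem mem_ite_append {α : Type*} {X : List α} {y z : α} [Decidable (y ∈ X)] : z ∈ (if y ∈ X then X else X ++ [y]) ↔ z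
    ∈ X ∨ z = y := by
  split_ifs with h
  · constructor
    · exact Or.inl
    · rintro (h' | rfl)
      · exact h'
      · exact h
  · simp

open Classical in
theorem copyP_spec (hL : L.Nodup) (hE : Env L c σ) (hX : ∀ x ∈ X, Good L c x ∧ Sorted L x) (hm : At (σ.arr aMEM) (σ.reg
    32) (enc L X)) (h33 : σ.reg 33 = σ.reg 32 + X.length * c) (hle : σ.reg 33 ≤ σ.reg rE) (ht : ∃ path, Trie path (σ.arr
    aCH) (σ.reg rT) D) (hpos : 0 < c) (hkpos : 0 < L.length) : Spec copyP σ (X.length * (230 * (c * L.length)) + 11)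
    (fun τ => ∃ Y D', Building L c (σ.reg rT) (σ.reg rE) Y D' τ ∧ (∀ y, y ∈ Y ↔ y ∈ X) ∧ SameOff (σ.reg rT) D D' ∧ MemLe
    σ τ ∧ τ.reg rRoot = σ.reg rT) := by
  obtain ⟨h1, h2, h3⟩ := le_mul_and hpos hkpos
  refine Spec.le (T := 6 + (2 + (X.length * (2 + ((c * 13 + 5) + (2 + 200 * (c * L.length))) + 3) + 3))) ?_ (by
    have : X.length * (2 + ((c * 13 + 5) + (2 + 200 * (c * L.length))) + 3) ≤ X.length * (230 * (c * L.length)) :=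
      Nat.mul_le_mul_left _ (by omega)
    omega)
  refine Spec.seqf (newP_spec (L := L) ht hpos hkpos) ?_
  rintro τ hf ⟨D1, hb1, hroot1, hE1, harr1, hoff1⟩
  have hEnv1 := hE.frame hf rfl
  refine Spec.blockseq 2 ?_
  set τ1 := (assign 34 (reg 32)).run τ with hτ1
  have hEnv2 : Env L c τ1 := hEnv1.congr
  have hmem1 : MemLe σ τ1 := ⟨hE1.ge, fun i _ => by show τ.arr aMEM i = _; rw [harr1]⟩
  refine (Spec.rows (fun i τ => ∃ Y D', Building L c (σ.reg rT) (σ.reg rE) Y D' τ ∧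
    (∀ y, y ∈ Y ↔ y ∈ X.take i) ∧ SameOff (σ.reg rT) D D' ∧ MemLe σ τ)
    (2 + ((c * 13 + 5) + (2 + 200 * (c * L.length)))) X.length c (σ.reg 32) rfl hpos ?_ ?_ ?_ ?_).mono ?_
  · show τ.reg 33 = _
    rw [hf.reg 33 rfl, h33]
  · simp [hτ1, run, hf.reg 32 rfl]
  · exact ⟨[], D1, hb1.congr, by simp, hoff1, hmem1⟩
  · rintro i hi ρ hfρ hp ⟨Y, D', g1, g2, g3, g4⟩
    have hEnv3 := hEnv2.frame hfρ rfl
    refine Spec.blockseq 2 ?_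
    set ρ1 := (assign 31 (reg 34)).run ρ with hρ1
    have hEnv4 : Env L c ρ1 := hEnv3.congr
    obtain ⟨x, hx⟩ := exists_getElem? (l := X) hi
    obtain ⟨hxg, hxs⟩ := hX x (mem_of_getElem? hx)
    have h31 : ρ1.reg 31 = σ.reg 32 + i * c := by simpa [hρ1, run] using hp
    refine Spec.seqf (loadP_spec hEnv4 (w := x.map (code L)) (by simpa using hxg.1) ?_) ?_
    · rw [h31]
      refine At.enc_get (fun l hl => (hX l hl).1) ?_ hx
      exact g4.at hm (by rw [length_enc fun l hl => (hX l hl).1]; omega)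
    rintro ρ2 hfρ2 ⟨hbuf, h31'⟩
    have hEnv5 := hEnv4.frame hfρ2 rfl
    refine Spec.blockseq 2 ?_
    set ρ3 := (assign 34 (reg 31)).run ρ2 with hρ3
    have hEnv6 : Env L c ρ3 := hEnv5.congr
    have g1' : Building L c (σ.reg rT) (σ.reg rE) Y D' ρ1 := g1.congr
    have g1'' : Building L c (σ.reg rT) (σ.reg rE) Y D' ρ3 := (g1'.frame hfρ2 rfl).congr
    have h34 : ρ3.reg 34 = σ.reg 32 + (i + 1) * c := by
      simp only [hρ3, run, eval, State.setR_reg, if_true, h31', h31]; ring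
    have hrt : ρ3.reg rRoot = σ.reg rT := ((hfρ2.reg rRoot rfl).trans (hfρ.reg rRoot rfl)) ▸ hroot1
    refine (insP_spec hL hEnv6 hxg hbuf g1'' hrt hpos hkpos).mono ?_
    rintro τ' hf' ⟨D'', k1, k2, k3⟩
    refine ⟨(hf'.reg 34 rfl).trans h34, _, D'', k1, ?_, g3.trans k2, ?_⟩
    · intro y
      rw [mem_ite_append, g2, radix_self hL hxg.2 hxs, take_add_one, hx]
      simp
    · have hm2 : MemLe ρ1 ρ2 := MemLe.of_frame hfρ2 rfl
      have hm3 : MemLe ρ ρ3 := ⟨hm2.1, hm2.2⟩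
      exact g4.trans (hm3.trans k3)
  · rintro ρ hfρ ⟨-, Y, D', g1, g2, g3, g4⟩
    rw [List.take_length] at g2
    exact ⟨Y, D', g1, g2, g3, g4, (hfρ.reg rRoot rfl).trans hroot1⟩

open Classical in
-- Breadth-first search with the memory as its queue: `rCur` follows the end pointer `rE`, and the
-- search is finished when it has caught up. Every scheme is expanded once, so a bound `N` for the
-- size of any repetition-free list of reachable schemes bounds the time.
theorem closureP_spec (hL : L.Nodup) (hE : Env L c σ) (hX : ∀ x ∈ X, Good L c x ∧ Sorted L x) (hXn : X.Nodup) (hm : At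
    (σ.arr aMEM) (σ.reg 32) (enc L X)) (h33 : σ.reg 33 = σ.reg 32 + X.length * c) (hle : σ.reg 33 ≤ σ.reg rE) (ht : ∃
    path, Trie path (σ.arr aCH) (σ.reg rT) D) (hpos : 0 < c) (hkpos : 0 < L.length) (hB : HasBits L B (σ.arr aBB)) {N :
    ℕ} (hN : ∀ Y : List Tuple, Y.Nodup → (∀ y ∈ Y, Reach L B X y) → Y.length ≤ N) : Spec closureP σ (700 * (N * (min c
    (2 ^ L.length) * L.length * (c * L.length))) + 20) (fun τ => ∃ Y D', Building L c (σ.reg rT) (σ.reg rE) Y D' τ ∧ (∀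
    y, y ∈ Y ↔ Reach L B X y) ∧ SameOff (σ.reg rT) D D' ∧ MemLe σ τ ∧ τ.reg rRoot = σ.reg rT) := by
  set M := min c (2 ^ L.length) with hM
  have hMpos : 0 < M := lt_min hpos (Nat.two_pow_pos _)
  set w := c * L.length with hw
  obtain ⟨h1, h2, h3⟩ := le_mul_and hpos hkpos
  set U := M * L.length * w with hU
  have hUw : w ≤ U := Nat.le_mul_of_pos_left _ (Nat.mul_pos hMpos hkpos)
  have hXN : X.length ≤ N := hN X hXn fun y hy => ⟨y, hy, Relation.ReflTransGen.refl⟩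
  set K := 420 * U + (c * (3 + 6) + 5) + 3 with hK
  refine Spec.le (T := 2 + ((X.length * (230 * w) + 11) + (N * K + 3))) ?_ (by
    have e1 : X.length * (230 * w) ≤ N * (230 * U) := Nat.mul_le_mul hXN (by omega)
    have e2 : N * K ≤ N * (450 * U) := Nat.mul_le_mul_left _ (by omega)
    nlinarith)
  refine Spec.blockseq 2 ?_
  set σ1 := (assign rCur (reg rE)).run σ with hσ1
  have hE1 : Env L c σ1 := hE.congr
  refine Spec.seqf (copyP_spec hL hE1 hX hm h33 hle ht hpos hkpos) ?_
  rintro τ hf ⟨Y0, D0, hb0, hY0, hoff0, hmem0, hroot0⟩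
  change Building L c (σ.reg rT) (σ.reg rE) Y0 D0 τ at hb0
  change SameOff (σ.reg rT) D D0 at hoff0
  change τ.reg rRoot = σ.reg rT at hroot0
  have hmem0' : MemLe σ τ := ⟨hmem0.1, hmem0.2⟩
  have hE2 := hE1.frame hf rfl
  have hcur0 : τ.reg rCur = σ.reg rE := by
    rw [hf.reg rCur rfl]; simp [hσ1, run]
  -- The ghost value is the number of schemes already expanded together with the list stored so far;
  -- the potential counts the expansions that can still come.
  have hloop := Spec.loop (σ := τ) (b := lt (reg rCur) (reg rE)) (p := expandP ;; forLoop rXz rC (inc rCur))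
    (fun (z : ℕ × List Tuple) ρ => ∃ D', Building L c (σ.reg rT) (σ.reg rE) z.2 D' ρ ∧
      ρ.reg rCur = σ.reg rE + z.1 * c ∧ z.1 ≤ z.2.length ∧ (∀ y ∈ X, y ∈ z.2) ∧
      (∀ y ∈ z.2, Reach L B X y) ∧
      (∀ j < z.1, ∀ x, z.2[j]? = some x → ∀ y, IsMove L B x y → y ∈ z.2) ∧
      SameOff (σ.reg rT) D D' ∧ MemLe σ ρ) (fun z => (N - z.1) * K) (0, Y0)
    ⟨D0, hb0, by simpa using hcur0, Nat.zero_le _, fun y hy => (hY0 y).2 hy,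
      fun y hy => ⟨y, (hY0 y).1 hy, Relation.ReflTransGen.refl⟩, by simp, hoff0, hmem0'⟩ ?_
  · refine (hloop.le (by show (N - 0) * K + 3 ≤ _; rw [Nat.sub_zero])).mono ?_
    rintro ρ hfρ ⟨⟨i, Y⟩, ⟨D', g1, g2, g3, g4, g5, g6, g7, g8⟩, hb⟩
    simp only at g1 g2 g3 g4 g5 g6
    refine ⟨Y, D', g1, ?_, g7, g8, (hfρ.reg rRoot rfl).trans hroot0⟩
    have hi : i = Y.length := by
      by_contra hne
      apply hb
      simp only [Holds, eval, g2, g1.last, length_enc g1.good]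
      exact Nat.add_lt_add_left ((Nat.mul_lt_mul_right hpos).2 (by omega)) _
    intro y
    refine ⟨g5 y, ?_⟩
    rintro ⟨x, hx, hxy⟩
    induction hxy with
    | refl => exact g4 x hx
    | @tail u v _ huv ih =>
      obtain ⟨j, hj⟩ := getElem?_of_mem ih
      exact g6 j (hi ▸ (getElem?_lt hj)) u hj v huv
  · rintro ⟨i, Y⟩ ρ hfρ ⟨D', g1, g2, g3, g4, g5, g6, g7, g8⟩ hb
    simp only at g1 g2 g3 g4 g5 g6
    have hE3 := hE2.frame hfρ rfl
    have hi : i < Y.length := by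
      simp only [Holds, eval, g2, g1.last, length_enc g1.good] at hb
      exact (Nat.mul_lt_mul_right hpos).1 (Nat.lt_of_add_lt_add_left hb)
    obtain ⟨x, hx⟩ := exists_getElem? (l := Y) hi
    have hxY := mem_of_getElem? hx
    obtain ⟨hxg, hxs⟩ := (g5 x hxY).good hL hX
    have hroot : ρ.reg rRoot = σ.reg rT := (hfρ.reg rRoot rfl).trans hroot0
    have hBρ : HasBits L B (ρ.arr aBB) := by
      rw [hfρ.arr aBB rfl, hf.arr aBB rfl]; exact hB
    refine ⟨420 * U + (c * (3 + 6) + 5), ?_⟩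
    refine Spec.seqf (expandP_spec hL hE3 hxg hxs ?_ ?_ hBρ g1 hroot hpos hkpos) ?_
    · rw [g2]; exact At.enc_get g1.good g1.mem hx
    · rw [g2, g1.last, length_enc g1.good]
      have := Nat.mul_le_mul_right c hi
      rw [Nat.succ_mul] at this
      omega
    rintro π hfπ ⟨Y', D'', k1, k2, k3, k4, k5, k6⟩
    have hE4 := hE3.frame hfπ rfl
    have hcπ : π.reg rCur = σ.reg rE + i * c := (hfπ.reg rCur rfl).trans g2
    refine (Spec.for 3 c (fun j τ => τ.reg rCur = σ.reg rE + i * c + j) hE4.rc ?_ ?_).mono ?_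
    · simpa using hcπ
    · intro j hj τ' hf' _ h
      refine Spec.block 3 ?_
      simp [run, inc, h]; ring
    · rintro τ' hf' ⟨-, hcur'⟩
      have hYY : ∀ y ∈ Y', Reach L B X y := by
        intro y hy
        rcases k3 y hy with h | h
        · exact g5 y h
        · obtain ⟨x0, hx0, hr⟩ := g5 x hxY
          exact ⟨x0, hx0, hr.tail h⟩
      refine ⟨(i + 1, Y'), ⟨D'', k1.frame hf' rfl, ?_, ?_, ?_, hYY, ?_, g7.trans k5,
        (g8.trans k6).trans (MemLe.of_frame hf' rfl)⟩, ?_⟩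
      · rw [hcur']; ring
      · exact Nat.succ_le_of_lt (hi.trans_le k2.length_le)
      · exact fun y hy => k2.subset (g4 y hy)
      · intro j hj u hu y huy
        simp only at hj hu
        have hju : Y[j]? = some u := by
          have hjl : j < Y.length := by omega
          obtain ⟨Z, rfl⟩ := k2
          rwa [getElem?_append_left hjl] at hu
        rcases (Nat.lt_succ_iff.1 hj).lt_or_eq with h | rfl
        · exact k2.subset (g6 j h u hju y huy)
        · obtain rfl := Option.some.inj (hx.symm.trans hju)
          exact k4 y huy
      · have hiN : i + 1 ≤ N := by
          have := hN Y g1.nodup g5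
          omega
        obtain ⟨d, rfl⟩ : ∃ d, N = i + 1 + d := ⟨N - (i + 1), by omega⟩
        simp only [Nat.add_sub_cancel_left, show i + 1 + d - i = d + 1 by omega, Test.cost, Expr.cost, hK]
        ring_nf; omega

/-! ### Reachability by moves and overapproximation -/

theorem coe_listOfFn (F : Fin c → Finset ℕ) : ((List.ofFn F : Tuple) : Scheme) = Scheme.ofFn F := by
  simp [Scheme.ofFn]

theorem coe_radix {j : ℕ} {l : Tuple} : ((radix L j l : Tuple) : Scheme) = l := Multiset.coe_eq_coe.2 radix_perm

section
variable {x y : Tuple}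

theorem eq_of_coe_eq (hL : L.Nodup) (hx : Good L c x) (hxs : Sorted L x) (hys : Sorted L y) (h : (x : Multiset (Finset
    ℕ)) = y) : x = y :=
  Sorted.eq_of_perm hL hx.2 (Multiset.coe_eq_coe.1 h) hxs hys

theorem notIn_eq_length {a : ℕ} : notIn L x a = x.length ↔ ∀ S ∈ x, lb L a ∉ S := by
  simp [notIn, List.countP_eq_length]

theorem one_lt_notIn_ofFn {F : Fin c → Finset ℕ} (hF : (x : Scheme) = Scheme.ofFn F) {i i' : Fin c} (hi : i ≠ i') {a :
    ℕ} (h : lb L a ∉ F i) (h' : lb L a ∉ F i') : 1 < notIn L x a := by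
  have h1 : notIn L x a = Multiset.countP (fun S => lb L a ∉ S) (x : Scheme) := by
    rw [Multiset.coe_countP]; rfl
  have h2 : Multiset.card (Multiset.filter (fun j => lb L a ∉ F j) Finset.univ.val) =
      (Finset.univ.filter (fun j => lb L a ∉ F j)).card := rfl
  rw [h1, hF, Scheme.ofFn, Multiset.countP_map, h2, Finset.one_lt_card]
  exact ⟨i, by simpa using h, i', by simpa using h', hi⟩

theorem exists_notMem_of_one_lt {r a : ℕ} (hr : x[r]? = some S) (haS : lb L a ∉ S) (hn : 1 < notIn L x a) : ∃ T ∈ radix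
    L L.length (x.set r (insert (lb L a) S)), lb L a ∉ T := by
  have h0 : ∃ T ∈ (radix L L.length (x.set r (insert (lb L a) S)) : Scheme), lb L a ∉ T := by
    rw [coe_radix, coe_set hr]
    have h1 : notIn L x a = Multiset.countP (fun S => lb L a ∉ S) (x : Scheme) := by
      rw [Multiset.coe_countP]; rfl
    rw [h1, ← Multiset.cons_erase (show S ∈ (x : Scheme) from mem_of_getElem? hr),
      Multiset.countP_cons_of_pos (p := fun S => lb L a ∉ S) _ haS] at hn
    obtain ⟨S', hS', h2⟩ := Multiset.countP_pos.1 (Nat.lt_of_succ_lt_succ hn)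
    exact ⟨S', Multiset.mem_cons_of_mem hS', h2⟩
  exact h0

theorem IsMove.step (h : IsMove L B x y) : Scheme.Step (x : Scheme) y := by
  obtain ⟨r, S, a, hr, ha, haS, ⟨-, hn, -⟩, rfl⟩ := h
  refine ⟨S, mem_of_getElem? hr, lb L a, ?_, ?_⟩
  · rw [coe_radix, coe_set hr]
  · exact exists_notMem_of_one_lt hr haS hn

theorem isMove_of_ofFn (hL : L.Nodup) (hx : Good L c x) (hy : Good L c y) (hys : Sorted L y) {F : Fin c → Finset ℕ} (hF
    : (x : Scheme) = Scheme.ofFn F) {i : Fin c} {a : ℕ} (ha : a < L.length) (haF : lb L a ∉ F i) (hal : Allowed L B x a)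
    (hFy : (y : Scheme) = Scheme.ofFn (update F i (insert (lb L a) (F i)))) : IsMove L B x y := by
  have hmem : F i ∈ x := by
    have : F i ∈ (x : Scheme) := by rw [hF]; exact Scheme.mem_ofFn.2 ⟨i, rfl⟩
    exact this
  obtain ⟨r, hr⟩ := getElem?_of_mem hmem
  refine ⟨r, F i, a, hr, ha, haF, hal, ?_⟩
  have hg : Good L c (x.set r (insert (lb L a) (F i))) := hx.set (insert_lb_subset (hx.2 _ hmem) ha)
  refine eq_of_coe_eq hL hy hys (sorted_radix hL hg.2) ?_
  rw [coe_radix, coe_set hr, hFy, Scheme.ofFn_update_eq, hF]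

/-- Induction on the number of insertions still missing; the missing label with the least position
comes next. An earlier label of `B` is used by `y` and is missing nowhere, so `x` uses it already.
Two elements of `x` lack the chosen label: the one that receives it, and one that lacks it even in
`y`. -/
theorem reach_of_overapprox (hL : L.Nodup) (hy : Good L c y) (hys : Sorted L y) (hlab : Scheme.labels (y : Multiset
    (Finset ℕ)) = B) (hx : Good L c x) (hxs : Sorted L x) (h : Scheme.Overapprox (x : Scheme) y) : Relation.ReflTransGen
    (IsMove L B) x y := by
  obtain ⟨f, hf⟩ := Scheme.exists_ofFn (s := (x : Scheme)) hx.1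
  rw [hf] at h
  obtain ⟨g, hg, hle, hnf⟩ := Scheme.overapprox_ofFn_iff.1 h
  have hgL : ∀ i, g i ⊆ L.toFinset := by
    intro i
    have : g i ∈ (y : Scheme) := by rw [hg]; exact Scheme.mem_ofFn.2 ⟨i, rfl⟩
    exact hy.2 _ this
  clear h
  generalize hn : ∑ i, (g i \ f i).card = n
  induction n generalizing f x with
  | zero =>
    have : f = g := by
      funext i
      have := (Finset.sum_eq_zero_iff.1 hn) i (Finset.mem_univ i)
      rw [Finset.card_eq_zero, Finset.sdiff_eq_empty_iff_subset] at this
      exact (hle i).antisymm this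
    rw [eq_of_coe_eq hL hx hxs hys (by rw [hf, hg, this])]
  | succ n ih =>
    obtain ⟨i0, hi0⟩ : ∃ i, (g i \ f i).Nonempty := by
      by_contra hcon
      push Not at hcon
      have : ∑ i, (g i \ f i).card = 0 := Finset.sum_eq_zero fun i _ => by simp [hcon i]
      omega
    obtain ⟨a, ha, hmin⟩ := Finset.exists_min_image (Finset.univ.biUnion fun i => g i \ f i) (fun a => L.idxOf a) (by
        obtain ⟨a, ha⟩ := hi0
        exact ⟨a, Finset.mem_biUnion.2 ⟨i0, Finset.mem_univ _, ha⟩⟩)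
    obtain ⟨i, -, hai⟩ := Finset.mem_biUnion.1 ha
    rw [Finset.mem_sdiff] at hai
    have haL : a ∈ L := by simpa using hgL i hai.1
    have hidx := idxOf_lt_length_iff.2 haL
    have hlb := lb_idxOf haL
    obtain ⟨j, hj⟩ := hnf i a hai.1 hai.2
    have hle' : ∀ l, update f i (insert a (f i)) l ⊆ g l := by
      intro l
      by_cases hl : l = i
      · subst hl; simpa [Finset.insert_subset_iff] using ⟨hai.1, hle l⟩
      · simpa [hl] using hle l
    set f' := update f i (insert a (f i)) with hf'
    set z := radix L L.length (List.ofFn f') with hz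
    have hf'L : Good L c (List.ofFn f') := by
      refine ⟨by simp, fun S hS => ?_⟩
      obtain ⟨l, rfl⟩ := (List.mem_ofFn' _ _).1 hS
      exact (hle' l).trans (hgL l)
    have hzg : Good L c z := hf'L.radix _
    have hzs : Sorted L z := sorted_radix hL hf'L.2
    have hzc : (z : Scheme) = Scheme.ofFn f' := by rw [hz, coe_radix, coe_listOfFn]
    refine Relation.ReflTransGen.head (b := z) ?_ (ih hzg hzs f' hzc hle' ?_ ?_)
    · refine isMove_of_ofFn hL hx hzg hzs hf (i := i) (a := L.idxOf a) hidx (by rw [hlb]; exact hai.2) ?_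
        (by rw [hlb]; exact hzc)
      refine ⟨?_, ?_, ?_⟩
      · rw [hlb]
        have : a ∈ Scheme.labels (y : Scheme) := by
          rw [hg, Scheme.mem_labels_ofFn]; exact ⟨i, hai.1⟩
        rw [hlab] at this
        exact this
      · have hij : i ≠ j := by rintro rfl; exact hj hai.1
        exact one_lt_notIn_ofFn hf hij (by rw [hlb]; exact hai.2) (by rw [hlb]; exact fun h => hj (hle j h))
      · intro a' ha' hB' hcon
        rw [notIn_eq_length] at hcon
        have : lb L a' ∈ Scheme.labels (y : Scheme) := hlab ▸ hB'
        rw [hg, Scheme.mem_labels_ofFn] at this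
        obtain ⟨l, hl⟩ := this
        have hnl : lb L a' ∉ f l := by
          refine hcon _ ?_
          have : f l ∈ (x : Scheme) := by rw [hf]; exact Scheme.mem_ofFn.2 ⟨l, rfl⟩
          exact this
        have := hmin (lb L a') (Finset.mem_biUnion.2 ⟨l, Finset.mem_univ _, Finset.mem_sdiff.2 ⟨hl, hnl⟩⟩)
        rw [idxOf_lb hL (by omega)] at this
        omega
    · intro l b hb hb'
      refine hnf l b hb fun h => hb' ?_
      by_cases hl : l = i
      · subst hl; simp [hf', h]
      · simpa [hf', hl] using h
    · have key : ∀ l, (g l \ f l).card = (g l \ f' l).card + if l = i then 1 else 0 := by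
        intro l
        by_cases hl : l = i
        · subst hl
          have : g l \ f' l = (g l \ f l).erase a := by
            ext z; simp [hf']; tauto
          rw [this, Finset.card_erase_of_mem (by simp [hai])]
          have : 0 < (g l \ f l).card := Finset.card_pos.2 ⟨a, by simp [hai]⟩
          simp; omega
        · simp [hf', hl]
      simp only [key, Finset.sum_add_distrib, Finset.sum_ite_eq', Finset.mem_univ, if_true] at hn
      omega

theorem reach_iff (hL : L.Nodup) (hX : ∀ x ∈ X, Good L c x ∧ Sorted L x) (hy : Good L c y) (hys : Sorted L y) (hlab :
    Scheme.labels (y : Scheme) = B) : Reach L B X y ↔ ∃ x ∈ X, Scheme.Overapprox (x : Scheme) y := by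
  constructor
  · rintro ⟨x, hx, h⟩
    refine ⟨x, hx, ?_⟩
    clear hy hys hlab
    induction h with
    | refl => exact Relation.ReflTransGen.refl
    | tail _ h ih => exact ih.tail h.step
  · rintro ⟨x, hx, h⟩
    exact ⟨x, hx, reach_of_overapprox hL hy hys hlab (hX x hx).1 (hX x hx).2 h⟩

/-- The labels of `B` before position `i`. -/
def initial (L : List ℕ) (B : Finset ℕ) (i : ℕ) : Finset ℕ := B.filter (fun b => L.idxOf b < i)

/-- No label is contained in all elements, and the set of labels is the union of `B₁` and an initial
part of `B`. -/
def Stage (L : List ℕ) (B₁ B : Finset ℕ) (y : Tuple) : Prop :=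
  (∀ a, ∃ S ∈ y, a ∉ S) ∧ ∃ i ≤ L.length, ∀ a, (∃ S ∈ y, a ∈ S) ↔ a ∈ B₁ ∪ initial L B i

/-- If the added label was in use, the label set does not change. If it is new, `UsedBelow` says
that the part of `B` before it is in use, and the initial part now ends just behind it. The
requirement of two elements without the label keeps it from filling all elements. -/
theorem Stage.of_isMove (hL : L.Nodup) {B₁ : Finset ℕ} (hB : B ⊆ L.toFinset) (h : Stage L B₁ B x) (hm : IsMove L B x y)
    : Stage L B₁ B y := by
  obtain ⟨h1, i, hi, h2⟩ := h
  refine ⟨fun b => ?_, ?_⟩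
  · by_cases hb : ∃ S ∈ y, b ∉ S
    · exact hb
    push Not at hb
    obtain ⟨r, S, a, hr, ha, haS, hal, rfl⟩ := hm
    obtain ⟨T, hT, hbT⟩ := h1 b
    obtain ⟨j, hj⟩ := getElem?_of_mem hT
    by_cases hba : b = lb L a
    · exfalso
      obtain ⟨T, hT, haT⟩ := exists_notMem_of_one_lt hr haS hal.2.1
      exact haT (hba ▸ hb T hT)
    · by_cases hjr : j = r
      · subst hjr
        obtain rfl := Option.some.inj (hr.symm.trans hj)
        refine ⟨insert (lb L a) S, radix_perm.mem_iff.2 ?_, by simp [hba, hbT]⟩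
        exact List.mem_set (getElem?_lt hr) _
      · refine ⟨T, radix_perm.mem_iff.2 ?_, hbT⟩
        refine mem_of_getElem? (i := j) ?_
        rw [List.getElem?_set_ne (fun h => hjr h.symm)]
        exact hj
  · obtain ⟨r, S, a, hr, ha, haS, hal, rfl⟩ := hm
    have hSx := mem_of_getElem? hr
    have hlab : ∀ b, (∃ T ∈ radix L L.length (x.set r (insert (lb L a) S)), b ∈ T) ↔ b = lb L a ∨ ∃ T ∈ x, b ∈ T := by
      intro b
      simp only [radix_perm.mem_iff]
      constructor
      · rintro ⟨T, hT, hb⟩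
        rcases List.mem_or_eq_of_mem_set hT with h | rfl
        · exact Or.inr ⟨T, h, hb⟩
        · rcases Finset.mem_insert.1 hb with h | h
          · exact Or.inl h
          · exact Or.inr ⟨S, hSx, h⟩
      · have hins := List.mem_set (getElem?_lt hr) (insert (lb L a) S)
        rintro (rfl | ⟨T, hT, hb⟩)
        · exact ⟨_, hins, Finset.mem_insert_self _ _⟩
        · obtain ⟨j, hj⟩ := getElem?_of_mem hT
          by_cases hjr : j = r
          · subst hjr
            obtain rfl := Option.some.inj (hr.symm.trans hj)
            exact ⟨_, hins, Finset.mem_insert_of_mem hb⟩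
          · refine ⟨T, mem_of_getElem? (i := j) ?_, hb⟩
            rw [List.getElem?_set_ne (fun h => hjr h.symm)]
            exact hj
    have hlow : ∀ b ∈ B, L.idxOf b < a → b ∈ B₁ ∪ initial L B i := by
      intro b hb hba
      have hbL : b ∈ L := by simpa using hB hb
      have := hal.2.2 (L.idxOf b) hba (by rw [lb_idxOf hbL]; exact hb)
      rw [Ne, notIn_eq_length, lb_idxOf hbL] at this
      push Not at this
      exact (h2 b).1 this
    have hidx := idxOf_lb hL ha
    by_cases hmem : lb L a ∈ B₁ ∪ initial L B i
    · refine ⟨i, hi, fun b => ?_⟩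
      rw [hlab, h2]
      constructor
      · rintro (rfl | h)
        · exact hmem
        · exact h
      · exact Or.inr
    · refine ⟨a + 1, ha, fun b => ?_⟩
      have hai : i ≤ a := by
        by_contra hcon
        exact hmem (Finset.mem_union_right _ (mem_filter.2 ⟨hal.1, by omega⟩))
      rw [hlab, h2]
      simp only [Finset.mem_union, initial, mem_filter] at hlow ⊢
      constructor
      · rintro (rfl | h | h)
        · exact Or.inr ⟨hal.1, by omega⟩
        · exact Or.inl h
        · exact Or.inr ⟨h.1, by omega⟩
      · rintro (h | ⟨h, h'⟩)
        · exact Or.inr (Or.inl h)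
        · rcases (Nat.lt_succ_iff.1 h').lt_or_eq with h'' | h''
          · exact Or.inr (hlow b h h'')
          · left
            have hbL : b ∈ L := by simpa using hB h
            rw [← h'', lb_idxOf hbL]

theorem Stage.of_reach (hL : L.Nodup) {B₁ : Finset ℕ} (hB : B ⊆ L.toFinset) (hX : ∀ x ∈ X, (∀ a, ∃ S ∈ x, a ∉ S) ∧ ∀ a,
    (∃ S ∈ x, a ∈ S) ↔ a ∈ B₁) (h : Reach L B X y) : Stage L B₁ B y := by
  obtain ⟨x, hx, h⟩ := h
  induction h with
  | refl => exact ⟨(hX x hx).1, 0, Nat.zero_le _, fun a => by simpa [initial] using (hX x hx).2 a⟩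
  | tail _ h ih => exact ih.of_isMove hL hB h

end

/-! ## The number of schemes -/

section
variable {B B₁ : Finset ℕ} {x y : Tuple}

/-- The set of the labels used by a list. -/
def used (y : Tuple) : Finset ℕ := y.toFinset.biUnion id

theorem mem_used {a : ℕ} : a ∈ used y ↔ ∃ S ∈ y, a ∈ S := by simp [used]

/-- The positions of the elements that contain a given label. -/
def column (c : ℕ) (y : Tuple) (a : ℕ) : Finset (Fin c) := Finset.univ.filter (fun r => a ∈ y.getD r ∅)

/-- A list is determined by its columns, that is, by the sets of positions that contain the
individual labels of `U`. A column is neither empty nor full, which leaves `2 ^ c - 2`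
possibilities. -/
theorem card_used_eq_le (Y : Finset (Tuple)) (U : Finset ℕ) (hY : ∀ y ∈ Y, Good L c y ∧ (∀ a, ∃ S ∈ y, a ∉ S) ∧ used y =
    U) : Y.card ≤ (2 ^ c - 2) ^ U.card := by
  rcases Nat.eq_zero_or_pos c with rfl | hc
  · have : Y = ∅ := by
      refine Finset.eq_empty_of_forall_notMem fun y hy => ?_
      obtain ⟨h1, h2, -⟩ := hY y hy
      obtain ⟨S, hS, -⟩ := h2 0
      rw [List.eq_nil_of_length_eq_zero h1.1] at hS
      simp at hS
    simp [this]
  have : Nonempty (Fin c) := ⟨⟨0, hc⟩⟩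
  have hcard : (Fintype.piFinset (fun _ : U => (Finset.univ.erase Finset.univ).erase (∅ : Finset (Fin c)))).card =
      (2 ^ c - 2) ^ U.card := by
    rw [Fintype.card_piFinset]
    simp only [Finset.prod_const, Finset.card_univ, Fintype.card_coe]
    rw [Finset.card_erase_of_mem, Finset.card_erase_of_mem (Finset.mem_univ _)]
    · simp; rfl
    · simp [Finset.univ_nonempty.ne_empty.symm]
  rw [← hcard]
  refine Finset.card_le_card_of_injOn (fun y (a : U) => column c y a) ?_ ?_
  · intro y hy
    obtain ⟨h1, h2, h3⟩ := hY y hy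
    refine Fintype.mem_piFinset.2 fun a => ?_
    rw [Finset.mem_erase, Finset.mem_erase]
    refine ⟨?_, ?_, Finset.mem_univ _⟩
    · have ha2 : (a : ℕ) ∈ used y := h3 ▸ a.2
      obtain ⟨S, hS, ha⟩ := mem_used.1 ha2
      obtain ⟨r, hr⟩ := getElem?_of_mem hS
      have hrc : r < c := h1.1 ▸ (getElem?_lt hr)
      refine Finset.ne_empty_of_mem (a := (⟨r, hrc⟩ : Fin c)) ?_
      simp [column, List.getD_eq_getElem?_getD, hr, ha]
    · obtain ⟨S, hS, ha⟩ := h2 a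
      obtain ⟨r, hr⟩ := getElem?_of_mem hS
      have hrc : r < c := h1.1 ▸ (getElem?_lt hr)
      intro h
      have := Finset.mem_univ (⟨r, hrc⟩ : Fin c)
      rw [← h] at this
      simp [column, List.getD_eq_getElem?_getD, hr, ha] at this
  · intro y hy y' hy' h
    obtain ⟨h1, -, h3⟩ := hY y hy
    obtain ⟨h1', -, h3'⟩ := hY y' hy'
    refine List.ext_getElem (h1.1.trans h1'.1.symm) fun r hr hr' => ?_
    ext a
    by_cases ha : a ∈ U
    · have := congrFun h ⟨a, ha⟩
      simp only at this
      have h5 : (⟨r, h1.1 ▸ hr⟩ : Fin c) ∈ column c y a ↔ (⟨r, h1.1 ▸ hr⟩ : Fin c) ∈ column c y' a := by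
        rw [this]
      simpa [column, hr, hr'] using h5
    · constructor
      · intro h; exact absurd (h3 ▸ mem_used.2 ⟨_, List.getElem_mem hr, h⟩) ha
      · intro h; exact absurd (h3' ▸ mem_used.2 ⟨_, List.getElem_mem hr', h⟩) ha

theorem sum_pow_le {q : ℕ} (hq : 2 ≤ q) (k : ℕ) : ∑ j ∈ Finset.range (k + 1), q ^ j ≤ 2 * q ^ k := by
  induction k with
  | zero => simp
  | succ k ih =>
    rw [Finset.sum_range_succ, pow_succ]
    have : q ^ k * 2 ≤ q ^ k * q := Nat.mul_le_mul_left _ hq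
    omega

/-- The possible label sets form a chain, hence have different cardinalities. The counts for the
single label sets then add up to a geometric sum, dominated by its last term because `2 ^ c - 2 ≥
2`. -/
theorem length_le_of_stage (hc : 2 ≤ c) (hB₁ : B₁ ⊆ L.toFinset) (hB : B ⊆ L.toFinset) {Y : List Tuple} (hY : Y.Nodup) (h
    : ∀ y ∈ Y, Good L c y ∧ Stage L B₁ B y) : Y.length ≤ 2 * (2 ^ c - 2) ^ L.length := by
  classical
  set 𝒰 := (Finset.range (L.length + 1)).image (fun i => B₁ ∪ initial L B i) with h𝒰
  have hmono : ∀ i j, i ≤ j → B₁ ∪ initial L B i ⊆ B₁ ∪ initial L B j := by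
    intro i j hij
    refine Finset.union_subset_union_right fun b hb => ?_
    rw [initial, mem_filter] at hb ⊢
    exact ⟨hb.1, hb.2.trans_le hij⟩
  have hinj : Set.InjOn Finset.card (𝒰 : Set (Finset ℕ)) := by
    intro U hU U' hU' he
    rw [h𝒰, Finset.coe_image] at hU hU'
    obtain ⟨i, -, rfl⟩ := hU
    obtain ⟨j, -, rfl⟩ := hU'
    rcases le_total i j with hij | hij
    · exact Finset.eq_of_subset_of_card_le (hmono i j hij) he.ge
    · exact (Finset.eq_of_subset_of_card_le (hmono j i hij) he.le).symm
  have hlt : ∀ U ∈ 𝒰, U.card ∈ Finset.range (L.length + 1) := by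
    intro U hU
    obtain ⟨i, -, rfl⟩ := Finset.mem_image.1 hU
    rw [Finset.mem_range, Nat.lt_succ_iff]
    refine (Finset.card_le_card (Finset.union_subset hB₁ ((Finset.filter_subset _ _).trans hB))).trans ?_
    exact List.toFinset_card_le L
  have hmaps : Set.MapsTo used (Y.toFinset : Set (Tuple)) (𝒰 : Set (Finset ℕ)) := by
    intro y hy
    obtain ⟨-, -, i, hi, h2⟩ := h y (by simpa using hy)
    rw [h𝒰, Finset.coe_image]
    refine ⟨i, by simpa using Nat.lt_succ_iff.2 hi, ?_⟩
    ext a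
    rw [mem_used, h2]
  have h2c : 2 ≤ 2 ^ c - 2 := by
    have : 2 ^ 2 ≤ 2 ^ c := Nat.pow_le_pow_right (by norm_num) hc
    omega
  calc Y.length = Y.toFinset.card := (List.toFinset_card_of_nodup hY).symm
    _ = ∑ U ∈ 𝒰, (Y.toFinset.filter (fun y => used y = U)).card := Finset.card_eq_sum_card_fiberwise hmaps
    _ ≤ ∑ U ∈ 𝒰, (2 ^ c - 2) ^ U.card := Finset.sum_le_sum fun U _ => by
        refine card_used_eq_le (L := L) _ U fun y hy => ?_
        rw [mem_filter, List.mem_toFinset] at hy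
        exact ⟨(h y hy.1).1, (h y hy.1).2.1, hy.2⟩
    _ = ∑ j ∈ 𝒰.image Finset.card, (2 ^ c - 2) ^ j := (Finset.sum_image hinj).symm
    _ ≤ ∑ j ∈ Finset.range (L.length + 1), (2 ^ c - 2) ^ j :=
        Finset.sum_le_sum_of_subset (Finset.image_subset_iff.2 hlt)
    _ ≤ _ := sum_pow_le h2c _

/-- A scheme with `c` elements is determined by the multiplicities of its nonempty sets, each at
most `c`; the multiplicity of the empty set follows. The exponent saved in this way is what
`bound_mul_le` needs. -/
theorem length_le_of_sorted (hL : L.Nodup) {Y : List Tuple} (hY : Y.Nodup) (h : ∀ y ∈ Y, Good L c y ∧ Sorted L y) :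
    Y.length ≤ (c + 1) ^ (2 ^ L.length - 1) := by
  classical
  have hcard : Fintype.card ((L.toFinset.powerset.erase ∅ : Finset (Finset ℕ)) → Fin (c + 1)) =
      (c + 1) ^ (2 ^ L.length - 1) := by
    rw [Fintype.card_fun, Fintype.card_fin, Fintype.card_coe, Finset.card_erase_of_mem (by simp),
      Finset.card_powerset, List.toFinset_card_of_nodup hL]
  rw [← hcard, ← Finset.card_univ, ← List.toFinset_card_of_nodup hY]
  refine Finset.card_le_card_of_injOn (fun y T => Fin.ofNat (c + 1) (y.count T.1)) (by simp) ?_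
  intro y hy y' hy' he
  obtain ⟨hg, hs⟩ := h y (by simpa using hy)
  obtain ⟨hg', hs'⟩ := h y' (by simpa using hy')
  refine eq_of_coe_eq hL hg hs hs' ?_
  have hcount : ∀ T ≠ ∅, y.count T = y'.count T := by
    intro T hT
    by_cases hTL : T ⊆ L.toFinset
    · have := congrFun he ⟨T, by simp [hT, hTL]⟩
      have h1 : y.count T < c + 1 := Nat.lt_succ_of_le (hg.1 ▸ List.count_le_length)
      have h2 : y'.count T < c + 1 := Nat.lt_succ_of_le (hg'.1 ▸ List.count_le_length)
      simpa [Fin.ext_iff, Fin.ofNat, Nat.mod_eq_of_lt h1, Nat.mod_eq_of_lt h2] using this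
    · rw [List.count_eq_zero.2 fun h => hTL (hg.2 T h), List.count_eq_zero.2 fun h => hTL (hg'.2 T h)]
  have hfilter : Multiset.filter (· ≠ ∅) (y : Scheme) = Multiset.filter (· ≠ ∅) (y' : Scheme) := by
    ext T
    rw [Multiset.count_filter, Multiset.count_filter]
    split_ifs with hT
    · rw [Multiset.coe_count, Multiset.coe_count, hcount T hT]
    · rfl
  -- A scheme is its nonempty part, padded with empty sets up to its cardinality.
  have key : ∀ s : Scheme, s = Multiset.filter (· ≠ ∅) s +
      Multiset.replicate (Multiset.card s - Multiset.card (Multiset.filter (· ≠ ∅) s)) ∅ := by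
    intro s
    have h1 := Multiset.filter_add_not (· ≠ ∅) s
    have h2 : Multiset.filter (fun a : Finset ℕ => ¬ a ≠ ∅) s =
        Multiset.replicate (Multiset.card (Multiset.filter (fun a : Finset ℕ => ¬ a ≠ ∅) s)) ∅ := by
      refine Multiset.eq_replicate_card.2 fun b hb => ?_
      simpa using (Multiset.mem_filter.1 hb).2
    have h3 := congrArg Multiset.card h1
    rw [Multiset.card_add] at h3
    conv_lhs => rw [← h1, h2]
    congr 2
    omega
  rw [key (y : Scheme), key (y' : Scheme), hfilter, Multiset.coe_card, Multiset.coe_card, hg.1, hg'.1]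

/-- A bound for the number of schemes that occur at a time. -/
def bound (k c : ℕ) : ℕ := min ((c + 1) ^ (2 ^ k - 1)) (2 * (2 ^ c - 2) ^ k)

theorem length_le_bound (hL : L.Nodup) (hc : 2 ≤ c) (hB₁ : B₁ ⊆ L.toFinset) (hB : B ⊆ L.toFinset) {Y : List (List
    (Finset ℕ))} (hY : Y.Nodup) (h : ∀ y ∈ Y, Good L c y ∧ Sorted L y ∧ Stage L B₁ B y) : Y.length ≤ bound L.length c :=
  le_min (length_le_of_sorted hL hY fun y hy => ⟨(h y hy).1, (h y hy).2.1⟩)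
    (length_le_of_stage hc hB₁ hB hY fun y hy => ⟨(h y hy).1, (h y hy).2.2⟩)

end

/-! ### Comparison of the two counts of schemes -/

theorem succ_sq_le (hc : 3 ≤ c) : (c + 1) ^ 2 ≤ 8 * 2 ^ (c - 1) := by
  induction c, hc using Nat.le_induction with
  | base => norm_num
  | succ c hc ih =>
    obtain ⟨d, rfl⟩ : ∃ d, c = d + 1 := ⟨c - 1, by omega⟩
    simp only [Nat.add_sub_cancel] at ih ⊢
    rw [pow_succ 2 d]
    nlinarith

/-- Let `n = 2 ^ k` and `c = n + 1 + d`. Then `(c + 1) ^ n = n ^ n * (1 + (d + 2) / n) ^ n ≤ n ^ n *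
exp (d + 2)`. As `exp 2 ≤ 8` and `exp 1 ≤ 4 ≤ 2 ^ k` for `k ≥ 2`, this is at most `8 * (2 ^ k) ^ (n
+ d) = 8 * (2 ^ (c - 1)) ^ k`, and `2 ^ (c - 1) ≤ 2 ^ c - 2`. The case `k = 1`, where `4 ≤ 2 ^ k`
fails, is `succ_sq_le`. -/
theorem succ_pow_le {k c : ℕ} (hk : 1 ≤ k) (hc : 2 ^ k < c) : (c + 1) ^ 2 ^ k ≤ 8 * (2 ^ c - 2) ^ k := by
  have h1 : (c + 1) ^ 2 ^ k ≤ 8 * (2 ^ (c - 1)) ^ k := by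
    rcases hk.eq_or_lt with rfl | hk
    · simpa using succ_sq_le (c := c) (by omega)
    obtain ⟨d, rfl⟩ : ∃ d, c = 2 ^ k + 1 + d := ⟨c - (2 ^ k + 1), by omega⟩
    set n := 2 ^ k with hn
    have hn0 : (0 : ℝ) < n := by rw [hn]; positivity
    have e1 : ((n + 1 + d + 1 : ℕ) : ℝ) = n * (1 + (d + 2) / n) := by
      push_cast; field_simp; ring
    have e2 : (1 + ((d : ℝ) + 2) / n) ^ n ≤ Real.exp (d + 2) := by
      calc (1 + ((d : ℝ) + 2) / n) ^ n ≤ (Real.exp (((d : ℝ) + 2) / n)) ^ n := by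
            refine pow_le_pow_left₀ (by positivity) ?_ n
            rw [add_comm]; exact Real.add_one_le_exp _
        _ = Real.exp (d + 2) := by
            rw [← Real.exp_nat_mul]; congr 1; field_simp
    have hexp := Real.exp_one_lt_d9
    have e3 : Real.exp (d + 2) ≤ 8 * 4 ^ d := by
      have h2 : Real.exp (d + 2) = Real.exp 1 ^ d * (Real.exp 1) ^ 2 := by
        rw [← Real.exp_nat_mul, ← Real.exp_nat_mul, ← Real.exp_add]; congr 1; push_cast; ring
      have h3 : Real.exp 1 ^ d ≤ 4 ^ d := pow_le_pow_left₀ (Real.exp_pos 1).le (by linarith) d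
      have h4 : Real.exp 1 ^ 2 ≤ 8 := by nlinarith [Real.exp_pos 1]
      rw [h2, mul_comm (8 : ℝ)]
      exact mul_le_mul h3 h4 (by positivity) (by positivity)
    have e4 : (4 : ℝ) ^ d ≤ (2 ^ k) ^ d := by
      refine pow_le_pow_left₀ (by norm_num) ?_ d
      calc (4 : ℝ) = 2 ^ 2 := by norm_num
        _ ≤ 2 ^ k := pow_le_pow_right₀ (by norm_num) hk
    have : (((n + 1 + d + 1 : ℕ) : ℝ)) ^ n ≤ 8 * (2 ^ (n + 1 + d - 1)) ^ k := by
      rw [e1, mul_pow, Nat.add_right_comm n 1 d, Nat.add_sub_cancel, pow_add, mul_pow, ← pow_mul 2 n k,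
        mul_comm n k, pow_mul, ← pow_mul 2 d k, mul_comm d k, pow_mul 2 k d]
      have e5 : (n : ℝ) = 2 ^ k := by rw [hn]; push_cast; rfl
      rw [e5] at e2 ⊢
      calc ((2 : ℝ) ^ k) ^ n * (1 + ((d : ℝ) + 2) / 2 ^ k) ^ n ≤ (2 ^ k) ^ n * (8 * (2 ^ k) ^ d) :=
            mul_le_mul_of_nonneg_left (e2.trans (e3.trans (by linarith))) (by positivity)
        _ = _ := by ring
    exact_mod_cast this
  refine h1.trans (Nat.mul_le_mul_left _ (Nat.pow_le_pow_left ?_ k))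
  obtain ⟨d, rfl⟩ : ∃ d, c = d + 2 := ⟨c - 2, by have := Nat.one_lt_two_pow (n := k) (by omega); omega⟩
  have : 1 ≤ 2 ^ d := Nat.one_le_two_pow
  rw [show d + 2 - 1 = d + 1 by omega, pow_succ, pow_succ 2 (d + 1), pow_succ]
  omega

/-- If `c ≤ 2 ^ k`, then `c` is itself the allowed factor. Otherwise `(c + 1) ^ (2 ^ k - 1) * c ≤ (c
+ 1) ^ 2 ^ k`, which by `succ_pow_le` is within a factor 8 of both terms of the minimum. -/
theorem bound_mul_le {k c : ℕ} (hk : 1 ≤ k) : bound k c * c ≤ 8 * (min ((c + 1) ^ 2 ^ k) ((2 ^ c - 2) ^ k) * min c (2 ^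
    k)) := by
  rcases le_or_gt c (2 ^ k) with h | h
  · rw [min_eq_left h, ← mul_assoc]
    refine Nat.mul_le_mul_right _ ?_
    have h1 : (c + 1) ^ (2 ^ k - 1) ≤ (c + 1) ^ 2 ^ k := Nat.pow_le_pow_right (by omega) (by omega)
    rw [bound]
    have := min_le_min h1 (le_refl (2 * (2 ^ c - 2) ^ k))
    omega
  · rw [min_eq_right h.le]
    have h1 : bound k c * c ≤ (c + 1) ^ 2 ^ k := by
      obtain ⟨d, hd⟩ : ∃ d, 2 ^ k = d + 1 := ⟨2 ^ k - 1, by have := Nat.two_pow_pos k; omega⟩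
      rw [bound, hd, Nat.add_sub_cancel, pow_succ]
      exact Nat.mul_le_mul (min_le_left _ _) (by omega)
    have h2 := succ_pow_le hk h
    have h3 : (c + 1) ^ 2 ^ k ≤ 8 * min ((c + 1) ^ 2 ^ k) ((2 ^ c - 2) ^ k) := by omega
    have := Nat.two_pow_pos k
    calc _ ≤ 8 * min ((c + 1) ^ 2 ^ k) ((2 ^ c - 2) ^ k) * 1 := by omega
      _ ≤ 8 * min ((c + 1) ^ 2 ^ k) ((2 ^ c - 2) ^ k) * 2 ^ k := Nat.mul_le_mul_left _ this
      _ = _ := by ring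

/-! ## Operations on sets of schemes -/

theorem Frame.run {p : Prog} (h : p.flat = true) (σ : State) : Frame p σ (p.run σ) := by
  obtain ⟨T, h1, -⟩ := p.exec_run h σ
  exact h1.frame

/-- The list `X` represents the set `𝒮` of schemes. -/
structure Rep (L : List ℕ) (c : ℕ) (𝒮 : Set Scheme) (X : List Tuple) : Prop where
  good : ∀ x ∈ X, Good L c x
  sorted : ∀ x ∈ X, Sorted L x
  nodup : X.Nodup
  mem : ∀ s : Scheme, s ∈ 𝒮 ↔ ∃ x ∈ X, (x : Scheme) = s

/-- Insert elements that depend on the schemes between the positions in the registers `43` and `44`. -/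
def buildP (p : Prog) : Prog := Prog.loop (lt (reg 43) (reg 44))
  (assign 31 (reg 43) ;; loadP ;; assign 48 (reg 31) ;; p ;; assign 43 (reg 48))

/-- One loop rule for relabelling and selection: `R x y` says that `y` is inserted on account of
`x`. The extra invariant `J` on the dictionary is for the selection, which uses a second trie. -/
theorem buildP_spec {p : Prog} (h44 : p.wr 44 = false) (h48 : p.wr 48 = false) (hsafe : p.safe = true) (hE : Env L c σ)
    (hX : ∀ x ∈ X, Good L c x) {a : ℕ} (h43 : σ.reg 43 = a) (hm : At (σ.arr aMEM) a (enc L X)) (he : σ.reg 44 = a +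
    X.length * c) (hle : σ.reg 44 ≤ σ.reg rE) (hpos : 0 < c) {s : ℕ} {Y : List Tuple} (hb : Building L c root s Y D σ)
    (R : Tuple → Tuple → Prop) (J : ℕ → Set (ℕ × List Bool) → Prop) (hJ : J 0 D) (T : ℕ) (hp : ∀ i < X.length, ∀ x,
    X[i]? = some x → ∀ τ, Frame (buildP p) σ τ → Env L c τ → At (τ.arr aBUF) 0 (x.map (code L)) → τ.reg 43 = a + i * c →
    At (τ.arr aMEM) (a + i * c) (x.map (code L)) → ∀ Y' D', Building L c root s Y' D' τ → J i D' → Spec p τ T (fun ρ =>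
    ∃ Y'' D'', Building L c root s Y'' D'' ρ ∧ (∀ y, y ∈ Y'' ↔ y ∈ Y' ∨ R x y) ∧ MemLe τ ρ ∧ J (i + 1) D'')) : Spec
    (buildP p) σ (X.length * (c * 13 + T + 14) + 3) (fun τ => ∃ Y' D', Building L c root s Y' D' τ ∧ (∀ y, y ∈ Y' ↔ y ∈
    Y ∨ ∃ x ∈ X, R x y) ∧ MemLe σ τ ∧ J X.length D') := by
  have hs : (buildP p).safe = true := by
    simp only [Prog.safe, buildP, loadP, forLoop, inc, Prog.wr, Prog.wa, Bool.and_eq_true, Bool.not_eq_true'] at hsafe ⊢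
    simp [hsafe]
    decide
  refine Spec.le (T := X.length * (2 + ((c * 13 + 5) + (2 + (T + 2))) + 3) + 3) ?_
    (Nat.add_le_add_right (Nat.mul_le_mul_left _ (by omega)) _)
  refine (Spec.rows (fun i τ => ∃ Y' D', Building L c root s Y' D' τ ∧
    (∀ y, y ∈ Y' ↔ y ∈ Y ∨ ∃ x ∈ X.take i, R x y) ∧ MemLe σ τ ∧ J i D') _ X.length c a ?_ hpos he h43 ?_ ?_).mono ?_
  · simp [loadP, forLoop, inc, Prog.wr, h44]
    decide
  · exact ⟨Y, D, hb, by simp, MemLe.refl σ, hJ⟩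
  · rintro i hi τ hf hpτ ⟨Y', D', g1, g2, g3, g4⟩
    have hEτ := hE.frame hf hs
    obtain ⟨x, hx⟩ := exists_getElem? (l := X) hi
    have hxg := hX x (mem_of_getElem? hx)
    refine Spec.blockseq 2 ?_
    set τ1 := (assign 31 (reg 43)).run τ with hτ1
    have hE1 : Env L c τ1 := hEτ.congr
    have h31 : τ1.reg 31 = a + i * c := by simpa [hτ1, run] using hpτ
    have hmx : At (τ.arr aMEM) (a + i * c) (x.map (code L)) := by
      refine At.enc_get hX ?_ hx
      exact g3.at hm (by rw [length_enc hX]; omega)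
    refine Spec.seqf (loadP_spec hE1 (w := x.map (code L)) (by simpa using hxg.1) (h31 ▸ hmx)) ?_
    rintro τ2 hf2 ⟨hbuf, h31'⟩
    have hE2 := hE1.frame hf2 rfl
    refine Spec.blockseq 2 ?_
    set τ3 := (assign 48 (reg 31)).run τ2 with hτ3
    have hE3 : Env L c τ3 := hE2.congr
    have g1' : Building L c root s Y' D' τ1 := g1.congr
    have g1'' : Building L c root s Y' D' τ3 := (g1'.frame hf2 rfl).congr
    have hfr : Frame (buildP p) σ τ3 := by
      have e1 : Frame (buildP p) τ τ1 := (Frame.run (p := assign 31 (reg 43)) rfl τ).mono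
        (by simp +contextual [buildP, Prog.wr]) (by simp [Prog.wa]) (by simp [Prog.wo])
      have e2 : Frame (buildP p) τ1 τ2 := hf2.mono
        (by simp +contextual [buildP, Prog.wr]) (by simp +contextual [buildP, Prog.wa])
        (by simp +contextual [buildP, Prog.wo])
      have e3 : Frame (buildP p) τ2 τ3 := (Frame.run (p := assign 48 (reg 31)) rfl τ2).mono
        (by simp +contextual [buildP, Prog.wr]) (by simp [Prog.wa]) (by simp [Prog.wo])
      exact Frame.trans hf (e1.trans (e2.trans e3))
    have h48v : τ3.reg 48 = a + (i + 1) * c := by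
      simp only [hτ3, run, eval, State.setR_reg, if_true, h31', h31]; ring
    have h43v : τ3.reg 43 = a + i * c := (hf2.reg 43 rfl) ▸ hpτ
    have hmem3 : τ3.arr aMEM = τ.arr aMEM := hf2.arr aMEM rfl
    have hrE3 : τ3.reg rE = τ.reg rE := hf2.reg rE rfl
    refine Spec.seqf (hp i hi x hx τ3 hfr hE3 hbuf h43v (hmem3 ▸ hmx) Y' D' g1'' g4) ?_
    rintro τ4 hf4 ⟨Y'', D'', k1, k2, k3, k4⟩
    refine Spec.block 2 ⟨?_, Y'', D'', k1.congr, ?_, ?_, k4⟩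
    · simp only [run, eval, State.setR_reg, if_true]
      rw [hf4.reg 48 h48, h48v]
    · intro y
      rw [k2, g2, take_add_one, hx]
      simp only [Option.toList_some, List.mem_append, List.mem_singleton, or_and_right, exists_or,
        exists_eq_left, or_assoc]
    · have : MemLe τ τ4 := ⟨by rw [← hrE3]; exact k3.1, fun i hi => by
        rw [k3.2 i (hrE3 ▸ hi), hmem3]⟩
      have := g3.trans this
      exact ⟨this.1, this.2⟩
  · rintro τ - ⟨-, Y', D', g1, g2, g3, g4⟩
    rw [List.take_length] at g2
    exact ⟨Y', D', g1, g2, g3, g4⟩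

/-- Replace the numbers in `BUF`, one by one. -/
def mapP (p : Prog) : Prog := forLoop 35 rC (assign 36 (get aBUF (reg 35)) ;; p ;; store aBUF (reg 35) (reg 36))

theorem mapP_spec {p : Prog} (h0 : p.wr rC = false) (h35 : p.wr 35 = false) (hbuf : p.wa aBUF = false) (hc : σ.reg rC =
    c) (hx : Good L c x) (hB : At (σ.arr aBUF) 0 (x.map (code L))) (g : Finset ℕ → Finset ℕ) (T : ℕ) (hp : ∀ S ⊆
    L.toFinset, ∀ τ, Frame (mapP p) σ τ → τ.reg 36 = code L S → Spec p τ T (fun ρ => ρ.reg 36 = code L (g S))) : Spec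
    (mapP p) σ (c * (T + 12) + 5) (fun τ => At (τ.arr aBUF) 0 ((x.map g).map (code L))) := by
  refine Spec.le (T := c * ((3 + (T + 3)) + 6) + 5) ?_ (Nat.add_le_add_right (Nat.mul_le_mul_left _ (by omega)) _)
  refine (Spec.for (3 + (T + 3)) c (fun i τ => At (τ.arr aBUF) 0 (((x.take i).map g ++ x.drop i).map (code L)))
    hc (by simpa using hB) ?_ rfl (by simp [Prog.wr, h0]; decide) (by simp [Prog.wr, h35]; decide)).mono ?_
  · intro i hi τ hf hri h
    obtain ⟨S, hS, hSL⟩ := hx.getElem? hi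
    refine Spec.blockseq 3 ?_
    set τ1 := (assign 36 (get aBUF (reg 35))).run τ with hτ1
    have hlen : i < x.length := hx.1 ▸ hi
    have hdrop : x.drop i = S :: x.drop (i + 1) := by
      rw [List.drop_eq_getElem_cons hlen]
      rw [getElem?_eq_getElem hlen] at hS
      rw [Option.some.inj hS]
    have hb : τ.arr aBUF i = code L S := by
      have := h i (code L S) (by
        rw [hdrop, List.getElem?_map, getElem?_append_right (by simp)]
        simp [min_eq_left hlen.le])
      simpa using this
    have h36 : τ1.reg 36 = code L S := by simp [hτ1, run, hri, hb]
    have hfr : Frame (mapP p) σ τ1 := by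
      have e1 : Frame (mapP p) τ τ1 := (Frame.run (p := assign 36 (get aBUF (reg 35))) rfl τ).mono
        (by simp +contextual [mapP, forLoop, Prog.wr]) (by simp [Prog.wa]) (by simp [Prog.wo])
      exact Frame.trans hf e1
    refine Spec.seqf (hp S hSL τ1 hfr h36) ?_
    intro ρ hfρ h36'
    refine Spec.block 3 ?_
    have h35' : ρ.reg 35 = i := by
      rw [hfρ.reg 35 h35]; simpa [hτ1, run] using hri
    have hbρ : At (ρ.arr aBUF) 0 (((x.take i).map g ++ x.drop i).map (code L)) := by
      rw [hfρ.arr aBUF hbuf]; exact h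
    have := hbρ.set (i := i) (v := code L (g S))
    have hl : (((x.take i).map g ++ x.drop i).map (code L)).set i (code L (g S)) =
        ((x.take (i + 1)).map g ++ x.drop (i + 1)).map (code L) := by
      rw [hdrop, take_add_one, hS, List.map_append, List.set_append_right _ _ (by simp [min_eq_left hlen.le])]
      simp [min_eq_left hlen.le]
    rw [hl] at this
    simpa [run, h35', h36'] using this
  · rintro τ - ⟨-, h⟩
    rwa [take_of_length_le hx.1.le, List.drop_of_length_le hx.1.le, List.append_nil] at h

notation "aBU" => (16 : ℕ)
notation "aPD" => (17 : ℕ)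

/-- Intersect the set with the number in register `36` with the set in `BU`. -/
def restrictP : Prog := forLoop 37 rK (Prog.cond (eq (get aBU (reg 37)) (lit 0))
    (Prog.cond (eq (get aODD (reg 36)) (lit 1)) (assign 36 (pred (reg 36))) skip) skip ;;
   assign 36 (get aROT (reg 36)))

theorem restrictP_spec (hL : L.Nodup) (hE : Env L c σ) {U S : Finset ℕ} (hU : HasBits L U (σ.arr aBU)) (hS : S ⊆
    L.toFinset) (h36 : σ.reg 36 = code L S) : Spec restrictP σ (L.length * 20 + 5) (fun τ => τ.reg 36 = code L (S.filter
    (· ∈ U))) := by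
  refine (Spec.for 14 L.length (fun j τ => τ.reg 36 = rcode L j (S.filter (fun a => L.idxOf a < j → a ∈ U)))
    hE.rk ?_ ?_).mono ?_
  · simpa [code] using h36
  · intro j hj τ hf hrj h
    have hEτ := hE.frame hf rfl
    have hBj : τ.arr aBU j = if lb L j ∈ U then 1 else 0 := hf.arr aBU rfl ▸ hU j hj
    set S1 := S.filter (fun a => L.idxOf a < j → a ∈ U) with hS1
    set S2 := S.filter (fun a => L.idxOf a < j + 1 → a ∈ U) with hS2
    have hS1L : S1 ⊆ L.toFinset := (Finset.filter_subset _ _).trans hS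
    have hS2L : S2 ⊆ L.toFinset := (Finset.filter_subset _ _).trans hS
    have hodd := hEτ.odd_rcode hL hS1L hj
    have hrot1 := hEτ.rot_rcode hL hS1L hj
    have hrot2 := hEτ.rot_rcode hL hS2L hj
    have hidx := idxOf_lb hL hj
    have hrel : S2 = if lb L j ∈ U then S1 else S1.erase (lb L j) := by
      ext a
      by_cases haj : a = lb L j
      · subst haj
        split_ifs with h <;> simp [hS1, hS2, hidx, h]
      · have : a ∈ S → (L.idxOf a ≤ j ↔ L.idxOf a < j) := by
          intro ha
          have haL : a ∈ L := by simpa using hS ha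
          have : L.idxOf a ≠ j := fun h => haj (by rw [← h, lb_idxOf haL])
          omega
        split_ifs with h <;> simp [hS1, hS2, haj] <;> intro ha <;> rw [this ha]
    refine Spec.block 14 ?_
    by_cases hU' : lb L j ∈ U
    · rw [if_pos hU'] at hBj hrel
      rw [hrel]
      simp [run, hrj, hBj, h, hrot1]
    · rw [if_neg hU'] at hBj hrel
      by_cases hm : lb L j ∈ S1
      · rw [if_pos hm] at hodd
        have := rcode_erase hL hj hm
        rw [← hrel] at this
        have h2 : rcode L j S1 - 1 = rcode L j S2 := by omega
        simp [run, hrj, hBj, h, hodd, h2, hrot2]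
      · rw [if_neg hm] at hodd
        rw [Finset.erase_eq_of_notMem hm] at hrel
        rw [hrel]
        simp [run, hrj, hBj, h, hodd, hrot1]
  · rintro τ - ⟨-, h⟩
    rw [h, rcode_length]
    congr 1
    refine Finset.filter_congr fun a ha => ?_
    have haL : a ∈ L := by simpa using hS ha
    simp [idxOf_lt_length_iff.2 haL]

/-- Change the bit at the position in register `38` of the number in register `36`: remove it, and
record in register `40` whether it was present. -/
def takeP : Prog := assign 40 (lit 0) ;; forLoop 37 rK
  (Prog.cond (eq (reg 37) (reg 38)) (Prog.cond (eq (get aODD (reg 36)) (lit 1))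
    (assign 40 (lit 1) ;; assign 36 (pred (reg 36))) skip) skip ;;
   assign 36 (get aROT (reg 36)))

/-- If register `40` is `1`, add the bit at the position in register `39` to the number in register `36`. -/
def putP : Prog := forLoop 37 rK (Prog.cond (eq (reg 37) (reg 39)) (Prog.cond (eq (get aODD (reg 36)) (lit 0))
    (Prog.cond (eq (reg 40) (lit 1)) (assign 36 (succ (reg 36))) skip) skip) skip ;;
   assign 36 (get aROT (reg 36)))

theorem takeP_spec (hL : L.Nodup) (hE : Env L c σ) (hS : S ⊆ L.toFinset) (h36 : σ.reg 36 = code L S) {a : ℕ} (ha : a <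
    L.length) (h38 : σ.reg 38 = a) : Spec takeP σ (L.length * 24 + 7) (fun τ => τ.reg 36 = code L (S.erase (lb L a)) ∧
    τ.reg 40 = if lb L a ∈ S then 1 else 0) := by
  refine Spec.le (T := 2 + (L.length * (18 + 6) + 5)) ?_ (by omega)
  refine Spec.blockseq 2 ?_
  set σ1 := (assign 40 (lit 0)).run σ with hσ1
  have hE1 : Env L c σ1 := hE.congr
  refine (Spec.for 18 L.length (fun j τ => τ.reg 36 = rcode L j (if a < j then S.erase (lb L a) else S) ∧
    τ.reg 40 = if a < j ∧ lb L a ∈ S then 1 else 0)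
    hE1.rk ?_ ?_).mono ?_
  · simpa [hσ1, run, code] using h36
  · rintro j hj τ hf hrj ⟨h1, h2⟩
    have hEτ := hE1.frame hf rfl
    have h38' : τ.reg 38 = a := (hf.reg _ rfl).trans h38
    have hSL : ∀ j, (if a < j then S.erase (lb L a) else S) ⊆ L.toFinset := fun j => by
      split_ifs
      · exact (Finset.erase_subset _ _).trans hS
      · exact hS
    have hodd := hEτ.odd_rcode hL (hSL j) hj
    have hrot1 := hEτ.rot_rcode hL (hSL j) hj
    have hrot2 := hEτ.rot_rcode hL (hSL (j + 1)) hj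
    refine Spec.block 18 ?_
    by_cases hja : j = a
    · subst hja
      simp only [lt_irrefl, if_false, Nat.lt_succ_self, if_true, false_and, true_and] at h1 h2 hodd hrot1 hrot2 ⊢
      by_cases hm : lb L j ∈ S
      · rw [if_pos hm] at hodd
        have h3 : rcode L j S - 1 = rcode L j (S.erase (lb L j)) := by
          have := rcode_erase hL hj hm
          omega
        simp [run, hrj, h38', h1, hodd, h3, hrot2, hm]
      · rw [if_neg hm] at hodd
        rw [Finset.erase_eq_of_notMem hm] at hrot2 ⊢
        simp [run, hrj, h38', h1, hodd, hrot2, hm, h2]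
    · have : (a < j + 1) ↔ a < j := by omega
      simp only [this]
      simp [run, hrj, h38', hja, h1, h2, hrot1]
  · rintro τ - ⟨-, h1, h2⟩
    rw [rcode_length] at h1
    simpa [ha] using And.intro h1 h2

theorem putP_spec (hL : L.Nodup) (hE : Env L c σ) (hS : S ⊆ L.toFinset) (h36 : σ.reg 36 = code L S) {b : ℕ} (hb : b <
    L.length) (h39 : σ.reg 39 = b) {P : Prop} [Decidable P] (h40 : σ.reg 40 = if P then 1 else 0) : Spec putP σ
    (L.length * 24 + 5) (fun τ => τ.reg 36 = code L (if P then insert (lb L b) S else S)) := by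
  refine (Spec.for 18 L.length (fun j τ => τ.reg 36 = rcode L j (if b < j ∧ P then insert (lb L b) S else S))
    hE.rk ?_ ?_).mono ?_
  · simpa [code] using h36
  · rintro j hj τ hf hrj h1
    have hEτ := hE.frame hf rfl
    have h39' : τ.reg 39 = b := (hf.reg _ rfl).trans h39
    have h40' : τ.reg 40 = if P then 1 else 0 := (hf.reg _ rfl).trans h40
    have hSL : ∀ j, (if b < j ∧ P then insert (lb L b) S else S) ⊆ L.toFinset := fun j => by
      split_ifs
      · exact insert_lb_subset hS hb
      · exact hS
    have hodd := hEτ.odd_rcode hL (hSL j) hj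
    have hrot1 := hEτ.rot_rcode hL (hSL j) hj
    have hrot2 := hEτ.rot_rcode hL (hSL (j + 1)) hj
    refine Spec.block 18 ?_
    by_cases hja : j = b
    · subst hja
      simp only [lt_irrefl, if_false, Nat.lt_succ_self, if_true, false_and, true_and] at h1 hodd hrot1 hrot2 ⊢
      by_cases hP : P
      · simp only [hP, if_true] at h40' hrot2 ⊢
        by_cases hm : lb L j ∈ S
        · rw [if_pos hm] at hodd
          rw [Finset.insert_eq_of_mem hm] at hrot2 ⊢
          simp [run, hrj, h39', h1, hodd, hrot2]
        · rw [if_neg hm] at hodd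
          have h3 := rcode_insert hL hj hm
          rw [h3] at hrot2
          simp [run, hrj, h39', h1, hodd, h40', hrot2]
      · simp only [hP, if_false] at h40' hrot2 ⊢
        simp [run, hrj, h39', h1, h40', hrot2]
    · have : (b < j + 1) ↔ b < j := by omega
      simp only [this]
      simp [run, hrj, h39', hja, h1, hrot1]
  · rintro τ - ⟨-, h1⟩
    rw [rcode_length] at h1
    simpa [hb] using h1

theorem image_relabel {a b : ℕ} : S.image (relabel a b) = if a ∈ S then insert b (S.erase a) else S := by
  ext z
  split_ifs with h
  · simp only [Finset.mem_image, relabel, Finset.mem_insert, Finset.mem_erase]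
    constructor
    · rintro ⟨y, hy, rfl⟩
      split_ifs with h1
      · exact Or.inl rfl
      · exact Or.inr ⟨h1, hy⟩
    · rintro (rfl | ⟨h1, h2⟩)
      · exact ⟨a, h, by simp⟩
      · exact ⟨z, h2, by simp [h1]⟩
  · simp only [Finset.mem_image, relabel]
    constructor
    · rintro ⟨y, hy, rfl⟩
      rw [if_neg (by rintro rfl; exact h hy)]
      exact hy
    · intro hz
      exact ⟨z, hz, if_neg (by rintro rfl; exact h hz)⟩

/-- By `image_relabel`, relabelling a set is a removal followed by a conditional insertion. In this
order `a = b` needs no special treatment. -/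
theorem relabelP_spec (hL : L.Nodup) (hE : Env L c σ) (hS : S ⊆ L.toFinset) (h36 : σ.reg 36 = code L S) {a b : ℕ} (ha :
    a < L.length) (h38 : σ.reg 38 = a) (hb : b < L.length) (h39 : σ.reg 39 = b) : Spec (takeP ;; putP) σ (L.length * 48
    + 12) (fun τ => τ.reg 36 = code L (S.image (relabel (lb L a) (lb L b)))) := by
  refine Spec.le (T := (L.length * 24 + 7) + (L.length * 24 + 5)) ?_ (by omega)
  refine Spec.seqf (takeP_spec hL hE hS h36 ha h38) ?_
  rintro τ hf ⟨h1, h2⟩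
  refine (putP_spec hL (hE.frame hf rfl) ((Finset.erase_subset _ _).trans hS) h1 hb ((hf.reg _ rfl).trans h39)
    h2).mono ?_
  intro ρ _ h
  rw [h, image_relabel]
  congr 1
  split_ifs with h3
  · rfl
  · exact Finset.erase_eq_of_notMem h3

/-- A representation of the set `𝒮` of schemes is stored between the positions `s` and `e`. -/
def Stored (L : List ℕ) (c : ℕ) (𝒮 : Set Scheme) (s e : ℕ) (σ : State) : Prop :=
  ∃ X, Rep L c 𝒮 X ∧ At (σ.arr aMEM) s (enc L X) ∧ e = s + X.length * c ∧ e ≤ σ.reg rE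

theorem Stored.of_memLe {s e : ℕ} (h : Stored L c 𝒮 s e σ) (hm : MemLe σ τ) : Stored L c 𝒮 s e τ := by
  obtain ⟨X, h1, h2, h3, h4⟩ := h
  exact ⟨X, h1, hm.at h2 (by rw [length_enc h1.good]; omega), h3, h4.trans hm.1⟩

/-- The arrays and registers of the dictionary are consistent. -/
def HasTrie (σ : State) : Prop := ∃ D path, Trie path (σ.arr aCH) (σ.reg rT) D

theorem Building.hasTrie {s : ℕ} (h : Building L c root s X D σ) : HasTrie σ := ⟨D, h.trie⟩

theorem HasTrie.congr (h : HasTrie σ) (h1 : τ.arr aCH = σ.arr aCH := by rfl)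
    (h2 : τ.reg rT = σ.reg rT := by rfl) : HasTrie τ := by rw [HasTrie, h1, h2]; exact h

theorem HasTrie.frame (h : HasTrie σ) {p : Prog} (hf : Frame p σ τ) (hp : p.calm = true) : HasTrie τ := by
  simp only [Prog.calm, Bool.and_eq_true, Bool.not_eq_true'] at hp
  obtain ⟨⟨⟨h1, h2⟩, h3⟩, h4⟩ := hp
  exact h.congr (hf.arr _ h4) (hf.reg _ h2)

theorem Building.stored {s : ℕ} (h : Building L c root s X D σ) (hs : ∀ x ∈ X, Sorted L x) (hmem : ∀ s : Scheme, s ∈ 𝒮 ↔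
    ∃ x ∈ X, (x : Scheme) = s) : Stored L c 𝒮 s (σ.reg rE) σ :=
  ⟨X, ⟨h.good, hs, h.nodup, hmem⟩, h.mem, by rw [h.last, length_enc h.good], le_rfl⟩

theorem code_empty : code L ∅ = 0 := by simp [code, rcode]

/-- Store the schemes of a vertex with the label at the position in register `38`, which is a boundary
label if register `40` is `1`. -/
def vertexP : Prog := assign 46 (reg rE) ;; newP ;; forLoop 35 rC (store aBUF (reg 35) (lit 0)) ;;
  Prog.cond (eq (reg 40) (lit 1)) (assign 39 (reg 38) ;; assign 36 (lit 0) ;; putP ;;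
    store aBUF (lit 0) (reg 36)) skip ;;
  insP

open Classical in
theorem vertexP_spec (hL : L.Nodup) (hE : Env L c σ) (hpos : 0 < c) (ht : HasTrie σ) {a : ℕ} (ha : a < L.length) (h38 :
    σ.reg 38 = a) {P : Prop} (h40 : σ.reg 40 = if P then 1 else 0) : Spec vertexP σ (300 * (c * L.length)) (fun τ =>
    Stored L c {(if P then {lb L a} else ∅) ::ₘ Multiset.replicate (c - 1) ∅} (τ.reg 46) (τ.reg rE) τ ∧ HasTrie τ ∧
    MemLe σ τ) := by
  have hkpos : 0 < L.length := by omega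
  obtain ⟨h1, h2, h3⟩ := le_mul_and hpos hkpos
  refine Spec.le (T := 2 + (6 + ((c * (3 + 6) + 5) + ((3 + max (2 + (2 + ((L.length * 24 + 5) + 3))) 1) +
    200 * (c * L.length))))) ?_ (by omega)
  refine Spec.blockseq 2 ?_
  set σ1 := (assign 46 (reg rE)).run σ with hσ1
  have hE1 : Env L c σ1 := hE.congr
  obtain ⟨D, ht⟩ := ht
  refine Spec.seqf (newP_spec (L := L) (σ := σ1) ht hpos hkpos) ?_
  rintro τ hf ⟨D1, hb1, hroot1, hrE1, harr1, -⟩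
  have hE2 := hE1.frame hf rfl
  have h46 : τ.reg 46 = σ.reg rE := (hf.reg 46 rfl).trans (by simp [hσ1, run])
  have hmem1 : MemLe σ τ := ⟨hrE1.ge, fun i _ => by rw [harr1]; rfl⟩
  refine Spec.seqf (Spec.for 3 c (fun i τ => At (τ.arr aBUF) 0 (List.replicate i 0)) hE2.rc At.nil ?_) ?_
  · intro i hi ρ hfρ hri h
    refine Spec.block 3 ?_
    have := h.snoc (v := 0)
    rw [List.length_replicate, ← List.replicate_succ'] at this
    simpa [run, hri] using this
  rintro ρ hfρ ⟨-, hbuf⟩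
  have hE3 := hE2.frame hfρ rfl
  set l : Tuple := (if P then {lb L a} else ∅) :: List.replicate (c - 1) ∅ with hl
  have hgood : Good L c l := by
    refine ⟨by simp [hl]; omega, ?_⟩
    intro S hS
    rcases List.mem_cons.1 hS with rfl | hS
    · split_ifs
      · simpa using lb_mem ha
      · simp
    · rw [List.eq_of_mem_replicate hS]; simp
  obtain ⟨n, hn⟩ : ∃ n, c = n + 1 := ⟨c - 1, by omega⟩
  have hrep : List.replicate c 0 = 0 :: List.replicate (c - 1) 0 := by
    rw [hn, List.replicate_succ]; simp
  have hbase : (List.replicate (c - 1) (∅ : Finset ℕ)).map (code L) = List.replicate (c - 1) 0 := by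
    simp [code_empty]
  refine Spec.seqf (R := fun τ => At (τ.arr aBUF) 0 (l.map (code L)))
    (Spec.cond (b := eq (reg 40) (lit 1)) (fun hc => ?_) (fun hc => ?_)) ?_
  · simp only [Holds, eval] at hc
    have hP : P := by
      by_contra h
      rw [hfρ.reg 40 rfl, hf.reg 40 rfl] at hc
      change σ.reg 40 = 1 at hc
      rw [h40, if_neg h] at hc
      omega
    refine Spec.blockseq 2 (Spec.blockseq 2 ?_)
    set ρ1 := (assign 36 (lit 0)).run ((assign 39 (reg 38)).run ρ) with hρ1
    have hE4 : Env L c ρ1 := hE3.congr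
    have h39 : ρ1.reg 39 = a := by
      have : ρ.reg 38 = a := by
        rw [hfρ.reg 38 rfl, hf.reg 38 rfl]; exact h38
      simp [hρ1, run, this]
    refine Spec.seqf (putP_spec hL hE4 (S := ∅) (by simp) (by simp [hρ1, run, code_empty]) ha h39
      (P := True) (by simpa [hρ1, run] using hc)) ?_
    intro ρ2 hf2 h36
    refine Spec.block 3 ?_
    rw [hl, if_pos hP, List.map_cons, hbase]
    have hbuf2 : At (ρ2.arr aBUF) 0 (List.replicate c 0) := hf2.arr aBUF rfl ▸ hbuf
    have := hbuf2.set (i := 0) (v := code L {lb L a})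
    rw [hrep] at this
    simpa [run, h36] using this
  · simp only [Holds, eval] at hc
    have hP : ¬ P := by
      intro h
      rw [hfρ.reg 40 rfl, hf.reg 40 rfl] at hc
      change σ.reg 40 ≠ 1 at hc
      rw [h40, if_pos h] at hc
      omega
    refine Spec.skip ?_
    rw [hl, if_neg hP, List.map_cons, hbase, code_empty, ← hrep]
    exact hbuf
  · intro π hfπ hbufπ
    have hb2 := (hb1.frame hfρ rfl).frame hfπ rfl
    have hmem2 : MemLe σ π := hmem1.trans ((MemLe.of_frame hfρ rfl).trans (MemLe.of_frame hfπ rfl))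
    have hroot : π.reg rRoot = σ1.reg rT := by
      rw [hfπ.reg rRoot rfl, hfρ.reg rRoot rfl, hroot1]
    refine (insP_spec hL (hE3.frame hfπ rfl) hgood hbufπ hb2 hroot hpos hkpos).mono ?_
    rintro τ' hf' ⟨D', k1, -, k3⟩
    have h46' : τ'.reg 46 = σ1.reg rE := by
      rw [hf'.reg 46 rfl, hfπ.reg 46 rfl, hfρ.reg 46 rfl, h46]
      rfl
    rw [if_neg (List.not_mem_nil), List.nil_append] at k1
    refine ⟨?_, k1.hasTrie, hmem2.trans k3⟩
    rw [h46']
    refine k1.stored ?_ ?_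
    · intro x hx
      rw [List.mem_singleton.1 hx]
      exact sorted_radix hL hgood.2
    · intro s
      simp only [Set.mem_singleton_iff, List.mem_singleton, exists_eq_left, coe_radix]
      rw [hl, ← Multiset.cons_coe, Multiset.coe_replicate, eq_comm]

/-- Store the schemes that result from those between the positions in the registers `43` and `44` if
the label at the position in register `38` is replaced by the one at the position in register `39`. -/
def renameP : Prog := assign 46 (reg rE) ;; newP ;;
  buildP (mapP (takeP ;; putP) ;; assign rCur (lit 0) ;; countP aBUF ;;
    Prog.cond (eq (get aCNT (reg 39)) (lit 0)) skip insP)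

theorem notIn_eq_zero {a : ℕ} : notIn L x a = 0 ↔ ∀ S ∈ x, lb L a ∈ S := by
  simp [notIn, List.countP_eq_zero]

open Classical in
theorem renameP_spec (hL : L.Nodup) (hE : Env L c σ) (hpos : 0 < c)
    (ht : HasTrie σ) {a b : ℕ} (ha : a < L.length) (h38 : σ.reg 38 = a) (hb : b < L.length)
    (h39 : σ.reg 39 = b) (hS : Stored L c 𝒮 (σ.reg 43) (σ.reg 44) σ) {N : ℕ}
    (hN : ∀ X, Rep L c 𝒮 X → X.length ≤ N) :
    Spec renameP σ (500 * (N * (c * L.length)) + 20) (fun τ =>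
      Stored L c {s' | ∃ s ∈ 𝒮, s' = s.map (fun S => S.image (relabel (lb L a) (lb L b))) ∧
        ¬ ∀ S ∈ s', lb L b ∈ S} (τ.reg 46) (τ.reg rE) τ ∧ HasTrie τ ∧ MemLe σ τ) := by
  obtain ⟨X, hX, hm, he, hle⟩ := hS
  have hkpos : 0 < L.length := by omega
  obtain ⟨h1, h2, h3⟩ := le_mul_and hpos hkpos
  have hXN := hN X hX
  set Tp := (c * ((L.length * 48 + 12) + 12) + 5) + (2 + (60 * (c * L.length) + (4 + max 1 (200 * (c * L.length))))) with hTp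
  refine Spec.le (T := 2 + (6 + (X.length * (c * 13 + Tp + 14) + 3))) ?_ (by
    have h4 : c * 13 + Tp + 14 ≤ 500 * (c * L.length) := by
      rw [hTp, max_eq_right (by omega)]; nlinarith
    have h5 := Nat.mul_le_mul hXN h4
    have h6 : N * (500 * (c * L.length)) = 500 * (N * (c * L.length)) := by ring
    omega)
  refine Spec.blockseq 2 ?_
  set σ1 := (assign 46 (reg rE)).run σ with hσ1
  have hE1 : Env L c σ1 := hE.congr
  obtain ⟨D, ht⟩ := ht
  refine Spec.seqf (newP_spec (L := L) (σ := σ1) ht hpos hkpos) ?_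
  rintro τ hf ⟨D1, hb1, hroot1, hrE1, harr1, -⟩
  have hE2 := hE1.frame hf rfl
  have h46 : τ.reg 46 = σ.reg rE := (hf.reg 46 rfl).trans (by simp [hσ1, run])
  have hmem1 : MemLe σ τ := ⟨hrE1.ge, fun i _ => by rw [harr1]; rfl⟩
  set g : Finset ℕ → Finset ℕ := fun S => S.image (relabel (lb L a) (lb L b)) with hg
  have hgL : ∀ S ⊆ L.toFinset, g S ⊆ L.toFinset := by
    intro S hS
    rw [hg]
    simp only
    rw [image_relabel]
    split_ifs
    · exact insert_lb_subset ((Finset.erase_subset _ _).trans hS) hb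
    · exact hS
  have hgood : ∀ x, Good L c x → Good L c (x.map g) := fun x hx =>
    ⟨by simpa using hx.1, fun S hS => by
      obtain ⟨S', hS', rfl⟩ := mem_map.1 hS
      exact hgL _ (hx.2 S' hS')⟩
  refine (buildP_spec (T := Tp) rfl rfl rfl hE2 hX.good (a := σ.reg 43) ?_ ?_ ?_ ?_ hpos hb1
    (fun x y => (¬ ∀ S ∈ x.map g, lb L b ∈ S) ∧ y = radix L L.length (x.map g)) (fun _ _ => True) trivial ?_).mono ?_
  · exact hf.reg 43 rfl
  · rw [harr1]; exact hm
  · rw [hf.reg 44 rfl]; exact he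
  · rw [hf.reg 44 rfl, hrE1]; exact hle
  · intro i hi x hx ρ hfρ hEρ hbuf _ _ Y' D' hbY _
    have hxg := hX.good x (mem_of_getElem? hx)
    have h38ρ : ρ.reg 38 = a := hfρ.reg 38 rfl ▸ hf.reg 38 rfl ▸ h38
    have h39ρ : ρ.reg 39 = b := hfρ.reg 39 rfl ▸ hf.reg 39 rfl ▸ h39
    have hrootρ : ρ.reg rRoot = σ1.reg rT := by rw [hfρ.reg rRoot rfl, hroot1]
    refine Spec.seqf (mapP_spec rfl rfl rfl hEρ.rc hxg hbuf g (L.length * 48 + 12) ?_) ?_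
    · intro S hS π hfπ h36
      exact relabelP_spec hL (hEρ.frame hfπ rfl) hS h36 ha ((hfπ.reg 38 rfl).trans h38ρ) hb
        ((hfπ.reg 39 rfl).trans h39ρ)
    intro π hfπ hbuf'
    have hEπ := hEρ.frame hfπ rfl
    refine Spec.blockseq 2 ?_
    set π1 := (assign rCur (lit 0)).run π with hπ1
    have hEπ1 : Env L c π1 := hEπ.congr
    refine Spec.seqf (countP_spec (A := aBUF) rfl hL hEπ1 (hgood x hxg) (by simpa [hπ1, run] using hbuf') hpos hkpos) ?_
    intro π2 hf2 hcnt
    have hbY1 : Building L c (σ1.reg rT) (σ1.reg rE) Y' D' π1 := (hbY.frame hfπ rfl).congr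
    have hbY2 := hbY1.frame hf2 rfl
    have h39π : π2.reg 39 = b := by
      rw [hf2.reg 39 rfl]
      show π.reg 39 = b
      rw [hfπ.reg 39 rfl, h39ρ]
    have hmem : MemLe ρ π2 := by
      have e1 : MemLe ρ π := MemLe.of_frame hfπ rfl
      have e2 : MemLe π1 π2 := MemLe.of_frame hf2 rfl
      have e3 : MemLe ρ π1 := ⟨e1.1, e1.2⟩
      exact e3.trans e2
    -- The count 0 means that every element contains the new label, so the scheme is discarded.
    refine Spec.cond (b := eq (get aCNT (reg 39)) (lit 0)) (fun hc => ?_) (fun hc => ?_)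
    · simp only [Holds, eval, h39π, hcnt b hb, notIn_eq_zero] at hc
      refine Spec.skip ⟨Y', D', hbY2, fun y => ?_, hmem, trivial⟩
      exact ⟨Or.inl, fun h => h.resolve_right fun h => h.1 hc⟩
    · simp only [Holds, eval, h39π, hcnt b hb, notIn_eq_zero] at hc
      have hroot2 : π2.reg rRoot = σ1.reg rT := by
        rw [hf2.reg rRoot rfl]
        show π.reg rRoot = _
        rw [hfπ.reg rRoot rfl, hrootρ]
      have hbuf2 : At (π2.arr aBUF) 0 ((x.map g).map (code L)) := by
        rw [hf2.arr aBUF rfl]; exact hbuf'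
      refine (insP_spec hL (hEπ1.frame hf2 rfl) (hgood x hxg) hbuf2 hbY2 hroot2 hpos hkpos).mono ?_
      rintro π3 hf3 ⟨D3, k1, k2, k3⟩
      refine ⟨_, D3, k1, fun y => ?_, hmem.trans k3, trivial⟩
      rw [mem_ite_append]
      exact or_congr Iff.rfl ⟨fun h => ⟨hc, h⟩, fun h => h.2⟩
  · rintro ρ hfρ ⟨Y, D', k1, k2, k3, -⟩
    have h46' : ρ.reg 46 = σ1.reg rE := by rw [hfρ.reg 46 rfl, h46]; rfl
    refine ⟨?_, k1.hasTrie, hmem1.trans k3⟩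
    rw [h46']
    refine k1.stored ?_ ?_
    · intro y hy
      rw [k2] at hy
      obtain ⟨x, hx, -, rfl⟩ := hy.resolve_left (by simp)
      exact sorted_radix hL (hgood x (hX.good x hx)).2
    · intro s'
      rw [Set.mem_ofPred_eq]
      constructor
      · rintro ⟨s, hs, rfl, hnot⟩
        obtain ⟨x, hx, rfl⟩ := (hX.mem s).1 hs
        exact ⟨_, (k2 _).2 (Or.inr ⟨x, hx, hnot, rfl⟩), coe_radix⟩
      · rintro ⟨y, hy, rfl⟩
        obtain ⟨x, hx, hnot, rfl⟩ := ((k2 y).1 hy).resolve_left (by simp)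
        refine ⟨(x : Scheme), (hX.mem _).2 ⟨x, hx, rfl⟩, coe_radix, ?_⟩
        rw [coe_radix]
        exact hnot

/-- The array `f` holds the characteristic function of the relation `P`. -/
def HasPairs (L : List ℕ) (P : ℕ → ℕ → Prop) [∀ a b, Decidable (P a b)] (f : ℕ → ℕ) : Prop :=
  ∀ a < L.length, ∀ b < L.length, f (a * L.length + b) = if P (lb L a) (lb L b) then 1 else 0

/-- Clear the register `47` if a label of `BB` is not used. -/
def checkUsedP : Prog := forLoop 24 rK (Prog.cond (eq (get aBB (reg 24)) (lit 1))
  (Prog.cond (eq (get aCNT (reg 24)) (reg rC)) (assign 47 (lit 0)) skip) skip)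

/-- Clear the register `47` if an element of the scheme at the position in register `43` contains a
pair in `PD`. -/
def checkPairsP : Prog := assign 25 (reg 43) ;;
  forLoop 22 rC (assign 23 (get aMEM (reg 25)) ;; inc 25 ;; assign 28 (reg 23) ;; assign 26 (lit 0) ;;
    forLoop 24 rK (assign 27 (reg 28) ;;
      forLoop 29 rK (Prog.cond (eq (get aPD (reg 26)) (lit 1)) (Prog.cond (eq (get aODD (reg 23)) (lit 1))
          (Prog.cond (eq (get aODD (reg 27)) (lit 1)) (assign 47 (lit 0)) skip) skip) skip ;;
        assign 27 (get aROT (reg 27)) ;; inc 26) ;;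
      assign 23 (get aROT (reg 23))))

open Classical in
theorem checkUsedP_spec (hE : Env L c σ) (hx : Good L c x) (hB : HasBits L B (σ.arr aBB)) (hcnt : ∀ a < L.length, σ.arr
    aCNT a = notIn L x a) (h47 : σ.reg 47 = 1) : Spec checkUsedP σ (L.length * 20 + 5) (fun τ => τ.reg 47 = if UsedBelow
    L B x L.length then 1 else 0) := by
  refine (Spec.for 14 L.length (fun i τ => τ.reg 47 = if UsedBelow L B x i then 1 else 0) hE.rk
    (by simpa [UsedBelow] using h47) ?_).mono (fun τ _ h => h.2)
  intro i hi τ hf hri h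
  have hBi : τ.arr aBB i = if lb L i ∈ B then 1 else 0 := hf.arr aBB rfl ▸ hB i hi
  have hci : τ.arr aCNT i = notIn L x i := hf.arr aCNT rfl ▸ hcnt i hi
  have hcc : τ.reg rC = x.length := (hf.reg rC rfl).trans (hE.rc.trans hx.1.symm)
  refine Spec.block 14 ?_
  rw [usedBelow_succ]
  by_cases hb : lb L i ∈ B <;> by_cases hn : notIn L x i = x.length <;> simp [run, hri, hBi, hci, hcc, hb, hn, h]

open Classical in
theorem checkPairsP_spec (hL : L.Nodup) (hE : Env L c σ) (hx : Good L c x) (hm : At (σ.arr aMEM) (σ.reg 43) (x.map (code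
    L))) {P : ℕ → ℕ → Prop} (hP : HasPairs L P (σ.arr aPD)) {Q : Prop} (h47 : σ.reg 47 = if Q then 1 else 0) (hpos : 0 <
    c) (hkpos : 0 < L.length) : Spec checkPairsP σ (100 * (c * L.length * L.length)) (fun τ => τ.reg 47 = if Q ∧ ∀ S ∈
    x, ∀ a < L.length, ∀ b < L.length, lb L a ∈ S → lb L b ∈ S → ¬ P (lb L a) (lb L b) then 1 else 0) := by
  set k := L.length with hk
  refine Spec.le (T := 2 + (c * ((3 + (3 + (2 + (2 + (k * (2 + (k * (22 + 6) + 5 + 3) + 6) + 5))))) + 6) + 5)) ?_ (by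
    have h1 : k ≤ k * k := Nat.le_mul_of_pos_left _ hkpos
    have h2 : k * k ≤ c * (k * k) := Nat.le_mul_of_pos_left _ hpos
    have h3 : c ≤ c * (k * k) := Nat.le_mul_of_pos_right _ (Nat.mul_pos hkpos hkpos)
    have h4 : c * k ≤ c * (k * k) := Nat.mul_le_mul_left _ h1
    nlinarith)
  refine Spec.blockseq 2 ?_
  set σ1 := (assign 25 (reg 43)).run σ with hσ1
  have hE1 : Env L c σ1 := hE.congr
  -- Up to the place `(i, j, l)` of the three nested loops, in lexicographic order, no forbidden
  -- pair has been found.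
  set F : ℕ → ℕ → ℕ → Prop := fun i j l => ∀ r S, x[r]? = some S → ∀ a < k, ∀ b < k,
    (r < i ∨ r = i ∧ (a < j ∨ a = j ∧ b < l)) → lb L a ∈ S → lb L b ∈ S → ¬ P (lb L a) (lb L b) with hF
  refine (Spec.for (3 + (3 + (2 + (2 + (k * (2 + (k * (22 + 6) + 5 + 3) + 6) + 5))))) c
    (fun i τ => (τ.reg 47 = if Q ∧ F i 0 0 then 1 else 0) ∧ τ.reg 25 = σ.reg 43 + i)
    hE1.rc ?_ ?_).mono ?_
  · refine ⟨?_, by simp [hσ1, run]⟩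
    have : F 0 0 0 := by intro r S _ a _ b _ h; omega
    simpa [hσ1, run, this] using h47
  · rintro i hi τ hf hri ⟨h1, h2⟩
    have hE2 := hE1.frame hf rfl
    obtain ⟨S, hS, hSL⟩ := hx.getElem? hi
    have hv : τ.arr aMEM (σ.reg 43 + i) = code L S := hf.arr aMEM rfl ▸ hm i _ (by simp [hS])
    refine Spec.blockseq 3 (Spec.blockseq 3 (Spec.blockseq 2 (Spec.blockseq 2 ?_)))
    set τ1 := (assign 26 (lit 0)).run ((assign 28 (reg 23)).run ((inc 25).run
      ((assign 23 (get aMEM (reg 25))).run τ))) with hτ1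
    have hE3 : Env L c τ1 := hE2.congr
    have e23 : τ1.reg 23 = code L S := by simp [hτ1, run, inc, h2, hv]
    have e28 : τ1.reg 28 = code L S := by simp [hτ1, run, inc, h2, hv]
    have e26 : τ1.reg 26 = 0 := by simp [hτ1, run, inc]
    have e25 : τ1.reg 25 = σ.reg 43 + (i + 1) := by simp [hτ1, run, inc, h2]; ring
    have e47 : τ1.reg 47 = τ.reg 47 := by simp [hτ1, run, inc]
    refine (Spec.for (2 + (k * (22 + 6) + 5 + 3)) k (fun j τ =>
      (τ.reg 47 = if Q ∧ F i j 0 then 1 else 0) ∧ τ.reg 23 = rcode L j S ∧ τ.reg 26 = j * k)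
    hE3.rk ?_ ?_).mono ?_
    · refine ⟨?_, ?_, ?_⟩
      · simpa [e47] using h1
      · simpa [code] using e23
      · simpa using e26
    · rintro j hj ρ hfρ hrj ⟨h3, h4, h5⟩
      have hE4 := hE3.frame hfρ rfl
      refine Spec.blockseq 2 ?_
      set ρ1 := (assign 27 (reg 28)).run ρ with hρ1
      have hE5 : Env L c ρ1 := hE4.congr
      have f28 : ρ.reg 28 = code L S := (hfρ.reg 28 rfl).trans e28
      have hodd1 := hE4.odd_rcode hL hSL hj
      refine Spec.seqf (Spec.for 22 k (fun l τ =>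
        (τ.reg 47 = if Q ∧ F i j l then 1 else 0) ∧ τ.reg 27 = rcode L l S ∧ τ.reg 26 = j * k + l)
    hE5.rk ?_ ?_) ?_
      · refine ⟨?_, ?_, ?_⟩
        · simpa [hρ1, run] using h3
        · simpa [hρ1, run, code] using f28
        · simpa [hρ1, run] using h5
      · rintro l hl π hfπ hrl ⟨h6, h7, h8⟩
        have hE6 := hE5.frame hfπ rfl
        have hodd2 := hE6.odd_rcode hL hSL hl
        have hrot2 := hE6.rot_rcode hL hSL hl
        have f23 : π.reg 23 = rcode L j S := (hfπ.reg 23 rfl).trans h4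
        have hodd1' := hE6.odd_rcode hL hSL hj
        have hpd : π.arr aPD (j * k + l) = if P (lb L j) (lb L l) then 1 else 0 := by
          rw [hfπ.arr aPD rfl]
          show ρ.arr aPD _ = _
          rw [hfρ.arr aPD rfl]
          show τ.arr aPD _ = _
          rw [hf.arr aPD rfl]
          exact hP j hj l hl
        have hFs : F i j (l + 1) ↔ F i j l ∧ (P (lb L j) (lb L l) → lb L j ∈ S → lb L l ∈ S → False) := by
          constructor
          · intro h
            refine ⟨fun r S' hS' a ha b hb hr => h r S' hS' a ha b hb (by omega), fun hp hj' hl' => ?_⟩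
            exact h i S hS j hj l hl (by omega) hj' hl' hp
          · rintro ⟨h, h'⟩ r S' hS' a ha b hb hr haS hbS hp
            by_cases hnew : r = i ∧ a = j ∧ b = l
            · obtain ⟨rfl, rfl, rfl⟩ := hnew
              obtain rfl := Option.some.inj (hS.symm.trans hS')
              exact h' hp haS hbS
            · exact h r S' hS' a ha b hb (by omega) haS hbS hp
        refine Spec.block 22 ?_
        rw [hFs]
        by_cases hp : P (lb L j) (lb L l) <;> by_cases hjS : lb L j ∈ S <;> by_cases hlS : lb L l ∈ S <;>
          simp only [hp, hjS, hlS, if_true, if_false] at hpd hodd1' hodd2 <;>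
          simp [run, inc, f23, h6, h7, h8, hpd, hodd1', hodd2, hp, hjS, hlS, hrot2, add_assoc]
      · rintro π hfπ ⟨-, h6, h7, h8⟩
        have hE6 := hE5.frame hfπ rfl
        have f23 : π.reg 23 = rcode L j S := (hfπ.reg 23 rfl).trans h4
        have hrot1 := hE6.rot_rcode hL hSL hj
        have hFs : F i j k ↔ F i (j + 1) 0 := ⟨fun h r S' hS' a ha b hb hr => h r S' hS' a ha b hb (by omega),
            fun h r S' hS' a ha b hb hr => h r S' hS' a ha b hb (by omega)⟩
        rw [hFs] at h6
        refine Spec.block 3 ⟨?_, ?_, ?_⟩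
        · simpa [run] using h6
        · simp [run, f23, hrot1]
        · simp [run, h8]; ring
    · rintro ρ hfρ ⟨-, h3, -, -⟩
      have hFs : F i k 0 ↔ F (i + 1) 0 0 := ⟨fun h r S' hS' a ha b hb hr => h r S' hS' a ha b hb (by omega),
          fun h r S' hS' a ha b hb hr => h r S' hS' a ha b hb (by omega)⟩
      rw [hFs] at h3
      refine ⟨by simpa using h3, ?_⟩
      simp only [State.setR_reg]
      rw [if_neg (by decide), hfρ.reg 25 rfl, e25]
  · rintro τ - ⟨-, h, -⟩
    rw [h]
    refine if_congr (and_congr Iff.rfl ?_) rfl rfl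
    constructor
    · intro h S hS a ha b hb
      obtain ⟨r, hr⟩ := getElem?_of_mem hS
      have := getElem?_lt hr
      rw [hx.1] at this
      exact h r S hr a ha b hb (by omega)
    · intro h r S hr a ha b hb _
      exact h S (mem_of_getElem? hr) a ha b hb

/-- Go through the schemes between the positions in the registers `43` and `44`, and insert the
restrictions of those that are to be kept. -/
def selectP : Prog := buildP (assign rCur (reg 43) ;; countP aMEM ;; assign 47 (lit 1) ;; checkUsedP ;; checkPairsP ;;
  Prog.cond (eq (reg 47) (lit 1)) (assign rRoot (reg 49) ;; walkP ;;
    Prog.cond (eq (reg rNew) (lit 0)) (assign rRoot (reg 45) ;; mapP restrictP ;; insP) skip) skip)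

/-- Start a new set and fill it with the schemes of a union of graphs; the schemes for the two
arguments are between the positions in the registers `50` and `51`, and `52` and `53`. -/
def unionP : Prog := assign 32 (reg 50) ;; assign 33 (reg 51) ;; assign 54 (reg rE) ;; closureP ;; assign 42 (reg rE) ;;
  assign 32 (reg 52) ;; assign 33 (reg 53) ;; closureP ;; assign 49 (reg rRoot) ;;
  assign 43 (reg 54) ;; assign 44 (reg 42) ;; assign 46 (reg rE) ;; newP ;; assign 45 (reg rRoot) ;;
  selectP

/-- The condition for a scheme to be kept in a union. -/
def Keep (L : List ℕ) (B : Finset ℕ) (P : ℕ → ℕ → Prop) (x : Tuple) : Prop :=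
  UsedBelow L B x L.length ∧ ∀ S ∈ x, ∀ a < L.length, ∀ b < L.length, lb L a ∈ S → lb L b ∈ S → ¬ P (lb L a) (lb L b)

theorem Building.ne_root {s : ℕ} (h : Building L c root s X D σ) : root ≠ σ.reg rT := by
  obtain ⟨path, ht⟩ := h.trie
  have := (ht.root _ _ h.isRoot).1.2.1
  omega

open Classical in
-- Membership in `Y₂` is tested by a walk, and the walk inserts its key into the dictionary of `Y₂`.
-- This is harmless since `Y₁` has no repetitions: the keys added wrongly belong to members of `Y₁`
-- that have been dealt with.
theorem selectP_spec (hL : L.Nodup) (hE : Env L c σ) (hpos : 0 < c) (hkpos : 0 < L.length) {B U : Finset ℕ} {P : ℕ → ℕ →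
    Prop} (hB : HasBits L B (σ.arr aBB)) (hU : HasBits L U (σ.arr aBU)) (hP : HasPairs L P (σ.arr aPD)) {Y₁ Y₂ : List
    Tuple} (hY₁ : ∀ x ∈ Y₁, Good L c x ∧ Sorted L x) (hn₁ : Y₁.Nodup) {root₂ root s : ℕ} (hne : root₂ ≠ root) (hb :
    Building L c root s [] D σ) (h49 : σ.reg 49 = root₂) (h45 : σ.reg 45 = root) (hr₂ : (root₂, []) ∈ D) (hd₂ : ∀ x,
    Good L c x → ((root₂, key L x) ∈ D ↔ x ∈ Y₂)) {a : ℕ} (h43 : σ.reg 43 = a) (hm : At (σ.arr aMEM) a (enc L Y₁)) (he :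
    σ.reg 44 = a + Y₁.length * c) (hle : σ.reg 44 ≤ σ.reg rE) : Spec selectP σ (Y₁.length * (600 * (c * L.length *
    L.length)) + 3) (fun τ => ∃ Y D', Building L c root s Y D' τ ∧ (∀ y, y ∈ Y ↔ ∃ x ∈ Y₁, Keep L B P x ∧ x ∈ Y₂ ∧ y =
    radix L L.length (x.map (fun S => S.filter (· ∈ U)))) ∧ MemLe σ τ) := by
  set k := L.length with hk
  obtain ⟨h1, h2, h3⟩ := le_mul_and hpos hkpos
  have h4 : c * k ≤ c * k * k := Nat.le_mul_of_pos_right _ hkpos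
  set Tp := 2 + (60 * (c * k) + (2 + ((k * 20 + 5) + (100 * (c * k * k) + (3 + max (2 + ((c * (k * 33 + 20) + 20) +
    (3 + max (2 + ((c * ((k * 20 + 5) + 12) + 5) + 200 * (c * k))) 1))) 1))))) with hTp
  have hTp' : c * 13 + Tp + 14 ≤ 600 * (c * k * k) := by
    rw [hTp, max_eq_left (by omega), max_eq_left (by omega)]
    nlinarith
  set g : Finset ℕ → Finset ℕ := fun S => S.filter (· ∈ U) with hg
  have hgL : ∀ S ⊆ L.toFinset, g S ⊆ L.toFinset := fun S hS => (Finset.filter_subset _ _).trans hS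
  have hgood : ∀ x, Good L c x → Good L c (x.map g) := fun x hx =>
    ⟨by simpa using hx.1, fun S hS => by
      obtain ⟨S', hS', rfl⟩ := mem_map.1 hS
      exact hgL _ (hx.2 S' hS')⟩
  refine ((buildP_spec (T := Tp) rfl rfl rfl hE (fun x hx => (hY₁ x hx).1) h43 hm he hle hpos hb
    (fun x y => Keep L B P x ∧ x ∈ Y₂ ∧ y = radix L k (x.map g))
    (fun i D' => (root₂, []) ∈ D' ∧ ∀ x, Good L c x → (x ∈ Y₂ → (root₂, key L x) ∈ D') ∧
      ((root₂, key L x) ∈ D' → x ∈ Y₂ ∨ x ∈ Y₁.take i))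
    ⟨hr₂, fun x hx => ⟨(hd₂ x hx).2, fun h => Or.inl ((hd₂ x hx).1 h)⟩⟩ ?_).le
      (Nat.add_le_add_right (Nat.mul_le_mul_left _ hTp') _)).mono ?_
  · rintro i hi x hx ρ hfρ hEρ hbuf h43ρ hmem Y' D' hbY ⟨hJ1, hJ2⟩
    obtain ⟨hxg, hxs⟩ := hY₁ x (mem_of_getElem? hx)
    have htake : ∀ z, z ∈ Y₁.take i → z ∈ Y₁.take (i + 1) := fun z hz => by
      rw [take_add_one]; exact List.mem_append_left _ hz
    have hJ' : (root₂, []) ∈ D' ∧ ∀ x, Good L c x → (x ∈ Y₂ → (root₂, key L x) ∈ D') ∧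
      ((root₂, key L x) ∈ D' → x ∈ Y₂ ∨ x ∈ Y₁.take (i + 1)) :=
      ⟨hJ1, fun z hz => ⟨(hJ2 z hz).1, fun h => ((hJ2 z hz).2 h).imp id (htake z)⟩⟩
    refine Spec.blockseq 2 ?_
    set ρ1 := (assign rCur (reg 43)).run ρ with hρ1
    have hE1 : Env L c ρ1 := hEρ.congr
    have hb1 : Building L c root s Y' D' ρ1 := hbY.congr
    have h21 : ρ1.reg rCur = a + i * c := by simpa [hρ1, run] using h43ρ
    refine Spec.seqf (countP_spec (A := aMEM) rfl hL hE1 hxg (h21 ▸ hmem) hpos hkpos) ?_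
    intro ρ2 hf2 hcnt
    have hE2 := hE1.frame hf2 rfl
    refine Spec.blockseq 2 ?_
    set ρ3 := (assign 47 (lit 1)).run ρ2 with hρ3
    have hE3 : Env L c ρ3 := hE2.congr
    have hB3 : HasBits L B (ρ3.arr aBB) := ((hf2.arr aBB rfl).trans (hfρ.arr aBB rfl)) ▸ hB
    refine Spec.seqf (checkUsedP_spec hE3 hxg hB3 hcnt (by simp [hρ3, run])) ?_
    intro ρ4 hf4 h47
    have hE4 := hE3.frame hf4 rfl
    have h43' : ρ4.reg 43 = a + i * c := (hf4.reg 43 rfl).trans ((hf2.reg 43 rfl).trans h43ρ)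
    have hmem4 : ρ4.arr aMEM = ρ.arr aMEM := (hf4.arr aMEM rfl).trans (hf2.arr aMEM rfl)
    have hP4 : HasPairs L P (ρ4.arr aPD) := ((hf4.arr aPD rfl).trans ((hf2.arr aPD rfl).trans (hfρ.arr aPD rfl))) ▸ hP
    refine Spec.seqf (checkPairsP_spec hL hE4 hxg (h43' ▸ hmem4 ▸ hmem) hP4 h47 hpos hkpos) ?_
    intro ρ5 hf5 h47v
    have h47' : ρ5.reg 47 = if Keep L B P x then 1 else 0 := h47v.trans (if_congr Iff.rfl rfl rfl)
    have hE5 := hE4.frame hf5 rfl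
    have hb2 := hb1.frame hf2 rfl
    have hb3 : Building L c root s Y' D' ρ3 := hb2.congr
    have hb5 := (hb3.frame hf4 rfl).frame hf5 rfl
    have hmem5 : MemLe ρ ρ5 := by
      have e1 : MemLe ρ1 ρ2 := MemLe.of_frame hf2 rfl
      have e2 : MemLe ρ3 ρ4 := MemLe.of_frame hf4 rfl
      have e3 : MemLe ρ4 ρ5 := MemLe.of_frame hf5 rfl
      have e4 : MemLe ρ ρ3 := ⟨e1.1, e1.2⟩
      exact e4.trans (e2.trans e3)
    have hreg : ∀ r, r = 49 ∨ r = 45 → ρ5.reg r = ρ.reg r := by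
      rintro r (rfl | rfl)
      · rw [hf5.reg 49 rfl, hf4.reg 49 rfl]
        show ρ2.reg 49 = _
        rw [hf2.reg 49 rfl]
        rfl
      · rw [hf5.reg 45 rfl, hf4.reg 45 rfl]
        show ρ2.reg 45 = _
        rw [hf2.reg 45 rfl]
        rfl
    have h49' : ρ5.reg 49 = root₂ := by rw [hreg 49 (Or.inl rfl), hfρ.reg 49 rfl, h49]
    have h45' : ρ5.reg 45 = root := by rw [hreg 45 (Or.inr rfl), hfρ.reg 45 rfl, h45]
    have hbuf5 : At (ρ5.arr aBUF) 0 (x.map (code L)) := ((hf5.arr aBUF rfl).trans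
      ((hf4.arr aBUF rfl).trans (hf2.arr aBUF rfl))) ▸ hbuf
    refine Spec.cond (b := eq (reg 47) (lit 1)) (fun hc => ?_) (fun hc => ?_)
    · simp only [Holds, eval, h47'] at hc
      have hkeep : Keep L B P x := by
        by_contra h
        rw [if_neg h] at hc
        omega
      refine Spec.blockseq 2 ?_
      set ρ6 := (assign rRoot (reg 49)).run ρ5 with hρ6
      have hE6 : Env L c ρ6 := hE5.congr
      have hb6 : Building L c root s Y' D' ρ6 := hb5.congr
      have hr6 : ρ6.reg rRoot = root₂ := by simp [hρ6, run, h49']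
      obtain ⟨path, ht⟩ := hb6.trie
      refine Spec.seqf (walkP_spec hL hE6 hxg.2 hxg.1 hbuf5 ht (hr6 ▸ hJ1)) ?_
      rintro ρ7 hf7 ⟨⟨path', ht'⟩, hnew⟩
      rw [hr6] at ht' hnew
      have hE7 := hE6.frame hf7 rfl
      set D'' := D' ∪ prefixes root₂ (key L x) with hD''
      have hJ'' : (root₂, []) ∈ D'' ∧ ∀ x, Good L c x → (x ∈ Y₂ → (root₂, key L x) ∈ D'') ∧
          ((root₂, key L x) ∈ D'' → x ∈ Y₂ ∨ x ∈ Y₁.take (i + 1)) := by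
        refine ⟨Or.inl hJ1, fun z hz => ?_⟩
        rw [hD'', mem_union_prefixes hxg hz]
        refine ⟨fun h => Or.inl ((hJ2 z hz).1 h), ?_⟩
        rintro (h | rfl)
        · exact ((hJ2 z hz).2 h).imp id (htake z)
        · right
          rw [take_add_one, hx]
          simp
      have hb7 : Building L c root s Y' D'' ρ7 := by
        refine ⟨⟨path', ht'⟩, by rw [hf7.arr aMEM rfl]; exact hb6.mem, by rw [hf7.reg rE rfl]; exact hb6.last,
          Or.inl hb6.isRoot, fun z hz => ?_, hb6.good, hb6.nodup⟩
        rw [← hb6.dict z hz]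
        refine ⟨fun h => h.resolve_right fun h => hne h.1.symm, Or.inl⟩
      have hmem7 : MemLe ρ ρ7 := by
        have e1 : MemLe ρ6 ρ7 := ⟨(hf7.reg _ rfl).ge, fun i _ => by rw [hf7.arr _ rfl]⟩
        exact hmem5.trans ⟨e1.1, e1.2⟩
      have hxi : x ∉ Y₁.take i := by
        intro h
        obtain ⟨j, hj⟩ := getElem?_of_mem h
        rw [List.getElem?_take] at hj
        split_ifs at hj with hji
        have hj1 := (List.getElem?_eq_some_iff.1 hj)
        have hi1 := (List.getElem?_eq_some_iff.1 hx)
        have := (hn₁.getElem_inj_iff (hi := hj1.1) (hj := hi1.1)).1 (hj1.2.trans hi1.2.symm)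
        omega
      have hiff : (root₂, key L x) ∈ D' ↔ x ∈ Y₂ := ⟨fun h => ((hJ2 x hxg).2 h).resolve_right hxi, (hJ2 x hxg).1⟩
      refine Spec.cond (b := eq (reg rNew) (lit 0)) (fun hc2 => ?_) (fun hc2 => ?_)
      · simp only [Holds, eval, hnew] at hc2
        have hx2 : x ∈ Y₂ := by
          rw [← hiff]
          by_contra h
          rw [if_neg h] at hc2
          omega
        refine Spec.blockseq 2 ?_
        set ρ8 := (assign rRoot (reg 45)).run ρ7 with hρ8
        have hE8 : Env L c ρ8 := hE7.congr
        have hb8 : Building L c root s Y' D'' ρ8 := hb7.congr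
        have hbuf8 : At (ρ8.arr aBUF) 0 (x.map (code L)) := (hf7.arr aBUF rfl) ▸ hbuf5
        have hU8 : HasBits L U (ρ8.arr aBU) := ((hf7.arr aBU rfl).trans ((hf5.arr aBU rfl).trans
          ((hf4.arr aBU rfl).trans ((hf2.arr aBU rfl).trans (hfρ.arr aBU rfl))))) ▸ hU
        have hr8 : ρ8.reg rRoot = root := by
          have : ρ7.reg 45 = root := by
            rw [hf7.reg 45 rfl]; exact h45'
          simp [hρ8, run, this]
        refine Spec.seqf (mapP_spec rfl rfl rfl hE8.rc hxg hbuf8 g (k * 20 + 5) ?_) ?_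
        · intro S hS π hfπ h36
          exact restrictP_spec hL (hE8.frame hfπ rfl) (hfπ.arr aBU rfl ▸ hU8) hS h36
        intro ρ9 hf9 hbuf9
        refine (insP_spec hL (hE8.frame hf9 rfl) (hgood x hxg) hbuf9 (hb8.frame hf9 rfl)
          ((hf9.reg rRoot rfl).trans hr8) hpos hkpos).mono ?_
        rintro π hfπ ⟨D3, k1, k2, k3⟩
        refine ⟨_, D3, k1, fun y => ?_, ?_, ?_, ?_⟩
        · rw [mem_ite_append]
          exact or_congr Iff.rfl ⟨fun h => ⟨hkeep, hx2, h⟩, fun h => h.2.2⟩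
        · have e1 : MemLe ρ8 ρ9 := MemLe.of_frame hf9 rfl
          have e2 : MemLe ρ ρ9 := hmem7.trans ⟨e1.1, e1.2⟩
          exact e2.trans k3
        · exact (k2 _ hne _).2 hJ''.1
        · intro z hz
          rw [k2 _ hne]
          exact hJ''.2 z hz
      · simp only [Holds, eval, hnew] at hc2
        have hx2 : x ∉ Y₂ := by
          rw [← hiff]
          intro h
          rw [if_pos h] at hc2
          exact hc2 rfl
        exact Spec.skip ⟨Y', D'', hb7, fun y => ⟨Or.inl, fun h => h.resolve_right fun h => hx2 h.2.1⟩, hmem7, hJ''⟩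
    · simp only [Holds, eval, h47'] at hc
      have hkeep : ¬ Keep L B P x := by
        intro h
        rw [if_pos h] at hc
        exact hc rfl
      exact Spec.skip ⟨Y', D', hb5, fun y => ⟨Or.inl, fun h => h.resolve_right fun h => hkeep h.1⟩, hmem5, hJ'⟩
  · rintro τ - ⟨Y, D', k1, k2, k3, -⟩
    exact ⟨Y, D', k1, fun y => by rw [k2]; simp, k3⟩

/-! ### The schemes of a union, from lists back to multisets -/

theorem _root_.Scheme.Overapprox.card_eq {s s' : Scheme} (h : Scheme.Overapprox s s') (hs : Multiset.card s = c) :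
    Multiset.card s' = c := by
  obtain ⟨f, rfl⟩ := Scheme.exists_ofFn hs
  obtain ⟨g, rfl, -, -⟩ := Scheme.overapprox_ofFn_iff.1 h
  exact Scheme.card_ofFn g

theorem exists_sorted_of_card (hL' : L.Nodup) {s : Scheme} (hs : Multiset.card s = c) (hL : ∀ S ∈ s, S ⊆ L.toFinset) : ∃
    x, Good L c x ∧ Sorted L x ∧ (x : Scheme) = s := by
  have hg : Good L c s.toList := ⟨by simpa using hs, fun S hS => hL S (by simpa using hS)⟩
  exact ⟨radix L L.length s.toList, hg.radix _, sorted_radix hL' hg.2, by rw [coe_radix, Multiset.coe_toList]⟩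

theorem coe_restrict {U : Finset ℕ} {j : ℕ} : ((radix L j (x.map (fun S => S.filter (· ∈ U))) : Tuple) : Scheme) =
    Scheme.restrict ↑U (x : Scheme) := by
  rw [coe_radix, Scheme.restrict, Multiset.map_coe]
  congr 2
  funext S
  ext a
  simp

section
variable {B B₁ : Finset ℕ}

theorem Rep.stage (hL : L.Nodup) (hX : Rep L c 𝒮 X) (hf : ∀ s ∈ 𝒮, Fits c B₁ s) (hB : B ⊆ L.toFinset) {y : List (Finset
    ℕ)} (h : Reach L B X y) : Good L c y ∧ Sorted L y ∧ Stage L B₁ B y := by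
  have hg := h.good hL fun x hx => ⟨hX.good x hx, hX.sorted x hx⟩
  refine ⟨hg.1, hg.2, Stage.of_reach hL hB ?_ h⟩
  intro x hx
  have := hf x ((hX.mem _).2 ⟨x, hx, rfl⟩)
  refine ⟨fun a => by simpa using this.notFull a, fun a => ?_⟩
  have h1 := Set.ext_iff.1 this.labels a
  simpa [Scheme.labels] using h1

/-- No label outside `B` ever enters, so it suffices to check that each label of `B` is used. -/
theorem Stage.labels_eq (hB₁ : B₁ ⊆ B) (hB : B ⊆ L.toFinset) (h : Stage L B₁ B x) (hu : UsedBelow L B x L.length) :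
    Scheme.labels (x : Scheme) = B := by
  obtain ⟨-, i, -, h⟩ := h
  ext a
  simp only [Scheme.labels, Set.mem_ofPred_eq, Multiset.mem_coe, Finset.mem_coe]
  constructor
  · intro ha
    rcases Finset.mem_union.1 ((h a).1 ha) with h' | h'
    · exact hB₁ h'
    · exact (mem_filter.1 h').1
  · intro ha
    have haL : a ∈ L := by simpa using hB ha
    have := hu _ (idxOf_lt_length_iff.2 haL) (by rw [lb_idxOf haL]; exact ha)
    rw [Ne, notIn_eq_length, lb_idxOf haL] at this
    push Not at this
    exact this

theorem usedBelow_of_labels (h : Scheme.labels (x : Scheme) = B) : UsedBelow L B x L.length := by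
  intro a _ ha hn
  rw [notIn_eq_length] at hn
  have : lb L a ∈ (B : Set ℕ) := ha
  rw [← h] at this
  obtain ⟨S, hS, haS⟩ := this
  exact hn S hS haS

end

open Classical in
-- Restricted moves also lead to schemes that do not use all of `B`; `Keep` removes these, and for
-- the remaining ones `reach_iff` identifies reachability with overapproximation. The number of
-- schemes met from either side is at most `bound L.length c`, since `Stage` holds with `B₁` and
-- with `B₂`.
theorem unionP_spec (hL : L.Nodup) (hE : Env L c σ) (hc : 2 ≤ c)
    (hkpos : 0 < L.length) (ht : HasTrie σ) {B U B₁ B₂ : Finset ℕ} (hBu : B = B₁ ∪ B₂)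
    (hBL : B ⊆ L.toFinset) {P : ℕ → ℕ → Prop} (hB : HasBits L B (σ.arr aBB))
    (hU : HasBits L U (σ.arr aBU)) (hP : HasPairs L P (σ.arr aPD)) {𝒮₁ 𝒮₂ : Set Scheme}
    (hS₁ : Stored L c 𝒮₁ (σ.reg 50) (σ.reg 51) σ) (hS₂ : Stored L c 𝒮₂ (σ.reg 52) (σ.reg 53) σ)
    (hf₁ : ∀ s ∈ 𝒮₁, Fits c B₁ s) (hf₂ : ∀ s ∈ 𝒮₂, Fits c B₂ s) :
    Spec unionP σ (2000 * (bound L.length c * (min c (2 ^ L.length) * L.length * (c * L.length))) + 100)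
      (fun τ => Stored L c {s' | ∃ s : Scheme, (∃ s₁ ∈ 𝒮₁, Scheme.Overapprox s₁ s) ∧
        (∃ s₂ ∈ 𝒮₂, Scheme.Overapprox s₂ s) ∧ s.labels = B ∧
        (∀ S ∈ s, ∀ a ∈ S, ∀ b ∈ S, ¬ P a b) ∧ s' = s.restrict U} (τ.reg 46) (τ.reg rE) τ ∧
        HasTrie τ ∧ MemLe σ τ) := by
  obtain ⟨X₁, hX₁, hm₁, he₁, hle₁⟩ := hS₁
  obtain ⟨X₂, hX₂, hm₂, he₂, hle₂⟩ := hS₂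
  obtain ⟨D₀, ht⟩ := ht
  have hpos : 0 < c := by omega
  have hB₁ : B₁ ⊆ B := hBu ▸ Finset.subset_union_left
  have hB₂ : B₂ ⊆ B := hBu ▸ Finset.subset_union_right
  set k := L.length with hk
  set M := min c (2 ^ k) with hM
  have hMpos : 0 < M := lt_min hpos (Nat.two_pow_pos _)
  set N := bound k c with hN
  set W := N * (M * k * (c * k)) with hW
  have hst₁ : ∀ y, Reach L B X₁ y → Good L c y ∧ Sorted L y ∧ Stage L B₁ B y := fun y hy => hX₁.stage hL hf₁ hBL hy
  have hst₂ : ∀ y, Reach L B X₂ y → Good L c y ∧ Sorted L y ∧ Stage L B₂ B y := fun y hy => hX₂.stage hL hf₂ hBL hy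
  refine Spec.le (T := 2 + (2 + (2 + ((700 * W + 20) + (2 + (2 + (2 + ((700 * W + 20) + (2 + (2 + (2 + (2 +
    (6 + (2 + (N * (600 * (c * k * k)) + 3))))))))))))))) ?_ (by
      have h1 : N * (600 * (c * k * k)) ≤ 600 * W := by
        have h2 : c * k * k ≤ M * k * (c * k) := by
          calc c * k * k = 1 * k * (c * k) := by ring
            _ ≤ _ := Nat.mul_le_mul_right _ (Nat.mul_le_mul_right _ hMpos)
        calc _ = 600 * (N * (c * k * k)) := by ring
          _ ≤ _ := Nat.mul_le_mul_left _ (Nat.mul_le_mul_left _ h2)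
      omega)
  refine Spec.blockseq 2 (Spec.blockseq 2 (Spec.blockseq 2 ?_))
  set σ1 := (assign 54 (reg rE)).run ((assign 33 (reg 51)).run ((assign 32 (reg 50)).run σ)) with hσ1
  have hE1 : Env L c σ1 := hE.congr
  have e32 : σ1.reg 32 = σ.reg 50 := by simp [hσ1, run]
  have e33 : σ1.reg 33 = σ.reg 51 := by simp [hσ1, run]
  have e54 : σ1.reg 54 = σ.reg rE := by simp [hσ1, run]
  refine Spec.seqf (closureP_spec hL hE1 (fun x hx => ⟨hX₁.good x hx, hX₁.sorted x hx⟩) hX₁.nodup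
    (e32 ▸ hm₁) (e32 ▸ e33 ▸ he₁) (e33 ▸ hle₁) (D := D₀) ht hpos hkpos
    hB (N := N) (fun Y hY h => length_le_bound hL hc (hB₁.trans hBL) hBL hY fun y hy => hst₁ y (h y hy))) ?_
  rintro σ2 hf2 ⟨Y₁, D₁, hb₁, hY₁, -, hle2, -⟩
  have hE2 := hE1.frame hf2 rfl
  refine Spec.blockseq 2 (Spec.blockseq 2 (Spec.blockseq 2 ?_))
  set σ3 := (assign 33 (reg 53)).run ((assign 32 (reg 52)).run ((assign 42 (reg rE)).run σ2)) with hσ3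
  have hE3 : Env L c σ3 := hE2.congr
  have g52 : σ2.reg 52 = σ.reg 52 := hf2.reg 52 rfl
  have g53 : σ2.reg 53 = σ.reg 53 := hf2.reg 53 rfl
  have g32 : σ3.reg 32 = σ.reg 52 := by simp [hσ3, run, g52]
  have g33 : σ3.reg 33 = σ.reg 53 := by simp [hσ3, run, g53]
  have g42 : σ3.reg 42 = σ2.reg rE := by simp [hσ3, run]
  have g54 : σ3.reg 54 = σ.reg rE := (hf2.reg 54 rfl).trans e54
  have hle3 : MemLe σ σ3 := ⟨hle2.1, hle2.2⟩
  refine Spec.seqf (closureP_spec hL hE3 (fun x hx => ⟨hX₂.good x hx, hX₂.sorted x hx⟩) hX₂.nodup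
    (by rw [g32]; exact hle3.at hm₂ (by rw [length_enc hX₂.good]; omega)) (g32 ▸ g33 ▸ he₂)
    (g33 ▸ hle₂.trans hle3.1) (D := D₁) hb₁.trie hpos hkpos
    (by show HasBits L B (σ2.arr aBB); rw [hf2.arr aBB rfl]; exact hB)
    (N := N) (fun Y hY h => length_le_bound hL hc (hB₂.trans hBL) hBL hY fun y hy => hst₂ y (h y hy))) ?_
  rintro σ4 hf4 ⟨Y₂, D₂, hb₂, hY₂, -, hle4, hroot₂⟩
  have hE4 := hE3.frame hf4 rfl
  refine Spec.blockseq 2 (Spec.blockseq 2 (Spec.blockseq 2 (Spec.blockseq 2 ?_)))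
  set σ5 := (assign 46 (reg rE)).run ((assign 44 (reg 42)).run ((assign 43 (reg 54)).run
    ((assign 49 (reg rRoot)).run σ4))) with hσ5
  have hE5 : Env L c σ5 := hE4.congr
  have k42 : σ4.reg 42 = σ2.reg rE := (hf4.reg 42 rfl).trans g42
  have k54 : σ4.reg 54 = σ.reg rE := (hf4.reg 54 rfl).trans g54
  have k49 : σ5.reg 49 = σ3.reg rT := by simp [hσ5, run, hroot₂]
  have k43 : σ5.reg 43 = σ.reg rE := by simp [hσ5, run, k54]
  have k44 : σ5.reg 44 = σ2.reg rE := by simp [hσ5, run, k42]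
  have k46 : σ5.reg 46 = σ4.reg rE := by simp [hσ5, run]
  refine Spec.seqf (newP_spec (L := L) (c := c) (σ := σ5) (D := D₂) hb₂.trie hpos hkpos) ?_
  rintro σ6 hf6 ⟨D₃, hb₃, hroot₃, hrE, harr, hoff⟩
  have hE6 := hE5.frame hf6 rfl
  refine Spec.blockseq 2 ?_
  set σ7 := (assign 45 (reg rRoot)).run σ6 with hσ7
  have hE7 : Env L c σ7 := hE6.congr
  have hb₃' : Building L c (σ5.reg rT) (σ5.reg rE) [] D₃ σ7 := hb₃.congr
  have hle24 : MemLe σ2 σ7 := by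
    refine ⟨?_, fun i hi => ?_⟩
    · show σ2.reg rE ≤ σ6.reg rE
      rw [hrE]
      exact hle4.1
    · show σ6.arr aMEM i = _
      rw [harr]
      exact hle4.2 i hi
  have hne : σ3.reg rT ≠ σ5.reg rT := hb₂.ne_root
  have hgood₁ : ∀ x ∈ Y₁, Good L c x ∧ Sorted L x := fun x hx =>
    ⟨(hst₁ x ((hY₁ x).1 hx)).1, (hst₁ x ((hY₁ x).1 hx)).2.1⟩
  have hlen := length_enc hb₁.good
  have hmY₁ : At (σ2.arr aMEM) (σ.reg rE) (enc L Y₁) := hb₁.mem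
  have hlY₁ : σ2.reg rE = σ.reg rE + (enc L Y₁).length := hb₁.last
  have hlast : σ2.reg rE = σ.reg rE + Y₁.length * c := by
    rw [hb₁.last, hlen]; rfl
  have hYN : Y₁.length ≤ N := length_le_bound hL hc (hB₁.trans hBL) hBL hb₁.nodup fun y hy =>
    hst₁ y ((hY₁ y).1 hy)
  refine Spec.le (T := Y₁.length * (600 * (c * k * k)) + 3) ?_ (Nat.add_le_add_right (Nat.mul_le_mul_right _ hYN) _)
  have harr' : ∀ A, A = aBB ∨ A = aBU ∨ A = aPD → σ7.arr A = σ.arr A := by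
    intro A hA
    show σ6.arr A = _
    rw [harr]
    show σ4.arr A = _
    rcases hA with rfl | rfl | rfl <;> rw [hf4.arr _ rfl] <;> show σ2.arr _ = _ <;> rw [hf2.arr _ rfl] <;> rfl
  refine (selectP_spec hL hE7 hpos hkpos (B := B) (U := U) (P := P) (Y₂ := Y₂) (a := σ.reg rE)
    (harr' _ (Or.inl rfl) ▸ hB) (harr' _ (Or.inr (Or.inl rfl)) ▸ hU)
    (harr' _ (Or.inr (Or.inr rfl)) ▸ hP) hgood₁ hb₁.nodup hne hb₃'
    ((hf6.reg 49 rfl).trans k49) (by simp [hσ7, run, hroot₃]) ((hoff _ hne _).2 hb₂.isRoot)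
    (fun x hx => by rw [hoff _ hne, hb₂.dict x hx]) ((hf6.reg 43 rfl).trans k43)
    (hle24.at hmY₁ hlY₁.ge) ?_ ?_).mono ?_
  · show σ6.reg 44 = _
    rw [hf6.reg 44 rfl, k44, hlast]
  · show σ6.reg 44 ≤ σ7.reg rE
    rw [hf6.reg 44 rfl, k44]
    exact hle24.1
  rintro τ hfτ ⟨Y, D', hbY, hY, hleτ⟩
  have h46 : τ.reg 46 = σ5.reg rE := (hfτ.reg 46 rfl).trans ((hf6.reg 46 rfl).trans k46)
  refine ⟨?_, hbY.hasTrie, ?_⟩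
  · rw [h46]
    refine hbY.stored ?_ ?_
    · intro y hy
      obtain ⟨x, hx, -, -, rfl⟩ := (hY y).1 hy
      refine sorted_radix hL fun S hS => ?_
      obtain ⟨S', hS', rfl⟩ := mem_map.1 hS
      exact (Finset.filter_subset _ _).trans ((hgood₁ x hx).1.2 S' hS')
    intro s'
    simp only [Set.mem_ofPred_eq, hY]
    constructor
    · rintro ⟨s, ⟨s₁, hs₁, ho₁⟩, ⟨s₂, hs₂, ho₂⟩, hlab, hpd, rfl⟩
      have hcard := ho₁.card_eq (hf₁ s₁ hs₁).card
      obtain ⟨x, hxg, hxs, rfl⟩ := exists_sorted_of_card hL hcard (fun S hS a ha => hBL (by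
        rw [← Finset.mem_coe, ← hlab]; exact ⟨S, hS, ha⟩))
      obtain ⟨x₁, hx₁, rfl⟩ := (hX₁.mem s₁).1 hs₁
      obtain ⟨x₂, hx₂, rfl⟩ := (hX₂.mem s₂).1 hs₂
      refine ⟨_, ⟨x, ?_, ⟨usedBelow_of_labels hlab, ?_⟩, ?_, rfl⟩, coe_restrict⟩
      · rw [hY₁]
        exact (reach_iff hL (fun x hx => ⟨hX₁.good x hx, hX₁.sorted x hx⟩) hxg hxs hlab).2 ⟨x₁, hx₁, ho₁⟩
      · exact fun S hS a _ b _ ha hb => hpd S hS _ ha _ hb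
      · rw [hY₂]
        exact (reach_iff hL (fun x hx => ⟨hX₂.good x hx, hX₂.sorted x hx⟩) hxg hxs hlab).2 ⟨x₂, hx₂, ho₂⟩
    · rintro ⟨y, ⟨x, hx₁, ⟨hu, hpd⟩, hx₂, rfl⟩, rfl⟩
      rw [hY₁] at hx₁
      rw [hY₂] at hx₂
      obtain ⟨hxg, hxs, hst⟩ := hst₁ x hx₁
      have hlab := hst.labels_eq hB₁ hBL hu
      obtain ⟨x₁, hx₁, ho₁⟩ := (reach_iff hL (fun x hx => ⟨hX₁.good x hx, hX₁.sorted x hx⟩) hxg hxs hlab).1 hx₁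
      obtain ⟨x₂, hx₂, ho₂⟩ := (reach_iff hL (fun x hx => ⟨hX₂.good x hx, hX₂.sorted x hx⟩) hxg hxs hlab).1 hx₂
      refine ⟨x, ⟨x₁, (hX₁.mem _).2 ⟨x₁, hx₁, rfl⟩, ho₁⟩, ⟨x₂, (hX₂.mem _).2 ⟨x₂, hx₂, rfl⟩, ho₂⟩, hlab, ?_,
        coe_restrict⟩
      intro S hS a ha b hb
      have haL : a ∈ L := by simpa using hxg.2 S hS ha
      have hbL : b ∈ L := by simpa using hxg.2 S hS hb
      have := hpd S hS _ (idxOf_lt_length_iff.2 haL) _ (idxOf_lt_length_iff.2 hbL)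
      rw [lb_idxOf haL, lb_idxOf hbL] at this
      exact this ha hb
  · have : MemLe σ σ7 := by
      have e1 : MemLe σ σ2 := ⟨hle2.1, hle2.2⟩
      exact e1.trans hle24
    exact this.trans hleτ

/-! ## Output -/

notation "aLBL" => (2 : ℕ)

/-- The array `LBL` holds the labels. -/
def HasLabels (L : List ℕ) (σ : State) : Prop := ∀ a < L.length, σ.arr aLBL a = lb L a

/-- A list of sets of labels, written down. -/
def toSchemeList (L : List ℕ) (x : Tuple) : SchemeList := x.map (fun S => (1, L.filter (· ∈ S)))

theorem toScheme_toSchemeList (h : ∀ S ∈ x, S ⊆ L.toFinset) : (toSchemeList L x).toScheme = (x : Scheme) := by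
  rw [SchemeList.toScheme, toSchemeList, List.map_map]
  induction x with
  | nil => rfl
  | cons S x ih =>
    rw [List.map_cons, List.sum_cons, ih fun S hS => h S (List.mem_cons_of_mem _ hS), ← Multiset.cons_coe]
    have : (L.filter (· ∈ S)).toFinset = S := by
      ext a
      have : a ∈ S → a ∈ L := fun ha => by simpa using h S List.mem_cons_self ha
      simpa using this
    simp [this]

/-- Write the set with the number in register `36`. -/
def printSetP : Prog :=
  forLoop 37 rK (Prog.cond (eq (get aODD (reg 36)) (lit 1)) (write (lit 1) ;; write (get aLBL (reg 37))) skip ;;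
    assign 36 (get aROT (reg 36))) ;;
  write (lit 0)

/-- Write the schemes between the positions in the registers `43` and `44`. -/
def printP : Prog := Prog.loop (lt (reg 43) (reg 44)) (write (lit 1) ;;
    forLoop 35 rC (assign 36 (get aMEM (reg 43)) ;; inc 43 ;; write (lit 1) ;; write (lit 1) ;; printSetP) ;;
    write (lit 0)) ;;
  write (lit 0)

theorem printSetP_spec (hL : L.Nodup) (hE : Env L c σ) (hl : HasLabels L σ) (hS : S ⊆ L.toFinset) (h36 : σ.reg 36 = code
    L S) : Spec printSetP σ (L.length * 19 + 7) (fun τ => τ.out = σ.out ++ codeList (fun a => [a]) (L.filter (· ∈ S)))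
    := by
  refine Spec.le (T := (L.length * (13 + 6) + 5) + 2) ?_ (by omega)
  refine Spec.seqf (Spec.for 13 L.length (fun j τ => τ.reg 36 = rcode L j S ∧
    τ.out = σ.out ++ ((L.take j).filter (· ∈ S)).flatMap (fun a => [1, a])) hE.rk ?_ ?_) ?_
  · simpa [code] using h36
  · rintro j hj τ hf hrj ⟨h1, h2⟩
    have hE1 := hE.frame hf rfl
    have hodd := hE1.odd_rcode hL hS hj
    have hrot := hE1.rot_rcode hL hS hj
    have hlj : τ.arr aLBL j = lb L j := hf.arr aLBL rfl ▸ hl j hj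
    have htake : L.take (j + 1) = L.take j ++ [lb L j] := by
      rw [take_add_one, getElem?_eq_getElem hj, lb, List.getD_eq_getElem _ _ hj]; rfl
    refine Spec.block 13 ?_
    rw [htake, List.filter_append, flatMap_append]
    by_cases hm : lb L j ∈ S
    · rw [if_pos hm] at hodd
      simp [run, h1, h2, hrj, hodd, hrot, hlj, hm]
    · rw [if_neg hm] at hodd
      simp [run, h1, h2, hodd, hrot, hm]
  · rintro τ - ⟨-, -, h⟩
    refine Spec.block 2 ?_
    rw [List.take_length] at h
    simp [run, h, codeList]

theorem printP_spec (hL : L.Nodup) (hE : Env L c σ) (hpos : 0 < c) (hkpos : 0 < L.length) (hl : HasLabels L σ)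
    (hS : Stored L c 𝒮 (σ.reg 43) (σ.reg 44) σ) {N : ℕ} (hN : ∀ X, Rep L c 𝒮 X → X.length ≤ N) :
    Spec printP σ (60 * (N * (c * L.length)) + 5) (fun τ => ∃ l : List SchemeList,
      τ.out = σ.out ++ codeList SchemeList.code l ∧ {s : Scheme | s ∈ l.map SchemeList.toScheme} = 𝒮) := by
  obtain ⟨X, hX, hm, he, hle⟩ := hS
  have hXN := hN X hX
  have h2 : c ≤ c * L.length := Nat.le_mul_of_pos_right _ hkpos
  refine Spec.le (T := (X.length * ((2 + ((c * ((3 + (3 + (2 + (2 + (L.length * 19 + 7))))) + 6) + 5) + 2)) + 3) + 3) + 2) ?_ (by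
    have h4 : (2 + ((c * ((3 + (3 + (2 + (2 + (L.length * 19 + 7))))) + 6) + 5) + 2)) + 3 ≤ 60 * (c * L.length) := by
      nlinarith
    have h5 := Nat.mul_le_mul hXN h4
    have h6 : N * (60 * (c * L.length)) = 60 * (N * (c * L.length)) := by ring
    omega)
  refine Spec.seqf (Spec.rows (fun i τ => τ.out = σ.out ++
    ((X.take i).map (toSchemeList L)).flatMap (fun y => 1 :: SchemeList.code y)) _ X.length c (σ.reg 43) rfl hpos he rfl
    (by simp) ?_) ?_
  · intro i hi τ hf h43 hout
    obtain ⟨x, hx⟩ := exists_getElem? (l := X) hi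
    have hxg := hX.good x (mem_of_getElem? hx)
    have hE1 := hE.frame hf rfl
    have hmx : At (τ.arr aMEM) (σ.reg 43 + i * c) (x.map (code L)) := by
      rw [hf.arr aMEM rfl]; exact At.enc_get hX.good hm hx
    refine Spec.blockseq 2 ?_
    set τ1 := (write (lit 1)).run τ with hτ1
    have hE2 : Env L c τ1 := hE1.congr
    refine Spec.seqf (Spec.for (3 + (3 + (2 + (2 + (L.length * 19 + 7))))) c (fun j ρ =>
      ρ.reg 43 = σ.reg 43 + i * c + j ∧ ρ.out = τ.out ++ 1 :: (toSchemeList L (x.take j)).flatMap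
        (fun p => 1 :: p.1 :: codeList (fun a => [a]) p.2)) hE2.rc ?_ ?_) ?_
    · simpa [hτ1, run, toSchemeList] using h43
    · rintro j hj ρ hfρ hrj ⟨h1, h3⟩
      have hE3 := hE2.frame hfρ rfl
      obtain ⟨S, hSj, hSL⟩ := hxg.getElem? hj
      have hv : ρ.arr aMEM (σ.reg 43 + i * c + j) = code L S := hfρ.arr aMEM rfl ▸ hmx j _ (by simp [hSj])
      refine Spec.blockseq 3 (Spec.blockseq 3 (Spec.blockseq 2 (Spec.blockseq 2 ?_)))
      set ρ1 := (write (lit 1)).run ((write (lit 1)).run ((inc 43).run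
        ((assign 36 (get aMEM (reg 43))).run ρ))) with hρ1
      have hE4 : Env L c ρ1 := hE3.congr
      have hl1 : HasLabels L ρ1 := by
        intro a ha
        show ρ.arr aLBL a = _
        rw [hfρ.arr aLBL rfl]
        show τ.arr aLBL a = _
        rw [hf.arr aLBL rfl]
        exact hl a ha
      refine (printSetP_spec hL hE4 hl1 hSL (by simp [hρ1, run, inc, h1, hv])).mono ?_
      intro π hfπ hπ
      have htake : x.take (j + 1) = x.take j ++ [S] := by rw [take_add_one, hSj]; rfl
      have e43 : π.reg 43 = ρ1.reg 43 := hfπ.reg 43 rfl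
      refine ⟨?_, ?_⟩
      · simp [e43, hρ1, run, inc, h1]; ring
      · rw [htake]
        simp [hπ, hρ1, run, inc, h3, toSchemeList]
    · rintro ρ hfρ ⟨-, h1, h3⟩
      refine Spec.block 2 ⟨?_, ?_⟩
      · show ρ.reg 43 = _
        rw [h1]; ring
      · rw [take_of_length_le hxg.1.le] at h3
        rw [take_add_one, hx]
        simp [run, h3, hout, SchemeList.code, codeList]
  · rintro τ hf ⟨-, h⟩
    refine Spec.block 2 ⟨X.map (toSchemeList L), ?_, ?_⟩
    · rw [List.take_length] at h
      simp [run, h, codeList]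
    · ext s
      simp only [List.map_map, Set.mem_ofPred_eq, mem_map, Function.comp_apply, hX.mem]
      refine exists_congr fun x => and_congr_right fun hx => ?_
      rw [toScheme_toSchemeList (hX.good x hx).2]

/-! ## Formulas about tables -/

notation "aBASE" => (23 : ℕ)

/-- Formulas about registers and about arrays with two-dimensional blocks. -/
inductive Fml : Type
  /-- the entry `(x, y)` of block `i` of array `A` is `1` -/
  | atom (A i x y : ℕ) : Fml
  | eq (x y : ℕ) : Fml
  | not (φ : Fml) : Fml
  | and (φ ψ : Fml) : Fml
  | or (φ ψ : Fml) : Fml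
  | ex (r : ℕ) (φ : Fml) : Fml

/-- Register `60` becomes the address of the entry given by the registers `62` and `63` of the block
given by register `61`. -/
def addrP : Prog := assign 60 (get aBASE (reg 61)) ;; forLoop 64 62 (forLoop 65 rK (inc 60)) ;;
  forLoop 64 63 (inc 60)

namespace Fml

/-- The meaning of a formula. -/
def Sem (k : ℕ) (f : ℕ → ℕ → ℕ) : Fml → (ℕ → ℕ) → Prop
  | atom A i x y, ν => f A (f aBASE (ν i) + ν x * k + ν y) = 1
  | eq x y, ν => ν x = ν y
  | not φ, ν => ¬ φ.Sem k f ν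
  | and φ ψ, ν => φ.Sem k f ν ∧ ψ.Sem k f ν
  | or φ ψ, ν => φ.Sem k f ν ∨ ψ.Sem k f ν
  | ex r φ, ν => ∃ v < k, φ.Sem k f (update ν r v)

/-- May a formula at level `r` refer to register `s`? -/
def var (r s : ℕ) : Bool := Nat.blt s 60 || (Nat.ble 66 s && Nat.blt s r) || (Nat.ble 70 s && Nat.blt s 100)

/-- The quantified registers are `r`, `r + 1`, … up to `69`, by level. -/
def wf : ℕ → Fml → Bool
  | r, atom _ i x y => var r i && var r x && var r y
  | r, eq x y => var r x && var r y
  | r, not φ => φ.wf r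
  | r, and φ ψ => φ.wf r && ψ.wf r
  | r, or φ ψ => φ.wf r && ψ.wf r
  | r, ex s φ => Nat.beq s r && Nat.ble 66 s && Nat.blt s 70 && φ.wf (s + 1)

/-- The positions in blocks are in range. -/
def InRange (k : ℕ) : Fml → (ℕ → ℕ) → Prop
  | atom _ _ x y, ν => ν x < k ∧ ν y < k
  | eq _ _, _ => True
  | not φ, ν => φ.InRange k ν
  | and φ ψ, ν => φ.InRange k ν ∧ ψ.InRange k ν
  | or φ ψ, ν => φ.InRange k ν ∧ ψ.InRange k ν
  | ex r φ, ν => ∀ v < k, φ.InRange k (update ν r v)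

/-- Evaluate a formula; the truth value is put into register `100 + d`. -/
def prog : ℕ → Fml → Prog
  | d, atom A i x y => assign 61 (reg i) ;; assign 62 (reg x) ;; assign 63 (reg y) ;; addrP ;;
      Prog.cond (Test.eq (get A (reg 60)) (lit 1)) (assign (100 + d) (lit 1)) (assign (100 + d) (lit 0))
  | d, eq x y =>
      Prog.cond (Test.eq (reg x) (reg y)) (assign (100 + d) (lit 1)) (assign (100 + d) (lit 0))
  | d, not φ => φ.prog d ;;
      Prog.cond (Test.eq (reg (100 + d)) (lit 1)) (assign (100 + d) (lit 0)) (assign (100 + d) (lit 1))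
  | d, and φ ψ => φ.prog d ;; ψ.prog (d + 1) ;;
      Prog.cond (Test.eq (reg (100 + d)) (lit 1)) (assign (100 + d) (reg (100 + (d + 1)))) skip
  | d, or φ ψ => φ.prog d ;; ψ.prog (d + 1) ;;
      Prog.cond (Test.eq (reg (100 + d)) (lit 0)) (assign (100 + d) (reg (100 + (d + 1)))) skip
  | d, ex r φ => assign (100 + d) (lit 0) ;;
      forLoop r rK (φ.prog (d + 1) ;;
        Prog.cond (Test.eq (reg (100 + (d + 1))) (lit 1)) (assign (100 + d) (lit 1)) skip)

/-- The nesting depth of the quantifiers. -/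
def depth : Fml → ℕ
  | atom _ _ _ _ => 0
  | eq _ _ => 0
  | not φ => φ.depth
  | and φ ψ => max φ.depth ψ.depth
  | or φ ψ => max φ.depth ψ.depth
  | ex _ φ => φ.depth + 1

/-- A factor in the evaluation time. -/
def weight : Fml → ℕ
  | atom _ _ _ _ => 60
  | eq _ _ => 10
  | not φ => φ.weight + 10
  | and φ ψ => φ.weight + ψ.weight + 10
  | or φ ψ => φ.weight + ψ.weight + 10
  | ex _ φ => φ.weight + 30

theorem var_iff {r s : ℕ} : var r s = true ↔ s < 60 ∨ (66 ≤ s ∧ s < r) ∨ (70 ≤ s ∧ s < 100) := by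
  simp [var, or_assoc]

/-- The registers are divided up: those below 60 and from 70 to 99 belong to the caller, 60 to 65 to
the computation of addresses, 66 to 69 to the quantifiers, and those from 100 on hold truth values.
So subformulas do not disturb each other. -/
theorem prog_wr {φ : Fml} {r d s : ℕ} (h : φ.wf r = true) (hs : s < 60 ∨ (66 ≤ s ∧ s < r ∧ s < 70) ∨ (70 ≤ s ∧ s < 100 +
    d)) : (φ.prog d).wr s = false := by
  have h0 : ∀ m, m ≠ s → Nat.beq m s = false := fun m hmn => by
    rw [← Bool.not_eq_true, Nat.beq_eq]; exact hmn
  induction φ generalizing r d with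
  | atom A i x y =>
    simp only [prog, Prog.wr, addrP, forLoop, inc, Bool.or_eq_false_iff]
    refine ⟨?_, ?_, ?_, ⟨?_, ⟨?_, ⟨?_, ?_, ?_⟩, ?_⟩, ?_, ?_, ?_⟩, ?_, ?_⟩ <;> exact h0 _ (by omega)
  | eq x y =>
    simp only [prog, Prog.wr, Bool.or_eq_false_iff]
    exact ⟨h0 _ (by omega), h0 _ (by omega)⟩
  | not φ ih =>
    simp only [wf] at h
    simp only [prog, Prog.wr, Bool.or_eq_false_iff]
    exact ⟨ih h hs, h0 _ (by omega), h0 _ (by omega)⟩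
  | and φ ψ ih1 ih2 =>
    simp only [wf, Bool.and_eq_true] at h
    simp only [prog, Prog.wr, Bool.or_eq_false_iff]
    exact ⟨ih1 h.1 hs, ih2 h.2 (by omega), h0 _ (by omega), trivial⟩
  | or φ ψ ih1 ih2 =>
    simp only [wf, Bool.and_eq_true] at h
    simp only [prog, Prog.wr, Bool.or_eq_false_iff]
    exact ⟨ih1 h.1 hs, ih2 h.2 (by omega), h0 _ (by omega), trivial⟩
  | ex q φ ih =>
    simp only [wf, Bool.and_eq_true, Nat.beq_eq, Nat.ble_eq, Nat.blt_eq] at h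
    simp only [prog, Prog.wr, forLoop, Bool.or_eq_false_iff]
    exact ⟨h0 _ (by omega), h0 _ (by omega), ⟨ih h.2 (by omega), h0 _ (by omega), trivial⟩, h0 _ (by omega)⟩

theorem prog_wa {φ : Fml} {d A : ℕ} : (φ.prog d).wa A = false := by
  induction φ generalizing d <;> simp_all [prog, Prog.wa, addrP, forLoop, inc]

theorem sem_congr {φ : Fml} {k r : ℕ} {f : ℕ → ℕ → ℕ} {ν ν' : ℕ → ℕ} (h : φ.wf r = true) (hν : ∀ s, var r s = true → ν s
    = ν' s) : φ.Sem k f ν ↔ φ.Sem k f ν' := by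
  induction φ generalizing r ν ν' with
  | atom A i x y =>
    simp only [wf, Bool.and_eq_true] at h
    simp only [Sem, hν _ h.1.1, hν _ h.1.2, hν _ h.2]
  | eq x y =>
    simp only [wf, Bool.and_eq_true] at h
    simp only [Sem, hν _ h.1, hν _ h.2]
  | not φ ih => exact not_congr (ih h hν)
  | and φ ψ ih1 ih2 =>
    simp only [wf, Bool.and_eq_true] at h
    exact and_congr (ih1 h.1 hν) (ih2 h.2 hν)
  | or φ ψ ih1 ih2 =>
    simp only [wf, Bool.and_eq_true] at h
    exact or_congr (ih1 h.1 hν) (ih2 h.2 hν)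
  | ex q φ ih =>
    simp only [wf, Bool.and_eq_true, Nat.beq_eq, Nat.ble_eq, Nat.blt_eq] at h
    refine exists_congr fun v => and_congr_right fun _ => ih h.2 fun s hs => ?_
    by_cases hsq : s = q
    · simp [hsq]
    · rw [update_of_ne hsq, update_of_ne hsq]
      rw [var_iff] at hs
      exact hν s (var_iff.2 (by omega))

theorem inRange_congr {φ : Fml} {k r : ℕ} {ν ν' : ℕ → ℕ} (h : φ.wf r = true) (hν : ∀ s, var r s = true → ν s = ν' s) :
    φ.InRange k ν ↔ φ.InRange k ν' := by
  induction φ generalizing r ν ν' with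
  | atom A i x y =>
    simp only [wf, Bool.and_eq_true] at h
    simp only [InRange, hν _ h.1.2, hν _ h.2]
  | eq x y => exact Iff.rfl
  | not φ ih => exact ih h hν
  | and φ ψ ih1 ih2 =>
    simp only [wf, Bool.and_eq_true] at h
    exact and_congr (ih1 h.1 hν) (ih2 h.2 hν)
  | or φ ψ ih1 ih2 =>
    simp only [wf, Bool.and_eq_true] at h
    exact and_congr (ih1 h.1 hν) (ih2 h.2 hν)
  | ex q φ ih =>
    simp only [wf, Bool.and_eq_true, Nat.beq_eq, Nat.ble_eq, Nat.blt_eq] at h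
    refine forall_congr' fun v => imp_congr_right fun _ => ih h.2 fun s hs => ?_
    by_cases hsq : s = q
    · simp [hsq]
    · rw [update_of_ne hsq, update_of_ne hsq]
      rw [var_iff] at hs
      exact hν s (var_iff.2 (by omega))

end Fml

/-- Without multiplication the address has to be reached by counting, which takes time quadratic in
`k`. -/
theorem addrP_spec {k x y : ℕ} (hk : σ.reg rK = k) (h62 : σ.reg 62 = x) (h63 : σ.reg 63 = y) (hx : x < k) (hy : y < k) :
    Spec addrP σ (40 * k ^ 2) (fun τ => τ.reg 60 = σ.arr aBASE (σ.reg 61) + x * k + y) := by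
  refine Spec.le (T := 3 + ((x * ((k * (3 + 6) + 5) + 6) + 5) + (y * (3 + 6) + 5))) ?_ (by nlinarith)
  refine Spec.blockseq 3 ?_
  set σ1 := (assign 60 (get aBASE (reg 61))).run σ with hσ1
  refine Spec.seqf (Spec.for (k * (3 + 6) + 5) x (fun i τ => τ.reg 60 = σ.arr aBASE (σ.reg 61) + i * k)
    (by simpa [hσ1, run] using h62) (by simp [hσ1, run]) ?_) ?_
  · intro i hi τ hf hri h
    have hkτ : τ.reg rK = k := (hf.reg _ rfl).trans (by simpa [hσ1, run] using hk)
    refine (Spec.for 3 k (fun j ρ => ρ.reg 60 = σ.arr aBASE (σ.reg 61) + i * k + j) hkτ (by simpa using h) ?_).mono ?_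
    · intro j hj ρ hfρ hrj h'
      refine Spec.block 3 ?_
      simp [run, inc, h', add_assoc]
    · rintro ρ - ⟨-, h'⟩
      simp [h']; ring
  · rintro τ hf ⟨-, h⟩
    have h63τ : τ.reg 63 = y := (hf.reg _ rfl).trans (by simpa [hσ1, run] using h63)
    refine (Spec.for 3 y (fun j ρ => ρ.reg 60 = σ.arr aBASE (σ.reg 61) + x * k + j) h63τ (by simpa using h) ?_).mono ?_
    · intro j hj ρ hfρ hrj h'
      refine Spec.block 3 ?_
      simp [run, inc, h', add_assoc]
    · rintro ρ - ⟨-, h'⟩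
      exact h'

namespace Fml

theorem frame_reg {φ : Fml} {r d : ℕ} (h : φ.wf r = true) (hr : r ≤ 70) (hf : Frame (φ.prog d) σ τ) {s : ℕ} (hs : var r
    s = true) : τ.reg s = σ.reg s := by
  rw [var_iff] at hs
  exact hf.reg s (prog_wr h (by omega))

open Classical in
-- An atom costs `k ^ 2` because of its address, and each quantifier multiplies the time by `k`.
theorem prog_spec {φ : Fml} {k r d : ℕ} (hkpos : 0 < k) (h : φ.wf r = true) (hr : r ≤ 70) (hk : σ.reg rK = k) (hR :
    φ.InRange k σ.reg) : Spec (φ.prog d) σ (φ.weight * k ^ (φ.depth + 2)) (fun τ => τ.reg (100 + d) = if φ.Sem k σ.arr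
    σ.reg then 1 else 0) := by
  have hpow : ∀ n, 1 ≤ k ^ n := fun n => Nat.one_le_pow _ _ hkpos
  induction φ generalizing r d σ with
  | atom A i x y =>
    simp only [wf, Bool.and_eq_true, var_iff] at h
    refine Spec.le (T := 2 + (2 + (2 + (40 * k ^ 2 + 6)))) ?_ (by
      have := hpow 2; simp only [weight, depth, Nat.zero_add]; omega)
    refine Spec.blockseq 2 (Spec.blockseq 2 (Spec.blockseq 2 ?_))
    set σ1 := (assign 63 (reg y)).run ((assign 62 (reg x)).run ((assign 61 (reg i)).run σ)) with hσ1
    have e61 : σ1.reg 61 = σ.reg i := by simp [hσ1, run]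
    have e62 : σ1.reg 62 = σ.reg x := by
      have : x ≠ 61 := by omega
      simp [hσ1, run, this]
    have e63 : σ1.reg 63 = σ.reg y := by
      have h1 : y ≠ 61 := by omega
      have h2 : y ≠ 62 := by omega
      simp [hσ1, run, h1, h2]
    refine Spec.seqf (addrP_spec (σ := σ1) (by simpa [hσ1, run] using hk) e62 e63 hR.1 hR.2) ?_
    intro τ hf h60
    refine Spec.block 6 ?_
    have harr : τ.arr = σ.arr := funext fun A => hf.arr A rfl
    simp only [Sem]
    rw [e61] at h60
    have h60' : τ.reg 60 = σ.arr aBASE (σ.reg i) + σ.reg x * k + σ.reg y := h60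
    by_cases hs : σ.arr A (σ.arr aBASE (σ.reg i) + σ.reg x * k + σ.reg y) = 1 <;> simp [run, h60', harr, hs]
  | eq x y =>
    refine Spec.le (T := 5) ?_ (by have := hpow 2; simp only [weight, depth, Nat.zero_add]; omega)
    refine Spec.block 5 ?_
    by_cases hs : σ.reg x = σ.reg y <;> simp [run, prog, Sem, hs]
  | not φ ih =>
    refine Spec.le (T := φ.weight * k ^ (φ.depth + 2) + 5) ?_ (by
      have := hpow (φ.depth + 2); simp only [weight, depth]; nlinarith)
    refine Spec.seqf (ih h hr hk hR) ?_
    intro τ hf h1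
    refine Spec.block 5 ?_
    simp only [run, Holds, eval, Sem, h1]
    split_ifs <;> simp_all
  | and φ ψ ih1 ih2 =>
    simp only [wf, Bool.and_eq_true] at h
    refine Spec.le (T := φ.weight * k ^ (φ.depth + 2) + (ψ.weight * k ^ (ψ.depth + 2) + 5)) ?_ (by
      have h1 := Nat.mul_le_mul_left φ.weight
        (Nat.pow_le_pow_right hkpos (show φ.depth + 2 ≤ max φ.depth ψ.depth + 2 by omega))
      have h2 := Nat.mul_le_mul_left ψ.weight
        (Nat.pow_le_pow_right hkpos (show ψ.depth + 2 ≤ max φ.depth ψ.depth + 2 by omega))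
      have := hpow (max φ.depth ψ.depth + 2)
      simp only [weight, depth]; nlinarith)
    refine Spec.seqf (ih1 h.1 hr hk hR.1) ?_
    intro τ hf h1
    have hν : ∀ s, var r s = true → σ.reg s = τ.reg s := fun s hs => (frame_reg h.1 hr hf hs).symm
    have harr : τ.arr = σ.arr := funext fun A => hf.arr A prog_wa
    refine Spec.seqf (ih2 (σ := τ) h.2 hr ((hf.reg _ (prog_wr h.1 (Or.inl (by norm_num)))).trans hk)
      ((inRange_congr h.2 hν).1 hR.2)) ?_
    intro ρ hfρ h2
    rw [harr, ← sem_congr h.2 hν] at h2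
    have h1' : ρ.reg (100 + d) = _ := (hfρ.reg _ (prog_wr h.2 (by omega))).trans h1
    refine Spec.block 5 ?_
    simp only [run, Holds, eval, Sem, h1']
    by_cases hs1 : φ.Sem k σ.arr σ.reg <;> simp [hs1, h1', h2]
  | or φ ψ ih1 ih2 =>
    simp only [wf, Bool.and_eq_true] at h
    refine Spec.le (T := φ.weight * k ^ (φ.depth + 2) + (ψ.weight * k ^ (ψ.depth + 2) + 5)) ?_ (by
      have h1 := Nat.mul_le_mul_left φ.weight
        (Nat.pow_le_pow_right hkpos (show φ.depth + 2 ≤ max φ.depth ψ.depth + 2 by omega))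
      have h2 := Nat.mul_le_mul_left ψ.weight
        (Nat.pow_le_pow_right hkpos (show ψ.depth + 2 ≤ max φ.depth ψ.depth + 2 by omega))
      have := hpow (max φ.depth ψ.depth + 2)
      simp only [weight, depth]; nlinarith)
    refine Spec.seqf (ih1 h.1 hr hk hR.1) ?_
    intro τ hf h1
    have hν : ∀ s, var r s = true → σ.reg s = τ.reg s := fun s hs => (frame_reg h.1 hr hf hs).symm
    have harr : τ.arr = σ.arr := funext fun A => hf.arr A prog_wa
    refine Spec.seqf (ih2 (σ := τ) h.2 hr ((hf.reg _ (prog_wr h.1 (Or.inl (by norm_num)))).trans hk)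
      ((inRange_congr h.2 hν).1 hR.2)) ?_
    intro ρ hfρ h2
    rw [harr, ← sem_congr h.2 hν] at h2
    have h1' : ρ.reg (100 + d) = _ := (hfρ.reg _ (prog_wr h.2 (by omega))).trans h1
    refine Spec.block 5 ?_
    simp only [run, Holds, eval, Sem, h1']
    by_cases hs1 : φ.Sem k σ.arr σ.reg <;> simp [hs1, h1', h2]
  | ex q φ ih =>
    simp only [wf, Bool.and_eq_true, Nat.beq_eq, Nat.ble_eq, Nat.blt_eq] at h
    obtain ⟨⟨⟨hq1, hq2⟩, hq3⟩, hwf⟩ := h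
    refine Spec.le (T := 2 + (k * ((φ.weight * k ^ (φ.depth + 2) + 6) + 6) + 5)) ?_ (by
      have h1 := hpow (φ.depth + 2)
      have h2 : k ≤ k ^ (φ.depth + 3) := Nat.le_self_pow (by omega) k
      have h3 : k * k ^ (φ.depth + 2) = k ^ (φ.depth + 3) := by ring
      simp only [weight, depth]
      rw [show φ.depth + 1 + 2 = φ.depth + 3 by ring]
      nlinarith)
    refine Spec.blockseq 2 ?_
    set σ1 := (assign (100 + d) (lit 0)).run σ with hσ1
    have hk1 : σ1.reg rK = k := by
      have : (1 : ℕ) ≠ 100 + d := by omega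
      simpa [hσ1, run, this] using hk
    have hbody : ∀ s, (s < 60 ∨ (66 ≤ s ∧ s < q + 1 ∧ s < 70) ∨ (70 ≤ s ∧ s < 100 + d)) →
        (φ.prog (d + 1) ;; Prog.cond (Test.eq (reg (100 + (d + 1))) (lit 1)) (assign (100 + d) (lit 1))
          Prog.skip).wr s = false := by
      intro s hs
      simp only [Prog.wr, prog_wr hwf (d := d + 1) (s := s) (by omega), Bool.or_false, Bool.false_or]
      rw [← Bool.not_eq_true, Nat.beq_eq]; omega
    have hν1 : ∀ s, var r s = true → σ.reg s = σ1.reg s := by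
      intro s hs
      rw [var_iff] at hs
      have : s ≠ 100 + d := by omega
      simp [hσ1, run, this]
    refine (Spec.for (φ.weight * k ^ (φ.depth + 2) + 6) k (fun j τ => τ.reg (100 + d) =
      if ∃ v < j, φ.Sem k σ.arr (update σ.reg q v) then 1 else 0) hk1 ?_ ?_
      (by rw [← Bool.not_eq_true, Nat.beq_eq]; omega) (hbody _ (by omega)) (hbody _ (by omega))).mono ?_
    · have : 100 + d ≠ q := by omega
      simp [hσ1, run, this]
    · intro j hj τ hf hrj h1
      have hτ : ∀ s, (s < 60 ∨ (66 ≤ s ∧ s < q ∧ s < 70) ∨ (70 ≤ s ∧ s < 100 + d)) → τ.reg s = σ1.reg s := by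
        intro s hs
        refine hf.reg s ?_
        have := hbody s (by omega)
        have hb : Nat.beq q s = false := by rw [← Bool.not_eq_true, Nat.beq_eq]; omega
        unfold forLoop
        simp only [Prog.wr] at this ⊢
        simpa [hb] using this
      have hν : ∀ s, var (q + 1) s = true → update σ.reg q j s = τ.reg s := by
        intro s hs
        rw [var_iff] at hs
        by_cases hsq : s = q
        · simp [hsq, hrj]
        · rw [update_of_ne hsq, hτ s (by omega)]
          have : s ≠ 100 + d := by omega
          simp [hσ1, run, this]
      have harr : τ.arr = σ.arr := funext fun A => by
        rw [hf.arr A (by simp [forLoop, Prog.wa, prog_wa])]; rfl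
      refine Spec.seqf (ih (σ := τ) hwf (by omega) ((hτ _ (Or.inl (by norm_num))).trans
        hk1) ((inRange_congr hwf hν).1 (hR j hj))) ?_
      intro ρ hfρ h2
      rw [harr, ← sem_congr hwf hν] at h2
      have h1' : ρ.reg (100 + d) = _ := (hfρ.reg _ (prog_wr hwf (by omega))).trans h1
      refine Spec.block 6 ?_
      have hne : 100 + d ≠ q := by omega
      have hstep : (∃ v < j + 1, φ.Sem k σ.arr (update σ.reg q v)) ↔
          (∃ v < j, φ.Sem k σ.arr (update σ.reg q v)) ∨ φ.Sem k σ.arr (update σ.reg q j) := by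
        constructor
        · rintro ⟨v, hv, hs⟩
          rcases Nat.lt_succ_iff_lt_or_eq.1 hv with h | rfl
          · exact Or.inl ⟨v, h, hs⟩
          · exact Or.inr hs
        · rintro (⟨v, hv, hs⟩ | hs)
          · exact ⟨v, by omega, hs⟩
          · exact ⟨j, by omega, hs⟩
      refine Eq.trans ?_ (if_congr (P := (∃ v < j, φ.Sem k σ.arr (update σ.reg q v)) ∨
        φ.Sem k σ.arr (update σ.reg q j)) hstep.symm rfl rfl)
      by_cases hs1 : φ.Sem k σ.arr (update σ.reg q j) <;>
        simp only [run, Holds, eval, h2, hs1, if_true, if_false, or_true, or_false, State.setR_reg, hne,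
          zero_ne_one, h1']
    · rintro τ - ⟨-, h1⟩
      rw [h1]
      exact if_congr Iff.rfl rfl rfl

end Fml

/-- Fill the block of the array `A` given by the register `i`: the entry at `(x, y)` becomes the truth
value of `φ`, for `x` in register `56` and `y` in register `57`. -/
def fillP (A i : ℕ) (φ : Fml) : Prog :=
  forLoop 56 rK (forLoop 57 rK (φ.prog 0 ;; assign 61 (reg i) ;; assign 62 (reg 56) ;; assign 63 (reg 57) ;;
    addrP ;; store A (reg 60) (reg 100)))

theorem fillP_wa {A i A' : ℕ} {φ : Fml} (h : A' ≠ A) : (fillP A i φ).wa A' = false := by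
  have h0 : Nat.beq A A' = false := by
    rw [← Bool.not_eq_true, Nat.beq_eq]; exact h.symm
  simp [fillP, forLoop, Prog.wa, addrP, inc, Fml.prog_wa, h0]

/-- The registers, with the position in a block. -/
def atPos (ν : ℕ → ℕ) (x y : ℕ) : ℕ → ℕ := update (update ν 56 x) 57 y

theorem lt_of_block {k x y : ℕ} (hx : x < k) (hy : y < k) : x * k + y < k * k := by nlinarith

theorem block_inj {k x y x' y' : ℕ} (hy : y < k) (hy' : y' < k) (h : x * k + y = x' * k + y') : x = x' ∧ y = y' := by
  have h1 : (x * k + y) / k = x := by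
    rw [mul_comm, Nat.mul_add_div (by omega), Nat.div_eq_of_lt hy, add_zero]
  have h2 : (x' * k + y') / k = x' := by
    rw [mul_comm, Nat.mul_add_div (by omega), Nat.div_eq_of_lt hy', add_zero]
  have h3 : x = x' := by rw [← h1, h, h2]
  subst h3
  exact ⟨rfl, by omega⟩

open Classical in
-- The table changes while the formula is being evaluated on it. By `hφ` the meaning of the formula
-- must not depend on the block under construction, which is the only thing that changes.
theorem fillP_spec {A i k : ℕ} {φ : Fml} (h : φ.wf 66 = true) (hA : A ≠ aBASE) (hi : i < 56 ∨ (70 ≤ i ∧ i < 100)) (hk :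
    σ.reg rK = k) (hkpos : 0 < k) (hR : ∀ x < k, ∀ y < k, φ.InRange k (atPos σ.reg x y)) (hφ : ∀ f : ℕ → ℕ → ℕ, (∀ A' ≠
    A, f A' = σ.arr A') → (∀ n, n < σ.arr aBASE (σ.reg i) ∨ σ.arr aBASE (σ.reg i) + k * k ≤ n → f A n = σ.arr A n) → ∀ x
    < k, ∀ y < k, (φ.Sem k f (atPos σ.reg x y) ↔ φ.Sem k σ.arr (atPos σ.reg x y))) : Spec (fillP A i φ) σ ((φ.weight +
    80) * k ^ (φ.depth + 4)) (fun τ => (∀ x < k, ∀ y < k, τ.arr A (σ.arr aBASE (σ.reg i) + x * k + y) = if φ.Sem k σ.arr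
    (atPos σ.reg x y) then 1 else 0) ∧ ∀ n, n < σ.arr aBASE (σ.reg i) ∨ σ.arr aBASE (σ.reg i) + k * k ≤ n → τ.arr A n =
    σ.arr A n) := by
  set b := σ.arr aBASE (σ.reg i) with hb
  have h0 : ∀ m s : ℕ, m ≠ s → Nat.beq m s = false := fun m s hmn => by
    rw [← Bool.not_eq_true, Nat.beq_eq]; exact hmn
  set Ti := φ.weight * k ^ (φ.depth + 2) + (2 + (2 + (2 + (40 * k ^ 2 + 3)))) with hTi
  refine Spec.le (T := k * ((k * (Ti + 6) + 5) + 6) + 5) ?_ (by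
    have h1 : 1 ≤ k ^ (φ.depth + 2) := Nat.one_le_pow _ _ hkpos
    have h2 : k ^ 2 ≤ k ^ (φ.depth + 2) := Nat.pow_le_pow_right hkpos (by omega)
    have h3 : Ti ≤ (φ.weight + 50) * k ^ (φ.depth + 2) := by rw [hTi]; nlinarith
    have h4 : k ≤ k * k := Nat.le_mul_of_pos_left _ hkpos
    have h5 : k * k * 1 ≤ k * k * k ^ (φ.depth + 2) := Nat.mul_le_mul_left _ h1
    have h6 : k * k * Ti ≤ k * k * ((φ.weight + 50) * k ^ (φ.depth + 2)) := Nat.mul_le_mul_left _ h3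
    have h7 : k ^ (φ.depth + 4) = k * k * k ^ (φ.depth + 2) := by ring
    rw [h7]
    nlinarith)
  set body := φ.prog 0 ;; assign 61 (reg i) ;; assign 62 (reg 56) ;; assign 63 (reg 57) ;;
    addrP ;; store A (reg 60) (reg 100) with hbody
  have hw : ∀ s, s < 60 ∨ (70 ≤ s ∧ s < 100) → body.wr s = false := by
    intro s hs
    have h1 := Fml.prog_wr h (d := 0) (s := s) (by omega)
    simp only [hbody, forLoop, Prog.wr, addrP, inc, h1, Bool.or_eq_false_iff]
    simp only [h0 60 s (by omega), h0 61 s (by omega), h0 62 s (by omega),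
      h0 63 s (by omega), h0 64 s (by omega), h0 65 s (by omega), and_self]
  have hwo : ∀ A' ≠ A, body.wa A' = false := by
    intro A' hA'
    simp [hbody, forLoop, Prog.wa, addrP, inc, Fml.prog_wa, h0 A A' hA'.symm]
  set I : ℕ → ℕ → State → Prop := fun p q τ => (∀ x < k, ∀ y < k, x < p ∨ x = p ∧ y < q →
      τ.arr A (b + x * k + y) = if φ.Sem k σ.arr (atPos σ.reg x y) then 1 else 0) ∧
      (∀ n, n < b ∨ b + k * k ≤ n → τ.arr A n = σ.arr A n) with hI
  have hIarr : ∀ p q τ τ', τ'.arr = τ.arr → I p q τ → I p q τ' := by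
    rintro p q τ τ' ha ⟨h1, h2⟩
    exact ⟨fun x hx y hy hxy => by rw [ha]; exact h1 x hx y hy hxy, fun n hn => by rw [ha]; exact h2 n hn⟩
  have h2 : (forLoop 57 rK body).wr rK = false := by
    simp [forLoop, Prog.wr, hw 1 (by omega)]; decide
  have h3 : (forLoop 57 rK body).wr 56 = false := by
    simp [forLoop, Prog.wr, hw 56 (by omega)]; decide
  refine (Spec.for (k * (Ti + 6) + 5) k (fun p τ => I p 0 τ) hk ?_ ?_ rfl h2 h3).mono ?_
  · exact ⟨fun x _ y _ hxy => by omega, fun n _ => rfl⟩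
  · intro p hp τ hf hrp hIp
    have hkτ : τ.reg rK = k := (hf.reg _ (by simp [forLoop, Prog.wr, hw 1 (by omega)]; decide)).trans hk
    refine (Spec.for Ti k (fun q ρ => I p q ρ) hkτ (hIarr _ _ _ _ rfl hIp) ?_ rfl
      (hw _ (by omega)) (hw _ (by omega))).mono ?_
    · intro q hq ρ hfρ hrq hIq
      have hreg : ∀ s, s < 56 ∨ s = 58 ∨ s = 59 ∨ (70 ≤ s ∧ s < 100) → ρ.reg s = σ.reg s := by
        intro s hs
        rw [hfρ.reg s, hf.reg s]
        · simp [forLoop, Prog.wr, hw s (by omega), h0 56 s (by omega), h0 57 s (by omega)]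
        · simp [forLoop, Prog.wr, hw s (by omega), h0 57 s (by omega)]
      have h56 : ρ.reg 56 = p := (hfρ.reg 56 h3).trans hrp
      have hν : ∀ s, Fml.var 66 s = true → atPos σ.reg p q s = ρ.reg s := by
        intro s hs
        rw [Fml.var_iff] at hs
        unfold atPos
        by_cases hs7 : s = 57
        · subst hs7; simp [hrq]
        by_cases hs6 : s = 56
        · subst hs6; simp [h56]
        rw [update_of_ne hs7, update_of_ne hs6, hreg s (by omega)]
      have harr : ∀ A' ≠ A, ρ.arr A' = σ.arr A' := by
        intro A' hA'
        rw [hfρ.arr A' (by simp [forLoop, Prog.wa, hwo A' hA']), hf.arr A' (by simp [forLoop, Prog.wa, hwo A' hA'])]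
      refine Spec.seqf (Fml.prog_spec hkpos h (by norm_num) ((hreg 1 (by omega)).trans hk)
        ((Fml.inRange_congr h hν).1 (hR p hp q hq))) ?_
      intro π hfπ h100
      rw [← Fml.sem_congr h hν, hφ ρ.arr harr hIq.2 p hp q hq] at h100
      refine Spec.blockseq 2 (Spec.blockseq 2 (Spec.blockseq 2 ?_))
      have hπ : ∀ s, s < 60 ∨ (70 ≤ s ∧ s < 100) → π.reg s = ρ.reg s := fun s hs =>
        hfπ.reg s (Fml.prog_wr h (by omega))
      set π1 := (assign 63 (reg 57)).run ((assign 62 (reg 56)).run ((assign 61 (reg i)).run π)) with hπ1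
      have e61 : π1.reg 61 = σ.reg i := by
        simp [hπ1, run, hπ i (by omega), hreg i (by omega)]
      have e62 : π1.reg 62 = p := by simp [hπ1, run, hπ 56 (by omega), h56]
      have e63 : π1.reg 63 = q := by simp [hπ1, run, hπ 57 (by omega), hrq]
      have e1 : π1.reg rK = k := by
        simp [hπ1, run, hπ 1 (by omega), hreg 1 (by omega), hk]
      have earr : π1.arr = ρ.arr := funext fun A' => hfπ.arr A' Fml.prog_wa
      refine Spec.seqf (addrP_spec e1 e62 e63 hp hq) ?_
      intro χ hfχ h60
      refine Spec.block 3 ?_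
      have hχ : χ.arr = ρ.arr := by
        rw [← earr]; exact funext fun A' => hfχ.arr A' rfl
      have h100' : χ.reg 100 = if φ.Sem k σ.arr (atPos σ.reg p q) then 1 else 0 := hfχ.reg 100 rfl ▸ h100
      have hv : χ.reg 60 = b + p * k + q := by
        rw [h60, earr, harr _ hA.symm, e61]
      have hst : ∀ n, ((store A (reg 60) (reg 100)).run χ).arr A n =
          if n = b + p * k + q then (if φ.Sem k σ.arr (atPos σ.reg p q) then 1 else 0) else ρ.arr A n := by
        intro n
        simp only [run, eval, State.setA_arr, if_true, hv, h100', hχ, update_apply]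
      refine ⟨fun x hx y hy hxy => ?_, fun n hn => ?_⟩
      · simp only [State.setR_arr]
        rw [hst]
        by_cases hn : b + x * k + y = b + p * k + q
        · obtain ⟨rfl, rfl⟩ := block_inj hy hq (show x * k + y = p * k + q by omega)
          rw [if_pos rfl]
        · have hne : ¬ (x = p ∧ y = q) := by rintro ⟨rfl, rfl⟩; exact hn rfl
          rw [if_neg hn, hIq.1 x hx y hy (by omega)]
      · simp only [State.setR_arr]
        rw [hst, if_neg (by have := lt_of_block hp hq; omega)]
        exact hIq.2 n hn
    · rintro ρ - ⟨-, hI'⟩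
      refine ⟨fun x hx y hy hxy => hI'.1 x hx y hy (by omega), hI'.2⟩
  · rintro τ - ⟨-, hI'⟩
    exact ⟨fun x hx y hy => hI'.1 x hx y hy (Or.inl hx), hI'.2⟩

/-! ## Tables for the occurrences -/

notation "aNF" => (5 : ℕ)
notation "aPM" => (6 : ℕ)
notation "aLEFT" => (7 : ℕ)
notation "aOP" => (20 : ℕ)
notation "aX" => (21 : ℕ)
notation "aY" => (22 : ℕ)

open Classical in
/-- Block `i` of a table holds the characteristic function of `R`. -/
def HasBlock (L : List ℕ) (g : ℕ → ℕ) (i : ℕ) (R : ℕ → ℕ → Prop) : Prop := ∀ x < L.length, ∀ y < L.length,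
    g (i * (L.length * L.length) + x * L.length + y) = if R (lb L x) (lb L y) then 1 else 0

theorem HasBlock.iff {f : ℕ → ℕ → ℕ} {A i : ℕ} {R : ℕ → ℕ → Prop} (h : HasBlock L (f A) i R) (hb : f aBASE i = i *
    (L.length * L.length)) {x y : ℕ} (hx : x < L.length) (hy : y < L.length) : f A (f aBASE i + x * L.length + y) = 1 ↔
    R (lb L x) (lb L y) := by
  rw [hb, h x hx y hy]
  split_ifs with h1 <;> simp [h1]

open Classical in
theorem fillP_block {A i : ℕ} {φ : Fml} (h : φ.wf 66 = true) (hA : A ≠ aBASE) (hi : i < 56 ∨ (70 ≤ i ∧ i < 100)) (hkpos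
    : 0 < L.length) (hk : σ.reg rK = L.length) {j : ℕ} (hj : σ.reg i = j) (hb : σ.arr aBASE j = j * (L.length *
    L.length)) (hR : ∀ x < L.length, ∀ y < L.length, φ.InRange L.length (atPos σ.reg x y)) {R : ℕ → ℕ → Prop} (hφ : ∀ f
    : ℕ → ℕ → ℕ, (∀ A' ≠ A, f A' = σ.arr A') → (∀ j' ≠ j, ∀ R', HasBlock L (σ.arr A) j' R' → HasBlock L (f A) j' R') → ∀
    x < L.length, ∀ y < L.length, (φ.Sem L.length f (atPos σ.reg x y) ↔ R (lb L x) (lb L y))) : Spec (fillP A i φ) σ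
    ((φ.weight + 80) * L.length ^ (φ.depth + 4)) (fun τ => HasBlock L (τ.arr A) j R ∧ ∀ j' ≠ j, ∀ R', HasBlock L (σ.arr
    A) j' R' → HasBlock L (τ.arr A) j' R') := by
  set k := L.length with hkL
  -- Different blocks are disjoint intervals of length `k * k`.
  have hoff : ∀ g : ℕ → ℕ, (∀ n, n < j * (k * k) ∨ j * (k * k) + k * k ≤ n → g n = σ.arr A n) →
      ∀ j' ≠ j, ∀ R', HasBlock L (σ.arr A) j' R' → HasBlock L g j' R' := by
    intro g hg j' hj' R' hR' x hx y hy
    rw [hg, hR' x hx y hy]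
    have h1 := lt_of_block hx hy
    rcases Nat.lt_or_gt_of_ne hj' with h2 | h2
    · left
      have : (j' + 1) * (k * k) ≤ j * (k * k) := Nat.mul_le_mul_right _ h2
      rw [← hkL] at h1 ⊢
      nlinarith
    · right
      have : (j + 1) * (k * k) ≤ j' * (k * k) := Nat.mul_le_mul_right _ h2
      rw [← hkL]
      nlinarith
  have hb' : σ.arr aBASE (σ.reg i) = j * (k * k) := by rw [hj, hb]
  have h1 := hφ σ.arr (fun _ _ => rfl) (fun _ _ _ h => h)
  refine (fillP_spec h hA hi hk hkpos hR ?_).mono ?_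
  · intro f hf hf' x hx y hy
    rw [hb'] at hf'
    rw [h1 x hx y hy]
    exact hφ f hf (hoff _ hf') x hx y hy
  · rintro τ - ⟨h2, h3⟩
    rw [hb'] at h2 h3
    refine ⟨fun x hx y hy => ?_, hoff _ h3⟩
    rw [h2 x hx y hy]
    exact if_congr (h1 x hx y hy) rfl rfl

/-- The symbol at position `i` is recorded. -/
def Recorded (L : List ℕ) (σ : State) (i : ℕ) (s : CWTerm) : Prop :=
  σ.arr aOP i = s.symbol ∧ ∀ j a, s.symbolLabels[j]? = some a → a ∈ L ∧ σ.arr (aX + j) i = L.idxOf a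

/-- The term is recorded. -/
structure Layout {V : Type} (L : List ℕ) (l : OccList V) (σ : State) : Prop where
  nodup : L.Nodup
  pos : 0 < L.length
  labels : ∀ o ∈ l, o.1.labels ⊆ L.toFinset
  order : Postorder l
  rk : σ.reg rK = L.length
  rm : σ.reg rM = l.length
  node : ∀ i o, l[i]? = some o → Recorded L σ i o.1
  base : ∀ i < l.length, σ.arr aBASE i = i * (L.length * L.length)
  left : ∀ i s₁ s₂ e, l[i]? = some ⟨union s₁ s₂, e⟩ → σ.arr aLEFT i = i - 1 - s₂.size

/-- Does a program keep the records? -/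
def Prog.keeps (p : Prog) : Bool := !(p.wr rK) && !(p.wr rM) && !(p.wa aOP) && !(p.wa aX) && !(p.wa aY) &&
  !(p.wa aBASE) && !(p.wa aLEFT)

section
variable {V : Type} {l : OccList V} {i : ℕ}

theorem Recorded.congr {s : CWTerm} (h : Recorded L σ i s) (h1 : τ.arr aOP = σ.arr aOP) (h2 : τ.arr aX = σ.arr aX) (h3 :
    τ.arr aY = σ.arr aY) : Recorded L τ i s := by
  refine ⟨by rw [h1]; exact h.1, fun j a hj => ⟨(h.2 j a hj).1, ?_⟩⟩
  have hj2 : j < 2 := by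
    have := getElem?_lt hj
    cases s <;> simp [symbolLabels] at this <;> omega
  interval_cases j
  · rw [show aX + 0 = aX from rfl, h2]; exact (h.2 _ a hj).2
  · rw [show aX + 1 = aY from rfl, h3]; exact (h.2 _ a hj).2

theorem Layout.congr (h : Layout L l σ) (h1 : τ.reg rK = σ.reg rK := by rfl) (h2 : τ.reg rM = σ.reg rM := by rfl)
    (h3 : τ.arr aOP = σ.arr aOP := by rfl) (h4 : τ.arr aX = σ.arr aX := by rfl) (h5 : τ.arr aY = σ.arr aY := by rfl)
    (h6 : τ.arr aBASE = σ.arr aBASE := by rfl) (h7 : τ.arr aLEFT = σ.arr aLEFT := by rfl) : Layout L l τ :=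
  ⟨h.nodup, h.pos, h.labels, h.order, h1.trans h.rk, h2.trans h.rm,
    fun i o hi => (h.node i o hi).congr h3 h4 h5, by rw [h6]; exact h.base, by rw [h7]; exact h.left⟩

theorem Layout.frame (h : Layout L l σ) {p : Prog} (hf : Frame p σ τ) (hp : p.keeps = true) : Layout L l τ := by
  simp only [Prog.keeps, Bool.and_eq_true, Bool.not_eq_true'] at hp
  obtain ⟨⟨⟨⟨⟨⟨h1, h2⟩, h3⟩, h4⟩, h5⟩, h6⟩, h7⟩ := hp
  exact h.congr (hf.reg _ h1) (hf.reg _ h2) (hf.arr _ h3) (hf.arr _ h4) (hf.arr _ h5) (hf.arr _ h6) (hf.arr _ h7)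

/-- Load the record of the occurrence given by register `70`. -/
def nodeP : Prog := assign 71 (get aLEFT (reg 70)) ;; assign 72 (pred (reg 70)) ;;
  assign 73 (get aX (reg 70)) ;; assign 74 (get aY (reg 70)) ;; assign 75 (lit 0) ;; assign 76 (get aOP (reg 70))

/-- The record of the occurrence of `s` at position `n` has been loaded. -/
structure Loaded (L : List ℕ) (s : CWTerm) (n : ℕ) (τ : State) : Prop where
  h70 : τ.reg 70 = n
  h71 : ∀ s₁ s₂, s = union s₁ s₂ → τ.reg 71 = n - 1 - s₂.size
  h72 : τ.reg 72 = n - 1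
  h73 : ∀ a, s.symbolLabels[0]? = some a → a ∈ L ∧ τ.reg 73 = L.idxOf a
  h74 : ∀ b, s.symbolLabels[1]? = some b → b ∈ L ∧ τ.reg 74 = L.idxOf b
  h75 : τ.reg 75 = 0
  h76 : τ.reg 76 = s.symbol

theorem Loaded.frame {s : CWTerm} {p : Prog} (h : Loaded L s i σ) (hf : Frame p σ τ)
    (hp : ∀ r, 69 < r → r < 77 → p.wr r = false := by intro r h1 h2; interval_cases r <;> rfl) : Loaded L s i τ := by
  have e : ∀ r, 69 < r → r < 77 → τ.reg r = σ.reg r := fun r h1 h2 => hf.reg r (hp r h1 h2)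
  obtain ⟨h1, h2, h3, h4, h5, h6, h7⟩ := h
  constructor <;> simpa [e]

theorem nodeP_spec (hl : Layout L l σ) {s : CWTerm} {e : s.Vert → V} (ho : l[i]? = some ⟨s, e⟩) (hi : σ.reg 70 = i) :
    Spec nodeP σ 18 (fun τ => Loaded L s i τ ∧ τ.arr = σ.arr) := by
  obtain ⟨h1, h2⟩ := hl.node i _ ho
  refine Spec.block 18 ⟨⟨?_, ?_, ?_, fun a ha => ?_, fun a ha => ?_, ?_, ?_⟩, by simp [run, nodeP]⟩
  · simp [run, nodeP, hi]
  · rintro s₁ s₂ rfl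
    simp [run, nodeP, hi, hl.left _ _ _ _ ho]
  · simp [run, nodeP, hi]
  · simpa [run, nodeP, hi] using h2 0 a ha
  · simpa [run, nodeP, hi] using h2 1 a ha
  · simp [run, nodeP]
  · simpa [run, nodeP, hi] using h1

/-- Branch on the symbol in register `76`. -/
def bySymbol (p₁ p₂ p₃ p₄ : Prog) : Prog := Prog.cond (eq (reg 76) (lit 1)) p₁
  (Prog.cond (eq (reg 76) (lit 2)) p₂ (Prog.cond (eq (reg 76) (lit 3)) p₃ p₄))

/-- Choose by the first symbol of a term. -/
def pick : CWTerm → Prog → Prog → Prog → Prog → Prog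
  | vertex _, p, _, _, _ => p
  | add _ _ _ _, _, p, _, _ => p
  | rename _ _ _, _, _, p, _ => p
  | union _ _, _, _, _, p => p

theorem bySymbol_spec {s : CWTerm} (h : τ.reg 76 = s.symbol) {p₁ p₂ p₃ p₄ : Prog} {T : ℕ} {Q : State → Prop} (hs : Spec
    (pick s p₁ p₂ p₃ p₄) τ T Q) : Spec (bySymbol p₁ p₂ p₃ p₄) τ (9 + T) Q := by
  have no : ∀ m, m ≠ s.symbol → ∀ {p}, (eq (reg 76) (lit m)).Holds τ → Spec p τ T Q := fun m hm _ hc =>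
    absurd (h.symm.trans hc).symm hm
  refine Spec.le (T := 3 + max T (3 + max T (3 + max T T))) ?_ (by omega)
  cases s with
  | vertex a => exact Spec.cond (fun _ => hs) fun hc => absurd h hc
  | add a b hab s => exact Spec.cond (no 1 (by simp [symbol])) fun _ => Spec.cond (fun _ => hs) fun hc => absurd h hc
  | rename a b s =>
    exact Spec.cond (no 1 (by simp [symbol])) fun _ => Spec.cond (no 2 (by simp [symbol])) fun _ =>
      Spec.cond (fun _ => hs) fun hc => absurd h hc
  | union s₁ s₂ =>
    exact Spec.cond (no 1 (by simp [symbol])) fun _ => Spec.cond (no 2 (by simp [symbol])) fun _ =>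
      Spec.cond (no 3 (by simp [symbol])) fun _ => hs

theorem eq_idxOf_iff (hL : L.Nodup) {x a : ℕ} (hx : x < L.length) (ha : a ∈ L) : x = L.idxOf a ↔ lb L x = a := by
  constructor
  · rintro rfl; exact lb_idxOf ha
  · rintro rfl; exact (idxOf_lb hL hx).symm

theorem eq_iff_lb (hL : L.Nodup) {x y : ℕ} (hx : x < L.length) (hy : y < L.length) : x = y ↔ lb L x = lb L y :=
  ⟨fun h => by rw [h], lb_inj hL hx hy⟩

/-- The quantifiers of formulas range over positions in `L`. This loses nothing, since the relations
in question hold only for labels of the term. -/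
theorem exists_lb_iff {p : ℕ → Prop} (h : ∀ a, p a → a ∈ L) : (∃ v < L.length, p (lb L v)) ↔ ∃ a, p a := by
  constructor
  · rintro ⟨v, -, hv⟩; exact ⟨_, hv⟩
  · rintro ⟨a, ha⟩
    exact ⟨L.idxOf a, idxOf_lt_length_iff.2 (h a ha), by rw [lb_idxOf (h a ha)]; exact ha⟩

end

/-- `y` results from `x` if the label in register `73` is replaced by that in register `74`. -/
def relF (x y : ℕ) : Fml := (((Fml.eq x 73).and (Fml.eq y 74)).or ((Fml.eq x 73).not.and (Fml.eq x y)))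

theorem relF_sem (hL : L.Nodup) {f : ℕ → ℕ → ℕ} {ν : ℕ → ℕ} {x y a b : ℕ} (hx : ν x < L.length) (hy : ν y < L.length)
    (ha : a ∈ L) (hb : b ∈ L) (h73 : ν 73 = L.idxOf a) (h74 : ν 74 = L.idxOf b) : (relF x y).Sem L.length f ν ↔ relabel
    a b (lb L (ν x)) = lb L (ν y) := by
  simp only [relF, Fml.Sem, h73, h74, eq_idxOf_iff hL hx ha, eq_idxOf_iff hL hy hb, eq_iff_lb hL hx hy, relabel]
  split_ifs with h
  · simp [h]; exact eq_comm
  · simp [h]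

/-! ### Non-adjacency -/

/-- A formula for `NonAdj` at a vertex. -/
def nfVertexF : Fml := (Fml.eq 56 73).and (Fml.eq 57 73)
/-- A formula for `NonAdj` after the addition of edges. -/
def nfAddF : Fml := (Fml.atom aNF 72 56 57).and
  (((Fml.eq 56 73).and (Fml.eq 57 74)).not.and ((Fml.eq 56 74).and (Fml.eq 57 73)).not)
/-- A formula for `NonAdj` after a relabelling. -/
def nfRenameF : Fml := Fml.ex 66 (Fml.ex 67 ((Fml.atom aNF 72 66 67).and ((relF 66 56).and (relF 67 57))))
/-- A formula for `NonAdj` in a union. -/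
def nfUnionF : Fml := ((Fml.atom aNF 71 56 57).or (Fml.atom aNF 72 56 57)).or
  (((Fml.atom aNF 71 56 56).and (Fml.atom aNF 72 57 57)).or ((Fml.atom aNF 72 56 56).and (Fml.atom aNF 71 57 57)))

/-- Compute the block of non-adjacency for the occurrence given by register `70`. -/
def nfP : Prog := nodeP ;;
  bySymbol (fillP aNF 70 nfVertexF) (fillP aNF 70 nfAddF) (fillP aNF 70 nfRenameF) (fillP aNF 70 nfUnionF)

/-- The blocks of non-adjacency before position `n`. -/
def HasNF {V : Type} (L : List ℕ) (l : OccList V) (n : ℕ) (σ : State) : Prop :=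
  ∀ i < n, ∀ o, l[i]? = some o → HasBlock L (σ.arr aNF) i o.1.NonAdj

/-- The four formulas express the recursion for `NonAdj`. The exponent 6 is that of the relabelling:
two for the entries of the block, two for its quantifiers and two for the addresses. -/
theorem nfP_spec {V : Type} {l : OccList V} {n : ℕ} (hl : Layout L l σ) (hn : n < l.length) (h70 : σ.reg 70 = n) (hnf :
    HasNF L l n σ) : Spec nfP σ (700 * L.length ^ 6) (HasNF L l (n + 1)) := by
  obtain ⟨⟨s, e⟩, ho⟩ := exists_getElem? (l := l) hn
  have hpow : ∀ j ≤ 6, L.length ^ j ≤ L.length ^ 6 := fun j hj => Nat.pow_le_pow_right hl.pos hj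
  have hbase := hl.base n hn
  refine Spec.le (T := 18 + (9 + 600 * L.length ^ 6)) ?_ (by have := Nat.one_le_pow 6 _ hl.pos; omega)
  refine Spec.seqf (nodeP_spec hl ho h70) ?_
  rintro τ hf ⟨⟨h70, h71, h72, h73, h74, h75, h76⟩, harr⟩
  have hlτ := hl.frame hf rfl
  rw [← harr] at hbase
  have hprev : ∀ i < n, ∀ o, l[i]? = some o → HasBlock L (τ.arr aNF) i o.1.NonAdj := harr ▸ hnf
  have key : ∀ φ : Fml, φ.wf 66 = true → (φ.weight + 80) * L.length ^ (φ.depth + 4) ≤ 600 * L.length ^ 6 →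
      (∀ x < L.length, ∀ y < L.length, φ.InRange L.length (atPos τ.reg x y)) →
      (∀ f : ℕ → ℕ → ℕ, (∀ i < l.length, f aBASE i = i * (L.length * L.length)) →
        (∀ i < n, ∀ o, l[i]? = some o → HasBlock L (f aNF) i o.1.NonAdj) →
        ∀ x < L.length, ∀ y < L.length, (φ.Sem L.length f (atPos τ.reg x y) ↔ s.NonAdj (lb L x) (lb L y))) →
      Spec (fillP aNF 70 φ) τ (600 * L.length ^ 6) (HasNF L l (n + 1)) := by
    intro φ hwf hw hr hφ
    refine ((fillP_block hwf (by decide) (by decide) hl.pos hlτ.rk h70 hbase hr (R := s.NonAdj) ?_).le hw).mono ?_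
    · intro f hf1 hf2
      refine hφ f (by rw [hf1 _ (by decide)]; exact hlτ.base) fun i hi o ho => hf2 _ hi.ne _ (hprev i hi o ho)
    · rintro ρ - ⟨h1, h2⟩ i hi o ho'
      rcases Nat.lt_succ_iff_lt_or_eq.1 hi with h | rfl
      · exact h2 _ h.ne _ (hprev i h o ho')
      · obtain rfl := Option.some.inj (ho.symm.trans ho')
        exact h1
  refine bySymbol_spec h76 ?_
  cases s with
  | vertex a =>
    obtain ⟨ha, h73'⟩ := h73 a rfl
    refine key nfVertexF rfl ?_ ?_ ?_
    · have := hpow 4 (by omega)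
      simp only [nfVertexF, Fml.weight, Fml.depth]; simp; omega
    · intro x hx y hy; simp [nfVertexF, Fml.InRange]
    · intro f hf1 hf2 x hx y hy
      simp only [nfVertexF, Fml.Sem, atPos]
      simp [h73', eq_idxOf_iff hl.nodup hx ha, eq_idxOf_iff hl.nodup hy ha, nonAdj_vertex]
  | add a b hab s =>
    obtain ⟨ha, h73'⟩ := h73 a rfl
    obtain ⟨hb, h74'⟩ := h74 b rfl
    obtain ⟨hn0, hchild⟩ := hl.order.add_child ho
    refine key nfAddF rfl ?_ ?_ ?_
    · have := hpow 4 (by omega)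
      simp only [nfAddF, Fml.weight, Fml.depth]; simp; omega
    · intro x hx y hy; simp [nfAddF, Fml.InRange, atPos, hx, hy]
    · intro f hf1 hf2 x hx y hy
      have h1 := (hf2 (n - 1) (by omega) _ hchild).iff (hf1 _ (by omega)) hx hy
      simp only [nfAddF, Fml.Sem, atPos]
      simp [h72, h1, h73', h74', eq_idxOf_iff hl.nodup hx ha, eq_idxOf_iff hl.nodup hy ha,
        eq_idxOf_iff hl.nodup hx hb, eq_idxOf_iff hl.nodup hy hb, nonAdj_add]
  | rename a b s =>
    obtain ⟨ha, h73'⟩ := h73 a rfl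
    obtain ⟨hb, h74'⟩ := h74 b rfl
    obtain ⟨hn0, hchild⟩ := hl.order.rename_child ho
    refine key nfRenameF rfl ?_ ?_ ?_
    · exact Nat.mul_le_mul_right _ (by decide)
    · intro x hx y hy
      simp only [nfRenameF, relF, Fml.InRange, atPos]
      simp +contextual
    · intro f hf1 hf2 x hx y hy
      have hsub : s.labels ⊆ L.toFinset := hl.labels _ (mem_of_getElem? hchild)
      rw [nonAdj_rename]
      simp only [nfRenameF, Fml.Sem]
      have hv : ∀ v < L.length, ∀ w < L.length, ∀ ν : ℕ → ℕ, ν = update (update (atPos τ.reg x y) 66 v) 67 w →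
          ((f aNF (f aBASE (ν 72) + ν 66 * L.length + ν 67) = 1 ∧ (relF 66 56).Sem L.length f ν ∧
            (relF 67 57).Sem L.length f ν) ↔ s.NonAdj (lb L v) (lb L w) ∧
            relabel a b (lb L v) = lb L x ∧ relabel a b (lb L w) = lb L y) := by
        intro v hv w hw ν hν
        have e66 : ν 66 = v := by simp [hν, atPos]
        have e67 : ν 67 = w := by simp [hν, atPos]
        have e56 : ν 56 = x := by simp [hν, atPos]
        have e57 : ν 57 = y := by simp [hν, atPos]
        have e72 : ν 72 = n - 1 := by simp [hν, atPos, h72]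
        have e73 : ν 73 = L.idxOf a := by simp [hν, atPos, h73']
        have e74 : ν 74 = L.idxOf b := by simp [hν, atPos, h74']
        rw [relF_sem hl.nodup (e66 ▸ hv) (e56 ▸ hx) ha hb e73 e74,
          relF_sem hl.nodup (e67 ▸ hw) (e57 ▸ hy) ha hb e73 e74, e66, e67, e56, e57, e72,
          (hf2 (n - 1) (by omega) _ hchild).iff (hf1 _ (by omega)) hv hw]
      have h1 : ∀ v < L.length, (∃ w < L.length, s.NonAdj (lb L v) (lb L w) ∧
            relabel a b (lb L v) = lb L x ∧ relabel a b (lb L w) = lb L y) ↔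
            ∃ w, s.NonAdj (lb L v) w ∧ relabel a b (lb L v) = lb L x ∧ relabel a b w = lb L y :=
        fun v hv => exists_lb_iff (p := fun w => s.NonAdj (lb L v) w ∧ relabel a b (lb L v) = lb L x ∧
          relabel a b w = lb L y) fun w hw => by simpa using hsub hw.1.mem_labels.2
      refine Iff.trans ?_ (exists_lb_iff (L := L) (p := fun x' => ∃ y', s.NonAdj x' y' ∧
        relabel a b x' = lb L x ∧ relabel a b y' = lb L y)
        fun v ⟨w, hw⟩ => by simpa using hsub hw.1.mem_labels.1)
      refine exists_congr fun v => and_congr_right fun hv' => ?_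
      rw [← h1 v hv']
      exact exists_congr fun w => and_congr_right fun hw' => hv v hv' w hw' _ rfl
  | union s₁ s₂ =>
    obtain ⟨hn0, hright⟩ := hl.order.right_child ho
    obtain ⟨hn1, hleft⟩ := hl.order.left_child ho
    have h71' := h71 _ _ rfl
    refine key nfUnionF rfl ?_ ?_ ?_
    · have := hpow 4 (by omega)
      simp only [nfUnionF, Fml.weight, Fml.depth]; simp; omega
    · intro x hx y hy; simp [nfUnionF, Fml.InRange, atPos, hx, hy]
    · intro f hf1 hf2 x hx y hy
      have h1 : ∀ x < L.length, ∀ y < L.length, _ := fun x hx y hy =>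
        (hf2 (n - 1) (by omega) _ hright).iff (hf1 _ (by omega)) hx hy
      have h2 : ∀ x < L.length, ∀ y < L.length, _ := fun x hx y hy =>
        (hf2 (n - 1 - s₂.size) (by omega) _ hleft).iff (hf1 _ (by omega)) hx hy
      simp only [nfUnionF, Fml.Sem, atPos]
      simp [h72, h71', h1 x hx y hy, h2 x hx y hy, h1 x hx x hx, h2 x hx x hx, h1 y hy y hy, h2 y hy y hy, nonAdj_union]

/-! ### Contexts -/

/-- A formula for the context of the argument of an addition of edges. -/
def pmAddF : Fml := (Fml.atom aPM 70 56 57).or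
  (((Fml.eq 56 73).and (Fml.eq 57 74)).or ((Fml.eq 56 74).and (Fml.eq 57 73)))
/-- A formula for the context of the argument of a relabelling. -/
def pmRenameF : Fml := Fml.ex 66 (Fml.ex 67 (((relF 56 66).and (relF 57 67)).and
  (((Fml.eq 56 57).or (Fml.eq 66 67).not).and (Fml.atom aPM 70 66 67))))
/-- A formula for the context of an argument of a union, where register `i` gives the other argument. -/
def pmUnionF (i : ℕ) : Fml := (Fml.atom aPM 70 56 57).or
  ((Fml.eq 56 57).and (Fml.ex 66 ((Fml.eq 66 56).not.and ((Fml.atom aNF i 66 66).and (Fml.atom aPM 70 56 66)))))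

/-- Compute the contexts of the arguments of the occurrence given by register `70`. -/
def pmP : Prog := nodeP ;;
  bySymbol skip (fillP aPM 72 pmAddF) (fillP aPM 72 pmRenameF) (fillP aPM 71 (pmUnionF 72) ;; fillP aPM 72 (pmUnionF 71))

section
variable {V : Type} {l : OccList V} {n : ℕ} {G : SimpleGraph V}

/-- The context of the occurrence at position `j` is known. -/
def HasCtx (L : List ℕ) (G : SimpleGraph V) (l : OccList V) (σ : State) (j : ℕ) : Prop :=
  ∀ o, l[j]? = some o → ∃ Q, Ctx G o.1 o.2 Q ∧ HasBlock L (σ.arr aPM) j Q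

theorem pm_fill_spec {i j : ℕ} {φ : Fml} (hwf : φ.wf 66 = true) (hi : 70 ≤ i ∧ i < 100) (hl : Layout L l σ) (hnf : HasNF
    L l l.length σ) (hw : (φ.weight + 80) * L.length ^ (φ.depth + 4) ≤ 600 * L.length ^ 6) {s : CWTerm} {e : s.Vert → V}
    (hj : l[j]? = some ⟨s, e⟩) (hij : σ.reg i = j) (hjn : j < n) (hr : ∀ x < L.length, ∀ y < L.length, φ.InRange
    L.length (atPos σ.reg x y)) {Q Q' : ℕ → ℕ → Prop} (hQ : HasBlock L (σ.arr aPM) n Q) (hφ : ∀ f : ℕ → ℕ → ℕ, (∀ i <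
    l.length, f aBASE i = i * (L.length * L.length)) → (∀ i < l.length, ∀ o, l[i]? = some o → HasBlock L (f aNF) i
    o.1.NonAdj) → HasBlock L (f aPM) n Q → ∀ x < L.length, ∀ y < L.length, (φ.Sem L.length f (atPos σ.reg x y) ↔ Q' (lb
    L x) (lb L y))) (hc : Ctx G s e Q') : Spec (fillP aPM i φ) σ (600 * L.length ^ 6) (fun τ => HasCtx L G l τ j ∧
    HasBlock L (τ.arr aPM) n Q ∧ ∀ j', HasCtx L G l σ j' → HasCtx L G l τ j') := by
  have hjl := getElem?_lt hj
  refine ((fillP_block hwf (by decide) (Or.inr hi) hl.pos hl.rk hij (hl.base j hjl) hr (R := Q') ?_).le hw).mono ?_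
  · intro f hf1 hf2
    exact hφ f (by rw [hf1 _ (by decide)]; exact hl.base) (by rw [hf1 _ (by decide)]; exact hnf) (hf2 n (by omega) _ hQ)
  · rintro ρ - ⟨h1, h2⟩
    have hnew : HasCtx L G l ρ j := by
      intro o ho
      obtain rfl := Option.some.inj (hj.symm.trans ho)
      exact ⟨Q', hc, h1⟩
    refine ⟨hnew, h2 n (by omega) _ hQ, fun j' hj' => ?_⟩
    by_cases hjj : j' = j
    · rw [hjj]; exact hnew
    · intro o ho
      obtain ⟨R, hR1, hR2⟩ := hj' o ho
      exact ⟨R, hR1, h2 j' hjj _ hR2⟩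

theorem pmUnionF_sem {i j : ℕ} (hi : 70 ≤ i) (hl : Layout L l σ) {f : ℕ → ℕ → ℕ} {Q : ℕ → ℕ → Prop} (hf1 : ∀ i <
    l.length, f aBASE i = i * (L.length * L.length)) (hf2 : ∀ i < l.length, ∀ o, l[i]? = some o → HasBlock L (f aNF) i
    o.1.NonAdj) (hf3 : HasBlock L (f aPM) n Q) (hn : n < l.length) (h70 : σ.reg 70 = n) (hij : σ.reg i = j) {s : CWTerm}
    {e : s.Vert → V} (hj : l[j]? = some ⟨s, e⟩) {x y : ℕ} (hx : x < L.length) (hy : y < L.length) : (pmUnionF i).Sem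
    L.length f (atPos σ.reg x y) ↔ Q (lb L x) (lb L y) ∨ (lb L x = lb L y ∧ ∃ z, z ≠ lb L x ∧ s.NonAdj z z ∧ Q (lb L x)
    z) := by
  have hjl := getElem?_lt hj
  have hsub : s.labels ⊆ L.toFinset := hl.labels _ (mem_of_getElem? hj)
  rw [← exists_lb_iff (L := L) (p := fun z => z ≠ lb L x ∧ s.NonAdj z z ∧ Q (lb L x) z)
    fun z hz => by simpa using hsub hz.2.1.mem_labels.1, ← eq_iff_lb hl.nodup hx hy]
  have e56 : atPos σ.reg x y 56 = x := by simp [atPos]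
  have e57 : atPos σ.reg x y 57 = y := by simp [atPos]
  have e70 : atPos σ.reg x y 70 = n := by simp [atPos, h70]
  have ei : atPos σ.reg x y i = j := by
    rw [atPos, update_of_ne (by omega), update_of_ne (by omega), hij]
  simp only [pmUnionF, Fml.Sem, e56, e57, e70, hf3.iff (hf1 _ hn) hx hy]
  refine or_congr Iff.rfl (and_congr Iff.rfl (exists_congr fun z => and_congr_right fun hz => ?_))
  have hi' : i ≠ 66 := by omega
  simp only [update_self, update_of_ne hi', update_of_ne (show (56 : ℕ) ≠ 66 by decide),
    update_of_ne (show (70 : ℕ) ≠ 66 by decide), e56, e70, ei, hf3.iff (hf1 _ hn) hx hz,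
    (hf2 j hjl _ hj).iff (hf1 _ hjl) hz hz, eq_iff_lb hl.nodup hz hx]

theorem pmUnionF_inRange {i x y : ℕ} (hx : x < L.length) (hy : y < L.length) : (pmUnionF i).InRange L.length (atPos
    σ.reg x y) := by
  simp [pmUnionF, Fml.InRange, atPos, hx, hy]

/-- The contexts of the arguments follow from the context of the occurrence by `Ctx.add`,
`Ctx.rename`, `Ctx.union_left` and `Ctx.union_right`. At labels that do not occur, `Q` is not
determined by the graph, so `HasCtx` only asserts that the table represents some suitable `Q`. -/
theorem pmP_spec (hl : Layout L l σ) (hn : n < l.length) (h70 : σ.reg 70 = n) (hnf : HasNF L l l.length σ) (hctx :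
    HasCtx L G l σ n) : Spec pmP σ (1300 * L.length ^ 6) (fun τ => (∀ j, HasCtx L G l σ j → HasCtx L G l τ j) ∧ ∀ j o,
    l[n]? = some o → o.1.ChildAt n j → HasCtx L G l τ j) := by
  obtain ⟨⟨s, e⟩, ho⟩ := exists_getElem? (l := l) hn
  obtain ⟨Q, hQ, hb⟩ := hctx _ ho
  have hpow : L.length ^ 4 ≤ L.length ^ 6 := Nat.pow_le_pow_right hl.pos (by omega)
  have hpow5 : L.length ^ 5 ≤ L.length ^ 6 := Nat.pow_le_pow_right hl.pos (by omega)
  have hT := Nat.one_le_pow 6 _ hl.pos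
  refine Spec.le (T := 18 + (9 + (600 * L.length ^ 6 + 600 * L.length ^ 6))) ?_ (by omega)
  refine Spec.seqf (nodeP_spec hl ho h70) ?_
  rintro τ hf ⟨⟨h70, h71, h72, h73, h74, h75, h76⟩, harr⟩
  have hlτ := hl.frame hf rfl
  have hnfτ : HasNF L l l.length τ := by rw [HasNF, harr]; exact hnf
  have hbτ : HasBlock L (τ.arr aPM) n Q := harr ▸ hb
  have hcσ : ∀ j, HasCtx L G l σ j → HasCtx L G l τ j := fun j hj => by rw [HasCtx, harr]; exact hj
  refine bySymbol_spec h76 ?_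
  cases s with
  | vertex a =>
    refine (Spec.skip ⟨hcσ, fun j o ho' hch => ?_⟩).le (by omega)
    obtain rfl := Option.some.inj (ho.symm.trans ho')
    exact hch.elim
  | add a b hab s =>
    obtain ⟨ha, h73'⟩ := h73 a rfl
    obtain ⟨hb', h74'⟩ := h74 b rfl
    obtain ⟨hn0, hchild⟩ := hl.order.add_child ho
    refine ((pm_fill_spec (n := n) rfl (by decide) hlτ hnfτ ?_ hchild h72 (by omega) ?_ hbτ ?_ hQ.add).le (by omega)).mono ?_
    · simp only [pmAddF, Fml.weight, Fml.depth]; simp; omega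
    · intro x hx y hy; simp [pmAddF, Fml.InRange, atPos, hx, hy]
    · intro f hf1 hf2 hf3 x hx y hy
      have h1 := hf3.iff (hf1 n hn) hx hy
      simp only [pmAddF, Fml.Sem, atPos]
      simp [h70, h1, h73', h74', eq_idxOf_iff hl.nodup hx ha, eq_idxOf_iff hl.nodup hy ha,
        eq_idxOf_iff hl.nodup hx hb', eq_idxOf_iff hl.nodup hy hb']
    · rintro ρ - ⟨h1, -, h3⟩
      refine ⟨fun j hj => h3 j (hcσ j hj), fun j o ho' hch => ?_⟩
      obtain rfl := Option.some.inj (ho.symm.trans ho')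
      simp only [ChildAt] at hch
      rwa [show j = n - 1 by omega]
  | rename a b s =>
    obtain ⟨ha, h73'⟩ := h73 a rfl
    obtain ⟨hb', h74'⟩ := h74 b rfl
    obtain ⟨hn0, hchild⟩ := hl.order.rename_child ho
    refine ((pm_fill_spec (n := n) rfl (by decide) hlτ hnfτ ?_ hchild h72 (by omega) ?_ hbτ ?_ hQ.rename).le (by omega)).mono ?_
    · exact Nat.mul_le_mul_right _ (by decide)
    · intro x hx y hy
      simp only [pmRenameF, relF, Fml.InRange, atPos]
      simp +contextual
    · intro f hf1 hf2 hf3 x hx y hy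
      have hrel : ∀ z < L.length, relabel a b (lb L z) ∈ L := by
        intro z hz
        unfold relabel
        split_ifs
        · exact hb'
        · exact lb_mem hz
      simp only [pmRenameF, Fml.Sem]
      have hv : ∀ v < L.length, ∀ w < L.length, ∀ ν : ℕ → ℕ, ν = update (update (atPos τ.reg x y) 66 v) 67 w →
          ((((relF 56 66).Sem L.length f ν ∧ (relF 57 67).Sem L.length f ν) ∧ (ν 56 = ν 57 ∨ ¬ ν 66 = ν 67) ∧
            f aPM (f aBASE (ν 70) + ν 66 * L.length + ν 67) = 1) ↔
            (relabel a b (lb L x) = lb L v ∧ relabel a b (lb L y) = lb L w) ∧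
            (lb L x = lb L y ∨ ¬ lb L v = lb L w) ∧ Q (lb L v) (lb L w)) := by
        intro v hv w hw ν hν
        have e66 : ν 66 = v := by simp [hν, atPos]
        have e67 : ν 67 = w := by simp [hν, atPos]
        have e56 : ν 56 = x := by simp [hν, atPos]
        have e57 : ν 57 = y := by simp [hν, atPos]
        have e70 : ν 70 = n := by simp [hν, atPos, h70]
        have e73 : ν 73 = L.idxOf a := by simp [hν, atPos, h73']
        have e74 : ν 74 = L.idxOf b := by simp [hν, atPos, h74']
        rw [relF_sem hl.nodup (e56 ▸ hx) (e66 ▸ hv) ha hb' e73 e74,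
          relF_sem hl.nodup (e57 ▸ hy) (e67 ▸ hw) ha hb' e73 e74, e66, e67, e56, e57, e70,
          hf3.iff (hf1 _ hn) hv hw, eq_iff_lb hl.nodup hx hy, eq_iff_lb hl.nodup hv hw]
      constructor
      · rintro ⟨v, hv', w, hw', h⟩
        obtain ⟨⟨h1, h2⟩, h3, h4⟩ := (hv v hv' w hw' _ rfl).1 h
        rw [h1, h2]
        exact ⟨h3, h4⟩
      · rintro ⟨h3, h4⟩
        have hv' := idxOf_lt_length_iff.2 (hrel x hx)
        have hw' := idxOf_lt_length_iff.2 (hrel y hy)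
        refine ⟨_, hv', _, hw', (hv _ hv' _ hw' _ rfl).2 ?_⟩
        rw [lb_idxOf (hrel x hx), lb_idxOf (hrel y hy)]
        exact ⟨⟨rfl, rfl⟩, h3, h4⟩
    · rintro ρ - ⟨h1, -, h3⟩
      refine ⟨fun j hj => h3 j (hcσ j hj), fun j o ho' hch => ?_⟩
      obtain rfl := Option.some.inj (ho.symm.trans ho')
      simp only [ChildAt] at hch
      rwa [show j = n - 1 by omega]
  | union s₁ s₂ =>
    obtain ⟨hn0, hright⟩ := hl.order.right_child ho
    obtain ⟨hn1, hleft⟩ := hl.order.left_child ho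
    have h71' := h71 _ _ rfl
    have hw : ∀ i, ((pmUnionF i).weight + 80) * L.length ^ ((pmUnionF i).depth + 4) ≤ 600 * L.length ^ 6 := by
      intro i
      simp only [pmUnionF, Fml.weight, Fml.depth]; simp; omega
    refine Spec.seqf (pm_fill_spec (n := n) rfl (by decide) hlτ hnfτ (hw _) hleft h71' (by omega)
      (fun x hx y hy => pmUnionF_inRange hx hy) hbτ ?_ hQ.union_left) ?_
    · intro f hf1 hf2 hf3 x hx y hy
      exact pmUnionF_sem (by decide) hlτ hf1 hf2 hf3 hn h70 h72 hright hx hy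
    rintro ρ hfρ ⟨k1, k2, k3⟩
    have hlρ := hlτ.frame hfρ rfl
    have hnfρ : HasNF L l l.length ρ := by rw [HasNF, hfρ.arr aNF rfl]; exact hnfτ
    have e70 : ρ.reg 70 = n := (hfρ.reg _ rfl).trans h70
    have e71 : ρ.reg 71 = n - 1 - s₂.size := (hfρ.reg _ rfl).trans h71'
    have e72 : ρ.reg 72 = n - 1 := (hfρ.reg _ rfl).trans h72
    refine (pm_fill_spec (n := n) rfl (by decide) hlρ hnfρ (hw _) hright e72 (by omega)
      (fun x hx y hy => pmUnionF_inRange hx hy) k2 ?_ hQ.union_right).mono ?_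
    · intro f hf1 hf2 hf3 x hx y hy
      exact pmUnionF_sem (by decide) hlρ hf1 hf2 hf3 hn e70 e71 hleft hx hy
    · rintro χ - ⟨h1, -, h3⟩
      refine ⟨fun j hj => h3 j (k3 j (hcσ j hj)), fun j o ho' hch => ?_⟩
      obtain rfl := Option.some.inj (ho.symm.trans ho')
      simp only [ChildAt] at hch
      rcases hch with hch | hch
      · rwa [show j = n - 1 by omega]
      · rw [show j = n - 1 - s₂.size by omega]
        exact h3 _ k1

end

/-! ### The dynamic programming -/

notation "aSTART" => (18 : ℕ)
notation "aEND" => (19 : ℕ)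

/-- A formula for the boundary labels of the occurrence given by register `70`. -/
def buF : Fml := (Fml.atom aNF 70 57 57).and (Fml.atom aPM 70 57 57)
/-- A formula for the pending pairs of the occurrence given by register `70`. -/
def pdF : Fml := (Fml.atom aNF 70 56 57).and ((Fml.eq 56 57).not.and (Fml.atom aPM 70 56 57))
/-- A formula for the boundary labels of the arguments of a union. -/
def bbF : Fml := ((Fml.atom aNF 71 57 57).and (Fml.atom aPM 71 57 57)).or
  ((Fml.atom aNF 72 57 57).and (Fml.atom aPM 72 57 57))

section
variable {V : Type} {l : OccList V} {n c : ℕ} {G : SimpleGraph V}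

open Classical in
/-- The boundary labels, as a finite set. -/
noncomputable def bdry (G : SimpleGraph V) (s : CWTerm) (e : s.Vert → V) : Finset ℕ :=
  s.labels.filter (· ∈ boundary G s e)

theorem coe_bdry {s : CWTerm} {e : s.Vert → V} : (bdry G s e : Set ℕ) = boundary G s e := by
  ext a
  simp only [bdry, Finset.coe_filter, Set.mem_ofPred_eq, and_iff_right_iff_imp]
  exact boundary_subset_labels s e

theorem mem_bdry {s : CWTerm} {e : s.Vert → V} {a : ℕ} : a ∈ bdry G s e ↔ a ∈ boundary G s e := by
  rw [← coe_bdry, Finset.mem_coe]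

theorem Rep.length_le (hX : Rep L c 𝒮 X) (hL : L.Nodup) (hc : 2 ≤ c) (hB : B ⊆ L.toFinset) (hf : ∀ s ∈ 𝒮, Fits c B s) :
    X.length ≤ bound L.length c :=
  length_le_bound hL hc hB hB hX.nodup fun y hy =>
    hX.stage hL hf hB ⟨y, hy, Relation.ReflTransGen.refl⟩

/-- Everything that is known before the dynamic programming. -/
structure Ready (L : List ℕ) (c : ℕ) (G : SimpleGraph V) (l : OccList V) (σ : State) :
    Prop where
  layout : Layout L l σ
  nf : HasNF L l l.length σ
  ctx : ∀ j, HasCtx L G l σ j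
  env : Env L c σ
  labels : HasLabels L σ

/-- Does a program keep everything that is known before the dynamic programming? -/
def Prog.keepsAll (p : Prog) : Bool := p.keeps && p.safe && !(p.wa aNF) && !(p.wa aPM) && !(p.wa aLBL)

theorem Ready.congr (h : Ready L c G l σ) (h1 : Layout L l τ) (h2 : Env L c τ) (h3 : τ.arr aNF = σ.arr aNF) (h4 : τ.arr
    aPM = σ.arr aPM) (h5 : τ.arr aLBL = σ.arr aLBL) : Ready L c G l τ :=
  ⟨h1, by rw [HasNF, h3]; exact h.nf, fun j => by rw [HasCtx, h4]; exact h.ctx j, h2,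
    fun a ha => by rw [h5]; exact h.labels a ha⟩

theorem Ready.frame (h : Ready L c G l σ) {p : Prog} (hf : Frame p σ τ) (hp : p.keepsAll = true) : Ready L c G l τ := by
  simp only [Prog.keepsAll, Bool.and_eq_true, Bool.not_eq_true'] at hp
  obtain ⟨⟨⟨⟨h1, h2⟩, h3⟩, h4⟩, h5⟩ := hp
  exact h.congr (h.layout.frame hf h1) (h.env.frame hf h2) (hf.arr _ h3) (hf.arr _ h4) (hf.arr _ h5)

/-- Relations needed only at the current occurrence are put into block 0 of an array of their own,
addressed by register `75`, which contains 0. -/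
theorem scratch_spec {A : ℕ} {φ : Fml} (h : Ready L c G l σ) (hn : 0 < l.length) (h75 : σ.reg 75 = 0) (hr : ∀ x <
    L.length, ∀ y < L.length, φ.InRange L.length (atPos σ.reg x y)) {R : ℕ → ℕ → Prop} (hφ : ∀ f : ℕ → ℕ → ℕ, f aBASE
    = σ.arr aBASE → f aNF = σ.arr aNF → f aPM = σ.arr aPM → ∀ x < L.length, ∀ y < L.length, (φ.Sem L.length f (atPos
    σ.reg x y) ↔ R (lb L x) (lb L y))) (hwf : φ.wf 66 = true := by rfl) (hA : A ≠ aBASE := by decide) (hA' : A ≠ aNF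
    := by decide) (hA2 : A ≠ aPM := by decide) (hd : φ.depth = 0 := by rfl) (hw : φ.weight ≤ 500 := by decide) : Spec
    (fillP A 75 φ) σ (600 * L.length ^ 6) (fun τ => HasBlock L (τ.arr A) 0 R) := by
  have hpow : L.length ^ 4 ≤ L.length ^ 6 := Nat.pow_le_pow_right h.layout.pos (by omega)
  refine ((fillP_block hwf hA (by decide) h.layout.pos h.layout.rk h75 (by rw [h.layout.base 0 hn]) hr
    (R := R) ?_).le ?_).mono (fun τ _ h => h.1)
  · intro f hf1 _
    exact hφ f (hf1 _ hA.symm) (hf1 _ hA'.symm) (hf1 _ hA2.symm)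
  · rw [hd, Nat.zero_add]
    have := Nat.mul_le_mul_right (L.length ^ 4) (show φ.weight + 80 ≤ 600 by omega)
    omega

/-- A set of labels is computed as a relation that ignores its first argument; row 0 of the block is
then its characteristic function. -/
theorem HasBlock.hasBits {g : ℕ → ℕ} (h : HasBlock L g 0 (fun _ y => y ∈ B)) (hpos : 0 < L.length) : HasBits L B g := by
  intro a ha
  have := h 0 hpos a ha
  simp only [zero_mul, zero_add] at this
  rw [this]
  by_cases hB : lb L a ∈ B <;> simp [hB]

open Classical in
theorem HasBlock.hasPairs {g : ℕ → ℕ} {P : ℕ → ℕ → Prop} (h : HasBlock L g 0 P) : HasPairs L P g := by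
  intro a ha b hb
  have := h a ha b hb
  simp only [zero_mul, zero_add] at this
  rw [this]

theorem Ready.blocks_iff (h : Ready L c G l σ) {j : ℕ} {s : CWTerm} {e : s.Vert → V} (hj : l[j]? = some ⟨s, e⟩) {f : ℕ
    → ℕ → ℕ} (h1 : f aBASE = σ.arr aBASE) (h2 : f aNF = σ.arr aNF) (h3 : f aPM = σ.arr aPM) {x y : ℕ} (hx : x <
    L.length) (hy : y < L.length) : ((f aNF (f aBASE j + y * L.length + y) = 1 ∧ f aPM (f aBASE j + y * L.length + y) =
    1) ↔ lb L y ∈ bdry G s e) ∧ ((f aNF (f aBASE j + x * L.length + y) = 1 ∧ ¬ x = y ∧ f aPM (f aBASE j + x *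
    L.length + y) = 1) ↔ Pending G s e (lb L x) (lb L y)) := by
  have hjl := getElem?_lt hj
  obtain ⟨Q, hQ, hb⟩ := h.ctx j _ hj
  have hbase : f aBASE j = j * (L.length * L.length) := h1 ▸ h.layout.base j hjl
  have hnf : HasBlock L (f aNF) j s.NonAdj := h2 ▸ h.nf j hjl _ hj
  have hpm : HasBlock L (f aPM) j Q := h3 ▸ hb
  rw [hnf.iff hbase hy hy, hpm.iff hbase hy hy, mem_bdry, hQ.mem_boundary, hnf.iff hbase hx hy, hpm.iff hbase hx hy,
    hQ.pending, eq_iff_lb h.layout.nodup hx hy]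
  exact ⟨Iff.rfl, Iff.rfl⟩

/-- Compute the schemes for the occurrence given by register `70`; the registers `77` and `78` tell where
they are stored. -/
def schemesP : Prog := bySymbol
  (assign 38 (reg 73) ;; assign 40 (get aBU (reg 73)) ;; vertexP ;; assign 77 (reg 46) ;; assign 78 (reg rE))
  (assign 77 (get aSTART (reg 72)) ;; assign 78 (get aEND (reg 72)))
  (assign 43 (get aSTART (reg 72)) ;; assign 44 (get aEND (reg 72)) ;; assign 38 (reg 73) ;; assign 39 (reg 74) ;;
    renameP ;; assign 77 (reg 46) ;; assign 78 (reg rE))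
  (fillP aBB 75 bbF ;; assign 50 (get aSTART (reg 71)) ;; assign 51 (get aEND (reg 71)) ;;
    assign 52 (get aSTART (reg 72)) ;; assign 53 (get aEND (reg 72)) ;; unionP ;;
    assign 77 (reg 46) ;; assign 78 (reg rE))

/-- The time for the dynamic programming at an occurrence. -/
def nodeTime (k c : ℕ) : ℕ := bound k c * (min c (2 ^ k) * k * (c * k)) + k ^ 6

/-- Compute and write the schemes for the occurrence given by register `70`. -/
def dpP : Prog := nodeP ;; fillP aBU 75 buF ;; fillP aPD 75 pdF ;; schemesP ;;
  store aSTART (reg 70) (reg 77) ;; store aEND (reg 70) (reg 78) ;;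
  assign 43 (reg 77) ;; assign 44 (reg 78) ;; printP

/-- The schemes for the occurrences before position `n` are stored and written. -/
structure Done (L : List ℕ) (c : ℕ) (G : SimpleGraph V) (l : OccList V) (n : ℕ) (σ : State) :
    Prop where
  trie : HasTrie σ
  stored : ∀ j < n, ∀ o, l[j]? = some o → Stored L c (schemesAt c G o.1 o.2) (σ.arr aSTART j) (σ.arr aEND j) σ
  out : ∃ blocks : List (List SchemeList), σ.out = blocks.flatMap (codeList SchemeList.code) ∧
    blocks.map (fun b => {s : Scheme | s ∈ b.map SchemeList.toScheme}) = (l.take n).map (fun o => schemesAt c G o.1 o.2)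

end

/-! ### The dynamic programming at one occurrence -/

theorem bound_pos {k c : ℕ} (hc : 2 ≤ c) : 0 < bound k c := by
  have h : 0 < 2 ^ c - 2 := by
    have := Nat.pow_le_pow_right (show 0 < 2 by norm_num) hc
    omega
  exact lt_min (by positivity) (by positivity)

theorem nodeTime_ge {k c : ℕ} (hc : 2 ≤ c) (hk : 0 < k) : bound k c * (c * k) ≤ nodeTime k c ∧ c * k ≤ nodeTime k c ∧ 1
    ≤ nodeTime k c := by
  have h1 := bound_pos (k := k) hc
  have h2 : 0 < min c (2 ^ k) := lt_min (by omega) (Nat.two_pow_pos _)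
  have h3 : c * k ≤ min c (2 ^ k) * k * (c * k) := Nat.le_mul_of_pos_left _ (Nat.mul_pos h2 hk)
  have h4 : bound k c * (c * k) ≤ nodeTime k c := (Nat.mul_le_mul_left _ h3).trans (Nat.le_add_right _ _)
  have h5 : c * k ≤ bound k c * (c * k) := Nat.le_mul_of_pos_left _ h1
  have h6 : 0 < c * k := Nat.mul_pos (by omega) hk
  exact ⟨h4, h5.trans h4, by omega⟩

section
variable {V : Type} {l : OccList V} {n c : ℕ} {G : SimpleGraph V}

theorem fits_bdry (hc : 2 ≤ c) (s : CWTerm) (e : s.Vert → V) : ∀ S ∈ schemesAt c G s e, Fits c (bdry G s e) S := by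
  rw [coe_bdry]; exact fits_of_mem hc s e

open Classical in
theorem Ready.bdry_subset (h : Ready L c G l σ) {s : CWTerm} {e : s.Vert → V} (hn : l[n]? = some ⟨s, e⟩) : bdry G s e ⊆
    L.toFinset :=
  (Finset.filter_subset _ _).trans (h.layout.labels _ (mem_of_getElem? hn))

theorem Ready.length_le (h : Ready L c G l σ) (hc : 2 ≤ c) {s : CWTerm} {e : s.Vert → V} (hn : l[n]? = some ⟨s, e⟩) (X :
    List Tuple) (hX : Rep L c (schemesAt c G s e) X) : X.length ≤ bound L.length c :=
  hX.length_le h.layout.nodup hc (h.bdry_subset hn) (fits_bdry hc s e)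

open Classical in
theorem schemesP_spec (h : Ready L c G l σ) (hc : 2 ≤ c) (hn : n < l.length) {s : CWTerm} {e : s.Vert → V} (ho : l[n]? =
    some ⟨s, e⟩) (hr : Loaded L s n σ) (hU : HasBits L (bdry G s e) (σ.arr aBU)) (hP : HasPairs L (Pending G s e) (σ.arr
    aPD)) (ht : HasTrie σ) (hS : ∀ j < n, ∀ o, l[j]? = some o → Stored L c (schemesAt c G o.1 o.2) (σ.arr aSTART j)
    (σ.arr aEND j) σ) : Spec schemesP σ (3000 * nodeTime L.length c) (fun τ => Stored L c (schemesAt c G s e) (τ.reg 77)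
    (τ.reg 78) τ ∧ HasTrie τ ∧ MemLe σ τ) := by
  have hpos : 0 < L.length := h.layout.pos
  have hl := h.layout
  obtain ⟨hT1, hT2, hT3⟩ := nodeTime_ge hc hpos
  set X := nodeTime L.length c with hX
  have hT4 : X = bound L.length c * (min c (2 ^ L.length) * L.length * (c * L.length)) + L.length ^ 6 := hX
  have fin : ∀ ρ : State, ∀ 𝒮, Stored L c 𝒮 (ρ.reg 46) (ρ.reg rE) ρ ∧ HasTrie ρ ∧ MemLe σ ρ →
      Spec (assign 77 (reg 46) ;; assign 78 (reg rE)) ρ 4 (fun τ => Stored L c 𝒮 (τ.reg 77) (τ.reg 78) τ ∧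
        HasTrie τ ∧ MemLe σ τ) := by
    rintro ρ 𝒮 ⟨⟨X, k1, k2, k3, k4⟩, k5, k6⟩
    refine Spec.block 4 ⟨⟨X, k1, ?_, ?_, ?_⟩, k5.congr, ⟨k6.1, k6.2⟩⟩
    · simpa [run] using k2
    · simpa [run] using k3
    · simp [run]
  obtain ⟨h70, h71, h72, h73, h74, h75, h76⟩ := hr
  refine Spec.le (T := 9 + 2900 * X) ?_ (by omega)
  refine bySymbol_spec h76 ?_
  cases s with
  | vertex a =>
    obtain ⟨ha, h73'⟩ := h73 a rfl
    have hal := idxOf_lt_length_iff.2 ha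
    refine Spec.le (T := 2 + (3 + (300 * (c * L.length) + 4))) (Spec.blockseq 2 (Spec.blockseq 3 ?_)) (by omega)
    have hE : Env L c ((assign 40 (get aBU (reg 73))).run ((assign 38 (reg 73)).run σ)) := h.env.congr
    refine Spec.seqf (vertexP_spec hl.nodup hE (by omega) (ht.congr) hal (by simp [run, h73'])
      (P := a ∈ bdry G (vertex a) e) ?_) ?_
    · have := hU _ hal
      rw [lb_idxOf ha] at this
      by_cases hB : a ∈ bdry G (vertex a) e <;> simpa [run, h73', hB] using this
    · rintro ρ hf ⟨k1, k2, k3⟩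
      refine fin ρ _ ⟨?_, k2, ⟨k3.1, k3.2⟩⟩
      convert k1 using 1
      rw [lb_idxOf ha]
      by_cases hB : a ∈ bdry G (vertex a) e <;>
        simp [schemesAt, Scheme.restrict, Finset.filter_singleton, ← mem_bdry, hB]
  | add a b hab s =>
    obtain ⟨hn0, hchild⟩ := hl.order.add_child ho
    obtain ⟨X, k1, k2, k3, k4⟩ := hS (n - 1) (by omega) _ hchild
    -- An addition of edges shares the stored schemes of its argument; only the two pointers are
    -- copied.
    refine (Spec.block 6 ?_).le (by omega)
    refine ⟨⟨X, k1, ?_, ?_, ?_⟩, ht.congr, ⟨le_rfl, fun _ _ => rfl⟩⟩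
    · simpa [run, pick, h72] using k2
    · simpa [run, pick, h72] using k3
    · simpa [run, pick, h72] using k4
  | rename a b s =>
    obtain ⟨ha, h73'⟩ := h73 a rfl
    obtain ⟨hb, h74'⟩ := h74 b rfl
    obtain ⟨hn0, hchild⟩ := hl.order.rename_child ho
    refine Spec.le (T := 3 + (3 + (2 + (2 + ((500 * (bound L.length c * (c * L.length)) + 20) + 4)))))
      (Spec.blockseq 3 (Spec.blockseq 3 (Spec.blockseq 2 (Spec.blockseq 2 ?_)))) (by omega)
    set σ1 := (assign 39 (reg 74)).run ((assign 38 (reg 73)).run ((assign 44 (get aEND (reg 72))).run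
      ((assign 43 (get aSTART (reg 72))).run σ))) with hσ1
    have hE : Env L c σ1 := h.env.congr
    have hS1 : Stored L c (schemesAt c G s e) (σ1.reg 43) (σ1.reg 44) σ1 := by
      obtain ⟨X, k1, k2, k3, k4⟩ := hS (n - 1) (by omega) _ hchild
      refine ⟨X, k1, ?_, ?_, ?_⟩
      · simpa [hσ1, run, h72] using k2
      · simpa [hσ1, run, h72] using k3
      · simpa [hσ1, run, h72] using k4
    refine Spec.seqf (renameP_spec hl.nodup hE (by omega) (ht.congr) (idxOf_lt_length_iff.2 ha)
      (by simp [hσ1, run, h73']) (idxOf_lt_length_iff.2 hb) (by simp [hσ1, run, h74']) hS1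
      (h.length_le hc hchild)) ?_
    rintro ρ hf ⟨k1, k2, k3⟩
    rw [lb_idxOf ha, lb_idxOf hb] at k1
    exact fin ρ _ ⟨k1, k2, ⟨k3.1, k3.2⟩⟩
  | union s₁ s₂ =>
    obtain ⟨hn0, hright⟩ := hl.order.right_child ho
    obtain ⟨hn1, hleft⟩ := hl.order.left_child ho
    have h71 := h71 _ _ rfl
    set B₁ := bdry G s₁ (fun x => e (Sum.inl x)) with hB₁
    set B₂ := bdry G s₂ (fun x => e (Sum.inr x)) with hB₂
    refine Spec.le (T := 600 * L.length ^ 6 + (3 + (3 + (3 + (3 + ((2000 * (bound L.length c * (min c (2 ^ L.length) *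
      L.length * (c * L.length))) + 100) + 4)))))) ?_ (by omega)
    refine Spec.seqf (scratch_spec (A := aBB) (φ := bbF) (R := fun _ y => y ∈ B₁ ∪ B₂) h (by omega) h75 ?_ ?_) ?_
    · intro x hx y hy; simp [bbF, Fml.InRange, atPos, hy]
    · intro f f1 f2 f3 x hx y hy
      have k1 := (h.blocks_iff hleft f1 f2 f3 hy hy).1
      have k2 := (h.blocks_iff hright f1 f2 f3 hy hy).1
      simp only [bbF, Fml.Sem, atPos]
      simp [h71, h72, k1, k2, hB₁, hB₂]
    intro σ1 hf hbb
    have hm1 : MemLe σ σ1 := MemLe.of_frame hf rfl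
    refine Spec.blockseq 3 (Spec.blockseq 3 (Spec.blockseq 3 (Spec.blockseq 3 ?_)))
    set σ2 := (assign 53 (get aEND (reg 72))).run ((assign 52 (get aSTART (reg 72))).run
      ((assign 51 (get aEND (reg 71))).run ((assign 50 (get aSTART (reg 71))).run σ1))) with hσ2
    have hE : Env L c σ2 := (h.env.frame hf rfl).congr
    have e71 : σ1.reg 71 = n - 1 - s₂.size := (hf.reg 71 rfl).trans h71
    have e72 : σ1.reg 72 = n - 1 := (hf.reg 72 rfl).trans h72
    have eS : σ1.arr aSTART = σ.arr aSTART := hf.arr _ rfl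
    have eE : σ1.arr aEND = σ.arr aEND := hf.arr _ rfl
    have hm2 : MemLe σ σ2 := ⟨hm1.1, hm1.2⟩
    have hl1 := (hS _ (by omega) _ hleft).of_memLe hm2
    have hl2 := (hS _ (by omega) _ hright).of_memLe hm2
    refine Spec.seqf (unionP_spec hl.nodup hE hc hpos ((ht.frame hf rfl).congr) (B₁ := B₁) (B₂ := B₂) rfl
      (Finset.union_subset (h.bdry_subset hleft) (h.bdry_subset hright)) (U := bdry G (union s₁ s₂) e)
      (P := Pending G (union s₁ s₂) e) (hbb.hasBits hpos) ?_ ?_ (𝒮₁ := schemesAt c G s₁ _)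
      (𝒮₂ := schemesAt c G s₂ _) ?_ ?_ (fits_bdry hc _ _) (fits_bdry hc _ _)) ?_
    · have : HasBits L (bdry G (union s₁ s₂) e) (σ1.arr aBU) := hf.arr aBU rfl ▸ hU
      exact this
    · have : HasPairs L (Pending G (union s₁ s₂) e) (σ1.arr aPD) := hf.arr aPD rfl ▸ hP
      exact this
    · have f50 : σ2.reg 50 = σ.arr aSTART (n - 1 - s₂.size) := by simp [hσ2, run, e71, eS]
      have f51 : σ2.reg 51 = σ.arr aEND (n - 1 - s₂.size) := by simp [hσ2, run, e71, eE]
      rw [f50, f51]; exact hl1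
    · have f52 : σ2.reg 52 = σ.arr aSTART (n - 1) := by simp [hσ2, run, e72, eS]
      have f53 : σ2.reg 53 = σ.arr aEND (n - 1) := by simp [hσ2, run, e72, eE]
      rw [f52, f53]; exact hl2
    · rintro ρ hfρ ⟨k1, k2, k3⟩
      refine fin ρ _ ⟨?_, k2, hm2.trans k3⟩
      simp only [hB₁, hB₂, Finset.coe_union, coe_bdry] at k1
      exact k1

open Classical in
theorem dpP_spec (h : Ready L c G l σ) (hc : 2 ≤ c) (hn : n < l.length) (h70 : σ.reg 70 = n) (hd : Done L c G l n σ) :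
    Spec dpP σ (5000 * nodeTime L.length c) (Done L c G l (n + 1)) := by
  obtain ⟨⟨s, e⟩, ho⟩ := exists_getElem? (l := l) hn
  have hl := h.layout
  obtain ⟨hT1, hT2, hT3⟩ := nodeTime_ge hc hl.pos
  have hT4 : L.length ^ 6 ≤ nodeTime L.length c := Nat.le_add_left _ _
  refine Spec.le (T := 18 + (600 * L.length ^ 6 + (600 * L.length ^ 6 + (3000 * nodeTime L.length c + (3 + (3 + (2 + (2 +
    (60 * (bound L.length c * (c * L.length)) + 5))))))))) ?_ (by omega)
  refine Spec.seqf (nodeP_spec hl ho h70) ?_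
  rintro τ hf ⟨hr, harr⟩
  have hτ := h.frame hf rfl
  refine Spec.seqf (scratch_spec (A := aBU) (φ := buF) (R := fun _ y => y ∈ bdry G s e) hτ (by omega) hr.h75 ?_ ?_) ?_
  · intro x hx y hy; simp [buF, Fml.InRange, atPos, hy]
  · intro f f1 f2 f3 x hx y hy
    have k1 := (hτ.blocks_iff ho f1 f2 f3 hy hy).1
    simp only [buF, Fml.Sem, atPos]
    simp [hr.h70, k1]
  intro τ1 hf1 hbu
  have hτ1 := hτ.frame hf1 rfl
  refine Spec.seqf (scratch_spec (A := aPD) (φ := pdF) (R := Pending G s e) hτ1 (by omega) (hr.frame hf1).h75 ?_ ?_) ?_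
  · intro x hx y hy; simp [pdF, Fml.InRange, atPos, hx, hy]
  · intro f f1 f2 f3 x hx y hy
    have k1 := (hτ1.blocks_iff ho f1 f2 f3 hx hy).2
    simp only [pdF, Fml.Sem, atPos]
    simpa [(hr.frame hf1).h70] using k1
  intro τ2 hf2 hpd
  have hτ2 := hτ1.frame hf2 rfl
  have hr := (hr.frame hf1).frame hf2
  have ha : ∀ A, A ≠ aBU → A ≠ aPD → τ2.arr A = σ.arr A := fun A h1 h2 =>
    ((hf2.arr A (fillP_wa h2)).trans (hf1.arr A (fillP_wa h1))).trans (by rw [harr])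
  have hm2 : MemLe σ τ2 := ((MemLe.of_frame hf rfl).trans (MemLe.of_frame hf1 rfl)).trans (MemLe.of_frame hf2 rfl)
  have hU : HasBits L (bdry G s e) (τ2.arr aBU) := hf2.arr aBU rfl ▸ hbu.hasBits hl.pos
  refine Spec.seqf (schemesP_spec hτ2 hc hn ho hr hU hpd.hasPairs
    (((hd.trie.frame hf rfl).frame hf1 rfl).frame hf2 rfl) ?_) ?_
  · intro j hj o hjo
    rw [ha _ (by decide) (by decide), ha _ (by decide) (by decide)]
    exact (hd.stored j hj o hjo).of_memLe hm2
  rintro τ3 hf3 ⟨k1, k2, k3⟩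
  have e70 : τ3.reg 70 = n := (hf3.reg 70 rfl).trans hr.h70
  have eS : τ3.arr aSTART = σ.arr aSTART := (hf3.arr _ rfl).trans (ha _ (by decide) (by decide))
  have eE : τ3.arr aEND = σ.arr aEND := (hf3.arr _ rfl).trans (ha _ (by decide) (by decide))
  have eo : τ3.out = σ.out := (hf3.out rfl).trans ((hf2.out rfl).trans ((hf1.out rfl).trans (hf.out rfl)))
  have hτ3 := hτ2.frame hf3 rfl
  refine Spec.blockseq 3 (Spec.blockseq 3 (Spec.blockseq 2 (Spec.blockseq 2 ?_)))
  set σ1 := (assign 44 (reg 78)).run ((assign 43 (reg 77)).run ((store aEND (reg 70) (reg 78)).run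
    ((store aSTART (reg 70) (reg 77)).run τ3))) with hσ1
  have hE : Env L c σ1 := hτ3.env.congr
  have hm4 : MemLe τ3 σ1 := ⟨le_rfl, fun _ _ => rfl⟩
  have hS1 : Stored L c (schemesAt c G s e) (σ1.reg 43) (σ1.reg 44) σ1 := by
    have := k1.of_memLe hm4
    simpa [hσ1, run] using this
  refine (printP_spec hl.nodup hE (by omega) hl.pos hτ3.labels hS1 (h.length_le hc ho)).mono ?_
  rintro ρ hfρ ⟨b, hb1, hb2⟩
  have hm5 : MemLe σ1 ρ := MemLe.of_frame hfρ rfl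
  obtain ⟨blocks, hbl1, hbl2⟩ := hd.out
  refine ⟨(k2.congr : HasTrie σ1).frame hfρ rfl, ?_, blocks ++ [b], ?_, ?_⟩
  · intro j hj o hjo
    rw [hfρ.arr aSTART rfl, hfρ.arr aEND rfl]
    rcases Nat.lt_succ_iff_lt_or_eq.1 hj with hj | rfl
    · have := (((hd.stored j hj o hjo).of_memLe (hm2.trans k3)).of_memLe hm4).of_memLe hm5
      simpa [hσ1, run, e70, eS, eE, hj.ne] using this
    · obtain rfl := Option.some.inj (ho.symm.trans hjo)
      have := hS1.of_memLe hm5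
      simpa [hσ1, run, e70] using this
  · rw [hb1, flatMap_append, ← hbl1, ← eo]
    simp [hσ1, run]
  · rw [take_add_one, ho]
    simp only [List.map_append, hbl2, Option.toList_some, List.map_cons, List.map_nil, hb2]

end

/-- Compute the schemes for all occurrences, and the answer. -/
def solveP : Prog := forLoop 70 rM nfP ;; assign 70 (reg rM) ;; forLoop 88 rM (assign 70 (pred (reg 70)) ;; pmP) ;;
  forLoop 70 rM dpP ;;
  Prog.cond (lt (get aSTART (pred (reg rM))) (get aEND (pred (reg rM)))) (write (lit 1)) (write (lit 0))

section
variable {t : CWTerm}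

theorem Stored.lt_iff {s e : ℕ} (h : Stored L c 𝒮 s e σ) (hc : 0 < c) : s < e ↔ 𝒮.Nonempty := by
  obtain ⟨X, k1, -, k3, -⟩ := h
  constructor
  · intro hlt
    have : X ≠ [] := by rintro rfl; simp [k3] at hlt
    obtain ⟨x, hx⟩ := List.exists_mem_of_ne_nil X this
    exact ⟨_, (k1.mem _).2 ⟨x, hx, rfl⟩⟩
  · rintro ⟨S, hS⟩
    obtain ⟨x, hx, -⟩ := (k1.mem S).1 hS
    have := Nat.mul_pos (List.length_pos_of_mem hx) hc
    omega

open Classical in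
-- Non-adjacency depends on the arguments of an occurrence and the context on the operation above
-- it, so one is computed in postorder and the other in reverse; boundaries and pending pairs need
-- both. The context of the root is the empty relation, which the untouched array `aPM` already
-- represents.
theorem solveP_spec (hc : 2 ≤ c) (hl : Layout L (occurrences t (id : t.Vert → t.Vert)) σ) (hE : Env L c σ) (hlb :
    HasLabels L σ) (ht : HasTrie σ) (hpm : σ.arr aPM = fun _ => 0) (hout : σ.out = []) : Spec solveP σ (7100 * (t.size *
    nodeTime L.length c)) (fun τ => IsAnswer c t τ.out) := by
  set l := occurrences t (id : t.Vert → t.Vert) with hlo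
  have hlen : l.length = t.size := length_occurrences _ _
  have hm := t.size_pos
  obtain ⟨hT1, hT2, hT3⟩ := nodeTime_ge hc hl.pos
  have hT4 : L.length ^ 6 ≤ nodeTime L.length c := Nat.le_add_left _ _
  set W := nodeTime L.length c with hW
  refine Spec.le (T := (t.size * (700 * L.length ^ 6 + 6) + 5) + (2 + ((t.size * ((3 + 1300 * L.length ^ 6) + 6) + 5) +
    ((t.size * (5000 * W + 6) + 5) + 9)))) ?_ (by
      have h1 := Nat.mul_le_mul_left t.size (show (700 * L.length ^ 6 + 6) + ((3 + 1300 * L.length ^ 6) + 6) +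
        (5000 * W + 6) + 26 ≤ 7100 * W by omega)
      have h2 : t.size * (7100 * W) = 7100 * (t.size * W) := by ring
      nlinarith)
  refine Spec.seqf (Spec.for _ _ (HasNF L l) (hl.rm.trans hlen) (fun i hi => absurd hi (by omega)) ?_) ?_
  · intro j hj τ hf h70 hI
    exact nfP_spec (hl.frame hf rfl) (by omega) h70 hI
  rintro τ1 hf1 ⟨-, hnf⟩
  rw [← hlen] at hnf
  have hl1 := hl.frame hf1 rfl
  refine Spec.blockseq 2 ?_
  have hl1' : Layout L l ((assign 70 (reg rM)).run τ1) := hl1.congr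
  -- After `j` rounds the last `j` positions have passed on their contexts; known are the contexts
  -- of the root and of the arguments of these positions.
  refine Spec.seqf (Spec.for _ _ (fun j τ => τ.reg 70 = t.size - j ∧ HasNF L l l.length τ ∧ ∀ q, (q + 1 = t.size ∨
    ∃ p o, t.size - j ≤ p ∧ l[p]? = some o ∧ o.1.ChildAt p q) → HasCtx L t.graph l τ q)
    (hl1'.rm.trans hlen) ?_ ?_) ?_
  · refine ⟨by simp [run, hl1.rm, hlen], hnf, ?_⟩
    rintro q (hq | ⟨p, o, hp, ho, -⟩) o' ho'
    · have hroot := occurrences_getElem? t (id : t.Vert → t.Vert) hq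
      rw [← hlo, ho'] at hroot
      obtain rfl := Option.some.inj hroot
      refine ⟨_, Ctx.root t, fun x _ y _ => ?_⟩
      show τ1.arr aPM _ = _
      rw [hf1.arr aPM rfl, hpm]
      simp
    · have := getElem?_lt ho
      omega
  · rintro j hj τ hf - ⟨h70, hnf, hctx⟩
    refine Spec.blockseq 3 ?_
    set τ' := (assign 70 (pred (reg 70))).run τ with hτ'
    have hlτ : Layout L l τ' := (hl1'.frame hf rfl).congr
    have e70 : τ'.reg 70 = t.size - j - 1 := by simp [hτ', run, h70]
    have hc' : HasCtx L t.graph l τ' (t.size - j - 1) := by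
      refine hctx _ ?_
      by_cases hq : t.size - j - 1 + 1 = t.size
      · exact Or.inl hq
      · obtain ⟨p, o, ho, hch⟩ := exists_parent t (id : t.Vert → t.Vert) (t.size - j - 1) (by omega)
        exact Or.inr ⟨p, o, by have := hch.lt; omega, ho, hch⟩
    refine (pmP_spec hlτ (by omega) e70 hnf hc').mono ?_
    rintro ρ hfρ ⟨k1, k2⟩
    refine ⟨?_, ?_, ?_⟩
    · simp [hfρ.reg 70 rfl, e70]; omega
    · show HasNF L l l.length ρ
      rw [HasNF, hfρ.arr aNF rfl]; exact hnf
    · rintro q hq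
      show HasCtx L t.graph l ρ q
      rcases hq with hq | ⟨p, o, hp, ho, hch⟩
      · exact k1 q (hctx q (Or.inl hq))
      · rcases Nat.lt_or_ge p (t.size - j) with hlt | hge
        · obtain rfl : p = t.size - j - 1 := by omega
          exact k2 q o ho hch
        · exact k1 q (hctx q (Or.inr ⟨p, o, hge, ho, hch⟩))
  rintro τ2 hf2 ⟨-, -, hnf2, hctx⟩
  have hR : Ready L c t.graph l τ2 := by
    refine ⟨hl1'.frame hf2 rfl, hnf2, fun j o ho => ?_,
      ((hE.frame hf1 rfl).congr : Env L c ((assign 70 (reg rM)).run τ1)).frame hf2 rfl, ?_⟩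
    · have hj := getElem?_lt ho
      refine hctx j ?_ o ho
      by_cases hq : j + 1 = t.size
      · exact Or.inl hq
      · obtain ⟨p, o, ho, hch⟩ := exists_parent t (id : t.Vert → t.Vert) j (by omega)
        exact Or.inr ⟨p, o, by omega, ho, hch⟩
    · intro a ha
      rw [hf2.arr aLBL rfl]
      show τ1.arr aLBL a = _
      rw [hf1.arr aLBL rfl]
      exact hlb a ha
  have ht2 : HasTrie τ2 := ((ht.frame hf1 rfl).congr : HasTrie ((assign 70 (reg rM)).run τ1)).frame hf2 rfl
  have hout2 : τ2.out = [] := (hf2.out rfl).trans ((hf1.out rfl).trans hout)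
  refine Spec.seqf (Spec.for _ _ (Done L c t.graph l) (hR.layout.rm.trans hlen) ?_ ?_) ?_
  · exact ⟨ht2.congr, fun j hj => absurd hj (by omega), [], by simpa using hout2, by simp⟩
  · intro j hj τ hf h70 hI
    refine (dpP_spec (hR.frame hf rfl) hc (by omega) h70 hI).mono ?_
    rintro ρ - ⟨k1, k2, k3⟩
    exact ⟨k1.congr, fun j hj o ho => (k2 j hj o ho).of_memLe ⟨le_rfl, fun _ _ => rfl⟩, k3⟩
  rintro τ hf ⟨-, -, hst, blocks, hb1, hb2⟩
  have hroot := occurrences_getElem? t (id : t.Vert → t.Vert) (show t.size - 1 + 1 = t.size by omega)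
  have hrm : τ.reg rM = t.size := (hf.reg rM rfl).trans (hR.layout.rm.trans hlen)
  have hcol := (hst (t.size - 1) (by omega) _ hroot).lt_iff (by omega)
  have hne : (schemesAt c t.graph t id).Nonempty ↔ t.graph.Colorable c := schemes_nonempty_iff (by omega)
  rw [hne] at hcol
  rw [take_of_length_le hlen.le] at hb2
  refine Spec.block 9 ⟨blocks, if t.graph.Colorable c then 1 else 0, ?_, hb2, ?_⟩
  · by_cases hC : t.graph.Colorable c
    · simp [run, hrm, hcol.2 hC, hC, hb1]
    · simp [run, hrm, mt hcol.1 hC, hC, hb1]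
  · by_cases hC : t.graph.Colorable c <;> simp [hC]

end

/-! ### Reading the input -/

/-- Read a label, number it and record its number in array `A`. -/
def labP (A : ℕ) : Prog := Prog.cond (eq (get 1 (get 0 (reg 80))) (lit 0))
    (store aLBL (reg rK) (get 0 (reg 80)) ;; inc rK ;; store 1 (get 0 (reg 80)) (reg rK)) skip ;;
  store A (reg rM) (pred (get 1 (get 0 (reg 80)))) ;; inc 80

/-- Read the term. -/
def parseP : Prog := Prog.loop (lt (lit 0) (get 0 (reg 80)))
  (assign 81 (get 0 (reg 80)) ;; store aOP (reg rM) (reg 81) ;; inc 80 ;;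
    Prog.cond (lt (reg 81) (lit 4)) (labP aX ;; Prog.cond (lt (lit 1) (reg 81)) (labP aY) skip) skip ;; inc rM)

/-- The code of a list of symbols. -/
def symbolsCode (R : List CWTerm) : List ℕ := R.flatMap (fun s => s.symbol :: s.symbolLabels) ++ [0]

/-- The symbols `S` have been read and also the first `n` labels `ls` of the next symbol; `L` lists the labels
met so far. -/
structure Reading (L : List ℕ) (S : List CWTerm) (ls : List ℕ) (n : ℕ) (rest : List ℕ) (σ : State) : Prop where
  nodup : L.Nodup
  rk : σ.reg rK = L.length
  labels : HasLabels L σ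
  index : ∀ a, σ.arr 1 a = if a ∈ L then L.idxOf a + 1 else 0
  rm : σ.reg rM = S.length
  node : ∀ i s, S[i]? = some s → Recorded L σ i s
  here : ∀ j < n, ∀ a, ls[j]? = some a → a ∈ L ∧ σ.arr (aX + j) S.length = L.idxOf a
  mem : ∀ a, a ∈ L ↔ a ∈ S.flatMap symbolLabels ++ ls.take n
  rest : At (σ.arr 0) (σ.reg 80) (ls.drop n ++ rest)

/-- Array `1`, indexed by the label itself, contains the position of the label plus one, so that the
initial 0 means that the label is new. Numbering a label takes constant time, however large it is.
-/
theorem labP_spec {S : List CWTerm} {ls : List ℕ} {n : ℕ} {rest : List ℕ} (h : Reading L S ls n rest σ) (hn : n < 2) {a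
    : ℕ} (ha : ls[n]? = some a) : Spec (labP (aX + n)) σ 25 (fun τ => ∃ L', Reading L' S ls (n + 1) rest τ) := by
  have hlen := getElem?_lt ha
  have hrest := h.rest
  rw [List.drop_eq_getElem_cons hlen, (List.getElem?_eq_some_iff.1 ha).2, List.cons_append, At.cons_iff] at hrest
  obtain ⟨ha0, hrest⟩ := hrest
  have hia := h.index a
  have hn0 : ¬ 21 + n = 0 := by omega
  have hn1 : ¬ 21 + n = 1 := by omega
  have hn2 : ¬ 21 + n = 2 := by omega
  have key : Spec (labP (aX + n)) σ 25 (fun τ => ∃ L', L'.Nodup ∧ τ.reg rK = L'.length ∧ HasLabels L' τ ∧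
      (∀ b, τ.arr 1 b = if b ∈ L' then L'.idxOf b + 1 else 0) ∧ (∀ b ∈ L, L'.idxOf b = L.idxOf b) ∧
      (∀ b, b ∈ L' ↔ b ∈ L ∨ b = a) ∧ τ.arr (aX + n) = update (σ.arr (aX + n)) S.length (L'.idxOf a) ∧
      τ.reg 80 = σ.reg 80 + 1) := by
    refine Spec.block 25 ?_
    by_cases haL : a ∈ L
    · rw [if_pos haL] at hia
      refine ⟨L, h.nodup, ?_, fun b hb => ?_, fun b => ?_, fun b _ => rfl, fun b => ?_, ?_, ?_⟩
      · simp [labP, run, inc, ha0, hia, h.rk]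
      · simpa [labP, run, inc, ha0, hia, hn2, Ne.symm hn2] using h.labels b hb
      · simpa [labP, run, inc, ha0, hia, hn1, Ne.symm hn1] using h.index b
      · exact ⟨Or.inl, by rintro (h | rfl) <;> assumption⟩
      · simp [labP, run, inc, ha0, hia, h.rm]
      · simp [labP, run, inc, ha0, hia]
    · rw [if_neg haL] at hia
      refine ⟨L ++ [a], ?_, ?_, fun b hb => ?_, fun b => ?_, fun b hb => ?_, fun b => ?_, ?_, ?_⟩
      · exact List.nodup_append.2 ⟨h.nodup, List.nodup_singleton a, by rintro x hx y hy rfl; simp_all⟩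
      · simp [labP, run, inc, ha0, hia, h.rk]
      · rw [length_append, List.length_singleton, Nat.lt_succ_iff_lt_or_eq] at hb
        rcases hb with hb | rfl
        · have := h.labels b hb
          simpa [labP, run, inc, ha0, hia, hn2, Ne.symm hn2, h.rk, hb.ne, lb, hb, getElem?_append_left hb] using this
        · simp [labP, run, inc, ha0, hia, hn2, Ne.symm hn2, h.rk, lb]
      · have := h.index b
        by_cases hb : b = a
        · subst hb
          simp [labP, run, inc, ha0, hia, hn1, Ne.symm hn1, h.rk, List.idxOf_append_of_notMem haL]
        · by_cases hbL : b ∈ L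
          · simpa [labP, run, inc, ha0, hia, hn1, Ne.symm hn1, hb, hbL, List.idxOf_append_of_mem hbL] using this
          · simpa [labP, run, inc, ha0, hia, hn1, Ne.symm hn1, hb, hbL] using this
      · exact List.idxOf_append_of_mem hb
      · simp
      · simp [labP, run, inc, ha0, hia, h.rm, h.rk, List.idxOf_append_of_notMem haL, hn0, hn1, hn2]
      · simp [labP, run, inc, ha0, hia]
  refine key.mono ?_
  rintro τ hf ⟨L', k1, k2, k3, k4, k5, k6, k7, k8⟩
  have harr : ∀ A, A ≠ 1 → A ≠ 2 → A ≠ aX + n → τ.arr A = σ.arr A := by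
    intro A h1 h2 h3
    refine hf.arr A ?_
    have h0 : ∀ m, m ≠ A → Nat.beq m A = false := fun m hm => by rw [← Bool.not_eq_true, Nat.beq_eq]; exact hm
    simp only [labP, inc, Prog.wa, h0 aLBL h2.symm, h0 1 h1.symm, h0 (aX + n) h3.symm, Bool.or_self]
  have hX : ∀ j i, (i < S.length ∨ j ≠ n) → τ.arr (aX + j) i = σ.arr (aX + j) i := by
    intro j i hij
    by_cases hj : j = n
    · subst hj
      rw [k7, update_of_ne (by omega)]
    · rw [harr _ (by omega) (by omega) (by omega)]
  refine ⟨L', k1, k2, k3, k4, (hf.reg rM rfl).trans h.rm, fun i s hi => ?_, fun j hj b hb => ?_, fun b => ?_, ?_⟩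
  · obtain ⟨q1, q2⟩ := h.node i s hi
    refine ⟨by rw [harr _ (by decide) (by decide) (by omega), q1], fun j b hb => ?_⟩
    obtain ⟨q3, q4⟩ := q2 j b hb
    rw [hX j i (Or.inl (getElem?_lt hi)), k5 b q3]
    exact ⟨(k6 b).2 (Or.inl q3), q4⟩
  · rcases Nat.lt_succ_iff_lt_or_eq.1 hj with hj | rfl
    · obtain ⟨q3, q4⟩ := h.here j hj b hb
      rw [hX j _ (Or.inr hj.ne), k5 b q3]
      exact ⟨(k6 b).2 (Or.inl q3), q4⟩
    · obtain rfl := Option.some.inj (ha.symm.trans hb)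
      exact ⟨(k6 _).2 (Or.inr rfl), by rw [k7, update_self]⟩
  · rw [k6, h.mem, take_add_one, ha, ← List.append_assoc]
    simp [or_assoc]
  · rw [harr 0 (by decide) (by decide) (by omega), k8]
    exact hrest

/-- Symbols start with a nonzero entry, so the 0 behind the term ends the loop. -/
theorem parseP_spec {S : List CWTerm} (h : Reading [] [] [] 0 (symbolsCode S) σ) : Spec parseP σ (100 * S.length + 4)
    (fun τ => ∃ L, Reading L S [] 0 [0] τ) := by
  have hloop := Spec.loop (σ := σ) (p := assign 81 (get 0 (reg 80)) ;; store aOP (reg rM) (reg 81) ;; inc 80 ;;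
    Prog.cond (lt (reg 81) (lit 4)) (labP aX ;; Prog.cond (lt (lit 1) (reg 81)) (labP aY) skip) skip ;; inc rM)
    (b := lt (lit 0) (get 0 (reg 80)))
    (fun x τ => x.1 ++ x.2 = S ∧ ∃ L, Reading L x.1 [] 0 (symbolsCode x.2) τ) (fun x => 100 * x.2.length) ([], S)
    ⟨rfl, [], h⟩ ?_
  · refine hloop.mono ?_
    rintro τ - ⟨⟨S', R⟩, ⟨hS, L, hL⟩, hb⟩
    cases R with
    | nil =>
      obtain rfl : S' = S := by simpa using hS
      exact ⟨L, hL⟩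
    | cons s R =>
      have := (At.cons_iff.1 (show At _ _ (s.symbol :: _) from hL.rest)).1
      have hpos : 0 < s.symbol := by cases s <;> simp [symbol]
      simp [this] at hb
      omega
  rintro ⟨S', R⟩ τ - ⟨hS, L, hL⟩ hb
  cases R with
  | nil =>
    have := (At.cons_iff.1 (show At _ _ [0] from hL.rest)).1
    simp [this] at hb
  | cons s R =>
    obtain ⟨h0, hrest⟩ := At.cons_iff.1 (show At _ _ (s.symbol :: (s.symbolLabels ++ R.flatMap _ ++ [0])) by
      simpa [symbolsCode] using hL.rest)
    refine ⟨3 + (3 + (3 + ((3 + max (25 + (3 + max 25 1)) 1) + 3))), ?_⟩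
    have fin : ∀ ρ : State, ∀ L, Reading L S' s.symbolLabels s.symbolLabels.length (symbolsCode R) ρ →
        ρ.arr aOP S'.length = s.symbol → Spec (inc rM) ρ 3 (fun χ => ∃ y : List CWTerm × List CWTerm,
          (y.1 ++ y.2 = S ∧ ∃ L, Reading L y.1 [] 0 (symbolsCode y.2) χ) ∧
          3 + (3 + (3 + ((3 + max (25 + (3 + max 25 1)) 1) + 3))) + (lt (lit 0) (get 0 (reg 80))).cost +
            100 * y.2.length ≤ 100 * (s :: R).length) := by
      intro ρ L k kop
      refine Spec.block 3 ⟨(S' ++ [s], R), ⟨by simpa using hS, L, k.nodup, ?_, k.labels, k.index, ?_,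
        fun i s' hi => ?_, by simp, fun a => ?_, ?_⟩, by simp; omega⟩
      · simpa [run, inc] using k.rk
      · simp [run, inc, k.rm]
      · rcases lt_trichotomy i S'.length with hlt | rfl | hgt
        · rw [getElem?_append_left hlt] at hi
          exact k.node i s' hi
        · obtain rfl : s = s' := by simpa using hi
          exact ⟨kop, fun j a hj => k.here j (getElem?_lt hj) a hj⟩
        · rw [List.getElem?_eq_none (by simp; omega)] at hi
          simp at hi
      · rw [k.mem]; simp
      · simpa [run, inc] using k.rest
    refine Spec.blockseq 3 (Spec.blockseq 3 (Spec.blockseq 3 ?_))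
    set σ1 := (inc 80).run ((store aOP (reg rM) (reg 81)).run ((assign 81 (get 0 (reg 80))).run τ)) with hσ1
    have e81 : σ1.reg 81 = s.symbol := by simp [hσ1, run, inc, h0]
    have eop : σ1.arr aOP S'.length = s.symbol := by simp [hσ1, run, inc, h0, hL.rm]
    have hR : Reading L S' s.symbolLabels 0 (symbolsCode R) σ1 := by
      refine ⟨hL.nodup, ?_, hL.labels, hL.index, ?_, fun i s' hi => ?_, by simp, by simpa using hL.mem, ?_⟩
      · simpa [hσ1, run, inc] using hL.rk
      · simpa [hσ1, run, inc] using hL.rm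
      · obtain ⟨q1, q2⟩ := hL.node i s' hi
        have := getElem?_lt hi
        refine ⟨?_, fun j a hj => ⟨(q2 j a hj).1, ?_⟩⟩
        · simpa [hσ1, run, inc, hL.rm, this.ne] using q1
        · have h20 : ¬ 21 + j = 20 := by omega
          simpa [hσ1, run, inc, h20] using (q2 j a hj).2
      · simpa [hσ1, run, inc, symbolsCode] using hrest
    have two : ∀ a b, s.symbolLabels = [a, b] → 1 < s.symbol ∧ s.symbol < 4 →
        Spec (Prog.cond (lt (reg 81) (lit 4)) (labP aX ;; Prog.cond (lt (lit 1) (reg 81)) (labP aY) skip) skip) σ1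
        (3 + max (25 + (3 + max 25 1)) 1) (fun ρ => (∃ L, Reading L S' s.symbolLabels s.symbolLabels.length
          (symbolsCode R) ρ) ∧ ρ.arr aOP S'.length = s.symbol) := by
      intro a b hab hs
      refine Spec.cond (b := lt (reg 81) (lit 4)) (fun _ => ?_) (fun hc => absurd (e81.trans_lt hs.2) hc)
      refine Spec.seqf (labP_spec hR (by decide) (a := a) (by rw [hab]; rfl)) ?_
      rintro ρ hfρ ⟨L1, hL1⟩
      have e : ρ.reg 81 = s.symbol := (hfρ.reg 81 rfl).trans e81
      refine Spec.cond (b := lt (lit 1) (reg 81)) (fun _ => ?_) (fun hc => absurd (hs.1.trans_eq e.symm) hc)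
      refine (labP_spec hL1 (by decide) (a := b) (by rw [hab]; rfl)).mono ?_
      rintro χ hfχ hχ
      exact ⟨by rw [hab] at hχ ⊢; exact hχ, by rw [hfχ.arr aOP rfl, hfρ.arr aOP rfl, eop]⟩
    refine Spec.seqf (R := fun ρ => (∃ L, Reading L S' s.symbolLabels s.symbolLabels.length (symbolsCode R) ρ) ∧
      ρ.arr aOP S'.length = s.symbol) ?_ fun ρ _ h => by obtain ⟨⟨L, hL⟩, k⟩ := h; exact fin ρ L hL k
    cases s with
    | vertex a =>
      refine Spec.cond (b := lt (reg 81) (lit 4)) (fun _ => ?_) (fun hc => ?_)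
      · refine Spec.seqf (labP_spec hR (by decide) (a := a) rfl) ?_
        rintro ρ hfρ hL1
        have e : ρ.reg 81 = 1 := (hfρ.reg 81 rfl).trans e81
        refine Spec.cond (b := lt (lit 1) (reg 81)) (fun hc => ?_) (fun hc => ?_)
        · simp [e] at hc
        · exact Spec.skip ⟨hL1, by rw [hfρ.arr aOP rfl, eop]⟩
      · simp [e81, symbol] at hc
    | add a b hab s => exact two a b rfl (by simp [symbol])
    | rename a b s => exact two a b rfl (by simp [symbol])
    | union s₁ s₂ =>
      refine Spec.cond (b := lt (reg 81) (lit 4)) (fun hc => ?_) (fun hc => ?_)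
      · simp [e81, symbol] at hc
      · exact Spec.skip ⟨⟨L, hR⟩, eop⟩

/-! ### Tables -/

/-- Compute the powers of two, and the tables for rotation and parity. -/
def tablesP : Prog := assign rN (lit 1) ;;
  forLoop 81 rK (assign 84 (reg rN) ;; forLoop 82 84 (inc rN)) ;;
  assign 85 (lit 0) ;; assign 86 (reg 84) ;;
  forLoop 81 84 (store aROT (reg 85) (reg 81) ;; store aODD (reg 85) (lit 0) ;; inc 85 ;;
    store aROT (reg 85) (reg 86) ;; store aODD (reg 85) (lit 1) ;; inc 85 ;; inc 86)

/-- Compute the positions of the blocks and of the first arguments of unions; array `8` receives the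
first position of a subterm. -/
def baseP : Prog := assign 85 (lit 0) ;; forLoop 82 rK (forLoop 83 rK (inc 85)) ;; assign 84 (lit 0) ;;
  forLoop 70 rM (store aBASE (reg 70) (reg 84) ;; forLoop 82 85 (inc 84) ;;
    Prog.cond (eq (get aOP (reg 70)) (lit 4))
      (store aLEFT (reg 70) (pred (get 8 (pred (reg 70)))) ;; store 8 (reg 70) (get 8 (get aLEFT (reg 70))))
      (Prog.cond (eq (get aOP (reg 70)) (lit 1)) (store 8 (reg 70) (reg 70))
        (store 8 (reg 70) (get 8 (pred (reg 70))))))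

theorem add_spec {i n r N : ℕ} (hin : Nat.beq i n = false) (hn : Nat.beq r n = false) (hi : Nat.beq r i = false) (hN :
    σ.reg n = N) : Spec (forLoop i n (inc r)) σ (N * 9 + 5) (fun τ => τ.reg r = σ.reg r + N) := by
  have hri : ¬ r = i := fun h => by rw [h] at hi; simp at hi
  refine (Spec.for 3 N (fun j τ => τ.reg r = σ.reg r + j) hN (by simp [hri]) ?_ hin
    (by simp [inc, Prog.wr, hn]) (by simp [inc, Prog.wr, hi])).mono fun τ _ h => h.2
  intro j hj τ hf hτ h
  exact Spec.block 3 (by simp [run, inc, hri, h]; ring)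

/-- A number is doubled by counting, at a cost proportional to its size, so the last doubling
dominates. The induction needs the stronger form with 22 added on the left. -/
theorem sum_doubling_le (k : ℕ) : ∑ j ∈ Finset.range k, ((2 + (2 ^ j * 9 + 5)) + 6) ≤ 22 * 2 ^ k := by
  have : ∀ k, ∑ j ∈ Finset.range k, ((2 + (2 ^ j * 9 + 5)) + 6) + 22 ≤ 22 * 2 ^ k := by
    intro k
    induction k with
    | zero => simp
    | succ k ih =>
      rw [Finset.sum_range_succ, pow_succ]
      have := Nat.one_le_two_pow (n := k)
      omega
  have := this k
  omega

theorem tablesP_spec (hpos : 0 < L.length) (hc : σ.reg rC = c) (hk : σ.reg rK = L.length) : Spec tablesP σ (60 * 2 ^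
    L.length) (Env L c) := by
  set k := L.length with hkL
  have h2 : 2 * 2 ^ (k - 1) = 2 ^ k := by rw [← pow_succ', Nat.sub_add_cancel hpos]
  have h1 := Nat.one_le_two_pow (n := k - 1)
  refine Spec.le (T := 2 + ((∑ j ∈ Finset.range k, ((2 + (2 ^ j * 9 + 5)) + 6) + 5) + (2 + (2 +
    (2 ^ (k - 1) * (25 + 6) + 5))))) ?_ (by have := sum_doubling_le k; omega)
  refine Spec.blockseq 2 (Spec.seqf (Spec.forSum _ k (fun j τ => τ.reg rN = 2 ^ j ∧ (0 < j → τ.reg 84 = 2 ^ (j - 1)))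
    ?_ ?_ ?_) ?_)
  · exact hk
  · simp [run]
  · rintro j hj τ hf - ⟨h, -⟩
    refine Spec.blockseq 2 ((add_spec rfl rfl rfl (N := 2 ^ j) (by simp [run, h])).mono ?_)
    rintro ρ hfρ hρ
    refine ⟨?_, ?_⟩
    · simp [hρ, run, h, pow_succ]; ring
    · simp [hfρ.reg 84 rfl, run, h]
  rintro τ hf ⟨-, hN, h84⟩
  replace h84 := h84 hpos
  refine Spec.blockseq 2 (Spec.blockseq 2 ?_)
  -- The numbers are treated in pairs: `2 * j` rotates to `j` and `2 * j + 1` to `2 ^ (k - 1) + j`.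
  -- Both tables are thus filled by counting alone.
  refine Spec.mono (Spec.for 25 (2 ^ (k - 1)) (fun j τ => τ.reg 85 = 2 * j ∧ τ.reg 86 = 2 ^ (k - 1) + j ∧ ∀ x < 2 * j,
    τ.arr aROT x = x / 2 + x % 2 * 2 ^ (k - 1) ∧ τ.arr aODD x = x % 2) (by simpa [run] using h84)
    (by simp [run, h84]) ?_) ?_
  · rintro j hj ρ - h81 ⟨e1, e2, e3⟩
    refine Spec.block 25 ⟨?_, ?_, fun x hx => ?_⟩
    · simp [run, inc, e1]; ring
    · simp [run, inc, e2]; ring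
    · rcases (show x < 2 * j ∨ x = 2 * j ∨ x = 2 * j + 1 by omega) with h | rfl | rfl
      · have := e3 x h
        simpa [run, inc, e1, h.ne, (h.trans (Nat.lt_succ_self _)).ne] using this
      · simp [run, inc, e1, h81]
      · simp [run, inc, e1, e2]; omega
  · rintro ρ hfρ ⟨-, -, -, e⟩
    rw [h2] at e
    exact ⟨(hfρ.reg _ rfl).trans ((hf.reg _ rfl).trans hc), (hfρ.reg _ rfl).trans ((hf.reg _ rfl).trans hk),
      (hfρ.reg _ rfl).trans hN, fun x hx => (e x hx).1, fun x hx => (e x hx).2⟩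

theorem baseP_spec {V : Type} {l : OccList V} (hL : L.Nodup) (hpos : 0 < L.length) (hlab : ∀ o ∈ l, o.1.labels ⊆
    L.toFinset) (ho : Postorder l) (hk : σ.reg rK = L.length) (hm : σ.reg rM = l.length) (hnode : ∀ i o, l[i]? = some o
    → Recorded L σ i o.1) : Spec baseP σ ((l.length + 1) * (100 * (L.length * L.length))) (Layout L l) :=
    by
  set k := L.length with hkL
  have hkk : k ≤ k * k := Nat.le_mul_of_pos_left _ hpos
  refine Spec.le (T := 2 + ((k * ((k * 9 + 5) + 6) + 5) + (2 + (l.length * ((4 + ((k * k * 9 + 5) + 22)) + 6) + 5)))) ?_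
    (by nlinarith)
  refine Spec.blockseq 2 (Spec.seqf (Spec.for _ k (fun j τ => τ.reg 85 = j * k) hk (by simp [run]) ?_) ?_)
  · rintro j hj τ hf - h
    refine (add_spec rfl rfl rfl ((hf.reg rK rfl).trans hk)).mono ?_
    rintro ρ - hρ
    simp [hρ, h]; ring
  rintro τ hf ⟨-, h85⟩
  have hnτ : ∀ i o, l[i]? = some o → Recorded L τ i o.1 := fun i o hi =>
    (hnode i o hi).congr (hf.arr aOP rfl) (hf.arr aX rfl) (hf.arr aY rfl)
  refine Spec.blockseq 2 ?_
  -- Array `8` holds, for position `i`, the first position of the subterm that ends there. The left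
  -- argument of a union ends right before the first position of the right argument.
  refine Spec.mono (Spec.for (4 + ((k * k * 9 + 5) + 22)) l.length (fun j τ => τ.reg 84 = j * (k * k) ∧
    (∀ i < j, τ.arr aBASE i = i * (k * k)) ∧ ∀ i < j, ∀ o, l[i]? = some o → τ.arr 8 i + o.1.size = i + 1 ∧
      ∀ s₁ s₂, o.1 = union s₁ s₂ → τ.arr aLEFT i = i - 1 - s₂.size)
    ((hf.reg rM rfl).trans hm) (by simp [run]) ?_) ?_
  · rintro j hj ρ hfρ h70 ⟨e1, e2, e3⟩
    obtain ⟨⟨s, e⟩, hs⟩ := exists_getElem? (l := l) hj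
    have h85' : ρ.reg 85 = k * k := (hfρ.reg 85 rfl).trans h85
    have hop : ρ.arr aOP j = s.symbol := (congrFun (hfρ.arr aOP rfl) j).trans (hnτ j _ hs).1
    refine Spec.blockseq 4 (Spec.seqf (add_spec rfl rfl rfl (N := k * k) (by simpa [run] using h85')) ?_)
    rintro χ hfχ hχ
    have a84 : χ.reg 84 = (j + 1) * (k * k) := by rw [hχ]; simp [run, e1]; ring
    have a70 : χ.reg 70 = j := (hfχ.reg 70 rfl).trans h70
    have aop : χ.arr aOP j = s.symbol := hfχ.arr aOP rfl ▸ hop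
    have ab : ∀ i < j + 1, χ.arr aBASE i = i * (k * k) := by
      intro i hi
      rw [hfχ.arr aBASE rfl]
      rcases Nat.lt_succ_iff_lt_or_eq.1 hi with h | rfl
      · simpa [run, h70, h.ne] using e2 i h
      · simp [run, h70, e1]
    have a3 : ∀ i < j, ∀ o, l[i]? = some o → χ.arr 8 i + o.1.size = i + 1 ∧
        ∀ s₁ s₂, o.1 = union s₁ s₂ → χ.arr aLEFT i = i - 1 - s₂.size := hfχ.arr 8 rfl ▸ hfχ.arr aLEFT rfl ▸ e3
    have fin : ∀ ω : State, ∀ v, ω.arr 8 = update (χ.arr 8) j v → v + s.size = j + 1 →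
        (∀ i < j, ω.arr aLEFT i = χ.arr aLEFT i) →
        (∀ s₁ s₂, s = union s₁ s₂ → ω.arr aLEFT j = j - 1 - s₂.size) →
        ∀ i < j + 1, ∀ o, l[i]? = some o → ω.arr 8 i + o.1.size = i + 1 ∧
          ∀ s₁ s₂, o.1 = union s₁ s₂ → ω.arr aLEFT i = i - 1 - s₂.size := by
      intro ω v h8 hv hl hu i hi o hio
      rcases Nat.lt_succ_iff_lt_or_eq.1 hi with h | rfl
      · rw [h8, update_of_ne h.ne, hl i h]
        exact a3 i h o hio
      · obtain rfl := Option.some.inj (hs.symm.trans hio)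
        exact ⟨by rw [h8, update_self]; exact hv, hu⟩
    refine Spec.mono (Q := fun ω => ∀ i < j + 1, ∀ o, l[i]? = some o → ω.arr 8 i + o.1.size = i + 1 ∧
      ∀ s₁ s₂, o.1 = union s₁ s₂ → ω.arr aLEFT i = i - 1 - s₂.size) (Spec.block 22 ?_) ?_
    · cases s with
      | vertex a =>
        exact fin _ j (by simp [run, aop, a70, symbol]) rfl (by simp [run, aop, a70, symbol]) (by simp)
      | add a b hab s =>
        obtain ⟨q1, q2⟩ := ho.add_child hs
        have : χ.arr 8 (j - 1) + s.size = j - 1 + 1 := (a3 (j - 1) (by omega) _ q2).1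
        exact fin _ (χ.arr 8 (j - 1)) (by simp [run, aop, a70, symbol]) (by simp only [size] at this ⊢; omega)
          (by simp [run, aop, a70, symbol]) (by simp)
      | rename a b s =>
        obtain ⟨q1, q2⟩ := ho.rename_child hs
        have : χ.arr 8 (j - 1) + s.size = j - 1 + 1 := (a3 (j - 1) (by omega) _ q2).1
        exact fin _ (χ.arr 8 (j - 1)) (by simp [run, aop, a70, symbol]) (by simp only [size] at this ⊢; omega)
          (by simp [run, aop, a70, symbol]) (by simp)
      | union s₁ s₂ =>
        obtain ⟨q1, q2⟩ := ho.right_child hs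
        obtain ⟨q3, q4⟩ := ho.left_child hs
        have p1 := (a3 (j - 1) (by omega) _ q2).1
        have p2 := (a3 (j - 1 - s₂.size) (by omega) _ q4).1
        have p3 : χ.arr 8 (j - 1) - 1 = j - 1 - s₂.size := by simp only at p1; omega
        refine fin _ (χ.arr 8 (j - 1 - s₂.size)) (by simp [run, aop, a70, symbol, p3])
          (by simp only [size] at p2 ⊢; omega) ?_ ?_
        · intro i hi
          simp [run, aop, a70, symbol, hi.ne]
        · intro s₁' s₂' h
          obtain ⟨-, rfl⟩ := union.inj h
          simp [run, aop, a70, symbol, p3]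
    · intro ω hfω hω
      refine ⟨?_, ?_, hω⟩
      · simp [hfω.reg 84 rfl, a84]
      · rw [← hfω.arr aBASE rfl] at ab
        exact ab
  · rintro ρ hfρ ⟨-, -, e2, e3⟩
    exact ⟨hL, hpos, hlab, ho, (hfρ.reg _ rfl).trans ((hf.reg _ rfl).trans hk),
      (hfρ.reg _ rfl).trans ((hf.reg _ rfl).trans hm), fun i o hi =>
        (hnτ i o hi).congr (hfρ.arr aOP rfl) (hfρ.arr aX rfl) (hfρ.arr aY rfl), e2, fun i s₁ s₂ e hi =>
        (e3 i (getElem?_lt hi) _ hi).2 s₁ s₂ rfl⟩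

/-! ### The whole program -/

/-- Decide colourability. -/
def mainP : Prog := assign rC (get 0 (lit 0)) ;; assign rT (lit 2) ;; assign 80 (lit 1) ;; parseP ;; tablesP ;;
  baseP ;; solveP

/-- The summand `2 ^ k` pays for the tables. They are built only once, but charging them to every
symbol is cheap enough. -/
theorem mainP_spec (t : CWTerm) (hc : 2 ≤ c) : Spec mainP (init (c :: t.code)) (8000 * (t.size * (nodeTime t.width c + 2
    ^ t.width))) (fun τ => IsAnswer c t τ.out) := by
  set l := occurrences t (id : t.Vert → t.Vert) with hlo
  set k := t.width with hk
  have hlen : l.length = t.size := length_occurrences _ _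
  have hm := t.size_pos
  have hkpos : 0 < k := t.width_pos
  have hpk : 1 ≤ 2 ^ k := Nat.one_le_two_pow
  have hkk : k * k ≤ nodeTime k c := by
    rw [← pow_two]
    exact (Nat.pow_le_pow_right hkpos (by decide)).trans (Nat.le_add_left _ _)
  refine Spec.le (T := 3 + (2 + (2 + ((100 * t.size + 4) + (60 * 2 ^ k + ((t.size + 1) * (100 * (k * k)) +
    7100 * (t.size * nodeTime k c))))))) ?_ (by
      have h1 := Nat.mul_le_mul_left t.size hkk
      have h2 := Nat.mul_le_mul hm (le_refl (nodeTime k c))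
      have h3 := Nat.mul_le_mul_left t.size hpk
      have h4 := Nat.mul_le_mul hm (le_refl (2 ^ k))
      nlinarith)
  refine Spec.blockseq 3 (Spec.blockseq 2 (Spec.blockseq 2 ?_))
  set σ1 := (assign 80 (lit 1)).run ((assign rT (lit 2)).run ((assign rC (get 0 (lit 0))).run
    (init (c :: t.code)))) with hσ1
  have h1 : Reading [] [] [] 0 (symbolsCode (l.map (·.1))) σ1 := by
    refine ⟨List.nodup_nil, by simp [hσ1, run, init], fun a ha => absurd ha (by simp), by simp [hσ1, run, init],
      by simp [hσ1, run, init], by simp, by simp, by simp, ?_⟩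
    -- The final 0 is not part of the input; it is the content of the first cell behind it.
    have : symbolsCode (l.map (·.1)) = t.code ++ [0] := by
      rw [code_eq_flatMap t id, symbolsCode, List.flatMap_map]
    rw [this, List.drop_nil, List.nil_append]
    intro i v hi
    rcases lt_trichotomy i t.code.length with hlt | rfl | hgt
    · rw [getElem?_append_left hlt] at hi
      simp [hσ1, run, init, add_comm 1 i, hi]
    · simpa [hσ1, run, init, add_comm 1] using hi
    · rw [List.getElem?_eq_none (by simp; omega)] at hi
      simp at hi
  refine Spec.seqf ((parseP_spec h1).le (by simp [hlen])) ?_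
  rintro τ hf ⟨L, hL⟩
  have hLt : L.toFinset = t.labels := by
    rw [labels_eq_flatMap t id]
    ext a
    rw [List.mem_toFinset, hL.mem, List.mem_toFinset, List.flatMap_map]
    simp [hlo]
  have hLk : L.length = k := by rw [hk, width, ← hLt, List.toFinset_card_of_nodup hL.nodup]
  have hrm : τ.reg rM = l.length := by rw [hL.rm, length_map]
  have hrC : τ.reg rC = c := (hf.reg rC rfl).trans (by simp [hσ1, run, init])
  rw [← hLk] at hkpos ⊢
  refine Spec.seqf (tablesP_spec hkpos hrC hL.rk) ?_
  intro τ2 hf2 hE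
  have hn2 : ∀ i o, l[i]? = some o → Recorded L τ2 i o.1 := fun i o hi =>
    (hL.node i o.1 (by simp [hi])).congr (hf2.arr aOP rfl) (hf2.arr aX rfl) (hf2.arr aY rfl)
  refine Spec.seqf ((baseP_spec hL.nodup hkpos (fun o ho => ?_) (postorder_occurrences t id)
    ((hf2.reg rK rfl).trans hL.rk) ((hf2.reg rM rfl).trans hrm) hn2).le (by rw [hlen])) ?_
  · rw [hLt]
    exact labels_subset_of_mem t id o ho
  intro τ3 hf3 hl
  -- Arrays that have not been written are still 0, as required for the empty dictionary and for the
  -- context of the root.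
  have arr0 : ∀ A, A ≠ 0 → parseP.wa A = false → tablesP.wa A = false → baseP.wa A = false → τ3.arr A = fun _ => 0 := by
    intro A h0 a1 a2 a3
    rw [hf3.arr A a3, hf2.arr A a2, hf.arr A a1]
    simp [hσ1, run, init, h0]
  refine solveP_spec hc hl (hE.frame hf3 rfl) ?_ ?_ (arr0 _ (by decide) rfl rfl rfl) ?_
  · intro a ha
    rw [hf3.arr aLBL rfl, hf2.arr aLBL rfl]
    exact hL.labels a ha
  · refine ⟨∅, fun _ => (0, []), ?_⟩
    rw [arr0 _ (by decide) rfl rfl rfl, hf3.reg rT rfl, hf2.reg rT rfl, hf.reg rT rfl]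
    exact Trie.init
  · rw [hf3.out rfl, hf2.out rfl, hf.out rfl]
    simp [hσ1, run, init]

/-! ### Comparison of the step count with the stated bounds -/

theorem cube_le (k : ℕ) : k ^ 3 ≤ 4 * 2 ^ k := by
  rcases Nat.lt_or_ge k 4 with h | h
  · interval_cases k <;> norm_num
  · induction k, h using Nat.le_induction with
    | base => norm_num
    | succ k hk ih =>
      rw [pow_succ 2]
      nlinarith [mul_le_mul hk hk (by omega) (by omega), mul_le_mul_left hk (k ^ 2)]

/-- `bound_mul_le` replaces the factor `c` by `min c (2 ^ k)`. The terms `k ^ 6` and `2 ^ k` are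
absorbed because `k ^ 3 ≤ 4 * 2 ^ k` and, by `c ≥ 2`, both counts of schemes are at least `2 ^ k`.
The constant is 8 + 4 + 1. -/
theorem nodeTime_le {k c : ℕ} (hk : 1 ≤ k) (hc : 2 ≤ c) : nodeTime k c + 2 ^ k ≤ 13 * (min ((c + 1) ^ 2 ^ k) ((2 ^ c -
    2) ^ k) * (min c (2 ^ k) + k) * k * min c (2 ^ k) * k) := by
  have hb := bound_mul_le (c := c) hk
  set M := min c (2 ^ k) with hM
  set N := min ((c + 1) ^ 2 ^ k) ((2 ^ c - 2) ^ k) with hN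
  have hM1 : 1 ≤ M := le_min (by omega) Nat.one_le_two_pow
  have hN1 : 2 ^ k ≤ N := by
    refine le_min ((Nat.pow_le_pow_right (by decide) Nat.lt_two_pow_self.le).trans
      (Nat.pow_le_pow_left (by omega) _)) (Nat.pow_le_pow_left ?_ _)
    have := Nat.pow_le_pow_right (show 0 < 2 by decide) hc
    omega
  have e1 : bound k c * (M * k * (c * k)) ≤ 8 * (N * (M + k) * k * M * k) :=
    calc bound k c * (M * k * (c * k)) = (bound k c * c) * (M * k * k) := by ring
      _ ≤ 8 * (N * M) * (M * k * k) := Nat.mul_le_mul_right _ hb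
      _ = 8 * (N * M * k * M * k) := by ring
      _ ≤ _ := by gcongr; omega
  have e2 : 2 ^ k * k ^ 3 ≤ N * (M + k) * k * M * k :=
    calc 2 ^ k * k ^ 3 = 2 ^ k * k * k * 1 * k := by ring
      _ ≤ _ := by gcongr; omega
  have e3 : k ^ 6 ≤ 4 * (2 ^ k * k ^ 3) :=
    calc k ^ 6 = k ^ 3 * k ^ 3 := by ring
      _ ≤ 4 * 2 ^ k * k ^ 3 := Nat.mul_le_mul_right _ (cube_le k)
      _ = _ := by ring
  have e4 : 2 ^ k ≤ 2 ^ k * k ^ 3 := Nat.le_mul_of_pos_right _ (by positivity)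
  rw [nodeTime, ← hM]
  omega

end RAM

/-- The summand `log c` in the stated bound is not needed: the last factor `k + log c` is used only
through `k`. -/
theorem le_preciseBound {m k c : ℕ} (hk : 1 ≤ k) (hc : 2 ≤ c) : ((m * (RAM.nodeTime k c + 2 ^ k) : ℕ) : ℝ) ≤ 13 *
    preciseBound m k c := by
  have h2 : 2 ≤ 2 ^ c := by
    have := Nat.pow_le_pow_right (show 0 < 2 by decide) hc
    omega
  have h := (Nat.cast_le (α := ℝ)).2 (Nat.mul_le_mul_left m (RAM.nodeTime_le hk hc))
  refine h.trans ?_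
  push_cast [Nat.cast_sub h2]
  have hlog : 0 ≤ Real.logb 2 c := Real.logb_nonneg (by norm_num) (by norm_cast; omega)
  have hD : (0 : ℝ) ≤ 2 ^ c - 2 := by
    have : (2 : ℝ) ≤ 2 ^ c := by exact_mod_cast h2
    linarith
  rw [preciseBound]
  calc _ = 13 * (m * min (((c : ℝ) + 1) ^ (2 ^ k)) (((2 : ℝ) ^ c - 2) ^ k) * (min (c : ℝ) (2 ^ k) + k) * k *
        min (c : ℝ) (2 ^ k) * (k + 0)) := by ring
    _ ≤ _ := by gcongr

/-- For `k ≥ 1` and `c ≥ 2`, sums are bounded by twice products. For the first term of the minimum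
`min c (2 ^ k)` is estimated by `2 ^ k`, for the second by `c`, and there also `log c ≤ c`. -/
theorem preciseBound_le {m k c : ℕ} (hk : 1 ≤ k) (hc : 2 ≤ c) : preciseBound m k c ≤ 4 * mainBound m k c := by
  have hk' : (1 : ℝ) ≤ k := by exact_mod_cast hk
  have hc' : (2 : ℝ) ≤ c := by exact_mod_cast hc
  have hlog : 1 ≤ Real.logb 2 c := by
    rw [Real.le_logb_iff_rpow_le (by norm_num) (by linarith)]
    simpa using hc'
  have hlogc : Real.logb 2 c ≤ c := by
    rw [Real.logb_le_iff_le_rpow (by norm_num) (by linarith), Real.rpow_natCast]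
    exact_mod_cast Nat.lt_two_pow_self.le
  have hD : (0 : ℝ) ≤ 2 ^ c - 2 := by
    have := pow_le_pow_right₀ (show (1 : ℝ) ≤ 2 by norm_num) hc
    linarith
  have hp : (1 : ℝ) ≤ 2 ^ k := one_le_pow₀ (by norm_num)
  set lg := Real.logb 2 (c : ℝ) with hlg
  set A := ((c : ℝ) + 1) ^ (2 ^ k) with hA
  set D := ((2 : ℝ) ^ c - 2) ^ k with hDD
  set M := min (c : ℝ) (2 ^ k) with hM
  have hA0 : 0 ≤ A := by positivity
  have hD0 : 0 ≤ D := by positivity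
  have hM0 : 0 ≤ M := le_min (by linarith) (by linarith)
  have key : min A D * ((M + k) * k * M * (k + lg)) ≤ 4 * (min (A * 2 ^ (2 * k) * lg) (D * (c : ℝ) ^ 3) * k ^ 3) := by
    have e1 : (M + k) * k * M * (k + lg) ≤ 4 * (2 ^ (2 * k) * lg * k ^ 3) :=
      calc (M + k) * k * M * (k + lg) ≤ (2 * 2 ^ k) * k * 2 ^ k * (2 * (k * lg)) := by
            have q1 : M ≤ 2 ^ k := min_le_right _ _
            have q2 : (k : ℝ) ≤ 2 ^ k := by exact_mod_cast Nat.lt_two_pow_self.le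
            have q3 : (k : ℝ) + lg ≤ 2 * (k * lg) := by nlinarith
            gcongr
            linarith
        _ = 4 * (2 ^ (2 * k) * lg * k ^ 2) := by rw [two_mul k, pow_add]; ring
        _ ≤ _ := by gcongr <;> norm_num [hk']
    have e2 : (M + k) * k * M * (k + lg) ≤ 4 * ((c : ℝ) ^ 3 * k ^ 3) :=
      calc (M + k) * k * M * (k + lg) ≤ (2 * (c * k)) * k * c * (2 * (c * k)) := by
            have q1 : M ≤ c := min_le_left _ _
            have q2 : (c : ℝ) + k ≤ 2 * (c * k) := by nlinarith
            gcongr <;> linarith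
        _ = _ := by ring
    rw [min_mul_of_nonneg _ _ (show (0 : ℝ) ≤ k ^ 3 by positivity), mul_min_of_nonneg _ _ (show (0 : ℝ) ≤ 4 by norm_num)]
    refine le_min ?_ ?_
    · calc _ ≤ A * (4 * (2 ^ (2 * k) * lg * k ^ 3)) := by gcongr; exact min_le_left _ _
        _ = _ := by ring
    · calc _ ≤ D * (4 * ((c : ℝ) ^ 3 * k ^ 3)) := by gcongr; exact min_le_right _ _
        _ = _ := by ring
  calc preciseBound m k c = m * (min A D * ((M + k) * k * M * (k + lg))) := by rw [preciseBound]; ring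
    _ ≤ m * (4 * (min (A * 2 ^ (2 * k) * lg) (D * (c : ℝ) ^ 3) * k ^ 3)) := by gcongr
    _ = _ := by rw [mainBound]; ring

theorem theorem1 : (∀ (t : CWTerm) (c : ℕ), 1 ≤ c → ((t.schemes c).Nonempty ↔ t.graph.Colorable c)) ∧ ∃ (P : RAM.Prog)
    (C : ℝ), ∀ (t : CWTerm) (c : ℕ), 2 ≤ c → ∃ (T : ℕ) (τ : RAM.State), RAM.Exec P (RAM.init (c :: t.code)) T τ ∧
    IsAnswer c t τ.out ∧ (T : ℝ) ≤ C * preciseBound t.size t.width c ∧ (T : ℝ) ≤ C * mainBound t.size t.width c := by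
  -- The factor 8000 comes from `mainP_spec`, 13 from `le_preciseBound`, and 4 from
  -- `preciseBound_le`; the last is needed for the second bound only.
  refine ⟨fun t c hc => CWTerm.schemes_nonempty_iff hc, RAM.mainP, 8000 * (13 * 4), fun t c hc => ?_⟩
  obtain ⟨T, τ, h1, h2, h3⟩ := RAM.mainP_spec t hc
  have hk := t.width_pos
  have e1 : (T : ℝ) ≤ 8000 * (13 * preciseBound t.size t.width c) := by
    refine ((Nat.cast_le (α := ℝ)).2 h2).trans ?_
    rw [Nat.cast_mul]
    exact mul_le_mul_of_nonneg_left (le_preciseBound hk hc) (by norm_num)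
  have e2 := preciseBound_le (m := t.size) hk hc
  have e3 : 0 ≤ 13 * preciseBound t.size t.width c := (Nat.cast_nonneg _).trans (le_preciseBound (m := t.size) hk hc)
  exact ⟨T, τ, h1, h3, by linarith, by linarith⟩
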